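/- For $L\in 4\mathbb N$ let $\Gamma_L=\mathbb Z^2/L\mathbb Z^2$. The total Hilbert space $\mathcal H_L$ is the tensor product of the fermionic Fock space over $\ell^2(\Gamma_L)$, with creation and annihilation operators $a^{\pm}_x$, and of one copy of $\mathbb C^2$ for each edge $(x,\mu)=(x,x+e_\mu)$ of $\Gamma_L$, on which the Pauli matrices $X_{x,\mu}$, $Z_{x,\mu}$ act. Let $n_x=a^+_xa^-_x$ and $Q_x=X_{x,1}X_{x,2}X_{x-e_1,1}X_{x-e_2,2}(-1)^{n_x}$, and let $P_L=\prod_{x}\frac{1+Q_x}{2}$ be the projection on the vectors that satisfy the Gauss law $Q_x\psi=\psi$ for all $x$. For $t>0$ consider the Hamiltonian $$H=-\sum_{\Lambda}\prod_{(x,\mu)\in\partial\Lambda}Z_{x,\mu}+H_f,\qquad H_f=-t\sum_{x\in\Gamma_L}\sum_{\mu=1,2}\big(a^+_xZ_{x,\mu}a^-_{x+e_\mu}+\text{h.c.}\big),$$ where $\Lambda$ runs over the elementary plaquettes, and the Gibbs state at half-filling $$\langle\mathcal O\rangle_{\beta,L}=\frac{\operatorname{Tr}_{\mathcal H_L}P_L\,\mathcal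 O\,e^{-\beta H}}{\operatorname{Tr}_{\mathcal H_L}P_L\,e^{-\beta H}} .$$ Write $\langle A;B\rangle_{\beta,L}=\langle AB\rangle_{\beta,L}-\langle A\rangle_{\beta,L}\langle B\rangle_{\beta,L}$ and $\mathcal O(s)=e^{sH}\mathcal Oe^{-sH}$. For $q\in\mathbb R$ and a vector potential $A=(A_1,A_2)$ on the plane, let $H_f(A)$ be obtained from $H_f$ by the Peierls substitution: the term $a^+_{x+e_\mu}Z_{x,\mu}a^-_x$ is multiplied by $e^{iq\theta}$, and the term $a^+_xZ_{x,\mu}a^-_{x+e_\mu}$ by $e^{-iq\theta}$, with $\theta=\int_0^1A_\mu(x+se_\mu)\,ds$. For $p=(0,p_2)$ and $p'=(0,p_2')$ set $$\hat J_1(p)=-\frac{\partial}{\partial z}H_f\big(z\,e^{-ip\cdot y}e_1\big)\Big|_{z=0},\qquad \hat K_{1,1}(p,p')=-\frac{\partial^2}{\partial z\,\partial w}H_f\big((z\,e^{-ip\cdot y}+w\,e^{-ip'\cdot y})e_1\big)\Big|_{z=w=0},$$ where $y$ denotes the argument of the vector potential. The magnetic susceptibility at external momentum $(0,p_2)$ is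 $$\chi(p_2)=\frac1{p_2^2}\lim_{L\to\infty}\lim_{\beta\to\infty}\frac1{L^2}\Big[\int_0^\beta ds\,\big\langle\hat J_1(-p,s);\hat J_1(p)\big\rangle_{\beta,L}+\big\langle\hat K_{1,1}(p,-p)\big\rangle_{\beta,L}\Big],$$ where $L$ runs over the multiples of $4$ and, at finite $L$, $p=(0,p_2^{(L)})$ with $p_2^{(L)}\in\frac{2\pi}{L}\mathbb Z$ and $p_2^{(L)}\to p_2$ as $L\to\infty$. **Proposition (ground state susceptibility).** There is $t_0>0$ such that, for every $t>t_0$ and every $q\in\mathbb R$, the limit defining $\chi(p_2)$ exists for every $p_2$ with $0<|p_2|<\pi$, does not depend on the choice of the admissible momenta $p_2^{(L)}\to p_2$, and satisfies $$\chi(p_2)=-\frac{q^2v}{8|p_2|}+o\Big(\frac1{|p_2|}\Big)\qquad\text{as }p_2\to0,\qquad v=2t .$$ -/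

import Mathlib

namespace Z2Gauge

/-- The periodic square lattice `ℤ² / L ℤ²`. -/
abbrev Site (L : ℕ) : Type := ZMod L × ZMod L

/-- The lattice unit vector in direction `μ` (`μ = 0` horizontal, `μ = 1` vertical). -/
def unitStep (L : ℕ) (μ : Fin 2) : Site L := if μ = 0 then (1, 0) else (0, 1)

/-- The edge `(x, μ)` joins `x` to `x + unitStep L μ`. -/
abbrev Edge (L : ℕ) : Type := Site L × Fin 2

/-- An enumeration of the sites, used to order the fermionic modes. -/
def siteIndex {L : ℕ} (x : Site L) : ℕ := x.1.val + L * x.2.val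

/-- Labels `(n, σ)` of the product basis of the total Hilbert space: the Fock space of fermions on
the lattice (occupation number basis, given by the set of occupied sites) tensored with one `ℂ²`
per edge (basis of joint eigenvectors of the vector potential operators). -/
abbrev BasisState (L : ℕ) : Type := Finset (Site L) × (Edge L → ℤˣ)

/-- Linear operators on the total Hilbert space, in the above orthonormal basis. -/
abbrev Op (L : ℕ) : Type := Matrix (BasisState L) (BasisState L) ℂ

noncomputable section

open scoped Matrix

/-- The fermionic annihilation operator at `x`:
it maps `|n, σ⟩` to `(-1)^#{y ∈ n : y before x} |n \ {x}, σ⟩` if `x ∈ n`, and to `0` otherwise. -/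
def annihilation {L : ℕ} [NeZero L] (x : Site L) : Op L :=
  Matrix.of fun b a =>
    if x ∈ a.1 ∧ b = (a.1.erase x, a.2) then
      (-1 : ℂ) ^ (a.1.filter fun y => siteIndex y < siteIndex x).card
    else 0

/-- The fermionic creation operator at `x`, the adjoint of the annihilation operator. -/
def creation {L : ℕ} [NeZero L] (x : Site L) : Op L := (annihilation x)ᴴ

/-- The number operator at `x`. -/
def numberOp {L : ℕ} [NeZero L] (x : Site L) : Op L := creation x * annihilation x

/-- The vector potential operator, i.e. the Pauli matrix `Z` on the edge `e`. -/
def pauliZ {L : ℕ} [NeZero L] (e : Edge L) : Op L :=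
  Matrix.diagonal fun a => (((a.2 e : ℤˣ) : ℤ) : ℂ)

/-- The electric field operator, i.e. the Pauli matrix `X` on the edge `e`. -/
def pauliX {L : ℕ} [NeZero L] (e : Edge L) : Op L :=
  Matrix.of fun b a => if b = (a.1, Function.update a.2 e (-a.2 e)) then 1 else 0

/-- The star operator at `x`, the product of the electric fields on the four edges touching `x`. -/
def starOp {L : ℕ} [NeZero L] (x : Site L) : Op L :=
  pauliX (x, 0) * pauliX (x, 1) * pauliX (x - unitStep L 0, 0) * pauliX (x - unitStep L 1, 1)

/-- The charge operator `Q_x = A_x (-1)^{n_x}`; here `(-1)^{n_x} = 1 - 2 n_x`, because `n_x` is a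
projection. -/
def chargeOp {L : ℕ} [NeZero L] (x : Site L) : Op L :=
  starOp x * (1 - (2 : ℂ) • numberOp x)

theorem pauliX_commute {L : ℕ} [NeZero L] (e f : Edge L) :
    Commute (pauliX e) (pauliX f) := by
  have key : ∀ (g : Edge L) (v : BasisState L → ℂ) (b : BasisState L),
      Matrix.mulVec (pauliX g) v b = v (b.1, Function.update b.2 g (-b.2 g)) := by
    intro g v b
    rw [Matrix.mulVec, dotProduct, Finset.sum_eq_single (b.1, Function.update b.2 g (-b.2 g))]
    · simp [pauliX]
    · intro c _ hc
      rw [pauliX, Matrix.of_apply, if_neg, zero_mul]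
      rintro rfl
      apply hc
      simp
    · simp
  rw [Commute, SemiconjBy]
  apply Matrix.mulVec_injective
  funext v
  rw [← Matrix.mulVec_mulVec, ← Matrix.mulVec_mulVec]
  funext b
  simp only [key]
  by_cases h : e = f
  · rw [h]
  · rw [Function.update_of_ne (Ne.symm h), Function.update_of_ne h, Function.update_comm h]

theorem numberOp_eq_diagonal {L : ℕ} [NeZero L] (x : Site L) :
    numberOp x = Matrix.diagonal fun a : BasisState L => if x ∈ a.1 then (1 : ℂ) else 0 := by
  ext b a
  simp only [numberOp, creation, Matrix.mul_apply, Matrix.conjTranspose_apply, annihilation,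
    Matrix.of_apply]
  rw [Finset.sum_eq_single (a.1.erase x, a.2)]
  · by_cases hab : b = a
    · subst hab
      by_cases hx : x ∈ b.1 <;> simp [hx, ← mul_pow]
    · rw [Matrix.diagonal_apply_ne _ hab]
      by_cases hx : x ∈ a.1 <;> by_cases hy : x ∈ b.1
      · have : ¬ ((a.1.erase x, a.2) = (b.1.erase x, b.2)) := by
          intro h
          apply hab
          have h1 := congrArg Prod.fst h
          have h2 := congrArg Prod.snd h
          simp only at h1 h2
          ext1
          · rw [← Finset.insert_erase hx, ← Finset.insert_erase hy, h1]
          · exact h2.symm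
        simp [this]
      all_goals simp [hx, hy]
  · intro c _ hc
    simp [hc]
  · simp

theorem chargeOp_commute {L : ℕ} [NeZero L] (x y : Site L) :
    Commute (chargeOp x) (chargeOp y) := by
  have hXn : ∀ (e : Edge L) (z : Site L), Commute (pauliX e) (1 - (2 : ℂ) • numberOp z) := by
    intro e z
    refine (Commute.one_right _).sub_right (Commute.smul_right ?_ _)
    rw [numberOp_eq_diagonal, Commute, SemiconjBy]
    ext b a
    rw [Matrix.mul_diagonal, Matrix.diagonal_mul, pauliX, Matrix.of_apply]
    split_ifs with h1 h2 h3 h3 <;> simp_all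
  have hnn : ∀ z w : Site L,
      Commute (1 - (2 : ℂ) • numberOp z) (1 - (2 : ℂ) • numberOp w) := by
    intro z w
    refine (Commute.one_right _).sub_right (Commute.smul_right ?_ _)
    refine (Commute.one_left _).sub_left (Commute.smul_left ?_ _)
    rw [numberOp_eq_diagonal, numberOp_eq_diagonal]
    exact Matrix.commute_diagonal _ _
  have hXs : ∀ (e : Edge L) (z : Site L), Commute (pauliX e) (starOp z) := fun e z =>
    (((pauliX_commute _ _).mul_right (pauliX_commute _ _)).mul_right
      (pauliX_commute _ _)).mul_right (pauliX_commute _ _)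
  have hss : Commute (starOp x) (starOp y) :=
    (((hXs _ _).mul_left (hXs _ _)).mul_left (hXs _ _)).mul_left (hXs _ _)
  have hsn : ∀ z w : Site L, Commute (starOp z) (1 - (2 : ℂ) • numberOp w) := fun z w =>
    (((hXn _ _).mul_left (hXn _ _)).mul_left (hXn _ _)).mul_left (hXn _ _)
  exact (hss.mul_right (hsn _ _)).mul_left ((hsn _ _).symm.mul_right (hnn _ _))

/-- The orthogonal projection `∏ₓ (1 + Q_x) / 2` onto the physical Hilbert space, the space of the
vectors that satisfy the Gauss law `Q_x ψ = ψ` at every site. -/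
def gaussProjection (L : ℕ) [NeZero L] : Op L :=
  Finset.univ.noncommProd (fun x : Site L => (1 / 2 : ℂ) • (1 + chargeOp x)) fun x _ y _ _ =>
    (((Commute.one_right _).add_right
      ((Commute.one_left _).add_left (chargeOp_commute x y))).smul_right _).smul_left _

/-- The plaquette operator: the product of the vector potentials on the boundary of the elementary
plaquette with lower left corner `x`. -/
def plaquetteOp {L : ℕ} [NeZero L] (x : Site L) : Op L :=
  pauliZ (x, 0) * pauliZ (x + unitStep L 0, 1) * pauliZ (x + unitStep L 1, 0) * pauliZ (x, 1)

/-- The fermionic hopping Hamiltonian with hopping parameter `t`, coupled to the gauge field. -/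
def matterHamiltonian (L : ℕ) [NeZero L] (t : ℝ) : Op L :=
  -(t : ℂ) • ∑ x : Site L, ∑ μ : Fin 2,
    (creation x * pauliZ (x, μ) * annihilation (x + unitStep L μ) +
      creation (x + unitStep L μ) * pauliZ (x, μ) * annihilation x)

/-- The Hamiltonian of the gauge theory in the absence of electric fields. -/
def hamiltonian (L : ℕ) [NeZero L] (t : ℝ) : Op L :=
  -(∑ x : Site L, plaquetteOp x) + matterHamiltonian L t

/-- The Gibbs state of the gauge theory on the physical Hilbert space, at inverse temperature `β`
and at half-filling (zero chemical potential). -/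
def gibbs {L : ℕ} [NeZero L] (t β : ℝ) (O : Op L) : ℂ :=
  (gaussProjection L * O * NormedSpace.exp (-(β : ℂ) • hamiltonian L t)).trace /
    (gaussProjection L * NormedSpace.exp (-(β : ℂ) • hamiltonian L t)).trace

/-- The truncated correlation `⟨A; B⟩ = ⟨A B⟩ - ⟨A⟩ ⟨B⟩`. -/
def truncated {L : ℕ} [NeZero L] (t β : ℝ) (A B : Op L) : ℂ :=
  gibbs t β (A * B) - gibbs t β A * gibbs t β B

/-- The imaginary-time evolution `O(s) = e^{sH} O e^{-sH}`. -/
def evolved {L : ℕ} [NeZero L] (t s : ℝ) (O : Op L) : Op L :=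
  NormedSpace.exp ((s : ℂ) • hamiltonian L t) * O * NormedSpace.exp (-(s : ℂ) • hamiltonian L t)

/-- The position in the plane of a lattice site, in the fundamental square `[0, L)²`. -/
def sitePosition {L : ℕ} (x : Site L) : ℝ × ℝ := ((x.1.val : ℝ), (x.2.val : ℝ))

/-- The line integral `∫ dℓ · A(ℓ)` of an external vector potential `A` along the edge `(x, μ)`, in
the direction from `x` to `x + unitStep L μ`. -/
def bondIntegral {L : ℕ} (A : ℝ × ℝ → Fin 2 → ℂ) (e : Edge L) : ℂ :=
  ∫ s in (0 : ℝ)..1,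
    A (sitePosition e.1 + s • (if e.2 = 0 then ((1, 0) : ℝ × ℝ) else (0, 1))) e.2

/-- The hopping Hamiltonian coupled to an external vector potential `A` by the Peierls substitution,
for fermions of electric charge `q`. -/
def peierlsHamiltonian (L : ℕ) [NeZero L] (t q : ℝ) (A : ℝ × ℝ → Fin 2 → ℂ) : Op L :=
  -(t : ℂ) • ∑ x : Site L, ∑ μ : Fin 2,
    (Complex.exp (-(Complex.I * q * bondIntegral A (x, μ))) •
        (creation x * pauliZ (x, μ) * annihilation (x + unitStep L μ)) +
      Complex.exp (Complex.I * q * bondIntegral A (x, μ)) •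
        (creation (x + unitStep L μ) * pauliZ (x, μ) * annihilation x))

/-- The horizontal vector potential `A(y) = (z e^{-i p₂ y₂}, 0)`. It has the single Fourier
coefficient `Â₁(-p) = L² z`, where `p = (0, p₂)`. -/
def planeWave (p₂ : ℝ) (z : ℂ) : ℝ × ℝ → Fin 2 → ℂ := fun y μ =>
  if μ = 0 then z * Complex.exp (-(Complex.I * p₂ * y.2)) else 0

/-- The current operator `Ĵ₁(p) = -L² ∂H_f(A) / ∂Â₁(-p)` at `A = 0`, for `p = (0, p₂)`. -/
def current (L : ℕ) [NeZero L] (t q p₂ : ℝ) : Op L :=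
  Matrix.of fun b a => -deriv (fun z : ℂ => peierlsHamiltonian L t q (planeWave p₂ z) b a) 0

/-- The operator `K̂₁₁(p, p') = -L⁴ ∂²H_f(A) / ∂Â₁(-p) ∂Â₁(-p')` at `A = 0`, for `p = (0, p₂)` and
`p' = (0, p₂')`; it is the coefficient of the expansion
`H_f(A) = H_f - L⁻² ∑ₚ Ĵ₁(p) Â₁(-p) - (1/2) L⁻⁴ ∑ₚ,ₚ' Â₁(-p) K̂₁₁(p, p') Â₁(-p') + O(A³)`
in horizontal vector potentials. -/
def diamagnetic (L : ℕ) [NeZero L] (t q p₂ p₂' : ℝ) : Op L :=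
  Matrix.of fun b a => -deriv (fun w : ℂ => deriv (fun z : ℂ =>
    peierlsHamiltonian L t q (planeWave p₂ z + planeWave p₂' w) b a) 0) 0

/-- The linear response coefficient
`L⁻² (∫₀^β ds ⟨Ĵ₁(-p, s); Ĵ₁(p)⟩ + ⟨K̂₁₁(p, -p)⟩)` of the current to a horizontal vector potential,
at momentum `p = (0, p₂)`. -/
def response (L : ℕ) [NeZero L] (t q β p₂ : ℝ) : ℂ :=
  (1 / (L : ℂ) ^ 2) *
    ((∫ s in (0 : ℝ)..β, truncated t β (evolved t s (current L t q (-p₂))) (current L t q p₂)) +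
      gibbs t β (diamagnetic L t q p₂ (-p₂)))

open Filter Topology in
/-- `c` is the magnetic susceptibility at external momentum `(0, p₂)`:
`p₂² c` is the limit, first `β → ∞` and then `L → ∞` along the multiples `L = 4 (ℓ + 1)` of four,
of the response coefficient. Since the momenta on the torus of side `L` belong to `(2π/L) ℤ`, the
external momentum is approximated by admissible ones, and the limit is required to exist and to be
the same for every such approximation. -/
def IsSusceptibility (t q p₂ c : ℝ) : Prop :=
  ∀ n : ℕ → ℤ,
    Tendsto (fun ℓ : ℕ => 2 * Real.pi * n ℓ / (4 * (ℓ + 1) : ℕ)) atTop (𝓝 p₂) →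
    ∃ G : ℕ → ℂ,
      (∀ᶠ ℓ : ℕ in atTop,
        Tendsto (fun β : ℝ =>
            response (4 * (ℓ + 1)) t q β (2 * Real.pi * n ℓ / (4 * (ℓ + 1) : ℕ)))
          atTop (𝓝 (G ℓ))) ∧
      Tendsto G atTop (𝓝 ((p₂ ^ 2 * c : ℝ) : ℂ))

end

end Z2Gauge

set_option linter.unusedSectionVars false

/-! The gauge field has no dynamics of its own. The Hamiltonian is block diagonal in the
configuration σ of the eigenvalues of the Z operators, and in each block the fermions are free, with
one particle matrix -tK, where K = `gaugeHopping σ` has entries ±1 on the edges. Expanding the Gauss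
projection gives a sum over gauge transformations, of which only the identity and the global one
have a nonzero trace against block diagonal operators; the global one acts as the fermion parity. So
the Gibbs state is a mixture, over σ, of free fermion states projected on even particle number
(`gibbs_blockDiagonal`). As β → ∞ only those σ survive that maximize the plaquette sum plus (t/2)
tr|K| (`tendsto_mixture`).

The plaquette term prefers flux 1 and the fermions prefer flux -1; for large t the fermions must win
with a margin per plaquette that is uniform in L. `exists_traceNorm_gap` provides it: relative to
the maximum, every plaquette of flux 1 costs at least 0.005 of tr|K|. The trace norm obeys a
reflection inequality (`traceNorm_reflection_le`): replacing either half of the torus by the mirror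
image of the other one, with the opposite sign, does not lower the average of the trace norm, and it
creates flux -1 in the plaquettes cut by the reflection lines. If flux 1 is rewarded in the
plaquettes with even corner, which the lines never cut, a chessboard argument leaves two candidates
for the maximizer: flux -1 everywhere, or flux 1 exactly at the even corners. Their trace norms are
told apart by comparing |x| with even polynomials of degree six, whose traces follow from the
second, fourth and sixth moments of K.

When all fluxes are -1 the elementary translations anticommute and their squares commute with
everything in sight, so K² is diagonalized by joint spectral projections of rank four, with
eigenvalues 4(cos² x + cos² y). For the response the sectors differ only by holonomies ±1, which
shift the quasimomenta by at most π/L. The zero temperature response of a sector is therefore q²t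
times the average of the explicit `responseDensity` over the quasimomenta
(`IsBandSystem.groundResponse_eq`). If sin p ≠ 0, the energies at two momenta that differ by p never
vanish together; hence the density is bounded, and the averages converge to `bulkResponse p`
whatever the holonomies and the admissible momenta are.

It remains to see that `bulkResponse p` is -|p|/4 + o(|p|). An integration by parts brings the
diamagnetic term to a form in which it can be subtracted pointwise from the paramagnetic one. After
the substitution u = cos x the difference `diracExcess` is integrable on the whole line, and
replacing the weight √(1 - u²) by 1 costs only o(|p|). The integral over u is then elementary and
depends on the other momentum k only through w = tan k tan(p/2). With w as variable there remains
-|tan(p/2)|/π² times an integral that tends to that of `coneDensity`, which equals π²/2 by a power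
series and the inversion w ↦ 1/w. -/

namespace Z2Gauge
noncomputable section
open scoped Matrix

/-! ### Variational characterization and reflection positivity of the trace norm -/

section TraceNorm

variable {ι κ : Type*} [Fintype ι] [DecidableEq ι] [Fintype κ] [DecidableEq κ]

/-- The sum of the absolute values of the eigenvalues of a real symmetric matrix. -/
def traceNorm (K : Matrix ι ι ℝ) : ℝ :=
  if h : K.IsHermitian then ∑ i, |h.eigenvalues i| else 0

theorem exists_orthogonal_diagonalization {K : Matrix ι ι ℝ} (h : K.IsHermitian) :
    ∃ V : Matrix ι ι ℝ, V * Vᵀ = 1 ∧ Vᵀ * V = 1 ∧ K = V * Matrix.diagonal h.eigenvalues * Vᵀ := by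
  refine ⟨h.eigenvectorUnitary, ?_, ?_, ?_⟩
  · have h2 := Unitary.coe_mul_star_self h.eigenvectorUnitary
    simpa [Matrix.star_eq_conjTranspose] using h2
  · have h2 := Unitary.coe_star_mul_self h.eigenvectorUnitary
    simpa [Matrix.star_eq_conjTranspose] using h2
  · have h2 := h.spectral_theorem
    rw [Unitary.conjStarAlgAut_apply] at h2
    simpa [Matrix.star_eq_conjTranspose] using! h2

theorem abs_apply_le_one_of_orthogonal {W : Matrix ι ι ℝ} (hW : W * Wᵀ = 1) (i j : ι) :
    |W i j| ≤ 1 := by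
  have h1 : ∑ k, W i k * W i k = 1 := by
    have := congrFun (congrFun hW i) i
    simpa [Matrix.mul_apply] using this
  have h2 : W i j * W i j ≤ 1 := by
    rw [← h1]
    exact Finset.single_le_sum (f := fun k => W i k * W i k) (fun k _ => mul_self_nonneg _)
      (Finset.mem_univ j)
  exact abs_le_one_iff_mul_self_le_one.2 h2

theorem trace_mul_conj_diagonal (U V : Matrix ι ι ℝ) (d : ι → ℝ) :
    (U * (V * Matrix.diagonal d * Vᵀ)).trace = ∑ i, (Vᵀ * U * V) i i * d i := by
  rw [show U * (V * Matrix.diagonal d * Vᵀ) = (U * V * Matrix.diagonal d) * Vᵀ by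
    simp only [Matrix.mul_assoc], Matrix.trace_mul_comm,
    show Vᵀ * (U * V * Matrix.diagonal d) = (Vᵀ * U * V) * Matrix.diagonal d by
    simp only [Matrix.mul_assoc], Matrix.trace]
  simp [Matrix.mul_diagonal]

/-- Conjugation by V turns U into another orthogonal matrix, whose diagonal entries are at most 1 in
modulus. Together with the next lemma this makes the trace norm the maximum of tr(UK) over
orthogonal U. -/
theorem trace_orthogonal_mul_le {U V : Matrix ι ι ℝ} (hU : U * Uᵀ = 1) (hV : V * Vᵀ = 1)
    (hV' : Vᵀ * V = 1) (d : ι → ℝ) :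
    (U * (V * Matrix.diagonal d * Vᵀ)).trace ≤ ∑ i, |d i| := by
  rw [trace_mul_conj_diagonal]
  refine Finset.sum_le_sum fun i _ => ?_
  have hW : (Vᵀ * U * V) * (Vᵀ * U * V)ᵀ = 1 := by
    simp only [Matrix.transpose_mul, Matrix.transpose_transpose, Matrix.mul_assoc]
    rw [← Matrix.mul_assoc V Vᵀ, hV, Matrix.one_mul, ← Matrix.mul_assoc U, hU, Matrix.one_mul, hV']
  calc _ ≤ |(Vᵀ * U * V) i i * d i| := le_abs_self _
    _ = |(Vᵀ * U * V) i i| * |d i| := abs_mul _ _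
    _ ≤ 1 * |d i| := by
      gcongr
      exact abs_apply_le_one_of_orthogonal hW i i
    _ = _ := one_mul _

/-- The maximizer is the sign of the matrix, with the value 1 on the kernel so that it stays
orthogonal. That it is a symmetric involution is essential for the block argument in
`traceNorm_reflection_le_blocks`. -/
theorem exists_symm_orthogonal_trace_eq {V : Matrix ι ι ℝ} (hV : V * Vᵀ = 1) (hV' : Vᵀ * V = 1)
    (d : ι → ℝ) : ∃ U : Matrix ι ι ℝ, Uᵀ = U ∧ U * U = 1 ∧
      (U * (V * Matrix.diagonal d * Vᵀ)).trace = ∑ i, |d i| := by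
  refine ⟨V * Matrix.diagonal (fun i => if 0 ≤ d i then 1 else -1) * Vᵀ, ?_, ?_, ?_⟩
  · simp [Matrix.mul_assoc]
  · rw [show ∀ D : Matrix ι ι ℝ, V * D * Vᵀ * (V * D * Vᵀ) = V * (D * (Vᵀ * V) * D) * Vᵀ by
      intro D; simp only [Matrix.mul_assoc], hV', Matrix.mul_one, Matrix.diagonal_mul_diagonal]
    rw [show (fun i => (if 0 ≤ d i then (1 : ℝ) else -1) * if 0 ≤ d i then 1 else -1)
      = fun _ => 1 by ext i; split_ifs <;> simp]
    simp [hV]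
  · rw [trace_mul_conj_diagonal]
    refine Finset.sum_congr rfl fun i _ => ?_
    rw [show ∀ D : Matrix ι ι ℝ, Vᵀ * (V * D * Vᵀ) * V = (Vᵀ * V) * D * (Vᵀ * V) by
      intro D; simp only [Matrix.mul_assoc], hV', Matrix.mul_one, Matrix.one_mul,
      Matrix.diagonal_apply_eq]
    split_ifs with h
    · rw [one_mul, abs_of_nonneg h]
    · rw [abs_of_neg (not_le.1 h)]; ring

theorem trace_orthogonal_mul_le_traceNorm {U K : Matrix ι ι ℝ} (hU : U * Uᵀ = 1)
    (hK : K.IsHermitian) : (U * K).trace ≤ traceNorm K := by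
  obtain ⟨V, h1, h2, h3⟩ := exists_orthogonal_diagonalization hK
  rw [traceNorm, dif_pos hK]
  conv_lhs => rw [h3]
  exact trace_orthogonal_mul_le hU h1 h2 _

theorem exists_trace_eq_traceNorm {K : Matrix ι ι ℝ} (hK : K.IsHermitian) :
    ∃ U : Matrix ι ι ℝ, Uᵀ = U ∧ U * U = 1 ∧ (U * K).trace = traceNorm K := by
  obtain ⟨V, h1, h2, h3⟩ := exists_orthogonal_diagonalization hK
  obtain ⟨U, hU, hU', h4⟩ := exists_symm_orthogonal_trace_eq h1 h2 hK.eigenvalues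
  refine ⟨U, hU, hU', ?_⟩
  rw [traceNorm, dif_pos hK, ← h4, ← h3]

theorem traceNorm_submatrix_le {K : Matrix ι ι ℝ} (hK : K.IsHermitian) (e : κ ≃ ι) :
    traceNorm (K.submatrix e e) ≤ traceNorm K := by
  obtain ⟨U, hU, hU', h⟩ := exists_trace_eq_traceNorm (hK.submatrix e)
  rw [← h]
  have h1 : U * K.submatrix e e = (U.submatrix e.symm e.symm * K).submatrix e e := by
    rw [← Matrix.submatrix_mul_equiv _ _ e e e]
    simp
  rw [h1, show ∀ M : Matrix ι ι ℝ, (M.submatrix e e).trace = M.trace from fun M =>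
    e.sum_comp fun i => M i i]
  refine trace_orthogonal_mul_le_traceNorm ?_ hK
  rw [Matrix.transpose_submatrix, hU, Matrix.submatrix_mul_equiv, hU', Matrix.submatrix_one_equiv]

theorem traceNorm_submatrix {K : Matrix ι ι ℝ} (hK : K.IsHermitian) (e : κ ≃ ι) :
    traceNorm (K.submatrix e e) = traceNorm K := by
  refine le_antisymm (traceNorm_submatrix_le hK e) ?_
  have := traceNorm_submatrix_le (hK.submatrix e) e.symm
  simpa using this

theorem traceNorm_eq_sum {V : Matrix ι ι ℝ} (hV : V * Vᵀ = 1) (hV' : Vᵀ * V = 1)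
    (d : ι → ℝ) : traceNorm (V * Matrix.diagonal d * Vᵀ) = ∑ i, |d i| := by
  have hK : (V * Matrix.diagonal d * Vᵀ).IsHermitian := by
    rw [Matrix.IsHermitian, Matrix.conjTranspose_eq_transpose_of_trivial]
    simp [Matrix.mul_assoc]
  apply le_antisymm
  · obtain ⟨U, h1, h2, h3⟩ := exists_trace_eq_traceNorm hK
    rw [← h3]
    exact trace_orthogonal_mul_le (by rw [h1, h2]) hV hV' d
  · obtain ⟨U, h1, h2, h3⟩ := exists_symm_orthogonal_trace_eq hV hV' d
    rw [← h3]
    exact trace_orthogonal_mul_le_traceNorm (by rw [h1, h2]) hK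

theorem posSemidef_conj_diagonal (V : Matrix ι ι ℝ) {d : ι → ℝ} (hd : ∀ i, 0 ≤ d i) :
    (V * Matrix.diagonal d * Vᵀ).PosSemidef := by
  have := (Matrix.PosSemidef.diagonal (n := ι) (R := ℝ) (d := d) hd).mul_mul_conjTranspose_same V
  simpa using this

open scoped MatrixOrder Matrix.Norms.L2Operator in
theorem posSemidef_eq_of_mul_self_eq {A B : Matrix ι ι ℝ} (hA : A.PosSemidef) (hB : B.PosSemidef)
    (h : A * A = B * B) : A = B := by
  rw [← CFC.sqrt_unique (a := A * A) rfl hA.nonneg, ← CFC.sqrt_unique h.symm hB.nonneg]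

/-- `√(1 - P²)` for a symmetric block `P` of a symmetric orthogonal matrix. -/
theorem exists_complementary_sqrt {P Q : Matrix ι ι ℝ} (hP : P.IsHermitian)
    (h : P * P + Q * Qᵀ = 1) :
    ∃ A : Matrix ι ι ℝ, A.PosSemidef ∧ Aᵀ = A ∧ A * A = Q * Qᵀ ∧ P * A = A * P := by
  obtain ⟨V, h1, h2, h3⟩ := exists_orthogonal_diagonalization hP
  set μ := hP.eigenvalues
  have hmul : ∀ C D : Matrix ι ι ℝ, V * C * Vᵀ * (V * D * Vᵀ) = V * (C * D) * Vᵀ := by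
    intro C D
    rw [show V * C * Vᵀ * (V * D * Vᵀ) = V * (C * (Vᵀ * V) * D) * Vᵀ by
      simp only [Matrix.mul_assoc], h2, Matrix.mul_one]
  have hQQ : Q * Qᵀ = V * Matrix.diagonal (fun i => 1 - μ i * μ i) * Vᵀ := by
    rw [eq_sub_of_add_eq' h, h3, hmul, Matrix.diagonal_mul_diagonal]
    nth_rewrite 1 [← h1]
    rw [show Matrix.diagonal (fun i => 1 - μ i * μ i) = 1 - Matrix.diagonal (fun i => μ i * μ i) by
      rw [← Matrix.diagonal_one, Matrix.diagonal_sub]]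
    simp [Matrix.mul_sub, Matrix.sub_mul]
  -- In the eigenbasis of P, the number 1 - μ² is a diagonal entry of the Gram matrix of the rows of
  -- VᵀQ.
  have hnn : ∀ i, 0 ≤ 1 - μ i * μ i := by
    intro i
    have h5 : Vᵀ * (Q * Qᵀ) * V = Matrix.diagonal (fun i => 1 - μ i * μ i) := by
      rw [hQQ, show ∀ D : Matrix ι ι ℝ, Vᵀ * (V * D * Vᵀ) * V = (Vᵀ * V) * D * (Vᵀ * V) by
        intro D; simp only [Matrix.mul_assoc], h2, Matrix.mul_one, Matrix.one_mul]
    have h6 := congrFun (congrFun h5 i) i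
    rw [Matrix.diagonal_apply_eq] at h6
    rw [← h6, show Vᵀ * (Q * Qᵀ) * V = (Vᵀ * Q) * (Vᵀ * Q)ᵀ by
      simp [Matrix.mul_assoc], Matrix.mul_apply]
    exact Finset.sum_nonneg fun j _ => mul_self_nonneg _
  refine ⟨V * Matrix.diagonal (fun i => √(1 - μ i * μ i)) * Vᵀ,
    posSemidef_conj_diagonal V fun i => Real.sqrt_nonneg _, by simp [Matrix.mul_assoc], ?_, ?_⟩
  · rw [hmul, Matrix.diagonal_mul_diagonal, hQQ]
    simp_rw [Real.mul_self_sqrt (hnn _)]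
  · rw [h3, hmul, hmul, Matrix.diagonal_mul_diagonal, Matrix.diagonal_mul_diagonal]
    simp_rw [mul_comm]

/-- The block diagonal matrix with blocks A, A' is the modulus of the symmetric matrix T with
off-diagonal blocks Q, Qᵀ, by uniqueness of positive square roots. So |T| ± T is positive
semidefinite; testing it on the sum of the two copies of the i-th basis vector gives the claim. -/
theorem two_mul_abs_apply_le {A A' Q : Matrix ι ι ℝ} (hA : A.PosSemidef) (hA' : A'.PosSemidef)
    (h1 : A * A = Q * Qᵀ) (h2 : A' * A' = Qᵀ * Q) (i : ι) :
    2 * |Q i i| ≤ A i i + A' i i := by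
  set T : Matrix (ι ⊕ ι) (ι ⊕ ι) ℝ := Matrix.fromBlocks 0 Q Qᵀ 0 with hT
  have hTh : T.IsHermitian := by
    rw [Matrix.IsHermitian, Matrix.conjTranspose_eq_transpose_of_trivial, hT]
    simp [Matrix.fromBlocks_transpose]
  obtain ⟨V, v1, v2, v3⟩ := exists_orthogonal_diagonalization hTh
  set μ := hTh.eigenvalues
  have hmul : ∀ C D : Matrix (ι ⊕ ι) (ι ⊕ ι) ℝ,
      V * C * Vᵀ * (V * D * Vᵀ) = V * (C * D) * Vᵀ := by
    intro C D
    rw [show V * C * Vᵀ * (V * D * Vᵀ) = V * (C * (Vᵀ * V) * D) * Vᵀ by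
      simp only [Matrix.mul_assoc], v2, Matrix.mul_one]
  have habs : Matrix.fromBlocks A 0 0 A' = V * Matrix.diagonal (fun i => |μ i|) * Vᵀ := by
    apply posSemidef_eq_of_mul_self_eq
    · refine Matrix.PosSemidef.of_dotProduct_mulVec_nonneg ?_ ?_
      · exact Matrix.IsHermitian.fromBlocks hA.1 (by simp) hA'.1
      · intro x
        have e1 := hA.dotProduct_mulVec_nonneg (x ∘ Sum.inl)
        have e2 := hA'.dotProduct_mulVec_nonneg (x ∘ Sum.inr)
        rw [Matrix.fromBlocks_mulVec]
        simp only [dotProduct, Fintype.sum_sum_type] at e1 e2 ⊢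
        simp at e1 e2 ⊢
        linarith
    · exact posSemidef_conj_diagonal V fun i => abs_nonneg _
    · rw [hmul, Matrix.diagonal_mul_diagonal]
      simp_rw [abs_mul_abs_self]
      rw [← Matrix.diagonal_mul_diagonal, ← hmul, ← v3, hT, Matrix.fromBlocks_multiply,
        Matrix.fromBlocks_multiply]
      simp [h1, h2]
  have key : ∀ s : ℝ, (s = 1 ∨ s = -1) → 0 ≤ A i i + A' i i + 2 * (s * Q i i) := by
    intro s hs
    have hp : (Matrix.fromBlocks A 0 0 A' + s • T).PosSemidef := by
      rw [habs, v3, show V * Matrix.diagonal (fun i => |μ i|) * Vᵀ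
        + s • (V * Matrix.diagonal μ * Vᵀ) = V * Matrix.diagonal (fun i => |μ i| + s * μ i) * Vᵀ by
          rw [← Matrix.diagonal_add, Matrix.mul_add, Matrix.add_mul]
          congr 1
          rw [show Matrix.diagonal (fun i => s * μ i) = s • Matrix.diagonal μ by
            rw [← Matrix.diagonal_smul]; rfl]
          simp]
      refine posSemidef_conj_diagonal V fun j => ?_
      rcases hs with rfl | rfl
      · linarith [neg_abs_le (μ j)]
      · linarith [le_abs_self (μ j)]
    have := hp.dotProduct_mulVec_nonneg (Pi.single (Sum.inl i) 1 + Pi.single (Sum.inr i) 1)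
    simp [Matrix.mulVec_add, add_dotProduct, hT] at this
    linarith
  have k1 := key 1 (Or.inl rfl)
  have k2 := key (-1) (Or.inr rfl)
  rcases abs_cases (Q i i) with h | h <;> linarith [h.1]

/-- Let U, with blocks P, Q, Qᵀ, S, be the symmetric involution that is optimal for the left side,
so that its trace is tr PX + 2 ∑ Q_ii d_i + tr SY. With A = √(1 - P²) and B = √(1 - S²), the block
matrices (P, A, A, -P) and (-S, B, B, S) are orthogonal and serve as trial matrices on the right.
They give 2 tr PX + 2 tr SY + 2 ∑ (A_ii + B_ii)|d_i|, which suffices because 2|Q_ii| ≤ A_ii + B_ii.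
-/
theorem traceNorm_reflection_le_blocks {X Y : Matrix ι ι ℝ} (hX : Xᵀ = X) (hY : Yᵀ = Y)
    (d : ι → ℝ) :
    2 * traceNorm (Matrix.fromBlocks X (Matrix.diagonal d) (Matrix.diagonal d) Y) ≤
      traceNorm (Matrix.fromBlocks X (Matrix.diagonal fun i => |d i|)
        (Matrix.diagonal fun i => |d i|) (-X)) +
      traceNorm (Matrix.fromBlocks (-Y) (Matrix.diagonal fun i => |d i|)
        (Matrix.diagonal fun i => |d i|) Y) := by
  have herm : ∀ (X Y : Matrix ι ι ℝ) (d : ι → ℝ), Xᵀ = X → Yᵀ = Y →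
      (Matrix.fromBlocks X (Matrix.diagonal d) (Matrix.diagonal d) Y).IsHermitian := by
    intro X Y d hX hY
    rw [Matrix.IsHermitian, Matrix.conjTranspose_eq_transpose_of_trivial,
      Matrix.fromBlocks_transpose, hX, hY, Matrix.diagonal_transpose]
  obtain ⟨U, hU, hU', hUK⟩ := exists_trace_eq_traceNorm (herm X Y d hX hY)
  obtain ⟨P, Q, R, S, rfl⟩ : ∃ P Q R S, U = Matrix.fromBlocks P Q R S :=
    ⟨_, _, _, _, (Matrix.fromBlocks_toBlocks U).symm⟩
  rw [Matrix.fromBlocks_transpose, Matrix.fromBlocks_inj] at hU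
  obtain ⟨hP, hR, hQ, hS⟩ := hU
  subst hQ
  rw [Matrix.fromBlocks_multiply, ← Matrix.fromBlocks_one, Matrix.fromBlocks_inj] at hU'
  obtain ⟨u1, -, -, u4⟩ := hU'
  obtain ⟨A, a1, a2, a3, a4⟩ := exists_complementary_sqrt (P := P) (Q := Q)
    (by rw [Matrix.IsHermitian, Matrix.conjTranspose_eq_transpose_of_trivial, hP]) u1
  obtain ⟨B, b1, b2, b3, b4⟩ := exists_complementary_sqrt (P := S) (Q := Qᵀ)
    (by rw [Matrix.IsHermitian, Matrix.conjTranspose_eq_transpose_of_trivial, hS])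
    (by rw [Matrix.transpose_transpose, add_comm]; exact u4)
  rw [Matrix.transpose_transpose] at b3
  have e1 := trace_orthogonal_mul_le_traceNorm (U := Matrix.fromBlocks P A A (-P))
    (K := Matrix.fromBlocks X (Matrix.diagonal fun i => |d i|) (Matrix.diagonal fun i => |d i|) (-X))
    (by
      rw [Matrix.fromBlocks_transpose, Matrix.transpose_neg, hP, a2, Matrix.fromBlocks_multiply,
        ← Matrix.fromBlocks_one, Matrix.fromBlocks_inj]
      refine ⟨by rw [a3, u1], by simp [a4], by simp [a4], ?_⟩
      rw [a3, neg_mul_neg, add_comm, u1])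
    (herm _ _ _ hX (by rw [Matrix.transpose_neg, hX]))
  have e2 := trace_orthogonal_mul_le_traceNorm (U := Matrix.fromBlocks (-S) B B S)
    (K := Matrix.fromBlocks (-Y) (Matrix.diagonal fun i => |d i|) (Matrix.diagonal fun i => |d i|) Y)
    (by
      rw [Matrix.fromBlocks_transpose, Matrix.transpose_neg, hS, b2, Matrix.fromBlocks_multiply,
        ← Matrix.fromBlocks_one, Matrix.fromBlocks_inj]
      refine ⟨by rw [b3, neg_mul_neg, add_comm, u4], by simp [b4], by simp [b4], ?_⟩
      rw [b3, u4])
    (herm _ _ _ (by rw [Matrix.transpose_neg, hY]) hY)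
  have e3 : ∀ i, 2 * (Q i i * d i) ≤ A i i * |d i| + B i i * |d i| := by
    intro i
    have := two_mul_abs_apply_le a1 b1 a3 b3 i
    calc 2 * (Q i i * d i) ≤ 2 * |Q i i * d i| := by gcongr; exact le_abs_self _
      _ = (2 * |Q i i|) * |d i| := by rw [abs_mul]; ring
      _ ≤ (A i i + B i i) * |d i| := by gcongr
      _ = _ := by ring
  have e4 : 2 * ∑ i, Q i i * d i ≤ ∑ i, A i i * |d i| + ∑ i, B i i * |d i| := by
    rw [Finset.mul_sum, ← Finset.sum_add_distrib]
    exact Finset.sum_le_sum fun i _ => e3 i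
  have tb : ∀ M1 M2 M3 M4 : Matrix ι ι ℝ,
      (Matrix.fromBlocks M1 M2 M3 M4).trace = M1.trace + M4.trace := by
    intros; simp [Matrix.trace, Fintype.sum_sum_type]
  have td : ∀ (M : Matrix ι ι ℝ) (f : ι → ℝ), (M * Matrix.diagonal f).trace = ∑ i, M i i * f i := by
    intros; simp [Matrix.trace]
  rw [← hUK]
  simp only [Matrix.fromBlocks_multiply, tb, Matrix.trace_add, td, Matrix.transpose_apply,
    neg_mul_neg] at e1 e2 ⊢
  linarith

/-- Reflection positivity of the trace norm: `r` is a reflection that exchanges the sites that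
satisfy `p` with those that do not, and the only nonzero matrix elements of `K` between the two
halves are those between a site and its mirror image. -/
theorem traceNorm_reflection_le (r : ι → ι) (p : ι → Prop) [DecidablePred p]
    (hr : ∀ x, r (r x) = x) (hp : ∀ x, p (r x) ↔ ¬ p x)
    {K : Matrix ι ι ℝ} (hK : Kᵀ = K) (hK0 : ∀ x y, p x → p y → x ≠ y → K x (r y) = 0) :
    2 * traceNorm K ≤
      traceNorm (Matrix.of fun x y => if p x then (if p y then K x y else |K x y|)
        else (if p y then |K x y| else -K (r x) (r y))) +
      traceNorm (Matrix.of fun x y => if p x then (if p y then -K (r x) (r y) else |K x y|)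
        else (if p y then |K x y| else K x y)) := by
  -- Coordinates in which the second half is identified with the first one through r; the blocks
  -- that connect the halves are then diagonal.
  set e : {x // p x} ⊕ {x // p x} ≃ ι :=
    { toFun := Sum.elim (fun x => x) (fun x => r x)
      invFun := fun x => if h : p x then Sum.inl ⟨x, h⟩ else Sum.inr ⟨r x, (hp x).2 h⟩
      left_inv := by
        rintro (x | x)
        · simp [x.2]
        · have : ¬ p (r x) := by rw [hp]; simpa using x.2
          simp [this, hr]
      right_inv := by
        intro x
        by_cases h : p x <;> simp [h, hr] } with he
  have el : ∀ x, e (Sum.inl x) = x := fun x => rfl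
  have er : ∀ x, e (Sum.inr x) = r x := fun x => rfl
  have hs : ∀ x y, K x y = K y x := fun x y => by
    conv_lhs => rw [← hK]
    rfl
  have pl : ∀ x : {x // p x}, p x := fun x => x.2
  have pr : ∀ x : {x // p x}, ¬ p (r x) := fun x => by rw [hp]; simpa using x.2
  have hodd : ∀ x y : {x // p x}, x ≠ y → K x (r y) = 0 := fun x y h =>
    hK0 x y x.2 y.2 fun h' => h (Subtype.ext h')
  have main := traceNorm_reflection_le_blocks (X := Matrix.of fun x y : {x // p x} => K x y)
    (Y := Matrix.of fun x y : {x // p x} => K (r x) (r y))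
    (by ext x y; exact hs _ _) (by ext x y; exact hs _ _) (fun x => K x (r x))
  have h1 : Matrix.fromBlocks (Matrix.of fun x y : {x // p x} => K x y)
      (Matrix.diagonal fun x : {x // p x} => K x (r x))
      (Matrix.diagonal fun x : {x // p x} => K x (r x))
      (Matrix.of fun x y : {x // p x} => K (r x) (r y)) = K.submatrix e e := by
    ext (x | x) (y | y)
    · simp [el]
    · by_cases h : x = y
      · subst h; simp [el, er]
      · simp [el, er, h, hodd x y h]
    · by_cases h : x = y
      · subst h; simp [el, er, hs]
      · simp [el, er, h, hs (r x) y, hodd y x (Ne.symm h)]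
    · simp [er]
  have h2 : Matrix.fromBlocks (Matrix.of fun x y : {x // p x} => K x y)
      (Matrix.diagonal fun x : {x // p x} => |K x (r x)|)
      (Matrix.diagonal fun x : {x // p x} => |K x (r x)|)
      (-Matrix.of fun x y : {x // p x} => K x y) =
      Matrix.submatrix (Matrix.of fun x y => if p x then (if p y then K x y else |K x y|)
        else (if p y then |K x y| else -K (r x) (r y))) e e := by
    ext (x | x) (y | y)
    · simp [el, pl]
    · by_cases h : x = y
      · subst h; simp [el, er, pl, pr]
      · simp [el, er, h, hodd x y h, pl, pr]
    · by_cases h : x = y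
      · subst h; simp [el, er, hs, pl, pr]
      · simp [el, er, h, hs (r x) y, hodd y x (Ne.symm h), pl, pr]
    · simp [er, pr, hr]
  have h3 : Matrix.fromBlocks (-Matrix.of fun x y : {x // p x} => K (r x) (r y))
      (Matrix.diagonal fun x : {x // p x} => |K x (r x)|)
      (Matrix.diagonal fun x : {x // p x} => |K x (r x)|)
      (Matrix.of fun x y : {x // p x} => K (r x) (r y)) =
      Matrix.submatrix (Matrix.of fun x y => if p x then (if p y then -K (r x) (r y) else |K x y|)
        else (if p y then |K x y| else K x y)) e e := by
    ext (x | x) (y | y)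
    · simp [el, pl]
    · by_cases h : x = y
      · subst h; simp [el, er, pl, pr]
      · simp [el, er, h, hodd x y h, pl, pr]
    · by_cases h : x = y
      · subst h; simp [el, er, hs, pl, pr]
      · simp [el, er, h, hs (r x) y, hodd y x (Ne.symm h), pl, pr]
    · simp [er, pr]
  rw [h1, h2, h3] at main
  rwa [traceNorm_submatrix, traceNorm_submatrix, traceNorm_submatrix] at main
  · rw [Matrix.IsHermitian, Matrix.conjTranspose_eq_transpose_of_trivial]
    ext x y
    simp only [Matrix.transpose_apply, Matrix.of_apply, hs y x, hs (r y)]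
    split_ifs <;> rfl
  · rw [Matrix.IsHermitian, Matrix.conjTranspose_eq_transpose_of_trivial]
    ext x y
    simp only [Matrix.transpose_apply, Matrix.of_apply, hs y x, hs (r y)]
    split_ifs <;> rfl
  · rw [Matrix.IsHermitian, Matrix.conjTranspose_eq_transpose_of_trivial, hK]

end TraceNorm
end
end Z2Gauge

namespace Z2Gauge
noncomputable section
open scoped Matrix

/-! ### Hopping matrices with signs and their fluxes -/

section Hopping

variable {L : ℕ} [NeZero L]

/-- Hopping matrices with amplitudes `±1` on the edges of the torus. -/
structure IsHopping (K : Matrix (Site L) (Site L) ℝ) : Prop where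
  symm : ∀ x y, K x y = K y x
  horizontal : ∀ x, K x (x + (1, 0)) * K x (x + (1, 0)) = 1
  vertical : ∀ x, K x (x + (0, 1)) * K x (x + (0, 1)) = 1
  eq_zero : ∀ x y, y ≠ x + (1, 0) → y ≠ x + (0, 1) → x ≠ y + (1, 0) → x ≠ y + (0, 1) → K x y = 0

/-- The product of the hopping amplitudes around the plaquette with lower left corner `x`. -/
def flux (K : Matrix (Site L) (Site L) ℝ) (x : Site L) : ℝ :=
  K x (x + (1, 0)) * K (x + (1, 0)) (x + (1, 1)) * K (x + (1, 1)) (x + (0, 1)) * K (x + (0, 1)) x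

theorem IsHopping.isHermitian {K : Matrix (Site L) (Site L) ℝ} (hK : IsHopping K) :
    K.IsHermitian := by
  rw [Matrix.IsHermitian, Matrix.conjTranspose_eq_transpose_of_trivial]
  ext x y
  exact hK.symm y x

theorem IsHopping.horizontal' {K : Matrix (Site L) (Site L) ℝ} (hK : IsHopping K) (x : Site L) :
    K (x + (1, 1)) (x + (0, 1)) * K (x + (1, 1)) (x + (0, 1)) = 1 := by
  have := hK.horizontal (x + (0, 1))
  rw [add_assoc] at this
  simpa [hK.symm (x + (1, 1))] using this

theorem IsHopping.vertical' {K : Matrix (Site L) (Site L) ℝ} (hK : IsHopping K) (x : Site L) :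
    K (x + (1, 0)) (x + (1, 1)) * K (x + (1, 0)) (x + (1, 1)) = 1 := by
  have := hK.vertical (x + (1, 0))
  rw [add_assoc] at this
  simpa using this

theorem IsHopping.flux_eq {K : Matrix (Site L) (Site L) ℝ} (hK : IsHopping K) (x : Site L) :
    flux K x = 1 ∨ flux K x = -1 := by
  have h1 := hK.horizontal x
  have h2 := hK.vertical' x
  have h3 := hK.horizontal' x
  have h4 := hK.vertical x
  rw [← sq_eq_one_iff, flux, hK.symm (x + (0, 1)) x]
  calc _ = (K x (x + (1, 0)) * K x (x + (1, 0))) *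
      (K (x + (1, 0)) (x + (1, 1)) * K (x + (1, 0)) (x + (1, 1))) *
      (K (x + (1, 1)) (x + (0, 1)) * K (x + (1, 1)) (x + (0, 1))) *
      (K x (x + (0, 1)) * K x (x + (0, 1))) := by ring
    _ = 1 := by rw [h1, h2, h3, h4]; norm_num

theorem IsHopping.apply_mem {K : Matrix (Site L) (Site L) ℝ} (hK : IsHopping K) (x y : Site L) :
    K x y ∈ ({-1, 0, 1} : Set ℝ) := by
  have aux : ∀ a : ℝ, a * a = 1 → a ∈ ({-1, 0, 1} : Set ℝ) := by
    intro a ha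
    rcases mul_self_eq_one_iff.1 ha with h | h <;> simp [h]
  by_cases h1 : y = x + (1, 0)
  · exact h1 ▸ aux _ (hK.horizontal x)
  by_cases h2 : y = x + (0, 1)
  · exact h2 ▸ aux _ (hK.vertical x)
  by_cases h3 : x = y + (1, 0)
  · rw [hK.symm]; exact h3 ▸ aux _ (hK.horizontal y)
  by_cases h4 : x = y + (0, 1)
  · rw [hK.symm]; exact h4 ▸ aux _ (hK.vertical y)
  simp [hK.eq_zero x y h1 h2 h3 h4]

/-- Finiteness provides the maximizers of the chessboard argument. -/
theorem finite_isHopping : {K : Matrix (Site L) (Site L) ℝ | IsHopping K}.Finite := by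
  refine Set.Finite.subset (s := Set.pi Set.univ fun _ => Set.pi Set.univ fun _ => {-1, 0, 1})
    (Set.Finite.pi fun x => Set.Finite.pi fun y => Set.toFinite _) ?_
  intro K hK x _ y _
  exact hK.apply_mem x y

/-- The translate of a hopping matrix. -/
def shiftHopping (v : Site L) (K : Matrix (Site L) (Site L) ℝ) : Matrix (Site L) (Site L) ℝ :=
  K.submatrix (Equiv.addRight v) (Equiv.addRight v)

theorem IsHopping.shift {K : Matrix (Site L) (Site L) ℝ} (hK : IsHopping K) (v : Site L) :
    IsHopping (shiftHopping v K) where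
  symm x y := hK.symm _ _
  horizontal x := by
    simpa [shiftHopping, add_right_comm] using hK.horizontal (x + v)
  vertical x := by
    simpa [shiftHopping, add_right_comm] using hK.vertical (x + v)
  eq_zero x y h1 h2 h3 h4 := by
    refine hK.eq_zero _ _ ?_ ?_ ?_ ?_ <;> simp only [Equiv.coe_addRight, add_right_comm _ v] <;>
      rwa [Ne, add_left_inj]

theorem flux_shift (v : Site L) (K : Matrix (Site L) (Site L) ℝ) (x : Site L) :
    flux (shiftHopping v K) x = flux K (x + v) := by
  simp [shiftHopping, flux, add_right_comm]

theorem traceNorm_shift {K : Matrix (Site L) (Site L) ℝ} (hK : IsHopping K) (v : Site L) :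
    traceNorm (shiftHopping v K) = traceNorm K :=
  traceNorm_submatrix hK.isHermitian _

/-- The image of a hopping matrix under the exchange of the two coordinates. -/
def swapHopping (K : Matrix (Site L) (Site L) ℝ) : Matrix (Site L) (Site L) ℝ :=
  K.submatrix (Equiv.prodComm _ _) (Equiv.prodComm _ _)

theorem IsHopping.swap {K : Matrix (Site L) (Site L) ℝ} (hK : IsHopping K) :
    IsHopping (swapHopping K) where
  symm x y := hK.symm _ _
  horizontal x := by
    simpa [swapHopping] using hK.vertical x.swap
  vertical x := by
    simpa [swapHopping] using hK.horizontal x.swap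
  eq_zero x y h1 h2 h3 h4 := by
    refine hK.eq_zero _ _ ?_ ?_ ?_ ?_ <;> simp_all [Prod.ext_iff, and_comm]

theorem flux_swap {K : Matrix (Site L) (Site L) ℝ} (hK : IsHopping K) (x : Site L) :
    flux (swapHopping K) x = flux K x.swap := by
  simp only [swapHopping, flux, Matrix.submatrix_apply, Equiv.coe_prodComm, Prod.swap_add,
    Prod.swap_prod_mk]
  rw [hK.symm x.swap (x.swap + (0, 1)), hK.symm (x.swap + (0, 1)) (x.swap + (1, 1)),
    hK.symm (x.swap + (1, 1)) (x.swap + (1, 0)), hK.symm (x.swap + (1, 0)) x.swap]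
  ring

theorem traceNorm_swap {K : Matrix (Site L) (Site L) ℝ} (hK : IsHopping K) :
    traceNorm (swapHopping K) = traceNorm K :=
  traceNorm_submatrix hK.isHermitian _

end Hopping

/-! ### The two halves of a period -/

section Halves

variable {ℓ : ℕ}

/-- The first half of a period of length `4 (ℓ + 1)`. -/
def InHalf (a : ZMod (4 * (ℓ + 1))) : Prop := a.val < 2 * (ℓ + 1)

instance (a : ZMod (4 * (ℓ + 1))) : Decidable (InHalf a) := inferInstanceAs (Decidable (_ < _))

/-- The parity of a coordinate. -/
def par : ZMod (4 * (ℓ + 1)) →+* ZMod 2 :=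
  ZMod.castHom (Dvd.intro (2 * (ℓ + 1)) (by ring)) (ZMod 2)

theorem par_natCast (n : ℕ) : par ((n : ℕ) : ZMod (4 * (ℓ + 1))) = (n : ZMod 2) := map_natCast _ _

theorem val_add_one_cases (a : ZMod (4 * (ℓ + 1))) :
    (a.val + 1 < 4 * (ℓ + 1) ∧ (a + 1).val = a.val + 1) ∨
      (a.val + 1 = 4 * (ℓ + 1) ∧ (a + 1).val = 0) := by
  have h := ZMod.val_lt a
  have h1 : (1 : ZMod (4 * (ℓ + 1))).val = 1 := by
    have : Fact (1 < 4 * (ℓ + 1)) := ⟨by omega⟩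
    exact ZMod.val_one _
  rcases Nat.lt_or_ge (a.val + 1) (4 * (ℓ + 1)) with h2 | h2
  · left
    refine ⟨h2, ?_⟩
    rw [ZMod.val_add_of_lt (by rwa [h1]), h1]
  · right
    have h3 : a.val + 1 = 4 * (ℓ + 1) := by omega
    refine ⟨h3, ?_⟩
    rw [ZMod.val_add, h1, h3, Nat.mod_self]

theorem inHalf_reflect (a : ZMod (4 * (ℓ + 1))) : InHalf (-1 - a) ↔ ¬ InHalf a := by
  have h := ZMod.val_lt a
  have h1 : (-1 - a).val = 4 * (ℓ + 1) - 1 - a.val := by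
    have h2 : (-1 - a) = ((4 * (ℓ + 1) - 1 - a.val : ℕ) : ZMod (4 * (ℓ + 1))) := by
      rw [Nat.cast_sub (by omega), Nat.cast_sub (by omega), ZMod.natCast_self, ZMod.natCast_val,
        ZMod.cast_id']
      simp
    rw [h2, ZMod.val_natCast, Nat.mod_eq_of_lt (by omega)]
  unfold InHalf
  omega

/-- The half is left or entered only from 2(ℓ+1) - 1 and from 4(ℓ+1) - 1. Both are odd, because half
the side is even, and both are fixed by the reflection of plaquette corners. Oddness is what keeps
the plaquettes with even corner uncut. -/
theorem crossing {a : ZMod (4 * (ℓ + 1))} (h : ¬ (InHalf a ↔ InHalf (a + 1))) :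
    -2 - a = a ∧ par a = 1 := by
  have h2 := ZMod.val_lt a
  have key : a.val = 2 * (ℓ + 1) - 1 ∨ a.val = 4 * (ℓ + 1) - 1 := by
    unfold InHalf at h
    rcases val_add_one_cases a with h1 | h1 <;> omega
  have ha : ((a.val : ℕ) : ZMod (4 * (ℓ + 1))) = a := by
    rw [ZMod.natCast_val, ZMod.cast_id']; rfl
  have h4 : ((4 * (ℓ + 1) : ℕ) : ZMod (4 * (ℓ + 1))) = 0 := ZMod.natCast_self _
  have h5 : (2 : ZMod 2) = 0 := rfl
  rw [← ha]
  rcases key with k | k <;> rw [k, par_natCast, Nat.cast_sub (by omega), Nat.cast_sub (by omega)]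
  · constructor
    · push_cast at h4 ⊢
      linear_combination -h4
    · push_cast
      rw [h5]; simp
  · constructor
    · push_cast at h4 ⊢
      linear_combination -2 * h4
    · push_cast
      rw [show (4 : ZMod 2) = 0 from rfl]; simp

theorem not_inHalf_neg_one : ¬ InHalf (-1 : ZMod (4 * (ℓ + 1))) := by
  have := inHalf_reflect (0 : ZMod (4 * (ℓ + 1)))
  rw [sub_zero] at this
  rw [this, not_not]
  simp [InHalf]

theorem inHalf_zero : InHalf (0 : ZMod (4 * (ℓ + 1))) := by
  simp [InHalf]

end Halves

end
end Z2Gauge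

namespace Z2Gauge
noncomputable section
open scoped Matrix

/-! ### Folding the torus along a pair of reflection lines -/

section Reflection

variable {ℓ : ℕ}

/-- The reflection of the torus across the vertical lines through the midpoints of the edges that
leave the half `InHalf`. -/
def reflect (x : Site (4 * (ℓ + 1))) : Site (4 * (ℓ + 1)) := (-1 - x.1, x.2)

/-- The action of the reflection on the lower left corners of plaquettes. -/
def reflectCorner (x : Site (4 * (ℓ + 1))) : Site (4 * (ℓ + 1)) := (-2 - x.1, x.2)

theorem reflect_reflect (x : Site (4 * (ℓ + 1))) : reflect (reflect x) = x := by
  simp [reflect]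

theorem inHalf_reflect_fst (x : Site (4 * (ℓ + 1))) :
    InHalf (reflect x).1 ↔ ¬ InHalf x.1 := inHalf_reflect x.1

/-- The hopping matrix obtained by replacing the right half by the mirror image of the left one. -/
def foldLeft (K : Matrix (Site (4 * (ℓ + 1))) (Site (4 * (ℓ + 1))) ℝ) :
    Matrix (Site (4 * (ℓ + 1))) (Site (4 * (ℓ + 1))) ℝ :=
  Matrix.of fun x y => if InHalf x.1 then (if InHalf y.1 then K x y else |K x y|)
    else (if InHalf y.1 then |K x y| else -K (reflect x) (reflect y))

/-- The hopping matrix obtained by replacing the left half by the mirror image of the right one. -/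
def foldRight (K : Matrix (Site (4 * (ℓ + 1))) (Site (4 * (ℓ + 1))) ℝ) :
    Matrix (Site (4 * (ℓ + 1))) (Site (4 * (ℓ + 1))) ℝ :=
  Matrix.of fun x y => if InHalf x.1 then (if InHalf y.1 then -K (reflect x) (reflect y)
    else |K x y|) else (if InHalf y.1 then |K x y| else K x y)

variable {K : Matrix (Site (4 * (ℓ + 1))) (Site (4 * (ℓ + 1))) ℝ}

theorem reflect_add_horizontal (x : Site (4 * (ℓ + 1))) :
    reflect (x + (1, 0)) = reflectCorner x := by
  simp only [reflect, reflectCorner, Prod.fst_add, Prod.snd_add]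
  ext1 <;> simp; ring

theorem reflect_eq (x : Site (4 * (ℓ + 1))) :
    reflect x = reflectCorner x + (1, 0) := by
  simp only [reflect, reflectCorner, Prod.mk_add_mk]
  ext1 <;> simp; ring

theorem reflect_add_vertical (x : Site (4 * (ℓ + 1))) :
    reflect (x + (0, 1)) = reflectCorner x + (1, 1) := by
  simp only [reflect, reflectCorner, Prod.fst_add, Prod.snd_add, Prod.mk_add_mk]
  ext1 <;> simp; ring

theorem reflect_add_diagonal (x : Site (4 * (ℓ + 1))) :
    reflect (x + (1, 1)) = reflectCorner x + (0, 1) := by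
  simp only [reflect, reflectCorner, Prod.fst_add, Prod.snd_add, Prod.mk_add_mk]
  ext1 <;> simp; ring

theorem IsHopping.reflect_horizontal (hK : IsHopping K) (x : Site (4 * (ℓ + 1))) :
    K (reflect x) (reflect (x + (1, 0))) * K (reflect x) (reflect (x + (1, 0))) = 1 := by
  rw [reflect_add_horizontal, reflect_eq, hK.symm]
  exact hK.horizontal _

theorem IsHopping.reflect_vertical (hK : IsHopping K) (x : Site (4 * (ℓ + 1))) :
    K (reflect x) (reflect (x + (0, 1))) * K (reflect x) (reflect (x + (0, 1))) = 1 := by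
  rw [reflect_add_vertical, reflect_eq]
  exact hK.vertical' _

theorem IsHopping.reflect_eq_zero (hK : IsHopping K) (x y : Site (4 * (ℓ + 1)))
    (h1 : y ≠ x + (1, 0)) (h2 : y ≠ x + (0, 1)) (h3 : x ≠ y + (1, 0)) (h4 : x ≠ y + (0, 1)) :
    K (reflect x) (reflect y) = 0 := by
  have inj : ∀ a b : Site (4 * (ℓ + 1)), reflect a = b → a = reflect b := fun a b h => by
    rw [← h, reflect_reflect]
  apply hK.eq_zero
  · refine fun h => h3 (inj _ _ h ▸ ?_)
    simp only [reflect, Prod.ext_iff, Prod.fst_add, Prod.snd_add]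
    exact ⟨by ring, by simp⟩
  · refine fun h => h2 (inj _ _ h ▸ ?_)
    simp only [reflect, Prod.ext_iff, Prod.fst_add, Prod.snd_add]
    exact ⟨by ring, by simp⟩
  · refine fun h => h1 (inj _ _ h ▸ ?_)
    simp only [reflect, Prod.ext_iff, Prod.fst_add, Prod.snd_add]
    exact ⟨by ring, by simp⟩
  · refine fun h => h4 (inj _ _ h ▸ ?_)
    simp only [reflect, Prod.ext_iff, Prod.fst_add, Prod.snd_add]
    exact ⟨by ring, by simp⟩

theorem IsHopping.foldLeft (hK : IsHopping K) : IsHopping (foldLeft K) where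
  symm x y := by
    simp only [Z2Gauge.foldLeft, Matrix.of_apply, hK.symm y x, hK.symm (reflect y)]
    split_ifs <;> rfl
  horizontal x := by
    simp only [Z2Gauge.foldLeft, Matrix.of_apply]
    split_ifs <;> simp only [abs_mul_abs_self, neg_mul_neg, hK.horizontal, hK.reflect_horizontal]
  vertical x := by
    simp only [Z2Gauge.foldLeft, Matrix.of_apply]
    split_ifs <;> simp only [abs_mul_abs_self, neg_mul_neg, hK.vertical, hK.reflect_vertical]
  eq_zero x y h1 h2 h3 h4 := by
    simp [Z2Gauge.foldLeft, hK.eq_zero x y h1 h2 h3 h4, hK.reflect_eq_zero x y h1 h2 h3 h4]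

theorem IsHopping.foldRight (hK : IsHopping K) : IsHopping (foldRight K) where
  symm x y := by
    simp only [Z2Gauge.foldRight, Matrix.of_apply, hK.symm y x, hK.symm (reflect y)]
    split_ifs <;> rfl
  horizontal x := by
    simp only [Z2Gauge.foldRight, Matrix.of_apply]
    split_ifs <;> simp only [abs_mul_abs_self, neg_mul_neg, hK.horizontal, hK.reflect_horizontal]
  vertical x := by
    simp only [Z2Gauge.foldRight, Matrix.of_apply]
    split_ifs <;> simp only [abs_mul_abs_self, neg_mul_neg, hK.vertical, hK.reflect_vertical]
  eq_zero x y h1 h2 h3 h4 := by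
    simp [Z2Gauge.foldRight, hK.eq_zero x y h1 h2 h3 h4, hK.reflect_eq_zero x y h1 h2 h3 h4]

/-- The reflection lines pass through midpoints of edges, so the edges that join the two halves are
those from a site to its mirror image. -/
theorem IsHopping.apply_reflect_eq_zero (hK : IsHopping K) {x y : Site (4 * (ℓ + 1))}
    (hx : InHalf x.1) (hy : InHalf y.1) (hxy : x ≠ y) : K x (reflect y) = 0 := by
  have hy' : ¬ InHalf (-1 - y.1) := by rw [inHalf_reflect]; simpa using hy
  apply hK.eq_zero <;> intro h <;> rw [Prod.ext_iff] at h <;>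
    simp only [reflect, Prod.fst_add, Prod.snd_add, add_zero] at h
  · have := (crossing (a := x.1) (by rw [← h.1]; tauto)).1
    exact hxy (Prod.ext (by linear_combination h.1 - this) h.2.symm)
  · rw [h.1] at hy'; exact hy' hx
  · have := (crossing (a := -1 - y.1) (by rw [← h.1]; tauto)).1
    exact hxy (Prod.ext (by linear_combination h.1 - this) h.2)
  · rw [← h.1] at hy'; exact hy' hx

theorem IsHopping.traceNorm_fold (hK : IsHopping K) :
    2 * traceNorm K ≤ traceNorm (Z2Gauge.foldLeft K) + traceNorm (Z2Gauge.foldRight K) :=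
  traceNorm_reflection_le reflect (fun x => InHalf x.1) reflect_reflect inHalf_reflect_fst
    (by ext x y; exact hK.symm y x) fun _ _ hx hy hxy => hK.apply_reflect_eq_zero hx hy hxy

/-- The four minus signs cancel, and the reversed orientation of the mirror image does not matter
for a symmetric matrix. -/
theorem IsHopping.flux_reflect (hK : IsHopping K) (x : Site (4 * (ℓ + 1))) :
    -K (reflect x) (reflect (x + (1, 0))) * -K (reflect (x + (1, 0))) (reflect (x + (1, 1))) *
      -K (reflect (x + (1, 1))) (reflect (x + (0, 1))) * -K (reflect (x + (0, 1))) (reflect x) =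
    flux K (reflectCorner x) := by
  rw [reflect_add_horizontal, reflect_add_diagonal, reflect_add_vertical, reflect_eq, flux,
    hK.symm _ (reflectCorner x), hK.symm (reflectCorner x + (0, 1)) (reflectCorner x),
    hK.symm (reflectCorner x + (0, 1)) (reflectCorner x + (1, 1)),
    hK.symm (reflectCorner x + (1, 1)) (reflectCorner x + (1, 0))]
  ring

theorem IsHopping.flux_fold_of_inHalf (hK : IsHopping K) {x : Site (4 * (ℓ + 1))}
    (h1 : InHalf x.1) (h2 : InHalf (x.1 + 1)) :
    flux (Z2Gauge.foldLeft K) x = flux K x ∧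
      flux (Z2Gauge.foldRight K) x = flux K (reflectCorner x) := by
  constructor
  · simp [flux, Z2Gauge.foldLeft, h1, h2]
  · rw [← hK.flux_reflect]
    simp [flux, Z2Gauge.foldRight, h1, h2]

theorem IsHopping.flux_fold_of_not_inHalf (hK : IsHopping K) {x : Site (4 * (ℓ + 1))}
    (h1 : ¬ InHalf x.1) (h2 : ¬ InHalf (x.1 + 1)) :
    flux (Z2Gauge.foldLeft K) x = flux K (reflectCorner x) ∧
      flux (Z2Gauge.foldRight K) x = flux K x := by
  constructor
  · rw [← hK.flux_reflect]
    simp [flux, Z2Gauge.foldLeft, h1, h2]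
  · simp [flux, Z2Gauge.foldRight, h1, h2]

/-- In a cut plaquette the two horizontal amplitudes have become 1, while the two vertical ones are
mirror images with opposite signs. The sign in the fold is thus what makes flux -1 the favoured
value. -/
theorem IsHopping.flux_fold_crossing (hK : IsHopping K) {x : Site (4 * (ℓ + 1))}
    (h : ¬ (InHalf x.1 ↔ InHalf (x.1 + 1))) :
    flux (Z2Gauge.foldLeft K) x = -1 ∧ flux (Z2Gauge.foldRight K) x = -1 := by
  have hc : reflectCorner x = x := Prod.ext (crossing h).1 rfl
  have e1 : reflect x = x + (1, 0) := by rw [reflect_eq, hc]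
  have e2 : reflect (x + (1, 0)) = x := by rw [reflect_add_horizontal, hc]
  have e3 : reflect (x + (1, 1)) = x + (0, 1) := by rw [reflect_add_diagonal, hc]
  have e4 : reflect (x + (0, 1)) = x + (1, 1) := by rw [reflect_add_vertical, hc]
  have aux : ∀ a : ℝ, a * a = 1 → |a| = 1 := fun a ha => by
    rcases mul_self_eq_one_iff.1 ha with h | h <;> simp [h]
  have k1 := aux _ (hK.horizontal x)
  have k3 := aux _ (hK.horizontal' x)
  have k2 := hK.vertical' x
  have k4 := hK.vertical x
  by_cases h1 : InHalf x.1
  · have h2 : ¬ InHalf (x.1 + 1) := by tauto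
    simp only [flux, Z2Gauge.foldLeft, Z2Gauge.foldRight, Matrix.of_apply, Prod.fst_add, add_zero,
      h1, h2, if_true, if_false, k1, k3, e1, e2, e3, e4, hK.symm (x + (0, 1)) x,
      hK.symm (x + (1, 1)) (x + (1, 0))]
    constructor <;> linarith
  · have h2 : InHalf (x.1 + 1) := by tauto
    simp only [flux, Z2Gauge.foldLeft, Z2Gauge.foldRight, Matrix.of_apply, Prod.fst_add, add_zero,
      h1, h2, if_true, if_false, k1, k3, e1, e2, e3, e4, hK.symm (x + (0, 1)) x,
      hK.symm (x + (1, 1)) (x + (1, 0))]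
    constructor <;> linarith

end Reflection
end
end Z2Gauge

namespace Z2Gauge
noncomputable section
open scoped Matrix

/-! ### Chessboard argument for the maximizers -/

section Chessboard

variable {ℓ : ℕ} {K : Matrix (Site (4 * (ℓ + 1))) (Site (4 * (ℓ + 1))) ℝ}

theorem two_mul_sum_le_of_involutive {α : Type*} [Fintype α] {ρ : α → α}
    (hρ : Function.Involutive ρ) {f g h : α → ℕ} (hle : ∀ x, f x + f (ρ x) ≤ g x + h x) :
    2 * ∑ x, f x ≤ ∑ x, g x + ∑ x, h x := by
  have e : ∑ x, f (ρ x) = ∑ x, f x := Equiv.sum_comp hρ.toPerm f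
  calc 2 * ∑ x, f x = ∑ x, (f x + f (ρ x)) := by rw [Finset.sum_add_distrib, e]; ring
    _ ≤ ∑ x, (g x + h x) := Finset.sum_le_sum fun x _ => hle x
    _ = _ := Finset.sum_add_distrib

/-- Equality after summation forces equality at every point; this is how maximality yields local
information about the fluxes. -/
theorem eq_of_sum_le_of_involutive {α : Type*} [Fintype α] {ρ : α → α}
    (hρ : Function.Involutive ρ) {f g h : α → ℕ} (hle : ∀ x, f x + f (ρ x) ≤ g x + h x)
    (hs : ∑ x, g x + ∑ x, h x ≤ 2 * ∑ x, f x) (x : α) : f x + f (ρ x) = g x + h x := by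
  have e : ∑ x, f (ρ x) = ∑ x, f x := Equiv.sum_comp hρ.toPerm f
  have h1 : ∑ x, (f x + f (ρ x)) = ∑ x, (g x + h x) := by
    refine le_antisymm (Finset.sum_le_sum fun x _ => hle x) ?_
    rw [Finset.sum_add_distrib, Finset.sum_add_distrib, e]
    linarith
  exact (Finset.sum_eq_sum_iff_of_le fun x _ => hle x).1 h1 x (Finset.mem_univ x)

/-- The corners with two even coordinates. -/
def EvenCorner (x : Site (4 * (ℓ + 1))) : Prop := par x.1 = 0 ∧ par x.2 = 0

instance (x : Site (4 * (ℓ + 1))) : Decidable (EvenCorner x) :=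
  inferInstanceAs (Decidable (_ ∧ _))

open Classical in
/-- Indicator of a plaquette with even corner and flux `1`. -/
def evenDefect (K : Matrix (Site (4 * (ℓ + 1))) (Site (4 * (ℓ + 1))) ℝ)
    (x : Site (4 * (ℓ + 1))) : ℕ := if EvenCorner x ∧ flux K x = 1 then 1 else 0

open Classical in
/-- Indicator of a plaquette with flux `-1` whose corner is not even. -/
def oddRegular (K : Matrix (Site (4 * (ℓ + 1))) (Site (4 * (ℓ + 1))) ℝ)
    (x : Site (4 * (ℓ + 1))) : ℕ := if ¬ EvenCorner x ∧ flux K x = -1 then 1 else 0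

open Classical in
/-- Indicator of vertically neighbouring even plaquettes with equal fluxes. -/
def verticalAgree (K : Matrix (Site (4 * (ℓ + 1))) (Site (4 * (ℓ + 1))) ℝ)
    (x : Site (4 * (ℓ + 1))) : ℕ :=
  if EvenCorner x ∧ flux K x = flux K (x + (0, 2)) then 1 else 0

open Classical in
/-- Indicator of horizontally neighbouring even plaquettes with equal fluxes. -/
def horizontalAgree (K : Matrix (Site (4 * (ℓ + 1))) (Site (4 * (ℓ + 1))) ℝ)
    (x : Site (4 * (ℓ + 1))) : ℕ :=
  if EvenCorner x ∧ flux K x = flux K (x + (2, 0)) then 1 else 0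

theorem par_two : par (2 : ZMod (4 * (ℓ + 1))) = 0 := by
  rw [map_ofNat]; rfl

theorem par_one : par (1 : ZMod (4 * (ℓ + 1))) = 1 := map_one _

theorem involutive_reflectCorner : Function.Involutive (reflectCorner (ℓ := ℓ)) := fun x => by
  simp [reflectCorner]

theorem evenCorner_reflectCorner (x : Site (4 * (ℓ + 1))) :
    EvenCorner (reflectCorner x) ↔ EvenCorner x := by
  simp [EvenCorner, reflectCorner, par_two]

theorem inHalf_iff_of_evenCorner {x : Site (4 * (ℓ + 1))} (h : EvenCorner x) :
    InHalf x.1 ↔ InHalf (x.1 + 1) := by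
  by_contra hc
  have := (crossing hc).2
  rw [h.1] at this
  exact absurd this (by decide)

/-- The reflection of pairs of horizontally neighbouring even corners. -/
def reflectPair (x : Site (4 * (ℓ + 1))) : Site (4 * (ℓ + 1)) := (-4 - x.1, x.2)

theorem involutive_reflectPair : Function.Involutive (reflectPair (ℓ := ℓ)) := fun x => by
  simp [reflectPair]

theorem evenCorner_reflectPair (x : Site (4 * (ℓ + 1))) :
    EvenCorner (reflectPair x) ↔ EvenCorner x := by
  have h4 : par (4 : ZMod (4 * (ℓ + 1))) = 0 := by
    rw [map_ofNat]; rfl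
  simp [EvenCorner, reflectPair, h4]

theorem evenCorner_add_horizontal (x : Site (4 * (ℓ + 1))) :
    EvenCorner (x + (2, 0)) ↔ EvenCorner x := by
  simp [EvenCorner, par_two]

/-- Even plaquettes are never cut, so each of them and its mirror image are simply distributed
between the two folds. The reward for flux 1 at even corners is therefore compatible with folding.
-/
theorem evenDefect_fold (hK : IsHopping K) (x : Site (4 * (ℓ + 1))) :
    evenDefect K x + evenDefect K (reflectCorner x) ≤
      evenDefect (foldLeft K) x + evenDefect (foldRight K) x := by
  simp only [evenDefect, evenCorner_reflectCorner]
  by_cases he : EvenCorner x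
  · have hi := inHalf_iff_of_evenCorner he
    by_cases h1 : InHalf x.1
    · obtain ⟨e1, e2⟩ := hK.flux_fold_of_inHalf h1 (hi.1 h1)
      rw [e1, e2]
    · obtain ⟨e1, e2⟩ := hK.flux_fold_of_not_inHalf h1 (fun h => h1 (hi.2 h))
      rw [e1, e2, add_comm]
  · simp [he]

/-- Uncut plaquettes are redistributed between the folds; cut ones acquire flux -1 in both. Hence
the inequality is strict unless the cut plaquettes already had flux -1. -/
theorem oddRegular_fold (hK : IsHopping K) (x : Site (4 * (ℓ + 1))) :
    oddRegular K x + oddRegular K (reflectCorner x) ≤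
      oddRegular (foldLeft K) x + oddRegular (foldRight K) x := by
  simp only [oddRegular, evenCorner_reflectCorner]
  by_cases he : EvenCorner x
  · simp [he]
  · by_cases hc : InHalf x.1 ↔ InHalf (x.1 + 1)
    · by_cases h1 : InHalf x.1
      · obtain ⟨e1, e2⟩ := hK.flux_fold_of_inHalf h1 (hc.1 h1)
        rw [e1, e2]
      · obtain ⟨e1, e2⟩ := hK.flux_fold_of_not_inHalf h1 (fun h => h1 (hc.2 h))
        rw [e1, e2, add_comm]
    · obtain ⟨e1, e2⟩ := hK.flux_fold_crossing hc
      simp only [e1, e2, he, not_false_eq_true, and_self, if_true, true_and]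
      split_ifs <;> norm_num

theorem verticalAgree_fold (hK : IsHopping K) (x : Site (4 * (ℓ + 1))) :
    verticalAgree K x + verticalAgree K (reflectCorner x) ≤
      verticalAgree (foldLeft K) x + verticalAgree (foldRight K) x := by
  simp only [verticalAgree, evenCorner_reflectCorner]
  have hr : reflectCorner (x + (0, 2)) = reflectCorner x + (0, 2) := by
    simp [reflectCorner]
  by_cases he : EvenCorner x
  · have hi := inHalf_iff_of_evenCorner he
    by_cases h1 : InHalf x.1
    · obtain ⟨e1, e2⟩ := hK.flux_fold_of_inHalf h1 (hi.1 h1)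
      obtain ⟨e3, e4⟩ := hK.flux_fold_of_inHalf (x := x + (0, 2)) (by simpa using h1)
        (by simpa using hi.1 h1)
      rw [e1, e2, e3, e4, hr]
    · have h2 : ¬ InHalf (x.1 + 1) := fun h => h1 (hi.2 h)
      obtain ⟨e1, e2⟩ := hK.flux_fold_of_not_inHalf h1 h2
      obtain ⟨e3, e4⟩ := hK.flux_fold_of_not_inHalf (x := x + (0, 2)) (by simpa using h1)
        (by simpa using h2)
      rw [e1, e2, e3, e4, hr, add_comm]
  · simp [he]

/-- A pair of even plaquettes on the two sides of a reflection line becomes a pair of mirror images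
in both folds, and then its fluxes agree; all other pairs are redistributed. -/
theorem horizontalAgree_fold (hK : IsHopping K) (x : Site (4 * (ℓ + 1))) :
    horizontalAgree K x + horizontalAgree K (reflectPair x) ≤
      horizontalAgree (foldLeft K) x + horizontalAgree (foldRight K) x := by
  simp only [horizontalAgree, evenCorner_reflectPair]
  have hr : reflectPair x + (2, 0) = reflectCorner x := by
    simp only [reflectCorner, reflectPair, Prod.mk_add_mk]
    ext1 <;> simp; ring
  have hr' : reflectCorner (x + (2, 0)) = reflectPair x := by
    simp only [reflectCorner, reflectPair, Prod.fst_add, Prod.snd_add]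
    ext1 <;> simp; ring
  by_cases he : EvenCorner x
  · have hi := inHalf_iff_of_evenCorner he
    have hi' := inHalf_iff_of_evenCorner ((evenCorner_add_horizontal x).2 he)
    -- If the two even corners lie in different halves, the line cuts the plaquette between them,
    -- and the pair is its own mirror image.
    have hcr : ¬ (InHalf x.1 ↔ InHalf (x + (2, 0)).1) → reflectPair x = x := by
      intro hn
      have := (crossing (a := x.1 + 1) (by
        rw [← hi, add_assoc]
        convert hn using 4
        norm_num)).1
      exact Prod.ext (by simp only [reflectPair]; linear_combination this) rfl
    by_cases h1 : InHalf x.1 <;> by_cases h2 : InHalf (x + (2, 0)).1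
    · obtain ⟨e1, e2⟩ := hK.flux_fold_of_inHalf h1 (hi.1 h1)
      obtain ⟨e3, e4⟩ := hK.flux_fold_of_inHalf h2 (hi'.1 h2)
      rw [e1, e2, e3, e4, hr, hr']
      simp only [eq_comm (a := flux K (reflectPair x))]
      rfl
    · obtain ⟨e1, e2⟩ := hK.flux_fold_of_inHalf h1 (hi.1 h1)
      obtain ⟨e3, e4⟩ := hK.flux_fold_of_not_inHalf h2 (fun h => h2 (hi'.2 h))
      have hx := hcr (by tauto)
      rw [hx] at hr hr'
      rw [e1, e2, e3, e4, hr', hx, ← hr]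
      simp only [he, true_and, if_true]
      split_ifs <;> norm_num
    · obtain ⟨e1, e2⟩ := hK.flux_fold_of_not_inHalf h1 (fun h => h1 (hi.2 h))
      obtain ⟨e3, e4⟩ := hK.flux_fold_of_inHalf h2 (hi'.1 h2)
      have hx := hcr (by tauto)
      rw [hx] at hr hr'
      rw [e1, e2, e3, e4, hr', hx, ← hr]
      simp only [he, true_and, if_true]
      split_ifs <;> norm_num
    · obtain ⟨e1, e2⟩ := hK.flux_fold_of_not_inHalf h1 (fun h => h1 (hi.2 h))
      obtain ⟨e3, e4⟩ := hK.flux_fold_of_not_inHalf h2 (fun h => h2 (hi'.2 h))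
      rw [e1, e2, e3, e4, hr, hr', add_comm]
      simp only [eq_comm (a := flux K (reflectPair x))]
      rfl
  · simp [he]

/-- The trace norm with a reward `c` for the even plaquettes of flux `1`. -/
def rewarded (c : ℝ) (K : Matrix (Site (4 * (ℓ + 1))) (Site (4 * (ℓ + 1))) ℝ) : ℝ :=
  traceNorm K + c * ((∑ x, evenDefect K x : ℕ) : ℝ)

/-- A measure of the regularity of the flux pattern. -/
def regularity (K : Matrix (Site (4 * (ℓ + 1))) (Site (4 * (ℓ + 1))) ℝ) : ℕ :=
  ∑ x, oddRegular K x + ∑ x, verticalAgree K x + ∑ x, horizontalAgree K x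

/-- Among the maximizers of `rewarded`, those of largest regularity. -/
structure IsRegularMaximizer (c : ℝ) (K : Matrix (Site (4 * (ℓ + 1))) (Site (4 * (ℓ + 1))) ℝ) :
    Prop where
  isHopping : IsHopping K
  max : ∀ K' : Matrix (Site (4 * (ℓ + 1))) (Site (4 * (ℓ + 1))) ℝ,
    IsHopping K' → rewarded c K' ≤ rewarded c K
  regular : ∀ K' : Matrix (Site (4 * (ℓ + 1))) (Site (4 * (ℓ + 1))) ℝ,
    IsHopping K' → rewarded c K' = rewarded c K → regularity K' ≤ regularity K

theorem exists_isRegularMaximizer (c : ℝ)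
    (hne : ∃ K : Matrix (Site (4 * (ℓ + 1))) (Site (4 * (ℓ + 1))) ℝ, IsHopping K) :
    ∃ K : Matrix (Site (4 * (ℓ + 1))) (Site (4 * (ℓ + 1))) ℝ, IsRegularMaximizer c K := by
  obtain ⟨K₀, h₀, h₀'⟩ := Set.exists_max_image _ (rewarded c)
    (finite_isHopping (L := 4 * (ℓ + 1))) hne
  obtain ⟨K, ⟨h1, h1'⟩, h2⟩ := Set.exists_max_image
    {K | IsHopping K ∧ rewarded c K = rewarded c K₀} regularity
    (finite_isHopping.subset fun K hK => hK.1) ⟨K₀, h₀, rfl⟩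
  exact ⟨K, h1, fun K' h => h1' ▸ h₀' K' h, fun K' h h' => h2 K' ⟨h, h'.trans h1'⟩⟩

/-- The average of `rewarded` over the two folds is at least its value at K, so both folds are
maximizers too. The folding inequality need not be strict, and maximality alone does not control the
cut plaquettes; the tie is broken by `regularity`, which can only grow on average and hence is
preserved term by term. Equality at the column -1 and at the pair of columns -2, 0 gives the two
conclusions. -/
theorem IsRegularMaximizer.fold {c : ℝ} (hc : 0 ≤ c) (h : IsRegularMaximizer c K) :
    (∀ y, flux K (-1, y) = -1) ∧
      ∀ y, par y = 0 → flux K (-2, y) = flux K (0, y) := by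
  have hK := h.isHopping
  have h1 : 2 * rewarded c K ≤ rewarded c (foldLeft K) + rewarded c (foldRight K) := by
    have t := hK.traceNorm_fold
    have d : (2 : ℝ) * (∑ x, evenDefect K x : ℕ) ≤ (∑ x, evenDefect (foldLeft K) x : ℕ) +
        (∑ x, evenDefect (foldRight K) x : ℕ) := by
      exact_mod_cast two_mul_sum_le_of_involutive involutive_reflectCorner (evenDefect_fold hK)
    unfold rewarded
    nlinarith [mul_le_mul_of_nonneg_left d hc]
  have hl := h.max _ hK.foldLeft
  have hr := h.max _ hK.foldRight
  have rl := h.regular _ hK.foldLeft (by linarith)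
  have rr := h.regular _ hK.foldRight (by linarith)
  have s1 := two_mul_sum_le_of_involutive involutive_reflectCorner (oddRegular_fold hK)
  have s2 := two_mul_sum_le_of_involutive involutive_reflectCorner (verticalAgree_fold hK)
  have s3 := two_mul_sum_le_of_involutive involutive_reflectPair (horizontalAgree_fold hK)
  unfold regularity at rl rr
  have t1 := eq_of_sum_le_of_involutive involutive_reflectCorner (oddRegular_fold hK) (by omega)
  have t3 := eq_of_sum_le_of_involutive involutive_reflectPair (horizontalAgree_fold hK) (by omega)
  have hcr : ¬ (InHalf (-1 : ZMod (4 * (ℓ + 1))) ↔ InHalf (-1 + 1 : ZMod (4 * (ℓ + 1)))) := by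
    rw [neg_add_cancel]
    exact fun h => not_inHalf_neg_one (h.2 inHalf_zero)
  constructor
  · intro y
    have t := t1 (-1, y)
    obtain ⟨e1, e2⟩ := hK.flux_fold_crossing (x := (-1, y)) hcr
    have hne : ¬ EvenCorner ((-1, y) : Site (4 * (ℓ + 1))) := by
      rintro ⟨h, -⟩
      simp only [map_neg, par_one] at h
      exact absurd h (by decide)
    have hfix : reflectCorner ((-1, y) : Site (4 * (ℓ + 1))) = (-1, y) :=
      Prod.ext (crossing hcr).1 rfl
    rw [hfix] at t
    simp only [oddRegular, hne, e1, e2, not_false_eq_true, true_and, if_true] at t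
    by_contra hn
    simp [hn] at t
  · intro y hy
    have t := t3 (-2, y)
    have he : EvenCorner ((-2, y) : Site (4 * (ℓ + 1))) := ⟨by simp [par_two], hy⟩
    have hfix : reflectPair ((-2, y) : Site (4 * (ℓ + 1))) = (-2, y) :=
      Prod.ext (by simp only [reflectPair]; ring) rfl
    have hz : ((-2, y) : Site (4 * (ℓ + 1))) + (2, 0) = (0, y) := by simp
    have i0 := inHalf_zero (ℓ := ℓ)
    have i1 : InHalf (0 + 1 : ZMod (4 * (ℓ + 1))) :=
      (inHalf_iff_of_evenCorner (x := (0, y)) ⟨map_zero _, hy⟩).1 i0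
    have i2 : ¬ InHalf (-2 + 1 : ZMod (4 * (ℓ + 1))) := by
      rw [show (-2 + 1 : ZMod (4 * (ℓ + 1))) = -1 by ring]
      exact not_inHalf_neg_one
    have i3 : ¬ InHalf (-2 : ZMod (4 * (ℓ + 1))) := fun h =>
      i2 ((inHalf_iff_of_evenCorner he).1 h)
    obtain ⟨e1, e2⟩ := hK.flux_fold_of_not_inHalf (x := (-2, y)) i3 i2
    obtain ⟨e3, e4⟩ := hK.flux_fold_of_inHalf (x := (0, y)) i0 i1
    have hc1 : reflectCorner ((-2, y) : Site (4 * (ℓ + 1))) = (0, y) := by simp [reflectCorner]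
    have hc2 : reflectCorner ((0, y) : Site (4 * (ℓ + 1))) = (-2, y) := by simp [reflectCorner]
    rw [hc1] at e1
    rw [hc2] at e4
    rw [hfix] at t
    simp only [horizontalAgree, he, hz, e1, e2, e3, e4, true_and, if_true] at t
    by_contra hn
    simp [hn] at t

theorem IsRegularMaximizer.shift {c : ℝ} (h : IsRegularMaximizer c K) {v : Site (4 * (ℓ + 1))}
    (hv : EvenCorner v) : IsRegularMaximizer c (shiftHopping v K) := by
  have he : ∀ x, EvenCorner (x + v) ↔ EvenCorner x := fun x => by
    simp [EvenCorner, hv.1, hv.2]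
  have hs : ∀ f : Site (4 * (ℓ + 1)) → ℕ, ∑ x, f (x + v) = ∑ x, f x := fun f =>
    Equiv.sum_comp (Equiv.addRight v) f
  have h1 : rewarded c (shiftHopping v K) = rewarded c K := by
    rw [rewarded, rewarded, traceNorm_shift h.isHopping, ← hs (evenDefect K)]
    simp only [evenDefect, flux_shift, he]
  have h2 : regularity (shiftHopping v K) = regularity K := by
    rw [regularity, regularity, ← hs (oddRegular K), ← hs (verticalAgree K),
      ← hs (horizontalAgree K)]
    simp only [oddRegular, verticalAgree, horizontalAgree, flux_shift, he, add_right_comm _ v]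
  refine ⟨h.isHopping.shift v, fun K' h' => h1 ▸ h.max K' h', fun K' h' e => ?_⟩
  rw [h2]
  exact h.regular K' h' (e.trans h1)

theorem IsRegularMaximizer.swap {c : ℝ} (h : IsRegularMaximizer c K) :
    IsRegularMaximizer c (swapHopping K) := by
  have he : ∀ x : Site (4 * (ℓ + 1)), EvenCorner x.swap ↔ EvenCorner x := fun x => by
    simp [EvenCorner, and_comm]
  have hs : ∀ f : Site (4 * (ℓ + 1)) → ℕ, ∑ x : Site (4 * (ℓ + 1)), f x.swap = ∑ x, f x := fun f =>
    Equiv.sum_comp (Equiv.prodComm _ _) f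
  have h1 : rewarded c (swapHopping K) = rewarded c K := by
    rw [rewarded, rewarded, traceNorm_swap h.isHopping, ← hs (evenDefect K)]
    simp only [evenDefect, flux_swap h.isHopping, he]
  have h2 : regularity (swapHopping K) = regularity K := by
    have e1 : ∑ x, verticalAgree (swapHopping K) x = ∑ x, horizontalAgree K x := by
      rw [← hs (horizontalAgree K)]
      simp [verticalAgree, horizontalAgree, flux_swap h.isHopping, he]
    have e2 : ∑ x, horizontalAgree (swapHopping K) x = ∑ x, verticalAgree K x := by
      rw [← hs (verticalAgree K)]
      simp [verticalAgree, horizontalAgree, flux_swap h.isHopping, he]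
    rw [regularity, regularity, ← hs (oddRegular K), e1, e2]
    simp only [oddRegular, flux_swap h.isHopping, he]
    ring
  refine ⟨h.isHopping.swap, fun K' h' => h1 ▸ h.max K' h', fun K' h' e => ?_⟩
  rw [h2]
  exact h.regular K' h' (e.trans h1)

/-- A translation by an even vector brings any odd column to the column -1, and any pair of
neighbouring even columns to the pair -2, 0. Only even translations preserve the class of even
corners. -/
theorem IsRegularMaximizer.horizontal {c : ℝ} (hc : 0 ≤ c) (h : IsRegularMaximizer c K) :
    (∀ x, par x.1 = 1 → flux K x = -1) ∧
      ∀ x, EvenCorner x → flux K (x + (2, 0)) = flux K x := by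
  constructor
  · intro x hx
    have hv : EvenCorner ((x.1 + 1, 0) : Site (4 * (ℓ + 1))) := by
      refine ⟨?_, map_zero _⟩
      simp only [map_add, par_one, hx]; rfl
    have := ((h.shift hv).fold hc).1 x.2
    rw [flux_shift] at this
    convert this using 2
    ext1 <;> simp
  · intro x hx
    have hv : EvenCorner ((x.1 + 2, 0) : Site (4 * (ℓ + 1))) := by
      refine ⟨?_, map_zero _⟩
      simp only [map_add, par_two, hx.1]; rfl
    have := ((h.shift hv).fold hc).2 x.2 hx.2
    rw [flux_shift, flux_shift] at this
    convert this.symm using 2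
    · ext1 <;> simp
    · ext1 <;> simp

theorem exists_eq_two_mul_of_par {a : ZMod (4 * (ℓ + 1))} (h : par a = 0) :
    ∃ n : ℕ, a = (n : ZMod (4 * (ℓ + 1))) * 2 := by
  have ha : ((a.val : ℕ) : ZMod (4 * (ℓ + 1))) = a := by
    rw [ZMod.natCast_val, ZMod.cast_id']; rfl
  rw [← ha, par_natCast, ZMod.natCast_eq_zero_iff] at h
  obtain ⟨n, hn⟩ := h
  exact ⟨n, by rw [← ha, hn]; push_cast; ring⟩

/-- A plaquette that is not even has an odd coordinate, so it is cut by a horizontal or vertical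
line after a suitable translation and has flux -1. The even plaquettes share one flux, since steps
of length two in the two directions connect them. -/
theorem IsRegularMaximizer.flux_eq {c : ℝ} (hc : 0 ≤ c) (h : IsRegularMaximizer c K) :
    (∀ x, flux K x = -1) ∨ ∀ x, flux K x = if EvenCorner x then 1 else -1 := by
  have h1 := h.horizontal hc
  have h2 := h.swap.horizontal hc
  have hs := fun x => flux_swap h.isHopping x
  simp only [hs] at h2
  have z2 : ∀ a : ZMod 2, a = 0 ∨ a = 1 := by decide
  have hodd : ∀ x, ¬ EvenCorner x → flux K x = -1 := by
    intro x hx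
    rcases z2 (par x.1) with h3 | h3
    · rcases z2 (par x.2) with h4 | h4
      · exact absurd ⟨h3, h4⟩ hx
      · simpa using h2.1 x.swap h4
    · exact h1.1 x h3
  have hh : ∀ (n : ℕ) (x : Site (4 * (ℓ + 1))), EvenCorner x →
      flux K (x + ((n : ZMod (4 * (ℓ + 1))) * 2, 0)) = flux K x := by
    intro n
    induction n with
    | zero =>
      intro x _
      congr 1
      ext1 <;> simp
    | succ n ih =>
      intro x hx
      rw [← h1.2 x hx, ← ih (x + (2, 0)) ((evenCorner_add_horizontal x).2 hx)]
      congr 1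
      ext1
      · simp; ring
      · simp
  have hv : ∀ (n : ℕ) (x : Site (4 * (ℓ + 1))), EvenCorner x →
      flux K (x + (0, (n : ZMod (4 * (ℓ + 1))) * 2)) = flux K x := by
    intro n
    induction n with
    | zero =>
      intro x _
      congr 1
      ext1 <;> simp
    | succ n ih =>
      intro x hx
      have e := h2.2 x.swap ⟨hx.2, hx.1⟩
      simp only [Prod.swap_add, Prod.swap_swap, Prod.swap_prod_mk] at e
      rw [← e, ← ih (x + (0, 2)) ⟨by simpa using hx.1, by simp [par_two, hx.2]⟩]
      congr 1
      ext1
      · simp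
      · simp; ring
  have heven : ∀ x, EvenCorner x → flux K x = flux K 0 := by
    intro x hx
    obtain ⟨m, hm⟩ := exists_eq_two_mul_of_par hx.1
    obtain ⟨n, hn⟩ := exists_eq_two_mul_of_par hx.2
    have e1 := hh m 0 ⟨map_zero _, map_zero _⟩
    have e2 := hv n (0 + ((m : ZMod (4 * (ℓ + 1))) * 2, 0)) (by
      rw [← hm]; exact ⟨by simpa using hx.1, by simp⟩)
    rw [← e1, ← e2, ← hm, ← hn]
    congr 1
    ext1 <;> simp
  rcases h.isHopping.flux_eq 0 with h0 | h0
  · right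
    intro x
    split_ifs with hx
    · rw [heven x hx, h0]
    · exact hodd x hx
  · left
    intro x
    by_cases hx : EvenCorner x
    · rw [heven x hx, h0]
    · exact hodd x hx

end Chessboard
end
end Z2Gauge

namespace Z2Gauge
noncomputable section
open scoped Matrix

/-! ### Traces of powers, and sign gradings -/

section Moments

variable {ι : Type*} [Fintype ι] [DecidableEq ι]

theorem trace_pow_eq_sum {K V : Matrix ι ι ℝ} {d : ι → ℝ} (h2 : Vᵀ * V = 1) (h3 : V * Vᵀ = 1)
    (hK : K = V * Matrix.diagonal d * Vᵀ) (n : ℕ) : (K ^ n).trace = ∑ i, d i ^ n := by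
  have hpow : K ^ n = V * Matrix.diagonal (d ^ n) * Vᵀ := by
    induction n with
    | zero => simp [h3]
    | succ n ih =>
      rw [pow_succ, ih, hK, show V * Matrix.diagonal (d ^ n) * Vᵀ * (V * Matrix.diagonal d * Vᵀ) =
        V * (Matrix.diagonal (d ^ n) * (Vᵀ * V) * Matrix.diagonal d) * Vᵀ by
        simp only [Matrix.mul_assoc], h2, Matrix.mul_one, Matrix.diagonal_mul_diagonal, pow_succ]
      rfl
  rw [hpow, Matrix.trace_mul_comm, ← Matrix.mul_assoc, h2, Matrix.one_mul, Matrix.trace_diagonal]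
  rfl

/-- `M` commutes up to the factor `g` with the diagonal matrix of the signs `s`. -/
def Graded (s : ι → ℝ) (g : ℝ) (M : Matrix ι ι ℝ) : Prop := ∀ x y, s x * M x y = g * (M x y * s y)

theorem Graded.mul {s : ι → ℝ} {g g' : ℝ} {M M' : Matrix ι ι ℝ} (h : Graded s g M)
    (h' : Graded s g' M') : Graded s (g * g') (M * M') := by
  intro x y
  simp only [Matrix.mul_apply, Finset.mul_sum, Finset.sum_mul]
  refine Finset.sum_congr rfl fun z _ => ?_
  linear_combination M' z y * h x z + g * M x z * h' z y

theorem Graded.add {s : ι → ℝ} {g : ℝ} {M M' : Matrix ι ι ℝ} (h : Graded s g M)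
    (h' : Graded s g M') : Graded s g (M + M') := by
  intro x y
  simp only [Matrix.add_apply]
  linear_combination h x y + h' x y

theorem Graded.transpose {s : ι → ℝ} {g : ℝ} {M : Matrix ι ι ℝ} (h : Graded s g M)
    (hg : g * g = 1) : Graded s g Mᵀ := by
  intro x y
  simp only [Matrix.transpose_apply]
  linear_combination -g * h y x - M y x * s x * hg

/-- The diagonal of an odd matrix vanishes. Two gradings, by the parity of the column and by the
parity of the 2 × 2 block, remove almost all words from the moments of K. -/
theorem Graded.trace_eq_zero {s : ι → ℝ} (hs : ∀ x, s x ≠ 0) {M : Matrix ι ι ℝ}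
    (h : Graded s (-1) M) : M.trace = 0 := by
  refine Finset.sum_eq_zero fun x _ => ?_
  have := h x x
  have h2 : s x * M x x = 0 := by linarith
  exact (mul_eq_zero.1 h2).resolve_left (hs x)

end Moments

/-! ### Matrices that displace by a fixed vector -/

section Shift

variable {L : ℕ} [NeZero L] {R : Type*} [Ring R]

/-- Matrices whose only nonzero elements are those that displace a site by `v`. -/
def IsShift (v : Site L) (M : Matrix (Site L) (Site L) R) : Prop := ∀ x y, M x y ≠ 0 → x = y + v

theorem IsShift.mul {v w : Site L} {M N : Matrix (Site L) (Site L) R} (h : IsShift v M)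
    (h' : IsShift w N) : IsShift (v + w) (M * N) := by
  intro x y hxy
  obtain ⟨z, -, hz⟩ := Finset.exists_ne_zero_of_sum_ne_zero (by rwa [Matrix.mul_apply] at hxy)
  rw [h x z fun h0 => hz (by rw [h0, zero_mul]), h' z y fun h0 => hz (by rw [h0, mul_zero])]
  abel

theorem IsShift.transpose {v : Site L} {M : Matrix (Site L) (Site L) R} (h : IsShift v M) :
    IsShift (-v) Mᵀ := by
  intro x y hxy
  rw [h y x hxy]
  abel

theorem IsShift.trace_eq_zero {v : Site L} {M : Matrix (Site L) (Site L) R} (h : IsShift v M)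
    (hv : v ≠ 0) : M.trace = 0 := by
  refine Finset.sum_eq_zero fun x _ => ?_
  by_contra h0
  exact hv (by simpa using h x x h0)

/-- The part of a hopping matrix that displaces by `v`. -/
def translation (v : Site L) (K : Matrix (Site L) (Site L) ℝ) : Matrix (Site L) (Site L) ℝ :=
  Matrix.of fun x y => if x = y + v then K x y else 0

theorem isShift_translation (v : Site L) (K : Matrix (Site L) (Site L) ℝ) :
    IsShift v (translation v K) := by
  intro x y h
  by_contra hn
  simp [translation, hn] at h

theorem translation_mul_apply (v w : Site L) (K : Matrix (Site L) (Site L) ℝ) (x y : Site L) :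
    (translation v K * translation w K) x y =
      if x = y + w + v then K x (y + w) * K (y + w) y else 0 := by
  rw [Matrix.mul_apply, Finset.sum_eq_single (y + w)]
  · simp only [translation, Matrix.of_apply]
    split_ifs <;> simp_all
  · intro z _ hz
    simp [translation, hz]
  · simp

theorem IsShift.apply_add {v : Site L} {M : Matrix (Site L) (Site L) R} (h : IsShift v M)
    {x y : Site L} (hxy : x ≠ y + v) : M x y = 0 := by
  by_contra h0
  exact hxy (h x y h0)

theorem translation_mul_transpose {K : Matrix (Site L) (Site L) ℝ} (hs : ∀ x y, K x y = K y x)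
    {v : Site L} (hv : ∀ x, K x (x + v) * K x (x + v) = 1) :
    translation v K * (translation v K)ᵀ = 1 := by
  ext x y
  rw [Matrix.mul_apply, Finset.sum_eq_single (x - v)]
  · by_cases h : x = y
    · subst h
      have := hv (x - v)
      rw [sub_add_cancel] at this
      simpa [translation, hs x (x - v)] using this
    · have h' : y ≠ x - v + v := by rw [sub_add_cancel]; exact Ne.symm h
      simp [translation, h, Ne.symm h]
  · intro z _ hz
    have : x ≠ z + v := fun h => hz (by rw [h, add_sub_cancel_right])
    simp [translation, this]
  · simp

theorem translation_transpose_mul {K : Matrix (Site L) (Site L) ℝ} (hs : ∀ x y, K x y = K y x)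
    {v : Site L} (hv : ∀ x, K x (x + v) * K x (x + v) = 1) :
    (translation v K)ᵀ * translation v K = 1 :=
  mul_eq_one_comm.1 (translation_mul_transpose hs hv)

/-- The two products follow the two paths from one corner of a plaquette to the opposite one, and
the ratio of their amplitudes is the flux. The translations therefore anticommute exactly where the
flux is -1. -/
theorem IsHopping.anticommutator_apply {K : Matrix (Site L) (Site L) ℝ} (hK : IsHopping K)
    (x y : Site L) :
    (translation (1, 0) K * translation (0, 1) K + translation (0, 1) K * translation (1, 0) K) x y
      = if x = y + (1, 1) then (1 + flux K y) * (K (y + (0, 1)) y * K (y + (1, 1)) (y + (0, 1)))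
        else 0 := by
  rw [Matrix.add_apply, translation_mul_apply, translation_mul_apply, add_assoc, add_assoc]
  simp only [Prod.mk_add_mk, add_zero, zero_add]
  split_ifs with h
  · subst h
    have h3 := hK.horizontal' y
    have h4 := hK.vertical y
    rw [flux, hK.symm (y + (0, 1)) y, hK.symm (y + (1, 1)) (y + (1, 0)), hK.symm (y + (1, 0)) y]
    linear_combination (-K y (y + (1, 0)) * K (y + (1, 0)) (y + (1, 1)) * (K y (y + (0, 1)) *
      K y (y + (0, 1)))) * h3 - (K y (y + (1, 0)) * K (y + (1, 0)) (y + (1, 1))) * h4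
  · simp

end Shift

/-! ### Second, fourth and sixth moment of a hopping matrix -/

section HoppingMoments

variable {ℓ : ℕ} {K : Matrix (Site (4 * (ℓ + 1))) (Site (4 * (ℓ + 1))) ℝ}

theorem natCast_ne_zero {n : ℕ} (h0 : 0 < n) (h : n < 4 * (ℓ + 1)) :
    (n : ZMod (4 * (ℓ + 1))) ≠ 0 := by
  rw [Ne, ZMod.natCast_eq_zero_iff]
  exact Nat.not_dvd_of_pos_of_lt h0 h

theorem IsHopping.eq_sum_translation (hK : IsHopping K) :
    K = translation (1, 0) K + (translation (1, 0) K)ᵀ + translation (0, 1) K +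
      (translation (0, 1) K)ᵀ := by
  have h1 : (1 : ZMod (4 * (ℓ + 1))) ≠ 0 := by
    simpa using natCast_ne_zero (ℓ := ℓ) (n := 1) (by omega) (by omega)
  have h2 : (2 : ZMod (4 * (ℓ + 1))) ≠ 0 := by
    simpa using natCast_ne_zero (ℓ := ℓ) (n := 2) (by omega) (by omega)
  have aux : ∀ v w y : Site (4 * (ℓ + 1)), v ≠ w → ¬ (y + v = y + w) := fun v w y h h' =>
    h (add_left_cancel h')
  have aux' : ∀ v w y : Site (4 * (ℓ + 1)), v + w ≠ 0 → ¬ (y = y + v + w) := fun v w y h h' => by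
    rw [add_assoc] at h'
    exact h (left_eq_add.1 h')
  have n1 : ((1, 0) : Site (4 * (ℓ + 1))) ≠ (0, 1) := by simp [h1]
  have n2 : ((1, 0) : Site (4 * (ℓ + 1))) + (1, 0) ≠ 0 := by
    rw [Ne, Prod.ext_iff]; simp [one_add_one_eq_two, h2]
  have n3 : ((0, 1) : Site (4 * (ℓ + 1))) + (0, 1) ≠ 0 := by
    rw [Ne, Prod.ext_iff]; simp [one_add_one_eq_two, h2]
  have n4 : ((1, 0) : Site (4 * (ℓ + 1))) + (0, 1) ≠ 0 := by
    rw [Ne, Prod.ext_iff]; simp [h1]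
  have n5 : ((0, 1) : Site (4 * (ℓ + 1))) + (1, 0) ≠ 0 := by
    rw [Ne, Prod.ext_iff]; simp [h1]
  ext x y
  simp only [Matrix.add_apply, Matrix.transpose_apply, translation, Matrix.of_apply]
  by_cases e1 : x = y + (1, 0)
  · subst e1
    rw [if_pos rfl, if_neg (aux' _ _ _ n2), if_neg (aux _ _ _ n1), if_neg (aux' _ _ _ n4)]
    simp
  by_cases e2 : x = y + (0, 1)
  · subst e2
    rw [if_neg (aux _ _ _ n1.symm), if_neg (aux' _ _ _ n5), if_pos rfl, if_neg (aux' _ _ _ n3)]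
    simp
  by_cases e3 : y = x + (1, 0)
  · subst e3
    rw [if_neg e1, if_pos rfl, if_neg e2, if_neg (aux _ _ _ n1), hK.symm]
    simp
  by_cases e4 : y = x + (0, 1)
  · subst e4
    rw [if_neg e1, if_neg e3, if_neg e2, if_pos rfl, hK.symm]
    simp
  · rw [if_neg e1, if_neg e3, if_neg e2, if_neg e4, hK.eq_zero x y e3 e4 e1 e2]
    simp

/-- The part of `K² - 4` that displaces by `±2` along the axes. -/
def axialPart (K : Matrix (Site (4 * (ℓ + 1))) (Site (4 * (ℓ + 1))) ℝ) :
    Matrix (Site (4 * (ℓ + 1))) (Site (4 * (ℓ + 1))) ℝ :=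
  translation (1, 0) K * translation (1, 0) K + (translation (1, 0) K * translation (1, 0) K)ᵀ +
    (translation (0, 1) K * translation (0, 1) K + (translation (0, 1) K * translation (0, 1) K)ᵀ)

/-- The anticommutator of the elementary translations. -/
def diagonalStep (K : Matrix (Site (4 * (ℓ + 1))) (Site (4 * (ℓ + 1))) ℝ) :
    Matrix (Site (4 * (ℓ + 1))) (Site (4 * (ℓ + 1))) ℝ :=
  translation (1, 0) K * translation (0, 1) K + translation (0, 1) K * translation (1, 0) K

/-- The part of `K² - 4` that displaces along the diagonals. -/
def diagonalPart (K : Matrix (Site (4 * (ℓ + 1))) (Site (4 * (ℓ + 1))) ℝ) :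
    Matrix (Site (4 * (ℓ + 1))) (Site (4 * (ℓ + 1))) ℝ :=
  diagonalStep K + (diagonalStep K)ᵀ +
    ((translation (0, 1) K)ᵀ * diagonalStep K * (translation (0, 1) K)ᵀ +
      ((translation (0, 1) K)ᵀ * diagonalStep K * (translation (0, 1) K)ᵀ)ᵀ)

/-- The steps back and forth contribute the constant 4, the repeated steps the axial part, and the
remaining words are anticommutators of a horizontal and a vertical step. -/
theorem IsHopping.sq_eq (hK : IsHopping K) : K * K = 4 • 1 + (axialPart K + diagonalPart K) := by
  have a1 := translation_mul_transpose hK.symm hK.horizontal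
  have a2 := translation_transpose_mul hK.symm hK.horizontal
  have b1 := translation_mul_transpose hK.symm hK.vertical
  have b2 := translation_transpose_mul hK.symm hK.vertical
  have hsum := hK.eq_sum_translation
  set S := translation (1, 0) K with hS
  set T := translation (0, 1) K with hT
  -- Since Tᵀ is the inverse of T, the anticommutator along the second diagonal is obtained from the
  -- one along the first.
  have e : Tᵀ * diagonalStep K * Tᵀ = S * Tᵀ + Tᵀ * S := by
    simp only [diagonalStep, ← hS, ← hT]
    calc Tᵀ * (S * T + T * S) * Tᵀ = Tᵀ * S * (T * Tᵀ) + Tᵀ * T * (S * Tᵀ) := by noncomm_ring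
      _ = _ := by rw [b1, b2]; noncomm_ring
  have h1 : K * K = (S + Sᵀ + T + Tᵀ) * (S + Sᵀ + T + Tᵀ) := by rw [← hsum]
  rw [h1, axialPart, diagonalPart, e]
  simp only [diagonalStep, ← hS, ← hT, Matrix.transpose_add, Matrix.transpose_mul,
    Matrix.transpose_transpose]
  calc _ = S * S + Sᵀ * Sᵀ + (T * T + Tᵀ * Tᵀ) + (S * T + T * S + (Tᵀ * Sᵀ + Sᵀ * Tᵀ) +
      (S * Tᵀ + Tᵀ * S + (T * Sᵀ + Sᵀ * T))) + (S * Sᵀ + Sᵀ * S + T * Tᵀ + Tᵀ * T) := by noncomm_ring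
    _ = _ := by
      rw [a1, a2, b1, b2]
      abel

/-- The sign of the parity of the horizontal coordinate. -/
def parSign (x : Site (4 * (ℓ + 1))) : ℝ := if par x.1 = 0 then 1 else -1

/-- The sign that changes from a `2 × 2` block to the neighbouring ones, in one coordinate. -/
def halfSign (a : ZMod (4 * (ℓ + 1))) : ℝ := (-1) ^ (a.val / 2)

/-- The sign that changes from a `2 × 2` block to the neighbouring ones. -/
def blockSign (x : Site (4 * (ℓ + 1))) : ℝ := halfSign x.1 * halfSign x.2

theorem parSign_ne_zero (x : Site (4 * (ℓ + 1))) : parSign x ≠ 0 := by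
  unfold parSign; split_ifs <;> norm_num

theorem halfSign_ne_zero (a : ZMod (4 * (ℓ + 1))) : halfSign a ≠ 0 := by
  unfold halfSign; positivity

theorem blockSign_ne_zero (x : Site (4 * (ℓ + 1))) : blockSign x ≠ 0 :=
  mul_ne_zero (halfSign_ne_zero _) (halfSign_ne_zero _)

/-- Around the torus there are 2(ℓ+1) blocks, an even number, so the alternating sign is consistent;
this is the second case of `key`. -/
theorem halfSign_add_two (a : ZMod (4 * (ℓ + 1))) : halfSign (a + 2) = -halfSign a := by
  have key : (a + 2).val / 2 = a.val / 2 + 1 ∨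
      (a.val / 2 + 1 = (a + 2).val / 2 + 2 * (ℓ + 1)) := by
    rw [show a + 2 = a + 1 + 1 by ring]
    rcases val_add_one_cases a with h | h <;> rcases val_add_one_cases (a + 1) with h' | h' <;> omega
  unfold halfSign
  rcases key with h | h
  · rw [h, pow_succ]; ring
  · have h1 : (-1 : ℝ) ^ (a.val / 2 + 1) = (-1) ^ ((a + 2).val / 2) := by
      rw [h, pow_add, pow_mul]; norm_num
    rw [← h1, pow_succ]; ring

theorem halfSign_add_one {a : ZMod (4 * (ℓ + 1))} (h : par a = 0) :
    halfSign (a + 1) = halfSign a := by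
  have ha : ((a.val : ℕ) : ZMod (4 * (ℓ + 1))) = a := by
    rw [ZMod.natCast_val, ZMod.cast_id']; rfl
  rw [← ha, par_natCast, ZMod.natCast_eq_zero_iff] at h
  have key : (a + 1).val / 2 = a.val / 2 := by
    rcases val_add_one_cases a with h | h <;> omega
  rw [halfSign, halfSign, key]

theorem graded_of_support {ι : Type*} {s : ι → ℝ} {g : ℝ} {M : Matrix ι ι ℝ}
    (h : ∀ x y, M x y ≠ 0 → s x = g * s y) : Graded s g M := by
  intro x y
  by_cases h0 : M x y = 0
  · simp [h0]
  · rw [h x y h0]; ring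

theorem parSign_add_one (x : Site (4 * (ℓ + 1))) (b : ZMod (4 * (ℓ + 1))) :
    parSign (x + (1, b)) = -1 * parSign x := by
  have z2 : ∀ a : ZMod 2, a = 0 ∨ a = 1 := by decide
  have z3 : (1 : ZMod 2) + 1 = 0 := rfl
  simp only [parSign, Prod.fst_add, map_add, par_one]
  rcases z2 (par x.1) with h | h <;> simp [h, z3]

theorem graded_parSign_horizontal (K : Matrix (Site (4 * (ℓ + 1))) (Site (4 * (ℓ + 1))) ℝ) :
    Graded parSign (-1) (translation (1, 0) K) :=
  graded_of_support fun x y h => by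
    rw [isShift_translation _ _ x y h, parSign_add_one]

theorem graded_parSign_vertical (K : Matrix (Site (4 * (ℓ + 1))) (Site (4 * (ℓ + 1))) ℝ) :
    Graded parSign 1 (translation (0, 1) K) :=
  graded_of_support fun x y h => by
    rw [isShift_translation _ _ x y h]; simp [parSign]

theorem graded_parSign_axialPart (K : Matrix (Site (4 * (ℓ + 1))) (Site (4 * (ℓ + 1))) ℝ) :
    Graded parSign 1 (axialPart K) := by
  have h1 : Graded parSign 1 (translation (1, 0) K * translation (1, 0) K) := by
    simpa using (graded_parSign_horizontal K).mul (graded_parSign_horizontal K)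
  have h2 : Graded parSign 1 (translation (0, 1) K * translation (0, 1) K) := by
    simpa using (graded_parSign_vertical K).mul (graded_parSign_vertical K)
  exact (h1.add (h1.transpose (by norm_num))).add (h2.add (h2.transpose (by norm_num)))

theorem graded_parSign_diagonalPart (K : Matrix (Site (4 * (ℓ + 1))) (Site (4 * (ℓ + 1))) ℝ) :
    Graded parSign (-1) (diagonalPart K) := by
  have h1 : Graded parSign (-1) (diagonalStep K) := by
    have e1 := (graded_parSign_horizontal K).mul (graded_parSign_vertical K)
    have e2 := (graded_parSign_vertical K).mul (graded_parSign_horizontal K)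
    simp only [mul_one, one_mul] at e1 e2
    exact e1.add e2
  have h2 : Graded parSign 1 (translation (0, 1) K)ᵀ :=
    (graded_parSign_vertical K).transpose (by norm_num)
  have h3 := (h2.mul h1).mul h2
  simp only [mul_one, one_mul] at h3
  exact (h1.add (h1.transpose (by norm_num))).add (h3.add (h3.transpose (by norm_num)))

theorem graded_blockSign_axialPart (K : Matrix (Site (4 * (ℓ + 1))) (Site (4 * (ℓ + 1))) ℝ) :
    Graded blockSign (-1) (axialPart K) := by
  have h1 : Graded blockSign (-1) (translation (1, 0) K * translation (1, 0) K) :=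
    graded_of_support fun x y h => by
      rw [((isShift_translation _ _).mul (isShift_translation _ _)) x y h]
      simp only [blockSign, Prod.fst_add, Prod.snd_add, Prod.mk_add_mk, add_zero,
        one_add_one_eq_two, halfSign_add_two]
      ring
  have h2 : Graded blockSign (-1) (translation (0, 1) K * translation (0, 1) K) :=
    graded_of_support fun x y h => by
      rw [((isShift_translation _ _).mul (isShift_translation _ _)) x y h]
      simp only [blockSign, Prod.fst_add, Prod.snd_add, Prod.mk_add_mk, add_zero,
        one_add_one_eq_two, halfSign_add_two]
      ring
  exact (h1.add (h1.transpose (by norm_num))).add (h2.add (h2.transpose (by norm_num)))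

theorem IsHopping.diagonalStep_apply (hK : IsHopping K) (x y : Site (4 * (ℓ + 1))) :
    diagonalStep K x y = if x = y + (1, 1) then
      (1 + flux K y) * (K (y + (0, 1)) y * K (y + (1, 1)) (y + (0, 1))) else 0 :=
  hK.anticommutator_apply x y

/-- A diagonal step across a plaquette of flux -1 has amplitude 0. If only even plaquettes can have
flux 1, the remaining diagonal steps join sites of the same 2 × 2 block. -/
theorem IsHopping.graded_blockSign_diagonalPart (hK : IsHopping K)
    (hf : ∀ x, ¬ EvenCorner x → flux K x = -1) : Graded blockSign 1 (diagonalPart K) := by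
  have hsupp : ∀ x y, diagonalStep K x y ≠ 0 → x = y + (1, 1) ∧ EvenCorner y := by
    intro x y h
    rw [hK.diagonalStep_apply] at h
    split_ifs at h with h1
    · refine ⟨h1, ?_⟩
      by_contra hn
      simp [hf y hn] at h
    · exact absurd rfl h
  have h1 : Graded blockSign 1 (diagonalStep K) := graded_of_support fun x y h => by
    obtain ⟨rfl, h2⟩ := hsupp x y h
    simp [blockSign, halfSign_add_one h2.1, halfSign_add_one h2.2]
  have h2 : Graded blockSign 1 ((translation (0, 1) K)ᵀ * diagonalStep K *
      (translation (0, 1) K)ᵀ) := graded_of_support fun x y h => by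
    rw [Matrix.mul_apply] at h
    obtain ⟨z, -, hz⟩ := Finset.exists_ne_zero_of_sum_ne_zero h
    have hz1 := left_ne_zero_of_mul hz
    have hz2 := right_ne_zero_of_mul hz
    rw [Matrix.mul_apply] at hz1
    obtain ⟨w, -, hw⟩ := Finset.exists_ne_zero_of_sum_ne_zero hz1
    obtain ⟨hw1, hw2⟩ := hsupp w z (right_ne_zero_of_mul hw)
    have hy := (isShift_translation (0, 1) K) y z hz2
    have hx := (isShift_translation (0, 1) K) w x (left_ne_zero_of_mul hw)
    have hx' : x = z + (1, 0) := by
      rw [hw1] at hx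
      apply add_right_cancel (b := ((0, 1) : Site (4 * (ℓ + 1))))
      rw [← hx, add_assoc]; simp
    rw [hy, hx']
    simp [blockSign, halfSign_add_one hw2.1, halfSign_add_one hw2.2]
  exact (h1.add (h1.transpose (by norm_num))).add (h2.add (h2.transpose (by norm_num)))

/-- Only the products of a displacement with its inverse return to the starting point. -/
theorem trace_sq_of_isShift {M N : Matrix (Site (4 * (ℓ + 1))) (Site (4 * (ℓ + 1))) ℝ}
    {v w : Site (4 * (ℓ + 1))} (hM : IsShift v M) (hN : IsShift w N) (h1 : v + v ≠ 0)
    (h2 : w + w ≠ 0) (h3 : v + w ≠ 0) (h4 : v + -w ≠ 0) :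
    ((M + Mᵀ + (N + Nᵀ)) * (M + Mᵀ + (N + Nᵀ))).trace =
      2 * (M * Mᵀ).trace + 2 * (N * Nᵀ).trace := by
  have e1 := (hM.mul hM).trace_eq_zero h1
  have e2 := (hN.mul hN).trace_eq_zero h2
  have e3 := (hM.mul hN).trace_eq_zero h3
  have e4 := (hM.mul hN.transpose).trace_eq_zero h4
  have e5 : (Mᵀ * Mᵀ).trace = 0 := by rw [← Matrix.transpose_mul, Matrix.trace_transpose, e1]
  have e6 : (Nᵀ * Nᵀ).trace = 0 := by rw [← Matrix.transpose_mul, Matrix.trace_transpose, e2]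
  have e7 : (Nᵀ * Mᵀ).trace = 0 := by rw [← Matrix.transpose_mul, Matrix.trace_transpose, e3]
  have e8 : (N * Mᵀ).trace = 0 := by
    rw [← Matrix.trace_transpose, Matrix.transpose_mul, Matrix.transpose_transpose, e4]
  have c1 := Matrix.trace_mul_comm Mᵀ M
  have c2 := Matrix.trace_mul_comm Nᵀ N
  have c3 := Matrix.trace_mul_comm N M
  have c4 := Matrix.trace_mul_comm Nᵀ M
  have c5 := Matrix.trace_mul_comm Mᵀ N
  have c6 := Matrix.trace_mul_comm Mᵀ Nᵀ
  simp only [Matrix.add_mul, Matrix.mul_add, Matrix.trace_add]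
  rw [e1, e2, e3, e4, e5, e6, e7, e8, c1, c2, c3, c4, c5, c6, e3, e4, e7, e8]
  ring

theorem pair_ne_zero {m n : ℕ} (h : (0 < m ∧ m < 4 * (ℓ + 1)) ∨ (0 < n ∧ n < 4 * (ℓ + 1))) :
    ((m : ZMod (4 * (ℓ + 1))), (n : ZMod (4 * (ℓ + 1)))) ≠ 0 := by
  intro h0
  rw [Prod.ext_iff] at h0
  rcases h with h | h
  · exact natCast_ne_zero h.1 h.2 h0.1
  · exact natCast_ne_zero h.1 h.2 h0.2

theorem IsHopping.trace_axialPart_sq (hK : IsHopping K) (hℓ : 1 ≤ ℓ) :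
    (axialPart K * axialPart K).trace = 4 * Fintype.card (Site (4 * (ℓ + 1))) := by
  have a1 := translation_mul_transpose hK.symm hK.horizontal
  have b1 := translation_mul_transpose hK.symm hK.vertical
  -- Two steps of length two must not wind around the torus, which excludes the side 4.
  have h4 : (4 : ZMod (4 * (ℓ + 1))) ≠ 0 := by
    simpa using natCast_ne_zero (ℓ := ℓ) (n := 4) (by omega) (by omega)
  have h2 : (2 : ZMod (4 * (ℓ + 1))) ≠ 0 := by
    simpa using natCast_ne_zero (ℓ := ℓ) (n := 2) (by omega) (by omega)
  have e4 : (2 : ZMod (4 * (ℓ + 1))) + 2 = 4 := by norm_num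
  have e2 : (1 : ZMod (4 * (ℓ + 1))) + 1 = 2 := by norm_num
  rw [axialPart, trace_sq_of_isShift ((isShift_translation _ K).mul (isShift_translation _ K))
    ((isShift_translation _ K).mul (isShift_translation _ K))]
  · have aux : ∀ S : Matrix (Site (4 * (ℓ + 1))) (Site (4 * (ℓ + 1))) ℝ, S * Sᵀ = 1 →
        S * S * (S * S)ᵀ = 1 := by
      intro S hS
      rw [Matrix.transpose_mul, Matrix.mul_assoc, ← Matrix.mul_assoc S Sᵀ, hS, Matrix.one_mul, hS]
    rw [aux _ a1, aux _ b1, Matrix.trace_one]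
    ring
  all_goals
    rw [Ne, Prod.ext_iff]
    simp [e4, e2, h4, h2]

/-- Each amplitude is ±(1 + flux), with square 2(1 + flux) because the flux is ±1. Every plaquette
is crossed along two diagonals, in both directions. -/
theorem IsHopping.trace_diagonalPart_sq (hK : IsHopping K) :
    (diagonalPart K * diagonalPart K).trace = 8 * ∑ x, (1 + flux K x) := by
  have b1 := translation_mul_transpose hK.symm hK.vertical
  have b2 := translation_transpose_mul hK.symm hK.vertical
  have h2 : (2 : ZMod (4 * (ℓ + 1))) ≠ 0 := by
    simpa using natCast_ne_zero (ℓ := ℓ) (n := 2) (by omega) (by omega)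
  have e2 : (1 : ZMod (4 * (ℓ + 1))) + 1 = 2 := by norm_num
  have hC : IsShift (1, 1) (diagonalStep K) := by
    intro x y h
    rw [hK.diagonalStep_apply] at h
    by_contra hn
    simp [hn] at h
  have hT := (isShift_translation (0, 1) K).transpose
  have hCC : (diagonalStep K * (diagonalStep K)ᵀ).trace = ∑ x, 2 * (1 + flux K x) := by
    rw [Matrix.trace_mul_comm]
    refine Finset.sum_congr rfl fun y _ => ?_
    rw [Matrix.diag_apply, Matrix.mul_apply, Finset.sum_eq_single (y + (1, 1))]
    · rw [Matrix.transpose_apply, hK.diagonalStep_apply, if_pos rfl]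
      have h3 := hK.horizontal' y
      have h4 := hK.vertical y
      rw [hK.symm (y + (0, 1)) y]
      have h5 : flux K y * flux K y = 1 := by
        rcases hK.flux_eq y with h | h <;> rw [h] <;> norm_num
      linear_combination (1 + flux K y) ^ 2 * (K y (y + (0, 1)) * K y (y + (0, 1))) * h3 +
        (1 + flux K y) ^ 2 * h4 + h5
    · intro z _ hz
      rw [hC.apply_add hz, mul_zero]
    · simp
  rw [diagonalPart, trace_sq_of_isShift hC ((hT.mul hC).mul hT)]
  · have hDD : ∀ C T : Matrix (Site (4 * (ℓ + 1))) (Site (4 * (ℓ + 1))) ℝ, T * Tᵀ = 1 →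
        Tᵀ * T = 1 → (Tᵀ * C * Tᵀ * (Tᵀ * C * Tᵀ)ᵀ).trace = (C * Cᵀ).trace := by
      intro C T h h'
      simp only [Matrix.transpose_mul, Matrix.transpose_transpose]
      rw [show Tᵀ * C * Tᵀ * (T * (Cᵀ * T)) = Tᵀ * (C * (Tᵀ * T) * Cᵀ * T) by
        simp only [Matrix.mul_assoc], h', Matrix.mul_one, Matrix.trace_mul_comm,
        Matrix.mul_assoc (C * Cᵀ), h, Matrix.mul_one]
    rw [hDD _ _ b1 b2, hCC, ← Finset.mul_sum]
    ring
  all_goals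
    rw [Ne, Prod.ext_iff]
    simp [e2, h2]

theorem IsHopping.trace_sq (hK : IsHopping K) :
    (K ^ 2).trace = 4 * Fintype.card (Site (4 * (ℓ + 1))) := by
  rw [pow_two, hK.sq_eq, Matrix.trace_add, Matrix.trace_add,
    (graded_blockSign_axialPart K).trace_eq_zero blockSign_ne_zero,
    (graded_parSign_diagonalPart K).trace_eq_zero parSign_ne_zero, Matrix.trace_smul,
    Matrix.trace_one]
  simp

theorem IsHopping.trace_pow_four (hK : IsHopping K) (hℓ : 1 ≤ ℓ) :
    (K ^ 4).trace = 20 * Fintype.card (Site (4 * (ℓ + 1))) + 8 * ∑ x, (1 + flux K x) := by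
  have w := (graded_blockSign_axialPart K).trace_eq_zero blockSign_ne_zero
  have y := (graded_parSign_diagonalPart K).trace_eq_zero parSign_ne_zero
  have wy := (graded_parSign_axialPart K).mul (graded_parSign_diagonalPart K)
  rw [one_mul] at wy
  have wy := wy.trace_eq_zero parSign_ne_zero
  have ww := hK.trace_axialPart_sq hℓ
  have yy := hK.trace_diagonalPart_sq
  rw [show K ^ 4 = K * K * (K * K) by noncomm_ring, hK.sq_eq]
  set W := axialPart K
  set Y := diagonalPart K
  rw [show (4 • (1 : Matrix (Site (4 * (ℓ + 1))) (Site (4 * (ℓ + 1))) ℝ) + (W + Y)) *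
    (4 • 1 + (W + Y)) = 16 • 1 + 8 • W + 8 • Y + W * W + W * Y + Y * W + Y * Y by noncomm_ring]
  simp only [Matrix.trace_add, Matrix.trace_smul, Matrix.trace_one, w, y, ww, yy,
    Matrix.trace_mul_comm Y W, wy]
  simp
  ring

/-- All cubic words in the axial part W and the diagonal part Y have trace zero: WWW and WYY are odd
for the block sign, WWY and YYY for the column parity. Only the squares of W and Y remain, as in the
fourth moment. -/
theorem IsHopping.trace_pow_six (hK : IsHopping K) (hℓ : 1 ≤ ℓ)
    (hf : ∀ x, ¬ EvenCorner x → flux K x = -1) :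
    (K ^ 6).trace = 112 * Fintype.card (Site (4 * (ℓ + 1))) + 96 * ∑ x, (1 + flux K x) := by
  have gW := graded_parSign_axialPart K
  have gY := graded_parSign_diagonalPart K
  have bW := graded_blockSign_axialPart K
  have bY := hK.graded_blockSign_diagonalPart hf
  have w := bW.trace_eq_zero blockSign_ne_zero
  have y := gY.trace_eq_zero parSign_ne_zero
  have ww := hK.trace_axialPart_sq hℓ
  have yy := hK.trace_diagonalPart_sq
  have wy := gW.mul gY
  have www := (bW.mul bW).mul bW
  have wwy := (gW.mul gW).mul gY
  have wyy := (bW.mul bY).mul bY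
  have yyy := (gY.mul gY).mul gY
  simp only [one_mul, mul_one, neg_mul_neg] at wy www wwy wyy yyy
  have wy := wy.trace_eq_zero parSign_ne_zero
  have www := www.trace_eq_zero blockSign_ne_zero
  have wwy := wwy.trace_eq_zero parSign_ne_zero
  have wyy := wyy.trace_eq_zero blockSign_ne_zero
  have yyy := yyy.trace_eq_zero parSign_ne_zero
  rw [show K ^ 6 = K * K * (K * K) * (K * K) by noncomm_ring, hK.sq_eq]
  set W := axialPart K
  set Y := diagonalPart K
  have t1 : (W * Y * W).trace = 0 := by
    rw [Matrix.trace_mul_comm, ← Matrix.mul_assoc, wwy]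
  have t2 : (Y * W * W).trace = 0 := by
    rw [Matrix.mul_assoc, Matrix.trace_mul_comm, wwy]
  have t3 : (Y * W * Y).trace = 0 := by
    rw [Matrix.mul_assoc, Matrix.trace_mul_comm, wyy]
  have t4 : (Y * Y * W).trace = 0 := by
    rw [Matrix.trace_mul_comm, ← Matrix.mul_assoc, wyy]
  rw [show (4 • (1 : Matrix (Site (4 * (ℓ + 1))) (Site (4 * (ℓ + 1))) ℝ) + (W + Y)) *
    (4 • 1 + (W + Y)) * (4 • 1 + (W + Y)) = 64 • 1 + 48 • W + 48 • Y + 12 • (W * W) +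
      12 • (W * Y) + 12 • (Y * W) + 12 • (Y * Y) + (W * W * W + W * W * Y + W * Y * W + W * Y * Y +
      Y * W * W + Y * W * Y + Y * Y * W + Y * Y * Y) by noncomm_ring]
  simp only [Matrix.trace_add, Matrix.trace_smul, Matrix.trace_one, w, y, ww, yy,
    Matrix.trace_mul_comm Y W, wy, www, wwy, wyy, yyy, t1, t2, t3, t4]
  simp
  ring

end HoppingMoments
end
end Z2Gauge

namespace Z2Gauge
noncomputable section
open scoped Matrix

/-! ### Comparison of the two flux patterns, and the gap per plaquette -/

section Gap

variable {ℓ : ℕ} {K : Matrix (Site (4 * (ℓ + 1))) (Site (4 * (ℓ + 1))) ℝ}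

/-- The nonnegative product in `h` is the difference of the two sides, up to rounding two
coefficients upwards. The sextic nearly touches |x| from above at the roots of y² - 3.7y + 2.83,
about 1.08 and 2.62, so the bound is sharp for the pattern with flux 1 at even corners. -/
theorem abs_le_sextic (x : ℝ) :
    286.69598 * |x| ≤ x ^ 6 - 18.89 * x ^ 4 + 172.7007 * x ^ 2 + 132.307228 := by
  rw [← sq_abs x, show x ^ 6 = |x| ^ 6 by rw [← abs_pow, abs_of_nonneg (by positivity)],
    show x ^ 4 = |x| ^ 4 by rw [← abs_pow, abs_of_nonneg (by positivity)]]
  set y := |x|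
  have h : 0 ≤ ((y + 3.7) ^ 2 + 2.83) * (y ^ 2 - 3.7 * y + 2.83) ^ 2 := by positivity
  nlinarith [h]

/-- Contact at 0 and at 2, where eigenvalues of root mean square 2 should be compared best, and at
the edge 2.83, which is slightly above √8. The nonnegative product in `h` is again the difference of
the two sides up to rounding. -/
theorem sextic_le_abs {x : ℝ} (h : |x| ≤ 2.83) :
    6.83 * x ^ 6 - 120.661287 * x ^ 4 + 901.5293 * x ^ 2 ≤ 1056.332592 * |x| := by
  rw [← sq_abs x, show x ^ 6 = |x| ^ 6 by rw [← abs_pow, abs_of_nonneg (by positivity)],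
    show x ^ 4 = |x| ^ 4 by rw [← abs_pow, abs_of_nonneg (by positivity)]]
  have h0 := abs_nonneg x
  set y := |x|
  have h : 0 ≤ y * (y - 2) ^ 2 * (2.83 - y) * (6.83 * y ^ 2 + 46.6489 * y + 93.3156) := by
    have : 0 ≤ 2.83 - y := by linarith
    positivity
  nlinarith [h]

theorem IsHopping.traceNorm_le (hK : IsHopping K) (hℓ : 1 ≤ ℓ)
    (hf : ∀ x, flux K x = if EvenCorner x then 1 else -1)
    (hcard : ∑ x, (1 + flux K x) = Fintype.card (Site (4 * (ℓ + 1))) / 2) :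
    traceNorm K ≤ 1.848 * Fintype.card (Site (4 * (ℓ + 1))) := by
  obtain ⟨V, h1, h2, h3⟩ := exists_orthogonal_diagonalization hK.isHermitian
  have t2 := hK.trace_sq
  have t4 := hK.trace_pow_four hℓ
  have t6 := hK.trace_pow_six hℓ fun x hx => by rw [hf, if_neg hx]
  rw [trace_pow_eq_sum h2 h1 h3] at t2 t4 t6
  rw [traceNorm, dif_pos hK.isHermitian]
  set d := hK.isHermitian.eigenvalues
  have h : ∑ i, 286.69598 * |d i| ≤
      ∑ i, (d i ^ 6 - 18.89 * d i ^ 4 + 172.7007 * d i ^ 2 + 132.307228) :=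
    Finset.sum_le_sum fun i _ => abs_le_sextic (d i)
  simp only [Finset.sum_add_distrib, Finset.sum_sub_distrib, ← Finset.mul_sum, t2, t4, t6, hcard,
    Finset.sum_const, Finset.card_univ, nsmul_eq_mul] at h
  have : (0 : ℝ) ≤ Fintype.card (Site (4 * (ℓ + 1))) := by positivity
  linarith

theorem IsHopping.anticommute (hK : IsHopping K) (hf : ∀ x, flux K x = -1) :
    diagonalStep K = 0 := by
  ext x y
  rw [hK.diagonalStep_apply, hf]
  simp

/-- With anticommuting translations S, T one has 8 - K² = (S - Sᵀ)ᵀ(S - Sᵀ) + (T - Tᵀ)ᵀ(T - Tᵀ), so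
the spectrum lies in [-√8, √8]. -/
theorem IsHopping.eigenvalues_abs_le (hK : IsHopping K) (hf : ∀ x, flux K x = -1)
    (i : Site (4 * (ℓ + 1))) : |hK.isHermitian.eigenvalues i| ≤ 2.83 := by
  obtain ⟨V, h1, h2, h3⟩ := exists_orthogonal_diagonalization hK.isHermitian
  set d := hK.isHermitian.eigenvalues
  have a1 := translation_mul_transpose hK.symm hK.horizontal
  have a2 := translation_transpose_mul hK.symm hK.horizontal
  have b1 := translation_mul_transpose hK.symm hK.vertical
  have b2 := translation_transpose_mul hK.symm hK.vertical
  have hsq : K * K = 4 • 1 + axialPart K := by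
    rw [hK.sq_eq, diagonalPart, hK.anticommute hf]; simp
  rw [axialPart] at hsq
  set S := translation (1, 0) K
  set T := translation (0, 1) K
  have e : 8 • 1 - K * K = (S - Sᵀ)ᵀ * (S - Sᵀ) + (T - Tᵀ)ᵀ * (T - Tᵀ) := by
    rw [hsq]
    simp only [Matrix.transpose_sub, Matrix.transpose_transpose, Matrix.transpose_mul]
    calc _ = 4 • 1 - S * S - Sᵀ * Sᵀ - T * T - Tᵀ * Tᵀ := by noncomm_ring
      _ = Sᵀ * S + S * Sᵀ + Tᵀ * T + T * Tᵀ - S * S - Sᵀ * Sᵀ - T * T - Tᵀ * Tᵀ := by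
        rw [a1, a2, b1, b2]; abel
      _ = _ := by noncomm_ring
  have e2 : Vᵀ * (8 • 1 - K * K) * V = Matrix.diagonal fun i => 8 - d i * d i := by
    have : Vᵀ * (8 • 1 - K * K) * V = 8 • (Vᵀ * V) - Vᵀ * K * (V * Vᵀ) * K * V := by
      rw [h1, Matrix.mul_one, Matrix.mul_sub, Matrix.sub_mul, Matrix.mul_smul, Matrix.smul_mul,
        Matrix.mul_one]
      simp only [Matrix.mul_assoc]
    rw [this]
    have hd : Vᵀ * K * V = Matrix.diagonal d := by
      conv_lhs => rw [h3]
      rw [show Vᵀ * (V * Matrix.diagonal d * Vᵀ) * V = (Vᵀ * V) * Matrix.diagonal d * (Vᵀ * V) by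
        simp only [Matrix.mul_assoc], h2, Matrix.mul_one, Matrix.one_mul]
    rw [show Vᵀ * K * (V * Vᵀ) * K * V = (Vᵀ * K * V) * (Vᵀ * K * V) by
      simp only [Matrix.mul_assoc], hd, h2, Matrix.diagonal_mul_diagonal]
    ext x y
    by_cases hxy : x = y
    · subst hxy
      rw [Matrix.sub_apply, Matrix.smul_apply, Matrix.one_apply_eq]
      simp
    · rw [Matrix.sub_apply, Matrix.smul_apply, Matrix.one_apply_ne hxy]
      simp [hxy]
  have e3 := congrFun (congrFun e2 i) i
  rw [Matrix.diagonal_apply_eq, e, Matrix.mul_add, Matrix.add_mul, Matrix.add_apply,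
    show ∀ M : Matrix (Site (4 * (ℓ + 1))) (Site (4 * (ℓ + 1))) ℝ,
      Vᵀ * (Mᵀ * M) * V = (M * V)ᵀ * (M * V) by
      intro M; rw [Matrix.transpose_mul]; simp only [Matrix.mul_assoc],
    show ∀ M : Matrix (Site (4 * (ℓ + 1))) (Site (4 * (ℓ + 1))) ℝ,
      Vᵀ * (Mᵀ * M) * V = (M * V)ᵀ * (M * V) by
      intro M; rw [Matrix.transpose_mul]; simp only [Matrix.mul_assoc],
    Matrix.mul_apply, Matrix.mul_apply] at e3
  have n1 : 0 ≤ ∑ j, ((S - Sᵀ) * V)ᵀ i j * ((S - Sᵀ) * V) j i :=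
    Finset.sum_nonneg fun j _ => mul_self_nonneg _
  have n2 : 0 ≤ ∑ j, ((T - Tᵀ) * V)ᵀ i j * ((T - Tᵀ) * V) j i :=
    Finset.sum_nonneg fun j _ => mul_self_nonneg _
  apply abs_le_of_sq_le_sq' _ (by norm_num) |> abs_le.2
  nlinarith

theorem IsHopping.le_traceNorm (hK : IsHopping K) (hℓ : 1 ≤ ℓ) (hf : ∀ x, flux K x = -1) :
    1.8534 * Fintype.card (Site (4 * (ℓ + 1))) ≤ traceNorm K := by
  obtain ⟨V, h1, h2, h3⟩ := exists_orthogonal_diagonalization hK.isHermitian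
  have t2 := hK.trace_sq
  have t4 := hK.trace_pow_four hℓ
  have t6 := hK.trace_pow_six hℓ fun x _ => hf x
  rw [trace_pow_eq_sum h2 h1 h3] at t2 t4 t6
  simp only [hf, add_neg_cancel, Finset.sum_const_zero, mul_zero, add_zero] at t4 t6
  rw [traceNorm, dif_pos hK.isHermitian]
  have hd := hK.eigenvalues_abs_le hf
  set d := hK.isHermitian.eigenvalues
  have h : ∑ i, (6.83 * d i ^ 6 - 120.661287 * d i ^ 4 + 901.5293 * d i ^ 2) ≤
      ∑ i, 1056.332592 * |d i| :=
    Finset.sum_le_sum fun i _ => sextic_le_abs (hd i)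
  simp only [Finset.sum_add_distrib, Finset.sum_sub_distrib, ← Finset.mul_sum, t2, t4, t6] at h
  have : (0 : ℝ) ≤ Fintype.card (Site (4 * (ℓ + 1))) := by positivity
  linarith

/-- The four translates of the class of even corners partition the torus. -/
theorem sum_evenCorner_translates {R : Type*} [AddCommMonoid R] (f : Site (4 * (ℓ + 1)) → R) :
    ∑ x, f x = (∑ x, if EvenCorner x then f x else 0) +
      (∑ x, if EvenCorner x then f (x + (1, 0)) else 0) +
      ((∑ x, if EvenCorner x then f (x + (0, 1)) else 0) +
      (∑ x, if EvenCorner x then f (x + (1, 1)) else 0)) := by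
  have hz : ∀ a : ZMod 2, a - 1 = 0 ↔ ¬ a = 0 := by decide
  have hs : ∀ v : Site (4 * (ℓ + 1)), (∑ x, if EvenCorner x then f (x + v) else 0) =
      ∑ x, if EvenCorner (x - v) then f x else 0 := fun v => by
    rw [← Equiv.sum_comp (Equiv.addRight v) fun x => if EvenCorner (x - v) then f x else 0]
    simp
  rw [hs, hs, hs, ← Finset.sum_add_distrib, ← Finset.sum_add_distrib, ← Finset.sum_add_distrib]
  refine Finset.sum_congr rfl fun x _ => ?_
  simp only [EvenCorner, Prod.fst_sub, Prod.snd_sub, map_sub, par_one, sub_zero, hz]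
  by_cases h1 : par x.1 = 0 <;> by_cases h2 : par x.2 = 0 <;> simp [h1, h2]

theorem sum_evenCorner_card :
    4 * (∑ x : Site (4 * (ℓ + 1)), if EvenCorner x then (1 : ℝ) else 0) =
      Fintype.card (Site (4 * (ℓ + 1))) := by
  have := sum_evenCorner_translates (ℓ := ℓ) fun _ => (1 : ℝ)
  simp only [Finset.sum_const, Finset.card_univ, nsmul_eq_mul, mul_one] at this
  linarith

/-- A hopping matrix with flux `-1` through all plaquettes. -/
def landauHopping (ℓ : ℕ) : Matrix (Site (4 * (ℓ + 1))) (Site (4 * (ℓ + 1))) ℝ :=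
  Matrix.of fun x y => if y = x + (1, 0) ∨ x = y + (1, 0) then 1 else
    if y = x + (0, 1) ∨ x = y + (0, 1) then parSign x else 0

theorem isHopping_landauHopping (ℓ : ℕ) : IsHopping (landauHopping ℓ) where
  symm x y := by
    simp only [landauHopping, Matrix.of_apply, or_comm (a := x = y + (1, 0)),
      or_comm (a := x = y + (0, 1))]
    split_ifs with h1 h2
    · rfl
    · rcases h2 with h | h <;> rw [h] <;> simp [parSign]
    · rfl
  horizontal x := by simp [landauHopping]
  vertical x := by
    simp only [landauHopping, Matrix.of_apply, true_or, if_true, parSign]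
    split_ifs <;> norm_num
  eq_zero x y h1 h2 h3 h4 := by simp [landauHopping, h1, h2, h3, h4]

theorem flux_landauHopping (x : Site (4 * (ℓ + 1))) : flux (landauHopping ℓ) x = -1 := by
  have h1 : (1 : ZMod (4 * (ℓ + 1))) ≠ 0 := by
    simpa using natCast_ne_zero (ℓ := ℓ) (n := 1) (by omega) (by omega)
  have hx : ∀ y : Site (4 * (ℓ + 1)), landauHopping ℓ y (y + (1, 0)) = 1 := fun y => by
    simp [landauHopping]
  have hy : ∀ y : Site (4 * (ℓ + 1)), landauHopping ℓ y (y + (0, 1)) = parSign y := fun y => by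
    have e1 : ((0, 1) : Site (4 * (ℓ + 1))) ≠ (1, 0) := by simp [h1]
    have e2 : ((0, 1) : Site (4 * (ℓ + 1))) + (1, 0) ≠ 0 := by
      rw [Ne, Prod.ext_iff]; simp [h1]
    have e3 : y ≠ y + (0, 1) + (1, 0) := fun h => by
      rw [add_assoc] at h
      exact e2 (left_eq_add.1 h)
    simp [landauHopping, e1, e3]
  have f1 := hx x
  have f2 := hx (x + (0, 1))
  have f3 := hy x
  have f4 := hy (x + (1, 0))
  rw [add_assoc] at f2 f4
  simp only [Prod.mk_add_mk, add_zero, zero_add] at f2 f4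
  have s := (isHopping_landauHopping ℓ).symm
  rw [flux, s (x + (0, 1)) x, s (x + (1, 1)) (x + (0, 1)), f1, f2, f3, f4, parSign_add_one]
  unfold parSign
  split_ifs <;> norm_num

/-- A regular maximizer of the trace norm with reward 0.02 has one of the two patterns. If it is the
constant one, the maximality is the assertion; the other one must be excluded. -/
theorem exists_traceNorm_gap_even (hℓ : 1 ≤ ℓ) :
    ∃ K₀ : Matrix (Site (4 * (ℓ + 1))) (Site (4 * (ℓ + 1))) ℝ, IsHopping K₀ ∧
      (∀ x, flux K₀ x = -1) ∧ ∀ K : Matrix (Site (4 * (ℓ + 1))) (Site (4 * (ℓ + 1))) ℝ,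
        IsHopping K → traceNorm K + 0.02 * ((∑ x, evenDefect K x : ℕ) : ℝ) ≤ traceNorm K₀ := by
  obtain ⟨K₀, h⟩ := exists_isRegularMaximizer (ℓ := ℓ) 0.02 ⟨_, isHopping_landauHopping ℓ⟩
  have hno : (∀ x, flux K₀ x = -1) → ∑ x, evenDefect K₀ x = 0 := fun h =>
    Finset.sum_eq_zero fun x _ => by
      rw [evenDefect, if_neg]
      rintro ⟨-, h'⟩
      rw [h] at h'
      norm_num at h'
  rcases h.flux_eq (by norm_num) with hf | hf
  · refine ⟨K₀, h.isHopping, hf, fun K hK => ?_⟩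
    have := h.max K hK
    rw [rewarded, rewarded, hno hf] at this
    simpa using this
  · exfalso
    have hpos : (0 : ℝ) < Fintype.card (Site (4 * (ℓ + 1))) := by
      exact_mod_cast Fintype.card_pos
    have e1 := (isHopping_landauHopping ℓ).le_traceNorm hℓ flux_landauHopping
    have e2 := h.max _ (isHopping_landauHopping ℓ)
    have c := sum_evenCorner_card (ℓ := ℓ)
    have hc1 : ((∑ x, evenDefect K₀ x : ℕ) : ℝ) =
        ∑ x : Site (4 * (ℓ + 1)), if EvenCorner x then (1 : ℝ) else 0 := by
      push_cast
      refine Finset.sum_congr rfl fun x _ => ?_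
      by_cases hx : EvenCorner x <;> simp [evenDefect, hf, hx]
    have hc2 : ∑ x, (1 + flux K₀ x) =
        ∑ x : Site (4 * (ℓ + 1)), 2 * if EvenCorner x then (1 : ℝ) else 0 := by
      refine Finset.sum_congr rfl fun x _ => ?_
      by_cases hx : EvenCorner x <;> simp [hf, hx]
      norm_num
    rw [← Finset.mul_sum] at hc2
    -- A quarter of the plaquettes is rewarded, so per site the second pattern reaches at most 1.848
    -- + 0.02/4 = 1.853, less than the 1.8534 of constant flux -1.
    have e3 := h.isHopping.traceNorm_le hℓ hf (by rw [hc2]; linarith)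
    have e4 : 0 ≤ 0.02 * ((∑ x, evenDefect (landauHopping ℓ) x : ℕ) : ℝ) := by positivity
    rw [rewarded, rewarded, hc1] at e2
    linarith

open Classical in
/-- Lieb's flux phase theorem with a gap: the trace norm of a hopping matrix is largest for flux
`-1` through all plaquettes, and every plaquette of flux `1` has a cost. -/
theorem exists_traceNorm_gap (hℓ : 1 ≤ ℓ) :
    ∃ K₀ : Matrix (Site (4 * (ℓ + 1))) (Site (4 * (ℓ + 1))) ℝ, IsHopping K₀ ∧
      (∀ x, flux K₀ x = -1) ∧ ∀ K : Matrix (Site (4 * (ℓ + 1))) (Site (4 * (ℓ + 1))) ℝ,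
        IsHopping K →
          traceNorm K + 0.005 * (∑ x, if flux K x = 1 then (1 : ℝ) else 0) ≤ traceNorm K₀ := by
  obtain ⟨K₀, h1, h2, h3⟩ := exists_traceNorm_gap_even hℓ
  refine ⟨K₀, h1, h2, fun K hK => ?_⟩
  -- Every plaquette is even for one of four translates of K; averaging the four inequalities turns
  -- 0.02 into 0.005.
  have key : ∀ v, traceNorm K + 0.02 * (∑ x, if EvenCorner x then
      (if flux K (x + v) = 1 then (1 : ℝ) else 0) else 0) ≤ traceNorm K₀ := fun v => by
    have := h3 _ (hK.shift v)
    rw [traceNorm_shift hK] at this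
    convert this using 3
    push_cast
    refine Finset.sum_congr rfl fun x _ => ?_
    rw [evenDefect, flux_shift]
    split_ifs <;> simp_all
  have e := sum_evenCorner_translates fun x => if flux K x = 1 then (1 : ℝ) else 0
  have k0 := key 0
  simp only [add_zero] at k0
  have k1 := key (1, 0)
  have k2 := key (0, 1)
  have k3 := key (1, 1)
  rw [e]
  linarith

end Gap
end
end Z2Gauge

namespace Z2Gauge
noncomputable section
open scoped Matrix

/-! ### Exponentials of matrices -/

section MatrixExp

variable {n : Type*} [Fintype n] [DecidableEq n]

theorem semiconjBy_exp {x a b : Matrix n n ℂ} (h : SemiconjBy x a b) :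
    SemiconjBy x (NormedSpace.exp a) (NormedSpace.exp b) := by
  let _ : NormedRing (Matrix n n ℂ) := Matrix.linftyOpNormedRing
  let _ : NormedAlgebra ℂ (Matrix n n ℂ) := Matrix.linftyOpNormedAlgebra
  let _ : NormedAlgebra ℚ (Matrix n n ℂ) := NormedAlgebra.restrictScalars ℚ ℂ _
  exact h.exp_right

theorem exp_smul_one (z : ℂ) :
    NormedSpace.exp (z • (1 : Matrix n n ℂ)) = Complex.exp z • (1 : Matrix n n ℂ) := by
  rw [← Matrix.diagonal_one, ← Matrix.diagonal_smul, Matrix.exp_diagonal, ← Matrix.diagonal_smul]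
  congr 1
  funext i
  rw [Pi.coe_exp]
  simp [Complex.exp_eq_exp_ℂ]

theorem exp_add_smul_one (z : ℂ) (A : Matrix n n ℂ) :
    NormedSpace.exp (A + z • (1 : Matrix n n ℂ)) = Complex.exp z • NormedSpace.exp A := by
  rw [Matrix.exp_add_of_commute _ _ ((Commute.one_right A).smul_right z), exp_smul_one]
  simp

/-- The exponential of a multiple of an idempotent. -/
theorem exp_smul_idempotent {p : Matrix n n ℂ} (hp : p * p = p) (z : ℂ) :
    NormedSpace.exp (z • p) = 1 + (Complex.exp z - 1) • p := by
  have h1 : SemiconjBy p (z • p) (z • (1 : Matrix n n ℂ)) := by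
    simp [SemiconjBy, hp]
  have h2 : SemiconjBy (1 - p) (z • p) 0 := by
    simp [SemiconjBy, sub_mul, hp]
  have e1 := (semiconjBy_exp h1).eq
  have e2 := (semiconjBy_exp h2).eq
  rw [exp_smul_one] at e1
  rw [NormedSpace.exp_zero, one_mul] at e2
  calc NormedSpace.exp (z • p) = p * NormedSpace.exp (z • p) + (1 - p) * NormedSpace.exp (z • p) := by
        noncomm_ring
    _ = _ := by
      rw [e1, e2, smul_mul_assoc, one_mul, sub_smul, one_smul]
      abel

end MatrixExp

/-! ### Canonical anticommutation relations and traces of Gaussian operators -/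

section CAR

variable {ι n : Type*} [Fintype ι] [DecidableEq ι] [Fintype n] [DecidableEq n]

/-- The canonical anticommutation relations. -/
structure IsCAR (c d : ι → Matrix n n ℂ) : Prop where
  cc : ∀ a b, c a * c b = -(c b * c a)
  dd : ∀ a b, d a * d b = -(d b * d a)
  cd : ∀ a b, c a * d b = (if a = b then 1 else 0) - d b * c a

/-- A linear combination of field operators. -/
def rotated (V : Matrix ι ι ℝ) (c : ι → Matrix n n ℂ) (a : ι) : Matrix n n ℂ :=
  ∑ x, (V x a : ℂ) • c x

theorem IsCAR.rotated {c d : ι → Matrix n n ℂ} (h : IsCAR c d) {V : Matrix ι ι ℝ}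
    (hV : Vᵀ * V = 1) : IsCAR (rotated V c) (rotated V d) where
  cc a b := by
    simp only [Z2Gauge.rotated, Finset.sum_mul_sum, smul_mul_smul_comm]
    rw [Finset.sum_comm, ← Finset.sum_neg_distrib]
    refine Finset.sum_congr rfl fun x _ => ?_
    rw [← Finset.sum_neg_distrib]
    refine Finset.sum_congr rfl fun y _ => ?_
    rw [h.cc y x, smul_neg, mul_comm]
  dd a b := by
    simp only [Z2Gauge.rotated, Finset.sum_mul_sum, smul_mul_smul_comm]
    rw [Finset.sum_comm, ← Finset.sum_neg_distrib]
    refine Finset.sum_congr rfl fun x _ => ?_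
    rw [← Finset.sum_neg_distrib]
    refine Finset.sum_congr rfl fun y _ => ?_
    rw [h.dd y x, smul_neg, mul_comm]
  cd a b := by
    have hab : ∑ x, (V x a : ℂ) * (V x b : ℂ) = if a = b then 1 else 0 := by
      have := congrFun (congrFun hV a) b
      rw [Matrix.mul_apply, Matrix.one_apply] at this
      simp only [Matrix.transpose_apply] at this
      have h2 := congrArg (fun r : ℝ => (r : ℂ)) this
      push_cast at h2
      rw [h2]
      split_ifs <;> simp
    simp only [Z2Gauge.rotated, Finset.sum_mul_sum, smul_mul_smul_comm, h.cd]
    simp only [smul_sub, Finset.sum_sub_distrib]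
    congr 1
    · simp only [smul_ite, smul_zero, Finset.sum_ite_eq, Finset.mem_univ, if_true]
      rw [← Finset.sum_smul, hab]
      split_ifs <;> simp
    · rw [Finset.sum_comm]
      refine Finset.sum_congr rfl fun x _ => Finset.sum_congr rfl fun y _ => ?_
      rw [mul_comm]

/-- The second quantization of a matrix. -/
def secondQuantized (c d : ι → Matrix n n ℂ) (A : Matrix ι ι ℂ) : Matrix n n ℂ :=
  ∑ x, ∑ y, A x y • (d x * c y)

/-- The matrix elements of `A` in the real orthonormal basis given by the columns of `V`. -/
def inBasis (V : Matrix ι ι ℝ) (A : Matrix ι ι ℂ) : Matrix ι ι ℂ :=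
  (V.map Complex.ofReal)ᵀ * A * V.map Complex.ofReal

/-- Second quantization does not depend on the orthonormal basis; this allows to pass to the
eigenmodes of the hopping matrix. -/
theorem secondQuantized_rotated {V : Matrix ι ι ℝ} (hV : V * Vᵀ = 1) (c d : ι → Matrix n n ℂ)
    (A : Matrix ι ι ℂ) :
    secondQuantized (rotated V c) (rotated V d) (inBasis V A) = secondQuantized c d A := by
  have hV' : (V.map Complex.ofReal) * (V.map Complex.ofReal)ᵀ = 1 := by
    rw [← Matrix.transpose_map]
    have := congrArg (fun M : Matrix ι ι ℝ => M.map Complex.ofReal) hV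
    simp only [Matrix.map_one Complex.ofReal Complex.ofReal_zero Complex.ofReal_one] at this
    rw [← this]
    exact (Matrix.map_mul (f := Complex.ofRealHom)).symm
  have hA : V.map Complex.ofReal * inBasis V A * (V.map Complex.ofReal)ᵀ = A := by
    rw [inBasis, show ∀ W : Matrix ι ι ℂ, W * (Wᵀ * A * W) * Wᵀ = (W * Wᵀ) * A * (W * Wᵀ) by
      intro W; simp only [Matrix.mul_assoc], hV', Matrix.one_mul, Matrix.mul_one]
  set B := inBasis V A
  rw [← hA]
  simp only [secondQuantized, rotated, Finset.sum_mul_sum, smul_mul_smul_comm, Finset.smul_sum,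
    smul_smul]
  simp only [Matrix.mul_apply, Matrix.transpose_apply, Matrix.map_apply, Finset.sum_mul,
    Finset.sum_smul]
  have comm4 : ∀ F : ι → ι → ι → ι → Matrix n n ℂ,
      ∑ a, ∑ b, ∑ x, ∑ y, F a b x y = ∑ x, ∑ y, ∑ b, ∑ a, F a b x y := by
    intro F
    calc _ = ∑ a, ∑ x, ∑ b, ∑ y, F a b x y :=
          Finset.sum_congr rfl fun a _ => Finset.sum_comm
      _ = ∑ x, ∑ a, ∑ b, ∑ y, F a b x y := Finset.sum_comm
      _ = ∑ x, ∑ a, ∑ y, ∑ b, F a b x y :=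
          Finset.sum_congr rfl fun x _ => Finset.sum_congr rfl fun a _ => Finset.sum_comm
      _ = ∑ x, ∑ y, ∑ a, ∑ b, F a b x y :=
          Finset.sum_congr rfl fun x _ => Finset.sum_comm
      _ = _ := Finset.sum_congr rfl fun x _ => Finset.sum_congr rfl fun y _ => Finset.sum_comm
  rw [comm4]
  refine Finset.sum_congr rfl fun x _ => Finset.sum_congr rfl fun y _ =>
    Finset.sum_congr rfl fun b _ => Finset.sum_congr rfl fun a _ => ?_
  congr 1
  ring

theorem secondQuantized_diagonal (c d : ι → Matrix n n ℂ) (z : ι → ℂ) :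
    secondQuantized c d (Matrix.diagonal z) = ∑ a, z a • (d a * c a) := by
  refine Finset.sum_congr rfl fun a _ => ?_
  rw [Finset.sum_eq_single a]
  · simp
  · intro b _ hb
    simp [Ne.symm hb]
  · simp

variable {c d : ι → Matrix n n ℂ}

theorem eq_zero_of_eq_neg {M : Matrix n n ℂ} (h : M = -M) : M = 0 := by
  ext i j
  exact self_eq_neg.1 (congrFun (congrFun h i) j)

theorem IsCAR.d_sq (h : IsCAR c d) (a : ι) : d a * d a = 0 := eq_zero_of_eq_neg (h.dd a a)

theorem IsCAR.number_mul_d (h : IsCAR c d) (a b : ι) :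
    (d a * c a) * d b = d b * (d a * c a) + if a = b then d b else 0 := by
  rw [Matrix.mul_assoc, h.cd, Matrix.mul_sub, ← Matrix.mul_assoc (d a) (d b), h.dd a b]
  split_ifs with hab
  · subst hab; noncomm_ring
  · noncomm_ring

theorem IsCAR.number_mul_c (h : IsCAR c d) (a b : ι) :
    (d a * c a) * c b = c b * (d a * c a) - if a = b then c b else 0 := by
  rw [Matrix.mul_assoc, h.cc a b, ← Matrix.mul_assoc (c b) (d a), h.cd]
  by_cases hab : a = b
  · subst hab
    rw [if_pos rfl, if_pos rfl]
    noncomm_ring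
  · rw [if_neg hab, if_neg (Ne.symm hab)]
    noncomm_ring

theorem IsCAR.number_sq (h : IsCAR c d) (a : ι) : (d a * c a) * (d a * c a) = d a * c a := by
  rw [← Matrix.mul_assoc, h.number_mul_d, if_pos rfl, Matrix.add_mul, ← Matrix.mul_assoc (d a) (d a),
    h.d_sq]
  simp

theorem IsCAR.number_commute (h : IsCAR c d) (a b : ι) : Commute (d a * c a) (d b * c b) := by
  rw [Commute, SemiconjBy, ← Matrix.mul_assoc, h.number_mul_d, Matrix.add_mul,
    Matrix.mul_assoc (d b) (d a * c a), h.number_mul_c]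
  by_cases hab : a = b
  · subst hab
    rw [if_pos rfl, if_pos rfl]
    noncomm_ring
  · rw [if_neg hab, if_neg hab]
    noncomm_ring

/-- The Gaussian operator with one particle matrix `diag z`. -/
def gaussian (c d : ι → Matrix n n ℂ) (z : ι → ℂ) : Matrix n n ℂ :=
  NormedSpace.exp (∑ a, z a • (d a * c a))

/-- A creation operator raises the occupation of its mode by one, hence shifts the exponent by z b.
-/
theorem IsCAR.gaussian_mul_d (h : IsCAR c d) (z : ι → ℂ) (b : ι) :
    gaussian c d z * d b = Complex.exp (z b) • (d b * gaussian c d z) := by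
  have hs : SemiconjBy (d b) (∑ a, z a • (d a * c a) + z b • 1) (∑ a, z a • (d a * c a)) := by
    rw [SemiconjBy, Matrix.mul_add, Finset.mul_sum, Finset.sum_mul, Matrix.mul_smul,
      Matrix.mul_one]
    simp only [Matrix.mul_smul, Matrix.smul_mul, h.number_mul_d, smul_add, Finset.sum_add_distrib,
      smul_ite, smul_zero, Finset.sum_ite_eq', Finset.mem_univ, if_true]
  have := (semiconjBy_exp hs).eq
  rw [exp_add_smul_one, Matrix.mul_smul] at this
  exact this.symm

theorem IsCAR.gaussian_mul_c (h : IsCAR c d) (z : ι → ℂ) (b : ι) :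
    gaussian c d z * c b = Complex.exp (-z b) • (c b * gaussian c d z) := by
  have hs : SemiconjBy (c b) (∑ a, z a • (d a * c a) + (-z b) • 1) (∑ a, z a • (d a * c a)) := by
    rw [SemiconjBy, Matrix.mul_add, Finset.mul_sum, Finset.sum_mul, Matrix.mul_smul,
      Matrix.mul_one]
    simp only [Matrix.mul_smul, Matrix.smul_mul, h.number_mul_c, smul_sub, Finset.sum_sub_distrib,
      smul_ite, smul_zero, Finset.sum_ite_eq', Finset.mem_univ, if_true, neg_smul, ← sub_eq_add_neg]
  have := (semiconjBy_exp hs).eq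
  rw [exp_add_smul_one, Matrix.mul_smul] at this
  exact this.symm

theorem IsCAR.trace_mul_d (h : IsCAR c d) (z : ι → ℂ) (O : Matrix n n ℂ) (a : ι) :
    (O * d a * gaussian c d z).trace = Complex.exp (-z a) * (d a * O * gaussian c d z).trace := by
  have e : d a * gaussian c d z = Complex.exp (-z a) • (gaussian c d z * d a) := by
    rw [h.gaussian_mul_d, smul_smul, ← Complex.exp_add]
    simp
  rw [Matrix.mul_assoc, e, Matrix.mul_smul, Matrix.trace_smul, smul_eq_mul, ← Matrix.mul_assoc,
    Matrix.trace_mul_comm, Matrix.mul_assoc (d a)]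

/-- Cyclicity moves the creation operator around the trace and the anticommutator brings it back.
The prefactor is not divided out, because it may vanish: with the parity twist it does so for a mode
of energy zero. -/
theorem IsCAR.trace_dc (h : IsCAR c d) (z : ι → ℂ) (a b : ι) :
    (1 + Complex.exp (-z a)) * (d a * c b * gaussian c d z).trace =
      if a = b then (gaussian c d z).trace else 0 := by
  have e := h.trace_mul_d z (c b) a
  rw [h.cd, Matrix.sub_mul, Matrix.trace_sub] at e
  have e2 : ((if b = a then (1 : Matrix n n ℂ) else 0) * gaussian c d z).trace =
      if a = b then (gaussian c d z).trace else 0 := by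
    by_cases hab : a = b
    · simp [hab]
    · simp [hab, Ne.symm hab]
  rw [e2] at e
  linear_combination -e

/-- The modes are added one by one, each contributing the factor (1 + exp z)/2; the dimension of the
space fixes the normalization. -/
theorem IsCAR.trace_gaussian (h : IsCAR c d) (hcard : Fintype.card n = 2 ^ Fintype.card ι)
    (z : ι → ℂ) : (gaussian c d z).trace = ∏ a, (1 + Complex.exp (z a)) := by
  have main : ∀ s : Finset ι, (NormedSpace.exp (∑ a ∈ s, z a • (d a * c a))).trace * 2 ^ s.card =
      2 ^ Fintype.card ι * ∏ a ∈ s, (1 + Complex.exp (z a)) := by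
    intro s
    induction s using Finset.induction_on with
    | empty => simp [NormedSpace.exp_zero, Matrix.trace_one, hcard]
    | insert b s hb ih =>
      have hcomm : Commute (z b • (d b * c b)) (∑ a ∈ s, z a • (d a * c a)) :=
        Commute.sum_right _ _ _ fun a _ => ((h.number_commute b a).smul_left _).smul_right _
      rw [Finset.sum_insert hb, Matrix.exp_add_of_commute _ _ hcomm,
        exp_smul_idempotent (h.number_sq b), Finset.prod_insert hb, Finset.card_insert_of_notMem hb]
      set Y := NormedSpace.exp (∑ a ∈ s, z a • (d a * c a))
      have hY : Y * c b = c b * Y := by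
        refine ((semiconjBy_exp (x := c b) ?_).eq).symm
        rw [SemiconjBy, Finset.mul_sum, Finset.sum_mul]
        refine Finset.sum_congr rfl fun a ha => ?_
        rw [Matrix.mul_smul, Matrix.smul_mul, h.number_mul_c,
          if_neg (fun hab => hb (by rwa [← hab])), sub_zero]
      -- An operator that does not involve the mode b gives the same weight to the occupied and the
      -- empty state of b.
      have ht : (d b * c b * Y).trace * 2 = Y.trace := by
        have h1 : (d b * c b * Y).trace = (c b * d b * Y).trace := by
          rw [Matrix.mul_assoc, ← hY, ← Matrix.mul_assoc, Matrix.trace_mul_comm, ← Matrix.mul_assoc]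
        have h2 : (c b * d b * Y).trace = Y.trace - (d b * c b * Y).trace := by
          rw [h.cd, if_pos rfl, Matrix.sub_mul, Matrix.one_mul, Matrix.trace_sub]
        linear_combination h1 + h2
      rw [Matrix.add_mul, Matrix.one_mul, Matrix.trace_add, Matrix.smul_mul, Matrix.trace_smul,
        smul_eq_mul, pow_succ]
      linear_combination (1 + Complex.exp (z b)) * ih +
        (Complex.exp (z b) - 1) * 2 ^ s.card * ht
  have := main Finset.univ
  rw [Finset.card_univ, mul_comm] at this
  exact mul_left_cancel₀ (pow_ne_zero _ two_ne_zero) this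


/-- Where the mode a is occupied, its part of the exponent is a number, so its parameter may be
reset to 0. There the prefactor in `IsCAR.trace_dc` is 2, which gives occupation formulas valid
without any division, also for parity twisted zero modes. -/
theorem gaussian_mul_number (h : IsCAR c d) (z : ι → ℂ) (a : ι) :
    d a * c a * gaussian c d z =
      Complex.exp (z a) • (d a * c a * gaussian c d (Function.update z a 0)) := by
  have e : ∑ b, z b • (d b * c b) =
      z a • (d a * c a) + ∑ b, Function.update z a 0 b • (d b * c b) := by
    rw [← Finset.add_sum_erase _ _ (Finset.mem_univ a),
      ← Finset.add_sum_erase _ (fun b => Function.update z a 0 b • (d b * c b)) (Finset.mem_univ a)]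
    simp only [Function.update_self, zero_smul, zero_add]
    congr 1
    refine Finset.sum_congr rfl fun b hb => ?_
    rw [Function.update_of_ne (Finset.ne_of_mem_erase hb)]
  have hcomm : Commute (z a • (d a * c a)) (∑ b, Function.update z a 0 b • (d b * c b)) :=
    Commute.sum_right _ _ _ fun b _ => ((h.number_commute a b).smul_left _).smul_right _
  rw [gaussian, e, Matrix.exp_add_of_commute _ _ hcomm, exp_smul_idempotent (h.number_sq a),
    ← Matrix.mul_assoc, Matrix.mul_add, Matrix.mul_one, Matrix.mul_smul, h.number_sq, gaussian,
    sub_smul, one_smul, add_sub_cancel, Matrix.smul_mul]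

theorem gaussian_mul_one_sub_number (h : IsCAR c d) (z : ι → ℂ) (a : ι) :
    (1 - d a * c a) * gaussian c d z =
      (1 - d a * c a) * gaussian c d (Function.update z a 0) := by
  have e : ∑ b, z b • (d b * c b) =
      z a • (d a * c a) + ∑ b, Function.update z a 0 b • (d b * c b) := by
    rw [← Finset.add_sum_erase _ _ (Finset.mem_univ a),
      ← Finset.add_sum_erase _ (fun b => Function.update z a 0 b • (d b * c b)) (Finset.mem_univ a)]
    simp only [Function.update_self, zero_smul, zero_add]
    congr 1
    refine Finset.sum_congr rfl fun b hb => ?_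
    rw [Function.update_of_ne (Finset.ne_of_mem_erase hb)]
  have hcomm : Commute (z a • (d a * c a)) (∑ b, Function.update z a 0 b • (d b * c b)) :=
    Commute.sum_right _ _ _ fun b _ => ((h.number_commute a b).smul_left _).smul_right _
  rw [gaussian, e, Matrix.exp_add_of_commute _ _ hcomm, exp_smul_idempotent (h.number_sq a),
    ← Matrix.mul_assoc, Matrix.mul_add, Matrix.mul_one, Matrix.mul_smul, Matrix.sub_mul,
    h.number_sq, gaussian]
  simp

theorem IsCAR.trace_number (h : IsCAR c d) (hcard : Fintype.card n = 2 ^ Fintype.card ι)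
    (z : ι → ℂ) (a : ι) : (d a * c a * gaussian c d z).trace =
      Complex.exp (z a) * ∏ b ∈ Finset.univ.erase a, (1 + Complex.exp (z b)) := by
  have h1 := h.trace_dc (Function.update z a 0) a a
  rw [if_pos rfl, h.trace_gaussian hcard, ← Finset.mul_prod_erase _ _ (Finset.mem_univ a)] at h1
  rw [Function.update_self, neg_zero, Complex.exp_zero] at h1
  have h2 : ∏ b ∈ Finset.univ.erase a, (1 + Complex.exp (Function.update z a 0 b)) =
      ∏ b ∈ Finset.univ.erase a, (1 + Complex.exp (z b)) :=
    Finset.prod_congr rfl fun b hb => by rw [Function.update_of_ne (Finset.ne_of_mem_erase hb)]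
  rw [h2] at h1
  rw [gaussian_mul_number h, Matrix.trace_smul, smul_eq_mul]
  linear_combination Complex.exp (z a) / 2 * h1

/-- The product equals n_a (1 - n_b): the mode a is occupied and b is empty. -/
theorem IsCAR.trace_pair (h : IsCAR c d) (hcard : Fintype.card n = 2 ^ Fintype.card ι)
    (z : ι → ℂ) {a b : ι} (hab : a ≠ b) : (d a * c b * (d b * c a) * gaussian c d z).trace =
      Complex.exp (z a) * ∏ e ∈ (Finset.univ.erase a).erase b, (1 + Complex.exp (z e)) := by
  have e0 : d a * c b * (d b * c a) = d a * c a * (1 - d b * c b) := by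
    have : d a * c b * (d b * c a) = d a * (c b * d b) * c a := by simp only [Matrix.mul_assoc]
    rw [this, h.cd, if_pos rfl, Matrix.mul_assoc, Matrix.sub_mul, h.number_mul_c,
      if_neg hab.symm, sub_zero]
    noncomm_ring
  have hb : b ∈ Finset.univ.erase a := Finset.mem_erase.2 ⟨hab.symm, Finset.mem_univ _⟩
  have ha : a ∈ Finset.univ.erase b := Finset.mem_erase.2 ⟨hab, Finset.mem_univ _⟩
  have t1 := h.trace_number hcard (Function.update z b 0) a
  have comm := (h.number_commute a b).eq
  rw [e0, Matrix.mul_assoc, gaussian_mul_one_sub_number h]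
  set z' := Function.update z b 0
  have t2 : (d a * c a * (d b * c b) * gaussian c d z').trace * 2 =
      (d a * c a * gaussian c d z').trace := by
    have k := h.trace_mul_d z' (d a * c a * c b) b
    have z0 : z' b = 0 := Function.update_self ..
    rw [z0, neg_zero, Complex.exp_zero, one_mul, Matrix.mul_assoc (d a * c a), h.cd, if_pos rfl,
      Matrix.mul_sub, Matrix.mul_one, Matrix.sub_mul, Matrix.trace_sub, ← Matrix.mul_assoc (d b),
      ← add_zero (d b * (d a * c a)), show d b * (d a * c a) + 0 = d a * c a * d b by
        rw [h.number_mul_d, if_neg hab]] at k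
    rw [Matrix.mul_assoc (d a * c a) (d b) (c b)] at k
    linear_combination -k
  rw [← Finset.mul_prod_erase _ _ hb, show z' b = 0 from Function.update_self .., Complex.exp_zero,
    show z' a = z a from Function.update_of_ne hab _ _] at t1
  have h2 : ∏ e ∈ (Finset.univ.erase a).erase b, (1 + Complex.exp (z' e)) =
      ∏ e ∈ (Finset.univ.erase a).erase b, (1 + Complex.exp (z e)) :=
    Finset.prod_congr rfl fun e he => by
      rw [show z' e = z e from Function.update_of_ne (Finset.ne_of_mem_erase he) _ _]
  rw [h2] at t1
  rw [Matrix.sub_mul, Matrix.one_mul, Matrix.mul_sub, Matrix.trace_sub, ← Matrix.mul_assoc]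
  linear_combination t1 - t2 / 2 + t1 * (-1/2)

theorem IsCAR.number_commute_gaussian (h : IsCAR c d) (z : ι → ℂ) (e : ι) :
    gaussian c d z * (d e * c e) = d e * c e * gaussian c d z := by
  refine ((semiconjBy_exp (x := d e * c e) ?_).eq).symm
  exact Commute.sum_right _ _ _ fun b _ => (h.number_commute e b).smul_right _

/-- The Gaussian commutes with each occupation number, so an operator that changes one of them has
no diagonal part. This replaces Wick's theorem for the terms that vanish. -/
theorem IsCAR.trace_eq_zero_of_charge (h : IsCAR c d) (z : ι → ℂ) {e : ι} {k : ℂ} (hk : k ≠ 0)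
    {O : Matrix n n ℂ} (hO : d e * c e * O = O * (d e * c e) + k • O) :
    (O * gaussian c d z).trace = 0 := by
  have h1 : (d e * c e * O * gaussian c d z).trace = (O * (d e * c e) * gaussian c d z).trace := by
    rw [Matrix.mul_assoc, Matrix.trace_mul_comm, Matrix.mul_assoc, h.number_commute_gaussian]
    simp only [Matrix.mul_assoc]
  rw [hO, Matrix.add_mul, Matrix.trace_add, Matrix.smul_mul, Matrix.trace_smul, smul_eq_mul] at h1
  have h2 : k * (O * gaussian c d z).trace = 0 := by linear_combination h1
  exact (mul_eq_zero.1 h2).resolve_left hk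

theorem IsCAR.number_mul_dc (h : IsCAR c d) (e a b : ι) : d e * c e * (d a * c b) =
    d a * c b * (d e * c e) +
      ((if e = a then 1 else 0) - (if e = b then 1 else 0) : ℂ) • (d a * c b) := by
  rw [← Matrix.mul_assoc (d e * c e), h.number_mul_d, Matrix.add_mul, Matrix.mul_assoc (d a),
    h.number_mul_c, Matrix.mul_sub]
  simp only [sub_smul, ite_smul, one_smul, zero_smul, mul_ite, ite_mul, mul_zero, zero_mul,
    Matrix.mul_assoc]
  abel

theorem IsCAR.trace_dc_of_ne (h : IsCAR c d) (z : ι → ℂ) {a b : ι} (hab : a ≠ b) :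
    (d a * c b * gaussian c d z).trace = 0 := by
  refine h.trace_eq_zero_of_charge z (e := a) one_ne_zero ?_
  rw [h.number_mul_dc, if_pos rfl, if_neg hab, sub_zero]

theorem IsCAR.trace_quartic_of_ne (h : IsCAR c d) (z : ι → ℂ) {a b a' b' : ι} (hab : a ≠ b)
    (hne : ¬(a' = b ∧ b' = a)) :
    (d a * c b * (d a' * c b') * gaussian c d z).trace = 0 := by
  have key : ∀ e, d e * c e * (d a * c b * (d a' * c b')) = d a * c b * (d a' * c b') * (d e * c e) +
      (((if e = a then 1 else 0) - (if e = b then 1 else 0) : ℂ) +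
        ((if e = a' then 1 else 0) - (if e = b' then 1 else 0))) •
          (d a * c b * (d a' * c b')) := by
    intro e
    rw [← Matrix.mul_assoc (d e * c e), h.number_mul_dc, Matrix.add_mul,
      Matrix.mul_assoc (d a * c b), h.number_mul_dc e a' b', Matrix.mul_add, Matrix.mul_smul,
      Matrix.smul_mul, add_smul, Matrix.mul_assoc (d a * c b) (d a' * c b')]
    abel
  by_cases h1 : b' = a
  · have h2 : a' ≠ b := fun hh => hne ⟨hh, h1⟩
    refine h.trace_eq_zero_of_charge z ?_ (key b)
    rw [if_neg hab.symm, if_pos rfl, if_neg h2.symm]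
    split_ifs <;> norm_num
  · refine h.trace_eq_zero_of_charge z ?_ (key a)
    rw [if_pos rfl, if_neg hab, if_neg (Ne.symm h1)]
    split_ifs <;> norm_num

end CAR
end
end Z2Gauge

namespace Z2Gauge
noncomputable section
open scoped Matrix

/-! ### Jordan-Wigner operators and the fermion parity -/

section Fock

variable {ι : Type*} [Fintype ι] [DecidableEq ι]

/-- The Jordan-Wigner sign of the mode `x` in the configuration `a`. -/
def jwSign (f : ι → ℕ) (x : ι) (a : Finset ι) : ℂ := (-1) ^ (a.filter fun y => f y < f x).card

/-- The annihilation operator of the mode `x` on the Fock space, with the modes ordered by `f`. -/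
def fockAnnihilation (f : ι → ℕ) (x : ι) : Matrix (Finset ι) (Finset ι) ℂ :=
  Matrix.of fun b a => if x ∈ a ∧ b = a.erase x then jwSign f x a else 0

theorem jwSign_mul_self (f : ι → ℕ) (x : ι) (a : Finset ι) : jwSign f x a * jwSign f x a = 1 := by
  rw [jwSign, ← mul_pow]
  norm_num

theorem star_jwSign (f : ι → ℕ) (x : ι) (a : Finset ι) : star (jwSign f x a) = jwSign f x a := by
  simp [jwSign]

theorem jwSign_insert (f : ι → ℕ) (x : ι) {z : ι} {a : Finset ι} (hz : z ∉ a) :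
    jwSign f x (insert z a) = (if f z < f x then -1 else 1) * jwSign f x a := by
  rw [jwSign, Finset.filter_insert]
  split_ifs with h
  · rw [Finset.card_insert_of_notMem (by simp [hz]), pow_succ, jwSign]
    ring
  · rw [one_mul, jwSign]

theorem fockAnnihilation_mulVec (f : ι → ℕ) (x : ι) (v : Finset ι → ℂ) (b : Finset ι) :
    (fockAnnihilation f x *ᵥ v) b = if x ∈ b then 0 else jwSign f x b * v (insert x b) := by
  rw [Matrix.mulVec, dotProduct]
  split_ifs with hx
  · refine Finset.sum_eq_zero fun a _ => ?_
    rw [fockAnnihilation, Matrix.of_apply, if_neg, zero_mul]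
    rintro ⟨-, rfl⟩
    simp at hx
  · rw [Finset.sum_eq_single (insert x b)]
    · rw [fockAnnihilation, Matrix.of_apply, if_pos (by simp [hx]), jwSign_insert f x hx]
      simp
    · intro a _ ha
      rw [fockAnnihilation, Matrix.of_apply, if_neg, zero_mul]
      rintro ⟨h1, rfl⟩
      exact ha (Finset.insert_erase h1).symm
    · simp

theorem fockAnnihilation_conjTranspose_mulVec (f : ι → ℕ) (x : ι) (v : Finset ι → ℂ)
    (b : Finset ι) : ((fockAnnihilation f x)ᴴ *ᵥ v) b =
      if x ∈ b then jwSign f x b * v (b.erase x) else 0 := by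
  rw [Matrix.mulVec, dotProduct, Finset.sum_eq_single (b.erase x)]
  · rw [Matrix.conjTranspose_apply, fockAnnihilation, Matrix.of_apply]
    split_ifs with h1 h2 h2
    · rw [star_jwSign]
    · exact absurd h1.1 h2
    · exact absurd ⟨h2, rfl⟩ h1
    · simp
  · intro a _ ha
    rw [Matrix.conjTranspose_apply, fockAnnihilation, Matrix.of_apply, if_neg (fun h => ha h.2)]
    simp
  · simp

/-- For two different modes, exactly one of the two signs is affected by the other mode, which
produces the anticommutation. -/
theorem isCAR_fockAnnihilation {f : ι → ℕ} (hf : Function.Injective f) :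
    IsCAR (fockAnnihilation f) fun x => (fockAnnihilation f x)ᴴ := by
  have cc : ∀ a b, fockAnnihilation f a * fockAnnihilation f b =
      -(fockAnnihilation f b * fockAnnihilation f a) := by
    intro x y
    apply Matrix.mulVec_injective
    funext v
    rw [Matrix.neg_mulVec, ← Matrix.mulVec_mulVec, ← Matrix.mulVec_mulVec]
    funext b
    simp only [Pi.neg_apply, fockAnnihilation_mulVec, Finset.mem_insert]
    by_cases hxy : x = y
    · subst hxy
      simp
    have hyx := Ne.symm hxy
    by_cases hx : x ∈ b
    · simp [hx]
    by_cases hy : y ∈ b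
    · simp [hy]
    simp only [hx, hy, hxy, hyx, or_self, if_false]
    rw [jwSign_insert f y hx, jwSign_insert f x hy, Finset.insert_comm]
    have : f x ≠ f y := fun h => hxy (hf h)
    rcases lt_or_gt_of_ne this with h | h <;> simp only [h, h.not_gt, if_true, if_false] <;> ring
  refine ⟨cc, fun a b => ?_, fun x y => ?_⟩
  · rw [← Matrix.conjTranspose_mul, cc, Matrix.conjTranspose_neg, Matrix.conjTranspose_mul]
  · apply Matrix.mulVec_injective
    funext v
    rw [Matrix.sub_mulVec, ← Matrix.mulVec_mulVec, ← Matrix.mulVec_mulVec]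
    funext b
    simp only [Pi.sub_apply, fockAnnihilation_mulVec, fockAnnihilation_conjTranspose_mulVec,
      Finset.mem_insert, Finset.mem_erase]
    by_cases hxy : x = y
    · subst hxy
      by_cases hx : x ∈ b
      · have e := jwSign_insert f x (Finset.notMem_erase x b)
        rw [Finset.insert_erase hx, if_neg (lt_irrefl _), one_mul] at e
        simp only [hx, if_true, ne_eq, not_true, false_and, if_false, Finset.insert_erase, ← e,
          Matrix.one_mulVec]
        linear_combination (v b) * jwSign_mul_self f x b
      · have e := jwSign_insert f x hx
        rw [if_neg (lt_irrefl _), one_mul] at e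
        simp only [hx, if_true, if_false, or_false, Finset.erase_insert, Matrix.one_mulVec, e,
          not_false_eq_true]
        linear_combination (v b) * jwSign_mul_self f x b
    · have hyx := Ne.symm hxy
      simp only [hxy, hyx, if_false, false_or, Matrix.zero_mulVec, Pi.zero_apply, zero_sub, ne_eq,
        not_false_eq_true, true_and]
      by_cases hx : x ∈ b
      · simp [hx]
      by_cases hy : y ∈ b
      · have e := jwSign_insert f x (Finset.notMem_erase y b)
        rw [Finset.insert_erase hy] at e
        simp only [hx, hy, if_true, if_false]
        rw [jwSign_insert f y hx, e, Finset.erase_insert_of_ne hxy]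
        have : f x ≠ f y := fun h => hxy (hf h)
        rcases lt_or_gt_of_ne this with h | h <;> simp only [h, h.not_gt, if_true, if_false] <;>
          ring
      · simp [hy]

/-- The fermion parity. -/
def parity (ι : Type*) [Fintype ι] [DecidableEq ι] : Matrix (Finset ι) (Finset ι) ℂ :=
  Matrix.diagonal fun a => (-1) ^ a.card

theorem fock_number (f : ι → ℕ) (x : ι) : (fockAnnihilation f x)ᴴ * fockAnnihilation f x =
    Matrix.diagonal fun a => if x ∈ a then 1 else 0 := by
  apply Matrix.mulVec_injective
  funext v
  rw [← Matrix.mulVec_mulVec]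
  funext b
  rw [fockAnnihilation_conjTranspose_mulVec, fockAnnihilation_mulVec, Matrix.mulVec_diagonal]
  by_cases hx : x ∈ b
  · have e := jwSign_insert f x (Finset.notMem_erase x b)
    rw [Finset.insert_erase hx, if_neg (lt_irrefl _), one_mul] at e
    simp only [hx, Finset.notMem_erase, if_true, if_false, Finset.insert_erase, ← e]
    linear_combination (v b) * jwSign_mul_self f x b
  · simp [hx]

/-- The parity is exp(iπN), itself a Gaussian operator; in a trace it changes the sign of every
Boltzmann factor. -/
theorem exp_number (f : ι → ℕ) : NormedSpace.exp
    (∑ x, (Complex.I * Real.pi) • ((fockAnnihilation f x)ᴴ * fockAnnihilation f x)) =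
      parity ι := by
  have : ∑ x, (Complex.I * Real.pi) • ((fockAnnihilation f x)ᴴ * fockAnnihilation f x) =
      Matrix.diagonal fun a : Finset ι => (a.card : ℂ) * (Complex.I * Real.pi) := by
    ext a b
    rw [Matrix.sum_apply]
    simp only [fock_number, Matrix.smul_apply, Matrix.diagonal_apply, smul_eq_mul]
    by_cases hab : a = b
    · simp only [hab, if_true, mul_ite, mul_one, mul_zero]
      rw [← Finset.sum_filter]
      simp
    · simp [hab]
  rw [this, Matrix.exp_diagonal, parity]
  congr 1
  funext a
  rw [Pi.coe_exp, ← Complex.exp_eq_exp_ℂ, Complex.exp_nat_mul, mul_comm Complex.I,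
    Complex.exp_pi_mul_I]

theorem inBasis_one {V : Matrix ι ι ℝ} (hV : Vᵀ * V = 1) : inBasis V 1 = 1 := by
  rw [inBasis, Matrix.mul_one, ← Matrix.transpose_map]
  have := congrArg (fun M : Matrix ι ι ℝ => M.map Complex.ofReal) hV
  simp only [Matrix.map_one Complex.ofReal Complex.ofReal_zero Complex.ofReal_one] at this
  rw [← this]
  exact (Matrix.map_mul (f := Complex.ofRealHom)).symm

theorem inBasis_diagonalized {V : Matrix ι ι ℝ} (hV : Vᵀ * V = 1) (d : ι → ℝ) :
    inBasis V ((V * Matrix.diagonal d * Vᵀ).map Complex.ofReal) =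
      Matrix.diagonal fun a => (d a : ℂ) := by
  have e : ∀ M N : Matrix ι ι ℝ, M.map Complex.ofReal * N.map Complex.ofReal =
      (M * N).map Complex.ofReal := fun M N => (Matrix.map_mul (f := Complex.ofRealHom)).symm
  rw [inBasis, ← Matrix.transpose_map, e, e]
  have : Vᵀ * (V * Matrix.diagonal d * Vᵀ) * V = Matrix.diagonal d := by
    calc _ = (Vᵀ * V) * Matrix.diagonal d * (Vᵀ * V) := by simp only [Matrix.mul_assoc]
      _ = _ := by simp [hV]
  rw [this, Matrix.diagonal_map Complex.ofReal_zero]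

end Fock
end
end Z2Gauge

namespace Z2Gauge
noncomputable section
open scoped Matrix

/-! ### The Gauss law as a sum over gauge transformations -/

section Gauss

variable {L : ℕ} [NeZero L]

/-- The operator that multiplies the gauge field by `τ`. -/
def shiftOp (τ : Edge L → ℤˣ) : Op L :=
  Matrix.of fun b a => if b = (a.1, τ * a.2) then 1 else 0

/-- Multiplication by a function of the fermion configuration. -/
def matterDiagonal (L : ℕ) [NeZero L] (g : Finset (Site L) → ℂ) : Op L :=
  Matrix.diagonal fun a => g a.1

theorem shiftOp_mulVec (τ : Edge L → ℤˣ) (v : BasisState L → ℂ) (b : BasisState L) :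
    (shiftOp τ *ᵥ v) b = v (b.1, τ⁻¹ * b.2) := by
  rw [Matrix.mulVec, dotProduct, Finset.sum_eq_single (b.1, τ⁻¹ * b.2)]
  · simp [shiftOp]
  · intro a _ ha
    rw [shiftOp, Matrix.of_apply, if_neg, zero_mul]
    rintro rfl
    exact ha (by simp)
  · simp

theorem shiftOp_mul (τ τ' : Edge L → ℤˣ) : shiftOp τ * shiftOp τ' = shiftOp (τ * τ') := by
  apply Matrix.mulVec_injective
  funext v
  rw [← Matrix.mulVec_mulVec]
  funext b
  simp only [shiftOp_mulVec, mul_inv_rev, mul_assoc]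

theorem matterDiagonal_mul (g g' : Finset (Site L) → ℂ) :
    matterDiagonal L g * matterDiagonal L g' = matterDiagonal L fun a => g a * g' a :=
  Matrix.diagonal_mul_diagonal _ _

theorem shiftOp_matterDiagonal_comm (τ : Edge L → ℤˣ) (g : Finset (Site L) → ℂ) :
    matterDiagonal L g * shiftOp τ = shiftOp τ * matterDiagonal L g := by
  apply Matrix.mulVec_injective
  funext v
  rw [← Matrix.mulVec_mulVec, ← Matrix.mulVec_mulVec]
  funext b
  simp only [shiftOp_mulVec, matterDiagonal, Matrix.mulVec_diagonal]

theorem pauliX_eq_shiftOp (e : Edge L) : pauliX e = shiftOp (Pi.mulSingle e (-1)) := by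
  ext b a
  rw [pauliX, shiftOp, Matrix.of_apply, Matrix.of_apply]
  have : Function.update a.2 e (-a.2 e) = Pi.mulSingle e (-1) * a.2 := by
    funext f
    by_cases hf : f = e
    · subst hf
      simp
    · simp [hf]
  rw [this]

/-- The gauge transformation at the site `x`. -/
def starField (x : Site L) : Edge L → ℤˣ :=
  Pi.mulSingle (x, 0) (-1) * Pi.mulSingle (x, 1) (-1) * Pi.mulSingle (x - unitStep L 0, 0) (-1) *
    Pi.mulSingle (x - unitStep L 1, 1) (-1)

theorem starOp_eq_shiftOp (x : Site L) : starOp x = shiftOp (starField x) := by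
  simp only [starOp, pauliX_eq_shiftOp, shiftOp_mul, starField]

/-- The gauge transformation by the indicator function of `S`. -/
def gaugeOp (S : Finset (Site L)) : Op L :=
  shiftOp (∏ x ∈ S, starField x) * matterDiagonal L fun a => (-1) ^ (a ∩ S).card

theorem one_eq_gaugeOp : (1 : Op L) = gaugeOp ∅ := by
  apply Matrix.mulVec_injective
  funext v
  rw [gaugeOp, ← Matrix.mulVec_mulVec]
  funext b
  simp [shiftOp_mulVec, matterDiagonal]

theorem chargeOp_mul_gaugeOp {x : Site L} {S : Finset (Site L)} (hx : x ∉ S) :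
    chargeOp x * gaugeOp S = gaugeOp (insert x S) := by
  have h1 : (1 : Op L) - (2 : ℂ) • numberOp x =
      matterDiagonal L fun a => if x ∈ a then -1 else 1 := by
    rw [numberOp_eq_diagonal, ← Matrix.diagonal_one, ← Matrix.diagonal_smul, Matrix.diagonal_sub]
    unfold matterDiagonal
    congr 1
    funext a
    simp only [Pi.smul_apply, smul_eq_mul]
    split_ifs <;> norm_num
  rw [chargeOp, h1, starOp_eq_shiftOp, gaugeOp, gaugeOp, Matrix.mul_assoc,
    ← Matrix.mul_assoc (matterDiagonal L _), shiftOp_matterDiagonal_comm, Matrix.mul_assoc,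
    matterDiagonal_mul, ← Matrix.mul_assoc, shiftOp_mul, Finset.prod_insert hx]
  congr 2
  funext a
  by_cases ha : x ∈ a
  · rw [if_pos ha, Finset.inter_insert_of_mem ha, Finset.card_insert_of_notMem (by simp [hx]),
      pow_succ]
    ring
  · rw [if_neg ha, Finset.inter_insert_of_notMem ha, one_mul]

theorem gaussProjection_eq_sum : gaussProjection L =
    (1 / 2 : ℂ) ^ Fintype.card (Site L) • ∑ S : Finset (Site L), gaugeOp S := by
  have hc : ∀ x y : Site L, Commute ((1 / 2 : ℂ) • (1 + chargeOp x))
      ((1 / 2 : ℂ) • (1 + chargeOp y)) := fun x y =>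
    (((Commute.one_right _).add_right
      ((Commute.one_left _).add_left (chargeOp_commute x y))).smul_right _).smul_left _
  have hp : ∀ s : Finset (Site L), (s : Set (Site L)).Pairwise
      (Function.onFun Commute fun x : Site L => (1 / 2 : ℂ) • (1 + chargeOp x)) :=
    fun s x _ y _ _ => hc x y
  have main : ∀ s : Finset (Site L),
      s.noncommProd (fun x : Site L => (1 / 2 : ℂ) • (1 + chargeOp x)) (hp s) =
        (1 / 2 : ℂ) ^ s.card • ∑ S ∈ s.powerset, gaugeOp S := by
    intro s
    induction s using Finset.induction_on with
    | empty =>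
      rw [Finset.noncommProd_empty, one_eq_gaugeOp]
      simp
    | insert x s hx ih =>
      rw [Finset.noncommProd_insert_of_notMem _ _ _ _ hx, ih, Finset.card_insert_of_notMem hx,
        Finset.sum_powerset_insert hx, smul_mul_smul_comm, pow_succ, Matrix.add_mul, Matrix.one_mul,
        Finset.mul_sum, mul_comm]
      congr 2
      refine Finset.sum_congr rfl fun S hS => ?_
      exact chargeOp_mul_gaugeOp fun h => hx (Finset.mem_powerset.1 hS h)
  have := main Finset.univ
  rwa [Finset.powerset_univ, Finset.card_univ] at this

theorem prod_starField_apply_zero (S : Finset (Site L)) (x : Site L) :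
    (∏ y ∈ S, starField y) (x, 0) =
      (if x ∈ S then -1 else 1) * if x + unitStep L 0 ∈ S then -1 else 1 := by
  have : ∀ y, starField y (x, 0) =
      (if y = x then -1 else 1) * if y = x + unitStep L 0 then -1 else 1 := by
    intro y
    simp only [starField, Pi.mul_apply, Pi.mulSingle_apply, Prod.mk.injEq, and_true,
      zero_ne_one, and_false, if_false, mul_one, eq_comm (a := x), sub_eq_iff_eq_add]
  rw [Finset.prod_apply]
  simp only [this, Finset.prod_mul_distrib, Finset.prod_ite_eq']

theorem prod_starField_apply_one (S : Finset (Site L)) (x : Site L) :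
    (∏ y ∈ S, starField y) (x, 1) =
      (if x ∈ S then -1 else 1) * if x + unitStep L 1 ∈ S then -1 else 1 := by
  have : ∀ y, starField y (x, 1) =
      (if y = x then -1 else 1) * if y = x + unitStep L 1 then -1 else 1 := by
    intro y
    simp only [starField, Pi.mul_apply, Pi.mulSingle_apply, Prod.mk.injEq, and_true,
      one_ne_zero, and_false, if_false, mul_one, one_mul, eq_comm (a := x), sub_eq_iff_eq_add]
  rw [Finset.prod_apply]
  simp only [this, Finset.prod_mul_distrib, Finset.prod_ite_eq']

/-- The transformation by S flips the edges between S and its complement; since the torus is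
connected, there is none only if S is empty or everything. -/
theorem prod_starField_eq_one_iff (S : Finset (Site L)) :
    ∏ y ∈ S, starField y = 1 ↔ S = ∅ ∨ S = Finset.univ := by
  have aux : ∀ (p r : Prop) [Decidable p] [Decidable r],
      ((if p then (-1 : ℤˣ) else 1) * if r then -1 else 1) = 1 ↔ (p ↔ r) := by
    intro p r _ _
    by_cases hp : p <;> by_cases hr : r <;> simp [hp, hr]
  constructor
  · intro h
    have h0 : ∀ x, x ∈ S ↔ x + unitStep L 0 ∈ S := fun x => by
      rw [← aux, ← prod_starField_apply_zero, h]
      rfl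
    have h1 : ∀ x, x ∈ S ↔ x + unitStep L 1 ∈ S := fun x => by
      rw [← aux, ← prod_starField_apply_one, h]
      rfl
    have h0' : ∀ (n : ℕ) x, x ∈ S ↔ x + n • unitStep L 0 ∈ S := by
      intro n
      induction n with
      | zero => simp
      | succ n ih => intro x; rw [ih, h0, succ_nsmul, add_assoc]
    have h1' : ∀ (n : ℕ) x, x ∈ S ↔ x + n • unitStep L 1 ∈ S := by
      intro n
      induction n with
      | zero => simp
      | succ n ih => intro x; rw [ih, h1, succ_nsmul, add_assoc]
    rcases S.eq_empty_or_nonempty with hS | ⟨x, hx⟩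
    · exact Or.inl hS
    · refine Or.inr (Finset.eq_univ_of_forall fun y => ?_)
      rw [h0' (y.1 - x.1).val, h1' (y.2 - x.2).val] at hx
      convert hx using 1
      ext <;> simp [unitStep]
  · rintro (rfl | rfl)
    · simp
    · funext ⟨x, μ⟩
      fin_cases μ
      · exact (prod_starField_apply_zero _ x).trans (by simp)
      · exact (prod_starField_apply_one _ x).trans (by simp)

/-- A transformation that flips some edge maps every block to a different one and has no trace
against a block diagonal operator. -/
theorem trace_gaugeOp_mul (S : Finset (Site L))
    (O : (Edge L → ℤˣ) → Matrix (Finset (Site L)) (Finset (Site L)) ℂ) :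
    (gaugeOp S * Matrix.blockDiagonal O).trace =
      if ∏ y ∈ S, starField y = 1 then
        ∑ σ, ((Matrix.diagonal fun a => (-1) ^ (a ∩ S).card) * O σ).trace else 0 := by
  have key : (gaugeOp S * Matrix.blockDiagonal O).trace = ∑ b : BasisState L,
      if ∏ y ∈ S, starField y = 1 then (-1 : ℂ) ^ (b.1 ∩ S).card * O b.2 b.1 b.1 else 0 := by
    refine Finset.sum_congr rfl fun b _ => ?_
    rw [Matrix.diag_apply, Matrix.mul_apply, Finset.sum_eq_single
      (b.1, (∏ y ∈ S, starField y)⁻¹ * b.2)]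
    · rw [gaugeOp, matterDiagonal, Matrix.mul_diagonal, shiftOp, Matrix.of_apply, if_pos (by simp),
        Matrix.blockDiagonal_apply]
      simp only [mul_eq_right, inv_eq_one]
      split_ifs with h
      · simp [h]
      · simp
    · intro a _ ha
      rw [gaugeOp, matterDiagonal, Matrix.mul_diagonal, shiftOp, Matrix.of_apply, if_neg]
      · simp
      · intro h
        exact ha (by rw [h]; simp)
    · simp
  rw [key]
  split_ifs
  · rw [Fintype.sum_prod_type_right]
    simp only [Matrix.trace, Matrix.diag_apply, Matrix.diagonal_mul]
  · simp

/-- The two surviving transformations are the identity and the global one, which acts as the parity.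
On gauge invariant traces the Gauss law thus amounts to even particle number in every gauge field.
-/
theorem trace_gaussProjection_mul
    (O : (Edge L → ℤˣ) → Matrix (Finset (Site L)) (Finset (Site L)) ℂ) :
    (gaussProjection L * Matrix.blockDiagonal O).trace =
      (1 / 2 : ℂ) ^ Fintype.card (Site L) *
        ∑ σ, ((O σ).trace + (parity (Site L) * O σ).trace) := by
  rw [gaussProjection_eq_sum, Matrix.smul_mul, Matrix.trace_smul, smul_eq_mul, Finset.sum_mul,
    Matrix.trace_sum]
  congr 1
  have hne : (∅ : Finset (Site L)) ≠ Finset.univ := Finset.univ_nonempty.ne_empty.symm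
  simp only [trace_gaugeOp_mul, prod_starField_eq_one_iff]
  rw [← Finset.sum_filter]
  have : (Finset.univ.filter fun S : Finset (Site L) => S = ∅ ∨ S = Finset.univ) =
      {∅, Finset.univ} := by
    ext S
    simp
  rw [this, Finset.sum_pair hne, ← Finset.sum_add_distrib]
  simp [parity]

end Gauss
end
end Z2Gauge

namespace Z2Gauge
noncomputable section
open scoped Matrix

/-! ### Decomposition of the Hamiltonian over gauge fields -/

section Sectors

variable {L : ℕ} [NeZero L]

theorem siteIndex_injective : Function.Injective (siteIndex (L := L)) := by
  intro x y h
  simp only [siteIndex] at h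
  have h1 := congrArg (· % L) h
  have h2 := congrArg (· / L) h
  simp only [Nat.add_mul_mod_self_left, Nat.mod_eq_of_lt (ZMod.val_lt _),
    Nat.add_mul_div_left _ _ (NeZero.pos L), Nat.div_eq_of_lt (ZMod.val_lt _), zero_add] at h1 h2
  exact Prod.ext (ZMod.val_injective L h1) (ZMod.val_injective L h2)

/-- The second quantization on the fermionic Fock space of the lattice. -/
def fockOp (A : Matrix (Site L) (Site L) ℂ) : Matrix (Finset (Site L)) (Finset (Site L)) ℂ :=
  secondQuantized (fockAnnihilation siteIndex) (fun x => (fockAnnihilation siteIndex x)ᴴ) A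

theorem annihilation_eq (x : Site L) :
    annihilation x = Matrix.blockDiagonal fun _ => fockAnnihilation siteIndex x := by
  ext ⟨b, τ⟩ ⟨a, σ⟩
  rw [Matrix.blockDiagonal_apply, annihilation, Matrix.of_apply, fockAnnihilation, Matrix.of_apply]
  simp only [Prod.mk.injEq]
  by_cases h : τ = σ <;> simp [h, jwSign]

theorem creation_eq (x : Site L) :
    creation x = Matrix.blockDiagonal fun _ => (fockAnnihilation siteIndex x)ᴴ := by
  rw [creation, annihilation_eq, Matrix.blockDiagonal_conjTranspose]

theorem pauliZ_eq (e : Edge L) : pauliZ e =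
    Matrix.blockDiagonal fun σ => ((((σ e : ℤˣ) : ℤ) : ℂ)) • (1 : Matrix _ _ ℂ) := by
  ext ⟨b, τ⟩ ⟨a, σ⟩
  rw [Matrix.blockDiagonal_apply, pauliZ, Matrix.diagonal_apply]
  simp only [Prod.mk.injEq, Matrix.smul_apply, Matrix.one_apply, smul_eq_mul, mul_ite, mul_one,
    mul_zero]
  by_cases h : τ = σ <;> by_cases h' : b = a <;> simp [h, h']

theorem blockDiagonal_sum {ι m o : Type*} [DecidableEq o] (s : Finset ι)
    (f : ι → o → Matrix m m ℂ) :
    ∑ i ∈ s, Matrix.blockDiagonal (f i) = Matrix.blockDiagonal fun k => ∑ i ∈ s, f i k := by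
  rw [← Finset.sum_fn]
  exact (map_sum (Matrix.blockDiagonalAddMonoidHom m m o ℂ) f s).symm

/-- The one particle matrix with amplitudes `u` for hopping along the edges, and `w` for hopping in
the opposite direction. -/
def edgeMatrix (u w : Edge L → ℂ) : Matrix (Site L) (Site L) ℂ :=
  Matrix.of fun x y => ∑ μ : Fin 2, ((if y = x + unitStep L μ then w (x, μ) else 0) +
    if x = y + unitStep L μ then u (y, μ) else 0)

theorem fockOp_edgeMatrix (u w : Edge L → ℂ) : fockOp (edgeMatrix u w) =
    ∑ x : Site L, ∑ μ : Fin 2,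
      (w (x, μ) • ((fockAnnihilation siteIndex x)ᴴ *
          fockAnnihilation siteIndex (x + unitStep L μ)) +
        u (x, μ) • ((fockAnnihilation siteIndex (x + unitStep L μ))ᴴ *
          fockAnnihilation siteIndex x)) := by
  simp only [fockOp, secondQuantized, edgeMatrix, Matrix.of_apply, Finset.sum_smul, add_smul,
    ite_smul, zero_smul, Finset.sum_add_distrib]
  congr 1
  · refine Finset.sum_congr rfl fun x _ => ?_
    rw [Finset.sum_comm]
    simp
  · rw [Finset.sum_comm]
    refine Finset.sum_congr rfl fun x _ => ?_
    rw [Finset.sum_comm]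
    simp

theorem sum_edges_eq_blockDiagonal (u w : Edge L → ℂ) :
    ∑ x : Site L, ∑ μ : Fin 2,
      (w (x, μ) • (creation x * pauliZ (x, μ) * annihilation (x + unitStep L μ)) +
        u (x, μ) • (creation (x + unitStep L μ) * pauliZ (x, μ) * annihilation x)) =
      Matrix.blockDiagonal fun σ : Edge L → ℤˣ => fockOp (edgeMatrix
        (fun e => u e * ((σ e : ℤˣ) : ℤ)) (fun e => w e * ((σ e : ℤˣ) : ℤ))) := by
  simp only [fockOp_edgeMatrix, creation_eq, annihilation_eq, pauliZ_eq]
  simp only [← Matrix.blockDiagonal_mul, ← Matrix.blockDiagonal_smul, ← Matrix.blockDiagonal_add,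
    blockDiagonal_sum]
  congr 1
  funext σ
  simp [smul_smul]

/-- The hopping matrix in a gauge field. -/
def gaugeHopping (σ : Edge L → ℤˣ) : Matrix (Site L) (Site L) ℝ :=
  Matrix.of fun x y => ∑ μ : Fin 2, ((if y = x + unitStep L μ then (((σ (x, μ) : ℤˣ) : ℤ) : ℝ) else 0) +
    if x = y + unitStep L μ then (((σ (y, μ) : ℤˣ) : ℤ) : ℝ) else 0)

/-- The sum of the plaquette variables of a gauge field. -/
def plaquetteSum (σ : Edge L → ℤˣ) : ℤ :=
  ∑ x : Site L, ((σ (x, 0) * σ (x + unitStep L 0, 1) * σ (x + unitStep L 1, 0) * σ (x, 1) : ℤˣ) : ℤ)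

/-- The Hamiltonian in a given gauge field. -/
def sectorHamiltonian (t : ℝ) (σ : Edge L → ℤˣ) : Matrix (Finset (Site L)) (Finset (Site L)) ℂ :=
  fockOp (-(t : ℂ) • (gaugeHopping σ).map Complex.ofReal) + (-(plaquetteSum σ : ℂ)) • 1

theorem edgeMatrix_eq_gaugeHopping (r : ℂ) (σ : Edge L → ℤˣ) :
    edgeMatrix (fun e => r * ((σ e : ℤˣ) : ℤ)) (fun e => r * ((σ e : ℤˣ) : ℤ)) =
      r • (gaugeHopping σ).map Complex.ofReal := by
  ext x y
  simp [edgeMatrix, gaugeHopping, mul_add, apply_ite Complex.ofReal]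

/-- Only the Z operators of the gauge field enter the Hamiltonian, so the gauge field is a static
background. -/
theorem hamiltonian_eq (t : ℝ) :
    hamiltonian L t = Matrix.blockDiagonal fun σ => sectorHamiltonian t σ := by
  have h1 : matterHamiltonian L t = Matrix.blockDiagonal fun σ =>
      fockOp (-(t : ℂ) • (gaugeHopping σ).map Complex.ofReal) := by
    have := sum_edges_eq_blockDiagonal (L := L) (fun _ => -(t : ℂ)) (fun _ => -(t : ℂ))
    simp only [edgeMatrix_eq_gaugeHopping] at this
    rw [← this, matterHamiltonian]
    simp only [Finset.smul_sum, smul_add]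
  have h2 : -(∑ x : Site L, plaquetteOp x) = Matrix.blockDiagonal fun σ =>
      (-(plaquetteSum σ : ℂ)) • (1 : Matrix (Finset (Site L)) (Finset (Site L)) ℂ) := by
    have : ∀ x : Site L, plaquetteOp x = Matrix.blockDiagonal fun σ =>
        ((((σ (x, 0) * σ (x + unitStep L 0, 1) * σ (x + unitStep L 1, 0) * σ (x, 1) : ℤˣ) : ℤ)) : ℂ) •
          (1 : Matrix (Finset (Site L)) (Finset (Site L)) ℂ) := by
      intro x
      simp only [plaquetteOp, pauliZ_eq, ← Matrix.blockDiagonal_mul]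
      congr 1
      funext σ
      simp only [smul_mul_smul_comm, one_mul, Units.val_mul, Int.cast_mul]
    simp only [this, blockDiagonal_sum, ← Matrix.blockDiagonal_neg]
    congr 1
    funext σ
    simp only [Pi.neg_apply, ← Finset.sum_smul, ← neg_smul]
    congr 1
    rw [plaquetteSum]
    push_cast
    rfl
  rw [hamiltonian, h1, h2, ← Matrix.blockDiagonal_add]
  congr 1
  funext σ
  rw [Pi.add_apply, add_comm]
  rfl

end Sectors

/-! ### Current and diamagnetic operators -/

section Currents

variable {L : ℕ} [NeZero L]

/-- The phase of a plane wave on a horizontal edge; vertical edges do not contribute. -/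
def bondPhase (p : ℝ) (e : Edge L) : ℂ :=
  if e.2 = 0 then Complex.exp (-(Complex.I * p * (e.1.2.val : ℝ))) else 0

theorem bondIntegral_planeWave_add (p p' : ℝ) (z w : ℂ) (e : Edge L) :
    bondIntegral (planeWave p z + planeWave p' w) e = z * bondPhase p e + w * bondPhase p' e := by
  obtain ⟨x, μ⟩ := e
  by_cases h : μ = 0
  · simp [bondIntegral, planeWave, bondPhase, h, sitePosition]
  · simp [bondIntegral, planeWave, bondPhase, h]

theorem bondIntegral_planeWave (p : ℝ) (z : ℂ) (e : Edge L) :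
    bondIntegral (planeWave p z) e = z * bondPhase p e := by
  obtain ⟨x, μ⟩ := e
  by_cases h : μ = 0
  · simp [bondIntegral, planeWave, bondPhase, h, sitePosition]
  · simp [bondIntegral, planeWave, bondPhase, h]

/-- The offset g makes one formula serve both orders: g = 0 for the current and for the outer
derivative, and g proportional to w for the inner derivative of the diamagnetic operator. -/
theorem deriv_sum_exp (t : ℂ) (q : ℂ) {ι κ : Type*} [Fintype ι] [Fintype κ]
    (c g α β : ι → κ → ℂ) :
    deriv (fun z : ℂ => -t * ∑ x, ∑ μ, (Complex.exp (-(Complex.I * q * (z * c x μ + g x μ))) * α x μ +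
      Complex.exp (Complex.I * q * (z * c x μ + g x μ)) * β x μ)) 0 =
    -t * ∑ x, ∑ μ, (Complex.exp (-(Complex.I * q * g x μ)) * (-(Complex.I * q * c x μ)) * α x μ +
      Complex.exp (Complex.I * q * g x μ) * (Complex.I * q * c x μ) * β x μ) := by
  apply HasDerivAt.deriv
  refine HasDerivAt.const_mul (-t) (HasDerivAt.fun_sum fun x _ => HasDerivAt.fun_sum fun μ _ => ?_)
  have h0 : HasDerivAt (fun z : ℂ => Complex.I * q * (z * c x μ + g x μ)) (Complex.I * q * c x μ) 0 := by
    have := (((hasDerivAt_id (0 : ℂ)).mul_const (c x μ)).add_const (g x μ)).const_mul (Complex.I * q)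
    simpa using this
  have h1 := (h0.fun_neg.cexp.mul_const (α x μ)).fun_add (h0.cexp.mul_const (β x μ))
  simpa using h1

theorem current_eq (t q p : ℝ) : current L t q p = Matrix.blockDiagonal fun σ : Edge L → ℤˣ =>
    fockOp (edgeMatrix (fun e => Complex.I * q * t * bondPhase p e * ((σ e : ℤˣ) : ℤ))
      (fun e => -(Complex.I * q * t * bondPhase p e) * ((σ e : ℤˣ) : ℤ))) := by
  rw [← sum_edges_eq_blockDiagonal]
  ext b a
  have := deriv_sum_exp (t : ℂ) (q : ℂ) (fun (x : Site L) (μ : Fin 2) => bondPhase p (x, μ))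
    (fun _ _ => 0)
    (fun x μ => (creation x * pauliZ (x, μ) * annihilation (x + unitStep L μ)) b a)
    (fun x μ => (creation (x + unitStep L μ) * pauliZ (x, μ) * annihilation x) b a)
  simp only [current, peierlsHamiltonian, bondIntegral_planeWave, Matrix.of_apply,
    Matrix.smul_apply, Matrix.sum_apply, Matrix.add_apply, smul_eq_mul]
  simp only [add_zero, mul_zero, neg_zero, Complex.exp_zero, one_mul] at this
  rw [this, neg_mul, neg_neg, Finset.mul_sum]
  refine Finset.sum_congr rfl fun x _ => ?_
  rw [Finset.mul_sum]
  refine Finset.sum_congr rfl fun μ _ => ?_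
  ring

theorem diamagnetic_eq (t q p p' : ℝ) :
    diamagnetic L t q p p' = Matrix.blockDiagonal fun σ : Edge L → ℤˣ =>
      fockOp (edgeMatrix (fun e => -(q ^ 2 * t * bondPhase p e * bondPhase p' e) * ((σ e : ℤˣ) : ℤ))
        (fun e => -(q ^ 2 * t * bondPhase p e * bondPhase p' e) * ((σ e : ℤˣ) : ℤ))) := by
  rw [← sum_edges_eq_blockDiagonal]
  ext b a
  simp only [diamagnetic, peierlsHamiltonian, bondIntegral_planeWave_add, Matrix.of_apply,
    Matrix.smul_apply, Matrix.sum_apply, Matrix.add_apply, smul_eq_mul]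
  have h1 := fun w : ℂ => deriv_sum_exp (t : ℂ) (q : ℂ)
    (fun (x : Site L) (μ : Fin 2) => bondPhase p (x, μ)) (fun x μ => w * bondPhase p' (x, μ))
    (fun x μ => (creation x * pauliZ (x, μ) * annihilation (x + unitStep L μ)) b a)
    (fun x μ => (creation (x + unitStep L μ) * pauliZ (x, μ) * annihilation x) b a)
  simp only [h1]
  have h2 := deriv_sum_exp (t : ℂ) (q : ℂ)
    (fun (x : Site L) (μ : Fin 2) => bondPhase p' (x, μ)) (fun x μ => 0)
    (fun x μ => -(Complex.I * q * bondPhase p (x, μ)) *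
      (creation x * pauliZ (x, μ) * annihilation (x + unitStep L μ)) b a)
    (fun x μ => (Complex.I * q * bondPhase p (x, μ)) *
      (creation (x + unitStep L μ) * pauliZ (x, μ) * annihilation x) b a)
  simp only [add_zero, mul_zero, neg_zero, Complex.exp_zero, one_mul, ← mul_assoc] at h2
  simp only [← mul_assoc]
  rw [h2, neg_mul, neg_neg, Finset.mul_sum]
  refine Finset.sum_congr rfl fun x _ => ?_
  rw [Finset.mul_sum]
  refine Finset.sum_congr rfl fun μ _ => ?_
  linear_combination (t * q ^ 2 * bondPhase p (x, μ) * bondPhase p' (x, μ) *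
    ((creation x * pauliZ (x, μ) * annihilation (x + unitStep L μ)) b a +
    (creation (x + unitStep L μ) * pauliZ (x, μ) * annihilation x) b a)) * Complex.I_sq

end Currents
end
end Z2Gauge

namespace Z2Gauge
noncomputable section
open scoped Matrix

/-! ### Thermal traces of one and two bilinears -/

section Thermal

variable {ι : Type*} [Fintype ι] [DecidableEq ι]

/-- The grand canonical partition function of modes with energies `ε`, with the weight `η` for every
particle. -/
def partition (η : ℝ) (ε : ι → ℝ) (β : ℝ) : ℝ := ∏ a, (1 + η * Real.exp (-(β * ε a)))

/-- The unnormalized probability that the mode `a` is occupied. -/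
def weightOne (η : ℝ) (ε : ι → ℝ) (β : ℝ) (a : ι) : ℝ :=
  η * Real.exp (-(β * ε a)) * ∏ b ∈ Finset.univ.erase a, (1 + η * Real.exp (-(β * ε b)))

/-- The unnormalized probability that the mode `a` is occupied and the mode `b` is empty. -/
def weightTwo (η : ℝ) (ε : ι → ℝ) (β : ℝ) (a b : ι) : ℝ :=
  η * Real.exp (-(β * ε a)) *
    ∏ e ∈ (Finset.univ.erase a).erase b, (1 + η * Real.exp (-(β * ε e)))

/-- The unnormalized response of free fermions with energies `ε`. -/
def numerator (η : ℝ) (ε : ι → ℝ) (κ : ι → ι → ℂ) (k : ι → ℂ) (β : ℝ) : ℂ :=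
  ∑ a, ∑ b, κ a b * (weightTwo η ε β a b * ∫ s in (0 : ℝ)..β, Real.exp (s * (ε a - ε b)) : ℝ) +
    ∑ a, k a * weightOne η ε β a

variable {n : Type*} [Fintype n] [DecidableEq n] {c d : ι → Matrix n n ℂ}

theorem IsCAR.gaussian_mul_gaussian (h : IsCAR c d) (z w : ι → ℂ) :
    gaussian c d z * gaussian c d w = gaussian c d fun a => z a + w a := by
  rw [gaussian, gaussian, gaussian, ← Matrix.exp_add_of_commute]
  · simp only [add_smul, Finset.sum_add_distrib]
  · exact Commute.sum_right _ _ _ fun b _ => Commute.sum_left _ _ _ fun a _ =>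
      ((h.number_commute a b).smul_left _).smul_right _

theorem gaussian_zero : gaussian c d (fun _ => 0) = 1 := by
  simp [gaussian, NormedSpace.exp_zero]

theorem IsCAR.gaussian_conj (h : IsCAR c d) (z : ι → ℂ) (a b : ι) :
    gaussian c d z * (d a * c b) * gaussian c d (fun e => -z e) =
      Complex.exp (z a - z b) • (d a * c b) := by
  have h1 : gaussian c d z * gaussian c d (fun e => -z e) = 1 := by
    rw [h.gaussian_mul_gaussian]
    simp only [add_neg_cancel, gaussian_zero]
  rw [← Matrix.mul_assoc (gaussian c d z), h.gaussian_mul_d, Matrix.smul_mul, Matrix.mul_assoc (d a),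
    h.gaussian_mul_c, Matrix.mul_smul, Matrix.smul_mul, Matrix.smul_mul, smul_smul,
    ← Complex.exp_add, Matrix.mul_assoc, Matrix.mul_assoc, h1, Matrix.mul_one, sub_eq_add_neg]

theorem IsCAR.gaussian_conj_secondQuantized (h : IsCAR c d) (z : ι → ℂ) (A : Matrix ι ι ℂ) :
    gaussian c d z * secondQuantized c d A * gaussian c d (fun e => -z e) =
      secondQuantized c d (Matrix.of fun a b => Complex.exp (z a - z b) * A a b) := by
  simp only [secondQuantized, Finset.mul_sum, Finset.sum_mul, Matrix.mul_smul, Matrix.smul_mul,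
    h.gaussian_conj, smul_smul, Matrix.of_apply, mul_comm]

theorem IsCAR.trace_secondQuantized (h : IsCAR c d) (hcard : Fintype.card n = 2 ^ Fintype.card ι)
    (z : ι → ℂ) (A : Matrix ι ι ℂ) : (secondQuantized c d A * gaussian c d z).trace =
      ∑ a, A a a * (Complex.exp (z a) * ∏ b ∈ Finset.univ.erase a, (1 + Complex.exp (z b))) := by
  simp only [secondQuantized, Finset.sum_mul, Matrix.trace_sum, Matrix.smul_mul,
    Matrix.trace_smul, smul_eq_mul]
  refine Finset.sum_congr rfl fun a _ => ?_
  rw [Finset.sum_eq_single a, h.trace_number hcard]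
  · intro b _ hb
    rw [h.trace_dc_of_ne z hb.symm, mul_zero]
  · simp

/-- As both matrices have zero diagonal, there is no disconnected term, and a particle moved from b
to a' = a by one factor must be moved back by the other: only the exchange pairs remain. -/
theorem IsCAR.trace_secondQuantized_mul (h : IsCAR c d)
    (hcard : Fintype.card n = 2 ^ Fintype.card ι) (z : ι → ℂ) {A B : Matrix ι ι ℂ}
    (hA : ∀ a, A a a = 0) (hB : ∀ a, B a a = 0) :
    (secondQuantized c d A * secondQuantized c d B * gaussian c d z).trace =
      ∑ a, ∑ b, A a b * B b a * (Complex.exp (z a) *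
        ∏ e ∈ (Finset.univ.erase a).erase b, (1 + Complex.exp (z e))) := by
  rw [secondQuantized, secondQuantized]
  simp only [Finset.sum_mul, Finset.mul_sum, Matrix.trace_sum, Matrix.smul_mul, Matrix.mul_smul,
    Matrix.trace_smul, smul_eq_mul, smul_smul]
  have key : ∀ a b a' b', B a' b' * A a b * (d a * c b * (d a' * c b') * gaussian c d z).trace =
      if a' = b then if b' = a then A a b * B b a * (Complex.exp (z a) *
        ∏ e ∈ (Finset.univ.erase a).erase b, (1 + Complex.exp (z e))) else 0 else 0 := by
    intro a b a' b'
    by_cases hab : a = b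
    · subst hab
      simp [hA]
    by_cases hab' : a' = b'
    · subst hab'
      rw [hB, zero_mul, zero_mul]
      split_ifs with h1 h2
      · exact absurd (h2.symm.trans h1) hab
      · rfl
      · rfl
    by_cases h1 : a' = b <;> by_cases h2 : b' = a
    · subst h1 h2
      rw [h.trace_pair hcard z hab, if_pos rfl, if_pos rfl]
      ring
    all_goals
      rw [h.trace_quartic_of_ne z hab (fun hh => by simp_all)]
      simp [h1, h2]
  have : ∀ F : ι → ι → ι → ι → ℂ, ∑ x, ∑ y, ∑ x', ∑ y', F x y x' y' =
      ∑ x', ∑ y', ∑ x, ∑ y, F x y x' y' := by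
    intro F
    calc _ = ∑ x, ∑ x', ∑ y, ∑ y', F x y x' y' :=
          Finset.sum_congr rfl fun x _ => Finset.sum_comm
      _ = ∑ x', ∑ x, ∑ y', ∑ y, F x y x' y' := by
          rw [Finset.sum_comm]
          exact Finset.sum_congr rfl fun x _ => Finset.sum_congr rfl fun a _ => Finset.sum_comm
      _ = _ := Finset.sum_congr rfl fun x _ => Finset.sum_comm
  simp only [key]
  rw [this]
  simp

end Thermal

/-! ### Thermal traces in a given gauge field -/

section SectorTraces

variable {L : ℕ} [NeZero L] {V : Matrix (Site L) (Site L) ℝ}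

/-- The annihilation operators of the modes given by the columns of `V`. -/
def modeC (V : Matrix (Site L) (Site L) ℝ) : Site L → Matrix (Finset (Site L)) (Finset (Site L)) ℂ :=
  rotated V (fockAnnihilation siteIndex)

/-- The creation operators of the modes given by the columns of `V`. -/
def modeD (V : Matrix (Site L) (Site L) ℝ) : Site L → Matrix (Finset (Site L)) (Finset (Site L)) ℂ :=
  rotated V fun x => (fockAnnihilation siteIndex x)ᴴ

theorem isCAR_mode (hV : Vᵀ * V = 1) : IsCAR (modeC V) (modeD V) :=
  (isCAR_fockAnnihilation siteIndex_injective).rotated hV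

theorem fockOp_eq (hV : V * Vᵀ = 1) (A : Matrix (Site L) (Site L) ℂ) :
    fockOp A = secondQuantized (modeC V) (modeD V) (inBasis V A) :=
  (secondQuantized_rotated hV _ _ A).symm

theorem parity_eq (hV : V * Vᵀ = 1) :
    parity (Site L) = gaussian (modeC V) (modeD V) fun _ => Complex.I * Real.pi := by
  have e := secondQuantized_rotated hV (fockAnnihilation siteIndex)
    (fun x : Site L => (fockAnnihilation siteIndex x)ᴴ) ((Complex.I * Real.pi) • 1)
  have h1 : inBasis V ((Complex.I * Real.pi) • 1) =
      Matrix.diagonal fun _ => (Complex.I * Real.pi : ℂ) := by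
    have : inBasis V ((Complex.I * Real.pi) • 1) = (Complex.I * Real.pi : ℂ) • inBasis V 1 := by
      simp [inBasis]
    rw [this, inBasis_one (mul_eq_one_comm.1 hV), ← Matrix.diagonal_one, ← Matrix.diagonal_smul]
    congr 1
    funext
    simp
  rw [h1, ← Matrix.diagonal_one, ← Matrix.diagonal_smul, secondQuantized_diagonal,
    secondQuantized_diagonal] at e
  simp only [Pi.smul_apply, smul_eq_mul, mul_one] at e
  rw [gaussian, ← exp_number siteIndex]
  exact congrArg NormedSpace.exp e.symm

theorem exp_sectorHamiltonian (hV : V * Vᵀ = 1) {σ : Edge L → ℤˣ} {lam : Site L → ℝ}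
    (hK : gaugeHopping σ = V * Matrix.diagonal lam * Vᵀ) (t : ℝ) (s : ℂ) :
    NormedSpace.exp (s • sectorHamiltonian t σ) = Complex.exp (-(s * plaquetteSum σ)) •
      gaussian (modeC V) (modeD V) fun a => s * (-(t * lam a) : ℝ) := by
  have h1 : inBasis V (-(t : ℂ) • (gaugeHopping σ).map Complex.ofReal) =
      Matrix.diagonal fun a => ((-(t * lam a) : ℝ) : ℂ) := by
    have : ∀ A, inBasis V (-(t : ℂ) • A) = -(t : ℂ) • inBasis V A := fun A => by simp [inBasis]
    rw [this, hK, inBasis_diagonalized (mul_eq_one_comm.1 hV), ← Matrix.diagonal_smul]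
    congr 1
    funext a
    simp
  rw [sectorHamiltonian, fockOp_eq hV, h1, secondQuantized_diagonal, smul_add, smul_smul,
    exp_add_smul_one, gaussian, Finset.smul_sum]
  simp only [smul_smul]
  congr 2
  ring

theorem card_fock : Fintype.card (Finset (Site L)) = 2 ^ Fintype.card (Site L) :=
  Fintype.card_finset

variable {σ : Edge L → ℤˣ} {lam : Site L → ℝ}

theorem exp_eta {η : ℝ} {θ : ℂ} (hθ : Complex.exp θ = η) (β e : ℝ) :
    Complex.exp (-(β : ℂ) * (e : ℝ) + θ) = (η * Real.exp (-(β * e)) : ℝ) := by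
  rw [Complex.exp_add, hθ]
  push_cast
  rw [mul_comm, neg_mul]

/-- The thermal density matrix of a sector, possibly twisted by the fermion parity. -/
def sectorDensity (V : Matrix (Site L) (Site L) ℝ) (lam : Site L → ℝ) (t β : ℝ) (θ : ℂ) :
    Matrix (Finset (Site L)) (Finset (Site L)) ℂ :=
  gaussian (modeC V) (modeD V) fun a => -(β : ℂ) * (-(t * lam a) : ℝ) + θ

theorem exp_neg_sectorHamiltonian (hV : V * Vᵀ = 1)
    (hK : gaugeHopping σ = V * Matrix.diagonal lam * Vᵀ) (t β : ℝ) :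
    NormedSpace.exp (-(β : ℂ) • sectorHamiltonian t σ) =
      (Real.exp (β * plaquetteSum σ) : ℂ) • sectorDensity V lam t β 0 := by
  rw [exp_sectorHamiltonian hV hK, sectorDensity]
  simp

theorem exp_neg_sectorHamiltonian_mul_parity (hV : V * Vᵀ = 1)
    (hK : gaugeHopping σ = V * Matrix.diagonal lam * Vᵀ) (t β : ℝ) :
    NormedSpace.exp (-(β : ℂ) • sectorHamiltonian t σ) * parity (Site L) =
      (Real.exp (β * plaquetteSum σ) : ℂ) • sectorDensity V lam t β (Complex.I * Real.pi) := by
  rw [exp_sectorHamiltonian hV hK, parity_eq hV, Matrix.smul_mul,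
    (isCAR_mode (mul_eq_one_comm.1 hV)).gaussian_mul_gaussian, sectorDensity]
  simp

theorem trace_sectorDensity (hV : V * Vᵀ = 1) (t β : ℝ) {η : ℝ} {θ : ℂ}
    (hθ : Complex.exp θ = η) :
    (sectorDensity V lam t β θ).trace = (partition η (fun a => -(t * lam a)) β : ℝ) := by
  rw [sectorDensity, (isCAR_mode (mul_eq_one_comm.1 hV)).trace_gaussian card_fock, partition]
  simp only [exp_eta hθ]
  push_cast
  rfl

theorem trace_fockOp (hV : V * Vᵀ = 1) (t β : ℝ) {η : ℝ} {θ : ℂ}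
    (hθ : Complex.exp θ = η) (A : Matrix (Site L) (Site L) ℂ) :
    (fockOp A * sectorDensity V lam t β θ).trace =
      ∑ a, inBasis V A a a * (weightOne η (fun a => -(t * lam a)) β a : ℝ) := by
  rw [sectorDensity, fockOp_eq hV,
    (isCAR_mode (mul_eq_one_comm.1 hV)).trace_secondQuantized card_fock]
  refine Finset.sum_congr rfl fun a _ => ?_
  simp only [exp_eta hθ, weightOne]
  push_cast
  rfl

theorem trace_evolved_fockOp (hV : V * Vᵀ = 1)
    (hK : gaugeHopping σ = V * Matrix.diagonal lam * Vᵀ) (t β s : ℝ) {η : ℝ} {θ : ℂ}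
    (hθ : Complex.exp θ = η) {A B : Matrix (Site L) (Site L) ℂ} (hA : ∀ a, inBasis V A a a = 0)
    (hB : ∀ a, inBasis V B a a = 0) :
    (NormedSpace.exp ((s : ℂ) • sectorHamiltonian t σ) * fockOp A *
        NormedSpace.exp (-(s : ℂ) • sectorHamiltonian t σ) * fockOp B *
          sectorDensity V lam t β θ).trace =
      ∑ a, ∑ b, inBasis V A a b * inBasis V B b a *
        ((weightTwo η (fun a => -(t * lam a)) β a b *
          Real.exp (s * (-(t * lam a) - -(t * lam b))) : ℝ) : ℂ) := by
  have hV' := mul_eq_one_comm.1 hV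
  rw [exp_sectorHamiltonian hV hK, exp_sectorHamiltonian hV hK, fockOp_eq hV A, fockOp_eq hV B]
  have e1 : ∀ (x y : ℂ) (M N O : Matrix (Finset (Site L)) (Finset (Site L)) ℂ), x * y = 1 →
      (x • M) * N * (y • O) = M * N * O := by
    intro x y M N O h
    rw [Matrix.smul_mul, smul_mul_smul_comm, h, one_smul]
  -- In a given gauge field the plaquette energy is a number and drops out of the time evolution.
  rw [e1 _ _ _ _ _ (by rw [← Complex.exp_add]; simp)]
  have e2 := (isCAR_mode hV').gaussian_conj_secondQuantized
    (fun a => (s : ℂ) * (-(t * lam a) : ℝ)) (inBasis V A)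
  have e3 : (fun a => -((s : ℂ) * (-(t * lam a) : ℝ))) = fun a => -(s : ℂ) * (-(t * lam a) : ℝ) :=
    funext fun a => (neg_mul _ _).symm
  rw [e3] at e2
  rw [e2, sectorDensity, (isCAR_mode hV').trace_secondQuantized_mul card_fock _ _ hB]
  · refine Finset.sum_congr rfl fun a _ => Finset.sum_congr rfl fun b _ => ?_
    simp only [exp_eta hθ, weightTwo, Matrix.of_apply]
    push_cast
    rw [mul_sub]
    ring
  · intro a
    rw [Matrix.of_apply, hA, mul_zero]

end SectorTraces
end
end Z2Gauge

namespace Z2Gauge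
noncomputable section
open scoped Matrix

/-! ### The response coefficient as a mixture over gauge fields -/

section Response

variable {L : ℕ} [NeZero L]

theorem exp_smul_blockDiagonal (s : ℂ)
    (M : (Edge L → ℤˣ) → Matrix (Finset (Site L)) (Finset (Site L)) ℂ) :
    NormedSpace.exp (s • Matrix.blockDiagonal M) =
      Matrix.blockDiagonal fun σ => NormedSpace.exp (s • M σ) := by
  rw [← Matrix.blockDiagonal_smul, Matrix.exp_blockDiagonal]
  congr 1
  funext σ
  let _ : NormedRing (Matrix (Finset (Site L)) (Finset (Site L)) ℂ) := Matrix.linftyOpNormedRing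
  let _ : NormedAlgebra ℂ (Matrix (Finset (Site L)) (Finset (Site L)) ℂ) :=
    Matrix.linftyOpNormedAlgebra
  let _ : NormedAlgebra ℚ (Matrix (Finset (Site L)) (Finset (Site L)) ℂ) :=
    NormedAlgebra.restrictScalars ℚ ℂ _
  refine @Pi.coe_exp _ _ _ _ _ (fun _ => ?_) (s • M) σ
  exact FiniteDimensional.complete ℂ _

/-- The one particle matrix of the current in a given gauge field. -/
def currentMatrix (t q p : ℝ) (σ : Edge L → ℤˣ) : Matrix (Site L) (Site L) ℂ :=
  edgeMatrix (fun e => Complex.I * q * t * bondPhase p e * ((σ e : ℤˣ) : ℤ))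
    (fun e => -(Complex.I * q * t * bondPhase p e) * ((σ e : ℤˣ) : ℤ))

/-- The one particle matrix of the diamagnetic operator in a given gauge field. -/
def diamagneticMatrix (t q p p' : ℝ) (σ : Edge L → ℤˣ) : Matrix (Site L) (Site L) ℂ :=
  edgeMatrix (fun e => -(q ^ 2 * t * bondPhase p e * bondPhase p' e) * ((σ e : ℤˣ) : ℤ))
    (fun e => -(q ^ 2 * t * bondPhase p e * bondPhase p' e) * ((σ e : ℤˣ) : ℤ))

/-- The current matrix is antisymmetric and the modes are real, so no mode carries a mean current.
-/
theorem inBasis_currentMatrix_diag (V : Matrix (Site L) (Site L) ℝ) (t q p : ℝ)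
    (σ : Edge L → ℤˣ) (a : Site L) : inBasis V (currentMatrix t q p σ) a a = 0 := by
  have h1 : (currentMatrix t q p σ)ᵀ = -currentMatrix t q p σ := by
    ext x y
    simp only [currentMatrix, edgeMatrix, Matrix.transpose_apply, Matrix.of_apply, Matrix.neg_apply,
      ← Finset.sum_neg_distrib]
    refine Finset.sum_congr rfl fun μ _ => ?_
    rw [neg_add, add_comm]
    congr 1
    · split_ifs <;> ring
    · split_ifs <;> ring
  have h2 : (inBasis V (currentMatrix t q p σ))ᵀ = -inBasis V (currentMatrix t q p σ) := by
    simp only [inBasis, Matrix.transpose_mul, Matrix.transpose_transpose, h1, Matrix.neg_mul,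
      Matrix.mul_neg, Matrix.mul_assoc]
  have h3 := congrFun (congrFun h2 a) a
  rw [Matrix.transpose_apply, Matrix.neg_apply] at h3
  exact self_eq_neg.1 h3

variable {V : (Edge L → ℤˣ) → Matrix (Site L) (Site L) ℝ} {lam : (Edge L → ℤˣ) → Site L → ℝ}

theorem gibbs_blockDiagonal (hV : ∀ σ, V σ * (V σ)ᵀ = 1)
    (hK : ∀ σ, gaugeHopping σ = V σ * Matrix.diagonal (lam σ) * (V σ)ᵀ) (t β : ℝ)
    (O : (Edge L → ℤˣ) → Matrix (Finset (Site L)) (Finset (Site L)) ℂ) :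
    gibbs t β (Matrix.blockDiagonal O) =
      (∑ σ, (Real.exp (β * plaquetteSum σ) : ℂ) *
        ((O σ * sectorDensity (V σ) (lam σ) t β 0).trace +
          (O σ * sectorDensity (V σ) (lam σ) t β (Complex.I * Real.pi)).trace)) /
      (∑ σ, Real.exp (β * plaquetteSum σ) * (partition 1 (fun a => -(t * lam σ a)) β +
        partition (-1) (fun a => -(t * lam σ a)) β) : ℝ) := by
  have key : ∀ O : (Edge L → ℤˣ) → Matrix (Finset (Site L)) (Finset (Site L)) ℂ,
      (gaussProjection L * Matrix.blockDiagonal O *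
        NormedSpace.exp (-(β : ℂ) • hamiltonian L t)).trace =
      (1 / 2 : ℂ) ^ Fintype.card (Site L) * ∑ σ, (Real.exp (β * plaquetteSum σ) : ℂ) *
        ((O σ * sectorDensity (V σ) (lam σ) t β 0).trace +
          (O σ * sectorDensity (V σ) (lam σ) t β (Complex.I * Real.pi)).trace) := by
    intro O
    rw [hamiltonian_eq, exp_smul_blockDiagonal, Matrix.mul_assoc, ← Matrix.blockDiagonal_mul,
      trace_gaussProjection_mul]
    congr 1
    refine Finset.sum_congr rfl fun σ _ => ?_
    rw [Matrix.trace_mul_comm (parity _), Matrix.mul_assoc,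
      exp_neg_sectorHamiltonian_mul_parity (hV σ) (hK σ), exp_neg_sectorHamiltonian (hV σ) (hK σ),
      Matrix.mul_smul, Matrix.mul_smul, Matrix.trace_smul, Matrix.trace_smul, smul_eq_mul,
      smul_eq_mul, mul_add]
  have hden := key fun _ => 1
  rw [show (fun _ : Edge L → ℤˣ => (1 : Matrix (Finset (Site L)) (Finset (Site L)) ℂ)) = 1 from rfl,
    Matrix.blockDiagonal_one, Matrix.mul_one] at hden
  rw [gibbs, key, hden, mul_div_mul_left _ _ (pow_ne_zero _ (by norm_num))]
  congr 1
  push_cast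
  refine Finset.sum_congr rfl fun σ _ => ?_
  rw [Matrix.one_mul, Matrix.one_mul,
    trace_sectorDensity (hV σ) t β (η := 1) (by simp),
    trace_sectorDensity (hV σ) t β (η := -1) (by rw [mul_comm, Complex.exp_pi_mul_I]; simp)]

/-- The mean current vanishes in each gauge field and each parity class, so the truncation is void
and the response is a ratio of finite sums. The parity projection appears as the sum over η = ±1. -/
theorem response_eq (hV : ∀ σ, V σ * (V σ)ᵀ = 1)
    (hK : ∀ σ, gaugeHopping σ = V σ * Matrix.diagonal (lam σ) * (V σ)ᵀ) (t q β p : ℝ) :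
    response L t q β p = (1 / (L : ℂ) ^ 2) *
      ((∑ σ, (Real.exp (β * plaquetteSum σ) : ℂ) * ∑ η ∈ ({1, -1} : Finset ℝ),
        numerator η (fun a => -(t * lam σ a))
          (fun a b => inBasis (V σ) (currentMatrix t q (-p) σ) a b *
            inBasis (V σ) (currentMatrix t q p σ) b a)
          (fun a => inBasis (V σ) (diamagneticMatrix t q p (-p) σ) a a) β) /
      (∑ σ, Real.exp (β * plaquetteSum σ) * (∑ η ∈ ({1, -1} : Finset ℝ),
        partition η (fun a => -(t * lam σ a)) β) : ℝ)) := by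
  have hne : (1 : ℝ) ≠ -1 := by norm_num
  have e0 : Complex.exp 0 = ((1 : ℝ) : ℂ) := by simp
  have eπ : Complex.exp (Complex.I * Real.pi) = ((-1 : ℝ) : ℂ) := by
    rw [mul_comm, Complex.exp_pi_mul_I]; simp
  have hJ : ∀ p, gibbs t β (current L t q p) = 0 := by
    intro p
    rw [current_eq, gibbs_blockDiagonal hV hK]
    refine div_eq_zero_iff.2 (Or.inl (Finset.sum_eq_zero fun σ _ => ?_))
    have h1 := trace_fockOp (lam := lam σ) (hV σ) t β e0 (currentMatrix t q p σ)
    have h2 := trace_fockOp (lam := lam σ) (hV σ) t β eπ (currentMatrix t q p σ)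
    simp only [inBasis_currentMatrix_diag, zero_mul, Finset.sum_const_zero] at h1 h2
    rw [currentMatrix] at h1 h2
    rw [h1, h2]
    simp
  have hJJ : ∀ s : ℝ, truncated t β (evolved t s (current L t q (-p))) (current L t q p) =
      (∑ σ, (Real.exp (β * plaquetteSum σ) : ℂ) * ∑ η ∈ ({1, -1} : Finset ℝ),
        ∑ a, ∑ b, inBasis (V σ) (currentMatrix t q (-p) σ) a b *
            inBasis (V σ) (currentMatrix t q p σ) b a *
          ((weightTwo η (fun a => -(t * lam σ a)) β a b *
          Real.exp (s * (-(t * lam σ a) - -(t * lam σ b))) : ℝ) : ℂ)) /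
      (∑ σ, Real.exp (β * plaquetteSum σ) * (∑ η ∈ ({1, -1} : Finset ℝ),
        partition η (fun a => -(t * lam σ a)) β) : ℝ) := by
    intro s
    rw [truncated, hJ p, mul_zero, sub_zero, evolved, current_eq, current_eq, hamiltonian_eq,
      exp_smul_blockDiagonal, exp_smul_blockDiagonal, ← Matrix.blockDiagonal_mul,
      ← Matrix.blockDiagonal_mul, ← Matrix.blockDiagonal_mul, gibbs_blockDiagonal hV hK]
    simp only [Finset.sum_pair hne]
    congr 1
    refine Finset.sum_congr rfl fun σ _ => ?_
    congr 1
    have h1 := trace_evolved_fockOp (hV σ) (hK σ) t β s e0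
      (inBasis_currentMatrix_diag (V σ) t q (-p) σ) (inBasis_currentMatrix_diag (V σ) t q p σ)
    have h2 := trace_evolved_fockOp (hV σ) (hK σ) t β s eπ
      (inBasis_currentMatrix_diag (V σ) t q (-p) σ) (inBasis_currentMatrix_diag (V σ) t q p σ)
    rw [← h1, ← h2]
    rfl
  have hD : gibbs t β (diamagnetic L t q p (-p)) =
      (∑ σ, (Real.exp (β * plaquetteSum σ) : ℂ) * ∑ η ∈ ({1, -1} : Finset ℝ),
        ∑ a, inBasis (V σ) (diamagneticMatrix t q p (-p) σ) a a *
          (weightOne η (fun a => -(t * lam σ a)) β a : ℝ)) /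
      (∑ σ, Real.exp (β * plaquetteSum σ) * (∑ η ∈ ({1, -1} : Finset ℝ),
        partition η (fun a => -(t * lam σ a)) β) : ℝ) := by
    rw [diamagnetic_eq, gibbs_blockDiagonal hV hK]
    simp only [Finset.sum_pair hne]
    congr 1
    refine Finset.sum_congr rfl fun σ _ => ?_
    congr 1
    rw [← trace_fockOp (hV σ) t β e0, ← trace_fockOp (hV σ) t β eπ]
    rfl
  have cont : ∀ r : ℝ, Continuous fun s : ℝ => Real.exp (s * r) := fun r => by fun_prop
  rw [response]
  congr 1
  simp only [hJJ]
  rw [hD, intervalIntegral.integral_div, ← add_div]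
  congr 1
  rw [intervalIntegral.integral_finsetSum fun σ _ =>
    Continuous.intervalIntegrable (by fun_prop) _ _, ← Finset.sum_add_distrib]
  refine Finset.sum_congr rfl fun σ _ => ?_
  rw [intervalIntegral.integral_const_mul, ← mul_add]
  congr 1
  rw [intervalIntegral.integral_finsetSum fun η _ =>
    Continuous.intervalIntegrable (by fun_prop) _ _, ← Finset.sum_add_distrib]
  refine Finset.sum_congr rfl fun η _ => ?_
  rw [numerator]
  congr 1
  rw [intervalIntegral.integral_finsetSum fun a _ =>
    Continuous.intervalIntegrable (by fun_prop) _ _]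
  refine Finset.sum_congr rfl fun a _ => ?_
  rw [intervalIntegral.integral_finsetSum fun b _ =>
    Continuous.intervalIntegrable (by fun_prop) _ _]
  refine Finset.sum_congr rfl fun b _ => ?_
  rw [intervalIntegral.integral_const_mul, intervalIntegral.integral_ofReal,
    intervalIntegral.integral_const_mul]

end Response
end
end Z2Gauge

namespace Z2Gauge
noncomputable section
open Filter Topology

/-! ### Zero temperature limit of free fermions -/

section ZeroTemperature

/-- The limit of the partition function of a mode of energy `x`, relative to its exponential
growth. -/
def modeWeight (η x : ℝ) : ℝ := (if 0 ≤ x then 1 else 0) + η * if x ≤ 0 then 1 else 0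

/-- The response of the pair of modes of energies `x`, `y` in the ground state. -/
def pairResponse (x y : ℝ) : ℝ := 1 / 2 * (1 - x * y / (|x| * |y|)) / (|x| + |y|)

/-- The occupation of a mode of energy `x` in the ground state. -/
def occupation (x : ℝ) : ℝ := 1 / 2 * (1 - x / |x|)

theorem tendsto_exp_neg_mul {u : ℝ} (hu : 0 ≤ u) :
    Tendsto (fun β : ℝ => Real.exp (-(β * u))) atTop (𝓝 (if u = 0 then 1 else 0)) := by
  split_ifs with h
  · simp [h]
  · exact Real.tendsto_exp_neg_atTop_nhds_zero.comp
      (tendsto_id.atTop_mul_const (lt_of_le_of_ne hu (Ne.symm h)))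

/-- The normalized partition function of a mode. -/
def modeFactor (η β x : ℝ) : ℝ :=
  Real.exp (-(β * ((|x| - x) / 2))) + η * Real.exp (-(β * ((|x| + x) / 2)))

/-- The normalized response of a pair of modes. -/
def pairFactor (β x y : ℝ) : ℝ :=
  Real.exp (-(β * ((|x| + x) / 2))) * Real.exp (-(β * ((|y| - y) / 2))) *
    ∫ s in (0 : ℝ)..β, Real.exp (s * (x - y))

theorem half_sub_eq_zero_iff (x : ℝ) : (|x| - x) / 2 = 0 ↔ 0 ≤ x := by
  constructor
  · intro h
    have := abs_nonneg x
    linarith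
  · intro h
    rw [abs_of_nonneg h]
    ring

theorem half_add_eq_zero_iff (x : ℝ) : (|x| + x) / 2 = 0 ↔ x ≤ 0 := by
  have := half_sub_eq_zero_iff (-x)
  rwa [abs_neg, sub_neg_eq_add, neg_nonneg] at this

theorem half_sub_nonneg (x : ℝ) : 0 ≤ (|x| - x) / 2 := by linarith [le_abs_self x]

theorem half_add_nonneg (x : ℝ) : 0 ≤ (|x| + x) / 2 := by linarith [neg_abs_le x]

theorem tendsto_modeFactor (η x : ℝ) :
    Tendsto (fun β => modeFactor η β x) atTop (𝓝 (modeWeight η x)) := by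
  have h1 := tendsto_exp_neg_mul (half_sub_nonneg x)
  have h2 := (tendsto_exp_neg_mul (half_add_nonneg x)).const_mul η
  simp only [half_sub_eq_zero_iff, half_add_eq_zero_iff] at h1 h2
  exact h1.add h2

theorem abs_modeFactor_le {η β x : ℝ} (hη : |η| ≤ 1) (hβ : 0 ≤ β) : |modeFactor η β x| ≤ 2 := by
  have h1 : Real.exp (-(β * ((|x| - x) / 2))) ≤ 1 :=
    Real.exp_le_one_iff.2 (neg_nonpos.2 (mul_nonneg hβ (half_sub_nonneg x)))
  have h2 : Real.exp (-(β * ((|x| + x) / 2))) ≤ 1 :=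
    Real.exp_le_one_iff.2 (neg_nonpos.2 (mul_nonneg hβ (half_add_nonneg x)))
  calc |modeFactor η β x| ≤ |Real.exp (-(β * ((|x| - x) / 2)))| +
        |η * Real.exp (-(β * ((|x| + x) / 2)))| := abs_add_le _ _
    _ ≤ 1 + 1 * 1 := by
        rw [abs_mul, Real.abs_exp, Real.abs_exp]
        gcongr
    _ = 2 := by norm_num

theorem integral_exp_mul {r : ℝ} (hr : r ≠ 0) (β : ℝ) :
    ∫ s in (0 : ℝ)..β, Real.exp (s * r) = (Real.exp (β * r) - 1) / r := by
  rw [intervalIntegral.integral_comp_mul_right (fun s => Real.exp s) hr, integral_exp]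
  simp [div_eq_inv_mul]

theorem pairFactor_nonneg {β : ℝ} (hβ : 0 ≤ β) (x y : ℝ) : 0 ≤ pairFactor β x y :=
  mul_nonneg (by positivity) (intervalIntegral.integral_nonneg hβ fun s _ => (Real.exp_pos _).le)

/-- For 0 ≤ s ≤ β the normalized integrand is at most 1. The linear growth that this leaves is
harmless in sectors above the ground state energy. -/
theorem pairFactor_le {β : ℝ} (hβ : 0 ≤ β) (x y : ℝ) : pairFactor β x y ≤ β := by
  rw [pairFactor, ← intervalIntegral.integral_const_mul]
  have : ∀ s ∈ Set.Icc 0 β, Real.exp (-(β * ((|x| + x) / 2))) * Real.exp (-(β * ((|y| - y) / 2))) *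
      Real.exp (s * (x - y)) ≤ 1 := by
    intro s hs
    rw [← Real.exp_add, ← Real.exp_add, Real.exp_le_one_iff]
    have h1 : s * x ≤ β * ((|x| + x) / 2) := by
      rcases le_total 0 x with hx | hx
      · rw [abs_of_nonneg hx]; nlinarith [hs.2]
      · rw [abs_of_nonpos hx]; nlinarith [hs.1]
    have h2 : -(s * y) ≤ β * ((|y| - y) / 2) := by
      rcases le_total 0 y with hx | hx
      · rw [abs_of_nonneg hx]; nlinarith [hs.1]
      · rw [abs_of_nonpos hx]; nlinarith [hs.2]
    linarith
  have hc : Continuous fun s : ℝ => Real.exp (-(β * ((|x| + x) / 2))) *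
      Real.exp (-(β * ((|y| - y) / 2))) * Real.exp (s * (x - y)) := by fun_prop
  have := intervalIntegral.integral_mono_on (μ := MeasureTheory.volume) hβ (hc.intervalIntegrable 0 β)
    (continuous_const.intervalIntegrable 0 β) this
  simpa using this

/-- A pair of zero modes is excluded, as its factor equals β. For equal nonzero energies the factor
decays exponentially, in accordance with the value 0 that division by x - y = 0 gives on the right.
-/
theorem tendsto_pairFactor {x y : ℝ} (h : ¬(x = 0 ∧ y = 0)) :
    Tendsto (fun β => pairFactor β x y) atTop
      (𝓝 (((if 0 ≤ x ∧ y ≤ 0 then 1 else 0) - if x ≤ 0 ∧ 0 ≤ y then 1 else 0) / (x - y))) := by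
  by_cases hxy : x = y
  · subst hxy
    have hx : 0 < |x| := abs_pos.2 fun h0 => h ⟨h0, h0⟩
    have e : (fun β => pairFactor β x x) = fun β => β * Real.exp (-(|x| * β)) := by
      funext β
      rw [pairFactor, ← Real.exp_add]
      simp only [sub_self, mul_zero, Real.exp_zero, intervalIntegral.integral_const, smul_eq_mul,
        sub_zero, mul_one]
      rw [mul_comm]
      congr 2
      ring
    rw [e, sub_self, div_zero]
    have := Real.tendsto_pow_mul_exp_neg_atTop_nhds_zero 1
    have h2 := (this.comp (tendsto_id.const_mul_atTop hx)).const_mul (|x|⁻¹)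
    rw [mul_zero] at h2
    refine h2.congr fun β => ?_
    simp only [Function.comp, id, pow_one]
    field_simp
  · have hr : x - y ≠ 0 := sub_ne_zero.2 hxy
    have e : (fun β => pairFactor β x y) = fun β =>
        (Real.exp (-(β * ((|x| - x) / 2))) * Real.exp (-(β * ((|y| + y) / 2))) -
          Real.exp (-(β * ((|x| + x) / 2))) * Real.exp (-(β * ((|y| - y) / 2)))) / (x - y) := by
      funext β
      rw [pairFactor, integral_exp_mul hr, mul_div_assoc', mul_sub, mul_one]
      congr 2
      rw [← Real.exp_add, ← Real.exp_add, ← Real.exp_add]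
      congr 1
      ring
    rw [e]
    have t1 := (tendsto_exp_neg_mul (half_sub_nonneg x)).mul
      (tendsto_exp_neg_mul (half_add_nonneg y))
    have t2 := (tendsto_exp_neg_mul (half_add_nonneg x)).mul
      (tendsto_exp_neg_mul (half_sub_nonneg y))
    simp only [half_sub_eq_zero_iff, half_add_eq_zero_iff, ← ite_and, mul_ite, mul_one,
      mul_zero] at t1 t2
    simp only [and_comm (a := y ≤ 0), and_comm (a := 0 ≤ y)] at t1 t2
    exact (t1.sub t2).div_const _

variable {ι : Type*} [Fintype ι] [DecidableEq ι]

/-- Since the energies sum to zero, the energy of the filled Fermi sea is -½ ∑ |ε|. Removing its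
exponential growth mode by mode leaves bounded factors. -/
theorem exp_norm_mul_prod {ε : ι → ℝ} (h0 : ∑ a, ε a = 0) (β : ℝ) :
    Real.exp (-(β / 2 * ∑ a, |ε a|)) = ∏ a, Real.exp (-(β * ((|ε a| - ε a) / 2))) := by
  rw [← Real.exp_sum]
  congr 1
  rw [Finset.sum_neg_distrib, ← Finset.mul_sum, ← Finset.sum_div, Finset.sum_sub_distrib, h0]
  ring

theorem exp_mul_mode (η β x : ℝ) :
    Real.exp (-(β * ((|x| - x) / 2))) * (1 + η * Real.exp (-(β * x))) = modeFactor η β x := by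
  rw [modeFactor, mul_add, mul_one, mul_left_comm, ← Real.exp_add]
  congr 3
  ring

theorem exp_norm_partition {ε : ι → ℝ} (h0 : ∑ a, ε a = 0) (η β : ℝ) :
    Real.exp (-(β / 2 * ∑ a, |ε a|)) * partition η ε β = ∏ a, modeFactor η β (ε a) := by
  rw [exp_norm_mul_prod h0, partition, ← Finset.prod_mul_distrib]
  simp only [exp_mul_mode]

theorem exp_norm_weightOne {ε : ι → ℝ} (h0 : ∑ a, ε a = 0) (η β : ℝ) (a : ι) :
    Real.exp (-(β / 2 * ∑ a, |ε a|)) * weightOne η ε β a =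
      η * Real.exp (-(β * ((|ε a| + ε a) / 2))) *
        ∏ b ∈ Finset.univ.erase a, modeFactor η β (ε b) := by
  rw [exp_norm_mul_prod h0, weightOne, ← Finset.mul_prod_erase _ _ (Finset.mem_univ a),
    mul_mul_mul_comm, ← Finset.prod_mul_distrib]
  simp only [exp_mul_mode]
  congr 1
  rw [mul_left_comm, ← Real.exp_add]
  congr 2
  ring

theorem exp_norm_weightTwo {ε : ι → ℝ} (h0 : ∑ a, ε a = 0) (η β : ℝ) {a b : ι} (hab : a ≠ b) :
    Real.exp (-(β / 2 * ∑ a, |ε a|)) * weightTwo η ε β a b =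
      η * (Real.exp (-(β * ((|ε a| + ε a) / 2))) * Real.exp (-(β * ((|ε b| - ε b) / 2)))) *
        ∏ e ∈ (Finset.univ.erase a).erase b, modeFactor η β (ε e) := by
  have hb : b ∈ Finset.univ.erase a := Finset.mem_erase.2 ⟨hab.symm, Finset.mem_univ _⟩
  rw [exp_norm_mul_prod h0, weightTwo, ← Finset.mul_prod_erase _ _ (Finset.mem_univ a),
    ← Finset.mul_prod_erase _ _ hb]
  have h1 : Real.exp (-(β * ((|ε a| + ε a) / 2))) =
      Real.exp (-(β * ((|ε a| - ε a) / 2))) * Real.exp (-(β * ε a)) := by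
    rw [← Real.exp_add]
    congr 1
    ring
  have h2 : (∏ e ∈ (Finset.univ.erase a).erase b, Real.exp (-(β * ((|ε e| - ε e) / 2)))) *
      ∏ e ∈ (Finset.univ.erase a).erase b, (1 + η * Real.exp (-(β * ε e))) =
      ∏ e ∈ (Finset.univ.erase a).erase b, modeFactor η β (ε e) := by
    rw [← Finset.prod_mul_distrib]
    simp only [exp_mul_mode]
  rw [h1, ← h2]
  ring

theorem exp_norm_numerator {ε : ι → ℝ} (h0 : ∑ a, ε a = 0) (η β : ℝ) {κ : ι → ι → ℂ}
    (hκ : ∀ a, κ a a = 0) (k : ι → ℂ) :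
    (Real.exp (-(β / 2 * ∑ a, |ε a|)) : ℂ) * numerator η ε κ k β =
      ∑ a, ∑ b, κ a b * (η * pairFactor β (ε a) (ε b) *
        ∏ e ∈ (Finset.univ.erase a).erase b, modeFactor η β (ε e) : ℝ) +
      ∑ a, k a * (η * Real.exp (-(β * ((|ε a| + ε a) / 2))) *
        ∏ b ∈ Finset.univ.erase a, modeFactor η β (ε b) : ℝ) := by
  have hW1 := exp_norm_weightOne h0 η β
  have hW2 := fun a b hab => exp_norm_weightTwo h0 η β (a := a) (b := b) hab
  generalize Real.exp (-(β / 2 * ∑ a, |ε a|)) = W at hW1 hW2 ⊢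
  rw [numerator, mul_add, Finset.mul_sum, Finset.mul_sum]
  congr 1
  · refine Finset.sum_congr rfl fun a _ => ?_
    rw [Finset.mul_sum]
    refine Finset.sum_congr rfl fun b _ => ?_
    by_cases hab : a = b
    · subst hab
      rw [hκ]
      simp
    · rw [mul_left_comm, ← Complex.ofReal_mul, ← mul_assoc, hW2 a b hab,
        pairFactor]
      congr 2
      ring
  · refine Finset.sum_congr rfl fun a _ => ?_
    rw [mul_left_comm, ← Complex.ofReal_mul, hW1]

/-- A sector whose energy exceeds the minimum by δ contributes at most exp(-δβ) times a linear
function of β. -/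
theorem tendsto_exp_norm_numerator_of_pos {ε : ι → ℝ} (h0 : ∑ a, ε a = 0) {η : ℝ} (hη : |η| ≤ 1)
    {κ : ι → ι → ℂ} (hκ : ∀ a, κ a a = 0) (k : ι → ℂ) {δ : ℝ} (hδ : 0 < δ) :
    Tendsto (fun β : ℝ => (Real.exp (-(δ * β)) : ℂ) *
      ((Real.exp (-(β / 2 * ∑ a, |ε a|)) : ℂ) * numerator η ε κ k β)) atTop (𝓝 0) := by
  have t0 : Tendsto (fun β : ℝ => Real.exp (-(δ * β))) atTop (𝓝 0) := by
    have := tendsto_exp_neg_mul hδ.le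
    rw [if_neg hδ.ne'] at this
    simpa [mul_comm] using this
  have t1 : Tendsto (fun β : ℝ => Real.exp (-(δ * β)) * β) atTop (𝓝 0) := by
    have := Real.tendsto_pow_mul_exp_neg_atTop_nhds_zero 1
    have h2 := (this.comp (tendsto_id.const_mul_atTop hδ)).const_mul (δ⁻¹)
    rw [mul_zero] at h2
    refine h2.congr fun β => ?_
    simp only [Function.comp, id, pow_one]
    field_simp
  have prodle : ∀ (s : Finset ι) (β : ℝ), 0 ≤ β →
      |∏ e ∈ s, modeFactor η β (ε e)| ≤ 2 ^ s.card := by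
    intro s β hβ
    rw [Finset.abs_prod, ← Finset.prod_const]
    exact Finset.prod_le_prod (fun _ _ => abs_nonneg _) fun e _ => abs_modeFactor_le hη hβ
  have b1 : ∀ a b, Tendsto (fun β : ℝ => Real.exp (-(δ * β)) * (η * pairFactor β (ε a) (ε b) *
        ∏ e ∈ (Finset.univ.erase a).erase b, modeFactor η β (ε e))) atTop (𝓝 0) := by
    intro a b
    have t2 := t1.mul_const (2 ^ ((Finset.univ.erase a).erase b).card : ℝ)
    rw [zero_mul] at t2
    refine squeeze_zero_norm' ?_ t2
    filter_upwards [eventually_ge_atTop 0] with β hβ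
    rw [Real.norm_eq_abs, abs_mul, abs_mul, abs_mul, Real.abs_exp,
      abs_of_nonneg (pairFactor_nonneg hβ _ _), mul_assoc (Real.exp _) β]
    refine mul_le_mul_of_nonneg_left ?_ (Real.exp_pos _).le
    refine mul_le_mul ?_ (prodle _ _ hβ) (abs_nonneg _) hβ
    simpa using mul_le_mul hη (pairFactor_le hβ (ε a) (ε b)) (pairFactor_nonneg hβ _ _) zero_le_one
  have b2 : ∀ a, Tendsto (fun β : ℝ => Real.exp (-(δ * β)) *
      (η * Real.exp (-(β * ((|ε a| + ε a) / 2))) *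
        ∏ b ∈ Finset.univ.erase a, modeFactor η β (ε b))) atTop (𝓝 0) := by
    intro a
    have t2 := t0.mul_const (2 ^ (Finset.univ.erase a).card : ℝ)
    rw [zero_mul] at t2
    refine squeeze_zero_norm' ?_ t2
    filter_upwards [eventually_ge_atTop 0] with β hβ
    rw [Real.norm_eq_abs, abs_mul, abs_mul, abs_mul, Real.abs_exp, Real.abs_exp]
    refine mul_le_mul_of_nonneg_left ?_ (Real.exp_pos _).le
    have h1 : Real.exp (-(β * ((|ε a| + ε a) / 2))) ≤ 1 :=
      Real.exp_le_one_iff.2 (neg_nonpos.2 (mul_nonneg hβ (half_add_nonneg _)))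
    simpa using mul_le_mul (mul_le_mul hη h1 (Real.exp_pos _).le zero_le_one)
      (prodle (Finset.univ.erase a) β hβ) (abs_nonneg _) (by norm_num)
  have c1 : ∀ a b, Tendsto (fun β : ℝ => κ a b * (Real.exp (-(δ * β)) *
      (η * pairFactor β (ε a) (ε b) *
        ∏ e ∈ (Finset.univ.erase a).erase b, modeFactor η β (ε e)) : ℝ)) atTop (𝓝 0) := by
    intro a b
    have := ((Complex.continuous_ofReal.tendsto 0).comp (b1 a b)).const_mul (κ a b)
    simpa using this
  have c2 : ∀ a, Tendsto (fun β : ℝ => k a * (Real.exp (-(δ * β)) *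
      (η * Real.exp (-(β * ((|ε a| + ε a) / 2))) *
        ∏ b ∈ Finset.univ.erase a, modeFactor η β (ε b)) : ℝ)) atTop (𝓝 0) := by
    intro a
    have := ((Complex.continuous_ofReal.tendsto 0).comp (b2 a)).const_mul (k a)
    simpa using this
  have := (tendsto_finsetSum Finset.univ fun a _ => tendsto_finsetSum Finset.univ fun b _ =>
    c1 a b).add (tendsto_finsetSum Finset.univ fun a _ => c2 a)
  simp only [Finset.sum_const_zero, add_zero] at this
  refine this.congr fun β => ?_
  rw [exp_norm_numerator h0 η β hκ, mul_add, Finset.mul_sum, Finset.mul_sum]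
  congr 1
  · refine Finset.sum_congr rfl fun a _ => ?_
    rw [Finset.mul_sum]
    refine Finset.sum_congr rfl fun b _ => ?_
    rw [Complex.ofReal_mul (Real.exp (-(δ * β))), mul_left_comm]
  · refine Finset.sum_congr rfl fun a _ => ?_
    rw [Complex.ofReal_mul (Real.exp (-(δ * β))), mul_left_comm]

/-- The convention x/|x| = 0 at x = 0 is the physical one here: a zero mode has weight 2, one for
each occupation, and the correlations average over both. -/
theorem modeWeight_one_mul {x y : ℝ} (h : ¬(x = 0 ∧ y = 0)) :
    ((if 0 ≤ x ∧ y ≤ 0 then 1 else 0) - if x ≤ 0 ∧ 0 ≤ y then 1 else 0) / (x - y) =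
      modeWeight 1 x * modeWeight 1 y * pairResponse x y := by
  unfold modeWeight pairResponse
  rcases lt_trichotomy x 0 with hx | hx | hx <;> rcases lt_trichotomy y 0 with hy | hy | hy
  · simp [hx.le, hx.not_ge, hy.le, hy.not_ge, abs_of_neg hx, abs_of_neg hy, hx.ne, hy.ne]
  · subst hy
    simp [hx.le, hx.not_ge, abs_of_neg hx]
    field_simp
    norm_num
  · have hx0 := hx.ne
    have hy0 := hy.ne'
    have : -x + y ≠ 0 := by linarith
    have h2 : x - y ≠ 0 := by linarith
    simp [hx.le, hx.not_ge, hy.le, hy.not_ge, abs_of_neg hx, abs_of_pos hy]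
    field_simp
    ring
  · subst hx
    simp [hy.le, hy.not_ge, abs_of_neg hy]
    field_simp
    norm_num
  · exact absurd ⟨hx, hy⟩ h
  · subst hx
    simp [hy.le, hy.not_ge, abs_of_pos hy]
    field_simp
    norm_num
  · have hx0 := hx.ne'
    have hy0 := hy.ne
    have : x + -y ≠ 0 := by linarith
    have h2 : x - y ≠ 0 := by linarith
    simp [hx.le, hx.not_ge, hy.le, hy.not_ge, abs_of_pos hx, abs_of_neg hy]
    field_simp
    ring
  · subst hy
    simp [hx.le, hx.not_ge, abs_of_pos hx]
    field_simp
    norm_num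
  · simp [hx.le, hx.not_ge, hy.le, hy.not_ge, abs_of_pos hx, abs_of_pos hy, hx.ne', hy.ne']

theorem modeWeight_neg_one_mul {x y : ℝ} (hx : x ≠ 0) (hy : y ≠ 0) :
    -(modeWeight 1 x * modeWeight 1 y * pairResponse x y) =
      modeWeight (-1) x * modeWeight (-1) y * pairResponse x y := by
  unfold modeWeight pairResponse
  rcases lt_or_gt_of_ne hx with hx' | hx' <;> rcases lt_or_gt_of_ne hy with hy' | hy' <;>
    simp [hx'.le, hx'.not_ge, hy'.le, hy'.not_ge, abs_of_neg, abs_of_pos, hx', hy', hx, hy]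

theorem modeWeight_zero : modeWeight (-1) 0 = 0 := by simp [modeWeight]

theorem modeWeight_mul_occupation {η x : ℝ} (h : η = 1 ∨ η = -1 ∧ x ≠ 0) :
    modeWeight η x * occupation x = η * if x ≤ 0 then 1 else 0 := by
  unfold modeWeight occupation
  rcases lt_trichotomy x 0 with hx | hx | hx
  · simp [hx.le, hx.not_ge, abs_of_neg hx, hx.ne]
    norm_num
  · subst hx
    rcases h with rfl | h
    · norm_num
    · exact absurd rfl h.2
  · simp [hx.le, hx.not_ge, abs_of_pos hx, hx.ne']

/-- Pairs of zero modes, whose response would diverge with β, must carry no matrix element. For η =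
-1 a zero mode has weight 0; if zero modes never come alone, one of them is left in each product
with one mode removed, and the limit is 0 on both sides. -/
theorem tendsto_exp_norm_numerator {ε : ι → ℝ} (h0 : ∑ a, ε a = 0) {η : ℝ}
    (hη : η = 1 ∨ η = -1 ∧ ∀ a, ε a = 0 → ∃ b, b ≠ a ∧ ε b = 0) {κ : ι → ι → ℂ}
    (hκ : ∀ a, κ a a = 0) (hκ0 : ∀ a b, ε a = 0 → ε b = 0 → κ a b = 0) (k : ι → ℂ) :
    Tendsto (fun β : ℝ => (Real.exp (-(β / 2 * ∑ a, |ε a|)) : ℂ) * numerator η ε κ k β) atTop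
      (𝓝 ((∏ a, modeWeight η (ε a) : ℝ) * (∑ a, ∑ b, κ a b * (pairResponse (ε a) (ε b) : ℝ) +
        ∑ a, k a * (occupation (ε a) : ℝ)))) := by
  have tprod : ∀ s : Finset ι, Tendsto (fun β => ∏ e ∈ s, modeFactor η β (ε e)) atTop
      (𝓝 (∏ e ∈ s, modeWeight η (ε e))) := fun s =>
    tendsto_finsetProd s fun e _ => tendsto_modeFactor η (ε e)
  have c1 : ∀ a b, Tendsto (fun β : ℝ => κ a b * (η * pairFactor β (ε a) (ε b) *
        ∏ e ∈ (Finset.univ.erase a).erase b, modeFactor η β (ε e) : ℝ)) atTop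
      (𝓝 (κ a b * ((∏ a, modeWeight η (ε a)) * pairResponse (ε a) (ε b) : ℝ))) := by
    intro a b
    by_cases hab : a = b
    · subst hab
      simp [hκ]
    by_cases hz : ε a = 0 ∧ ε b = 0
    · simp [hκ0 a b hz.1 hz.2]
    refine Tendsto.const_mul _ ((Complex.continuous_ofReal.tendsto _).comp ?_)
    have hb : b ∈ Finset.univ.erase a := Finset.mem_erase.2 ⟨Ne.symm hab, Finset.mem_univ _⟩
    -- With the parity sign, either no energy vanishes and the sign of η is absorbed by the two
    -- weights, or a zero mode different from a and b makes both products vanish.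
    have e1 : (∏ a, modeWeight η (ε a)) * pairResponse (ε a) (ε b) =
        η * (((if 0 ≤ ε a ∧ ε b ≤ 0 then 1 else 0) - if ε a ≤ 0 ∧ 0 ≤ ε b then 1 else 0) /
          (ε a - ε b)) * ∏ e ∈ (Finset.univ.erase a).erase b, modeWeight η (ε e) := by
      rw [modeWeight_one_mul hz]
      rcases hη with rfl | ⟨rfl, hη⟩
      · rw [← Finset.mul_prod_erase _ _ (Finset.mem_univ a), ← Finset.mul_prod_erase _ _ hb]
        ring
      · by_cases hc : ∃ c, ε c = 0
        · obtain ⟨c, hca, hcb, hc⟩ : ∃ c, c ≠ a ∧ c ≠ b ∧ ε c = 0 := by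
            by_cases ha : ε a = 0
            · obtain ⟨c, h1, h2⟩ := hη a ha
              exact ⟨c, h1, fun h => hz ⟨ha, h ▸ h2⟩, h2⟩
            by_cases hb : ε b = 0
            · obtain ⟨c, h1, h2⟩ := hη b hb
              exact ⟨c, fun h => ha (h ▸ h2), h1, h2⟩
            obtain ⟨c, hc⟩ := hc
            exact ⟨c, fun h => ha (h ▸ hc), fun h => hb (h ▸ hc), hc⟩
          rw [Finset.prod_eq_zero (Finset.mem_univ c) (by rw [hc, modeWeight_zero]),
            Finset.prod_eq_zero (i := c) (by simp [hca, hcb]) (by rw [hc, modeWeight_zero])]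
          ring
        · push Not at hc
          rw [neg_one_mul, modeWeight_neg_one_mul (hc a) (hc b),
            ← Finset.mul_prod_erase _ _ (Finset.mem_univ a), ← Finset.mul_prod_erase _ _ hb]
          ring
    rw [e1]
    exact ((tendsto_pairFactor hz).const_mul η).mul (tprod _)
  have c2 : ∀ a, Tendsto (fun β : ℝ => k a * (η * Real.exp (-(β * ((|ε a| + ε a) / 2))) *
        ∏ b ∈ Finset.univ.erase a, modeFactor η β (ε b) : ℝ)) atTop
      (𝓝 (k a * ((∏ a, modeWeight η (ε a)) * occupation (ε a) : ℝ))) := by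
    intro a
    refine Tendsto.const_mul _ ((Complex.continuous_ofReal.tendsto _).comp ?_)
    have e1 : (∏ a, modeWeight η (ε a)) * occupation (ε a) =
        η * (if ε a ≤ 0 then 1 else 0) * ∏ e ∈ Finset.univ.erase a, modeWeight η (ε e) := by
      by_cases hh : η = 1 ∨ η = -1 ∧ ε a ≠ 0
      · rw [← modeWeight_mul_occupation hh, ← Finset.mul_prod_erase _ _ (Finset.mem_univ a)]
        ring
      · rcases hη with h1 | ⟨rfl, hη⟩
        · exact absurd (Or.inl h1) hh
        · push Not at hh
          have ha := hh.2 rfl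
          obtain ⟨c, h1, h2⟩ := hη a ha
          rw [Finset.prod_eq_zero (Finset.mem_univ c) (by rw [h2, modeWeight_zero]),
            Finset.prod_eq_zero (i := c) (by simp [h1]) (by rw [h2, modeWeight_zero])]
          ring
    rw [e1]
    have := tendsto_exp_neg_mul (half_add_nonneg (ε a))
    simp only [half_add_eq_zero_iff] at this
    exact (this.const_mul η).mul (tprod _)
  have := (tendsto_finsetSum Finset.univ fun a _ => tendsto_finsetSum Finset.univ fun b _ =>
    c1 a b).add (tendsto_finsetSum Finset.univ fun a _ => c2 a)
  simp only [← exp_norm_numerator h0 η _ hκ] at this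
  convert this using 2
  rw [mul_add, Finset.mul_sum, Finset.mul_sum]
  congr 1
  · refine Finset.sum_congr rfl fun a _ => ?_
    rw [Finset.mul_sum]
    refine Finset.sum_congr rfl fun b _ => ?_
    push_cast
    ring
  · refine Finset.sum_congr rfl fun a _ => ?_
    push_cast
    ring

end ZeroTemperature
end
end Z2Gauge

namespace Z2Gauge
noncomputable section
open Filter Topology

/-! ### Ground states of a mixture of sectors -/

section GroundStates

variable {ι : Type*} [Fintype ι] [DecidableEq ι]

/-- The number of ground states of free fermions, after the projection on even particle number. -/
def groundWeight (ε : ι → ℝ) : ℝ := ∑ η ∈ ({1, -1} : Finset ℝ), ∏ a, modeWeight η (ε a)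

/-- The response of the ground state. -/
def groundResponse (ε : ι → ℝ) (κ : ι → ι → ℂ) (k : ι → ℂ) : ℂ :=
  ∑ a, ∑ b, κ a b * (pairResponse (ε a) (ε b) : ℝ) + ∑ a, k a * (occupation (ε a) : ℝ)

theorem card_pos_eq_card_neg {ε : ι → ℝ} (h : ∑ a, ε a / |ε a| = 0) :
    (Finset.univ.filter fun a => 0 < ε a).card = (Finset.univ.filter fun a => ε a < 0).card := by
  have e : ∀ a, ε a / |ε a| = (if 0 < ε a then 1 else 0) - if ε a < 0 then 1 else 0 := by
    intro a
    rcases lt_trichotomy (ε a) 0 with hx | hx | hx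
    · rw [abs_of_neg hx, if_neg hx.not_gt, if_pos hx, div_neg, div_self hx.ne]
      norm_num
    · simp [hx]
    · rw [abs_of_pos hx, if_neg hx.not_gt, if_pos hx, div_self hx.ne']
      norm_num
  simp only [e, Finset.sum_sub_distrib, Finset.sum_boole, sub_eq_zero] at h
  exact_mod_cast h

theorem card_eq_two_mul_add {ε : ι → ℝ} (h : ∑ a, ε a / |ε a| = 0) :
    Fintype.card ι = 2 * (Finset.univ.filter fun a => ε a < 0).card +
      (Finset.univ.filter fun a => ε a = 0).card := by
  have h1 := Finset.card_filter_add_card_filter_not (s := (Finset.univ : Finset ι))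
    (fun a => ε a < 0)
  have h2 := Finset.card_filter_add_card_filter_not
    (s := Finset.univ.filter fun a => ¬ε a < 0) (fun a => ε a = 0)
  have e1 : (Finset.univ.filter fun a => ¬ε a < 0).filter (fun a => ε a = 0) =
      Finset.univ.filter fun a => ε a = 0 := by
    ext a
    simp only [Finset.mem_filter, Finset.mem_univ, true_and, and_iff_right_iff_imp]
    intro h
    exact h.not_lt
  have e2 : (Finset.univ.filter fun a => ¬ε a < 0).filter (fun a => ¬ε a = 0) =
      Finset.univ.filter fun a => 0 < ε a := by
    ext a
    simp only [Finset.mem_filter, Finset.mem_univ, true_and, not_lt]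
    exact ⟨fun hh => lt_of_le_of_ne hh.1 (Ne.symm hh.2), fun hh => ⟨hh.le, hh.ne'⟩⟩
  rw [e1, e2, card_pos_eq_card_neg h] at h2
  rw [Finset.card_univ] at h1
  omega

/-- There are as many positive as negative energies, and the number of modes is even; hence the
number of zero modes is even. -/
theorem exists_zero_ne {ε : ι → ℝ} (h : ∑ a, ε a / |ε a| = 0) (h4 : 4 ∣ Fintype.card ι) {a : ι}
    (ha : ε a = 0) : ∃ b, b ≠ a ∧ ε b = 0 := by
  by_contra hn
  push Not at hn
  have : (Finset.univ.filter fun a => ε a = 0) = {a} := by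
    ext b
    simp only [Finset.mem_filter, Finset.mem_univ, true_and, Finset.mem_singleton]
    exact ⟨fun hb => by_contra fun hne => hn b hne hb, fun hb => hb ▸ ha⟩
  have := card_eq_two_mul_add h
  simp_all
  omega

/-- The parity projection must not remove the ground state. Without zero modes the Fermi sea
contains half of the modes, an even number because four divides their total, so both terms are 1;
with zero modes the second term vanishes and the first is positive. -/
theorem groundWeight_pos {ε : ι → ℝ} (h : ∑ a, ε a / |ε a| = 0) (h4 : 4 ∣ Fintype.card ι) :
    0 < groundWeight ε := by
  rw [groundWeight, Finset.sum_pair (by norm_num)]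
  have h1 : 1 ≤ ∏ a, modeWeight 1 (ε a) := by
    rw [← Finset.prod_const_one (s := (Finset.univ : Finset ι))]
    refine Finset.prod_le_prod (fun _ _ => zero_le_one) fun a _ => ?_
    unfold modeWeight
    rcases lt_trichotomy (ε a) 0 with hx | hx | hx
    · simp [hx.le, hx.not_ge]
    · simp [hx]
    · simp [hx.le, hx.not_ge]
  have h2 : 0 ≤ ∏ a, modeWeight (-1) (ε a) := by
    by_cases hz : ∃ a, ε a = 0
    · obtain ⟨a, ha⟩ := hz
      rw [Finset.prod_eq_zero (Finset.mem_univ a) (by rw [ha, modeWeight_zero])]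
    · push Not at hz
      have e : ∀ a, modeWeight (-1) (ε a) = if ε a < 0 then -1 else 1 := by
        intro a
        unfold modeWeight
        rcases lt_or_gt_of_ne (hz a) with hx | hx <;> simp [hx, hx.le, hx.not_ge, hx.not_gt]
      simp only [e]
      rw [Finset.prod_ite, Finset.prod_const, Finset.prod_const_one, mul_one]
      have hc := card_eq_two_mul_add h
      have h0 : (Finset.univ.filter fun a => ε a = 0).card = 0 := by simpa using hz
      rw [h0] at hc
      have : Even (Finset.univ.filter fun a => ε a < 0).card := by
        rw [Nat.even_iff]
        omega
      rw [this.neg_one_pow]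
      norm_num
  linarith

open Classical in
/-- The zero temperature limit of a mixture of free fermion systems. -/
theorem tendsto_mixture {τ : Type*} [Fintype τ] {ε : τ → ι → ℝ} {P : τ → ℝ} {M : ℝ}
    {κ : τ → ι → ι → ℂ} {k : τ → ι → ℂ} (h4 : 4 ∣ Fintype.card ι) (h0 : ∀ σ, ∑ a, ε σ a = 0)
    (hM : ∀ σ, P σ + 1 / 2 * ∑ a, |ε σ a| ≤ M) (hκ : ∀ σ a, κ σ a a = 0)
    (hne : ∃ σ, P σ + 1 / 2 * ∑ a, |ε σ a| = M)
    (hsgn : ∀ σ, P σ + 1 / 2 * ∑ a, |ε σ a| = M → ∑ a, ε σ a / |ε σ a| = 0)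
    (hκ0 : ∀ σ, P σ + 1 / 2 * ∑ a, |ε σ a| = M →
      ∀ a b, ε σ a = 0 → ε σ b = 0 → κ σ a b = 0) :
    Tendsto (fun β : ℝ =>
      (∑ σ, (Real.exp (β * P σ) : ℂ) * ∑ η ∈ ({1, -1} : Finset ℝ),
        numerator η (ε σ) (κ σ) (k σ) β) /
      (∑ σ, Real.exp (β * P σ) * (∑ η ∈ ({1, -1} : Finset ℝ), partition η (ε σ) β) : ℝ)) atTop
      (𝓝 ((∑ σ with P σ + 1 / 2 * ∑ a, |ε σ a| = M,
          (groundWeight (ε σ) : ℂ) * groundResponse (ε σ) (κ σ) (k σ)) /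
        (∑ σ with P σ + 1 / 2 * ∑ a, |ε σ a| = M, groundWeight (ε σ) : ℝ))) := by
  set E : τ → ℝ := fun σ => P σ + 1 / 2 * ∑ a, |ε σ a| with hE
  have hη : ∀ η ∈ ({1, -1} : Finset ℝ), η = 1 ∨ η = -1 := by simp
  -- After multiplication of numerator and denominator by exp(-Mβ), the sector σ decays at the rate
  -- M - E σ.
  have hexp : ∀ σ β, Real.exp (-(M * β)) * Real.exp (β * P σ) =
      Real.exp (-((M - E σ) * β)) * Real.exp (-(β / 2 * ∑ a, |ε σ a|)) := by
    intro σ β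
    rw [← Real.exp_add, ← Real.exp_add, hE]
    congr 1
    ring
  have num : Tendsto (fun β : ℝ => (Real.exp (-(M * β)) : ℂ) *
      ∑ σ, (Real.exp (β * P σ) : ℂ) * ∑ η ∈ ({1, -1} : Finset ℝ),
        numerator η (ε σ) (κ σ) (k σ) β) atTop
      (𝓝 (∑ σ with E σ = M, (groundWeight (ε σ) : ℂ) * groundResponse (ε σ) (κ σ) (k σ))) := by
    rw [Finset.sum_filter]
    simp only [Finset.mul_sum]
    refine tendsto_finsetSum _ fun σ _ => ?_
    have e : ∀ (β : ℝ) (z : ℂ), (Real.exp (-(M * β)) : ℂ) * ((Real.exp (β * P σ) : ℂ) * z) =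
        (Real.exp (-((M - E σ) * β)) : ℂ) * ((Real.exp (-(β / 2 * ∑ a, |ε σ a|)) : ℂ) * z) := by
      intro β z
      rw [← mul_assoc, ← Complex.ofReal_mul, hexp, Complex.ofReal_mul, mul_assoc]
    simp only [e]
    split_ifs with hσ
    · simp only [hσ, sub_self, zero_mul, neg_zero, Real.exp_zero, Complex.ofReal_one, one_mul]
      rw [groundWeight, Complex.ofReal_sum, Finset.sum_mul]
      refine tendsto_finsetSum _ fun η hη' => ?_
      refine tendsto_exp_norm_numerator (h0 σ) ?_ (hκ σ) (hκ0 σ hσ) (k σ)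
      exact (hη η hη').imp id fun h => ⟨h, fun a ha => exists_zero_ne (hsgn σ hσ) h4 ha⟩
    · have h2 := tendsto_finsetSum ({1, -1} : Finset ℝ) fun η hη' =>
        tendsto_exp_norm_numerator_of_pos (h0 σ)
          (show |η| ≤ 1 by rcases hη η hη' with rfl | rfl <;> simp) (hκ σ) (k σ)
          (sub_pos.2 (lt_of_le_of_ne (hM σ) hσ))
      simpa only [Finset.sum_const_zero] using h2
  have den : Tendsto (fun β : ℝ => Real.exp (-(M * β)) *
      ∑ σ, Real.exp (β * P σ) * (∑ η ∈ ({1, -1} : Finset ℝ), partition η (ε σ) β)) atTop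
      (𝓝 (∑ σ with E σ = M, groundWeight (ε σ))) := by
    rw [Finset.sum_filter]
    simp only [Finset.mul_sum]
    refine tendsto_finsetSum _ fun σ _ => ?_
    simp only [← mul_assoc, hexp]
    simp only [mul_assoc, exp_norm_partition (h0 σ)]
    have hp : ∀ η, Tendsto (fun β => ∏ a, modeFactor η β (ε σ a)) atTop
        (𝓝 (∏ a, modeWeight η (ε σ a))) := fun η =>
      tendsto_finsetProd _ fun a _ => tendsto_modeFactor η (ε σ a)
    split_ifs with hσ
    · simp only [hσ, sub_self, zero_mul, neg_zero, Real.exp_zero, one_mul]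
      exact tendsto_finsetSum _ fun η _ => hp η
    · have := tendsto_exp_neg_mul (sub_pos.2 (lt_of_le_of_ne (hM σ) hσ)).le
      rw [if_neg (sub_pos.2 (lt_of_le_of_ne (hM σ) hσ)).ne'] at this
      have h2 := tendsto_finsetSum ({1, -1} : Finset ℝ) fun η _ => this.mul (hp η)
      simp only [zero_mul, Finset.sum_const_zero] at h2
      refine h2.congr fun β => Finset.sum_congr rfl fun η _ => ?_
      rw [mul_comm β]
  have hd : (∑ σ with E σ = M, groundWeight (ε σ)) ≠ 0 := by
    obtain ⟨σ, hσ⟩ := hne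
    refine (Finset.sum_pos (fun σ hσ => groundWeight_pos (hsgn σ (Finset.mem_filter.1 hσ).2) h4)
      ⟨σ, by simpa using hσ⟩).ne'
  have hd' : ((∑ σ with E σ = M, groundWeight (ε σ) : ℝ) : ℂ) ≠ 0 := Complex.ofReal_ne_zero.2 hd
  refine (num.div ((Complex.continuous_ofReal.tendsto _).comp den) hd').congr fun β => ?_
  show _ * _ / ((_ * _ : ℝ) : ℂ) = _
  rw [Complex.ofReal_mul]
  exact mul_div_mul_left _ _ (Complex.ofReal_ne_zero.2 (Real.exp_pos _).ne')

end GroundStates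
end
end Z2Gauge

namespace Z2Gauge
noncomputable section
open scoped Matrix

/-! ### Gauge fields as hopping matrices, and the optimal sectors -/

section GaugeHopping

variable {ℓ : ℕ}

theorem gaugeHopping_symm {L : ℕ} [NeZero L] (σ : Edge L → ℤˣ) (x y : Site L) :
    gaugeHopping σ x y = gaugeHopping σ y x := by
  simp only [gaugeHopping, Matrix.of_apply]
  exact Finset.sum_congr rfl fun μ _ => add_comm _ _

theorem step_ne {x : Site (4 * (ℓ + 1))} : x ≠ x + (1, 0) + (1, 0) ∧ x ≠ x + (1, 0) + (0, 1) ∧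
    x + (1, 0) ≠ x + (0, 1) ∧ x ≠ x + (0, 1) + (0, 1) ∧ x ≠ x + (0, 1) + (1, 0) := by
  have h1 : (1 : ZMod (4 * (ℓ + 1))) ≠ 0 := by
    exact_mod_cast natCast_ne_zero (ℓ := ℓ) (n := 1) (by omega) (by omega)
  have h2 : (1 + 1 : ZMod (4 * (ℓ + 1))) ≠ 0 := by
    have := natCast_ne_zero (ℓ := ℓ) (n := 1 + 1) (by omega) (by omega)
    push_cast at this
    exact this
  refine ⟨?_, ?_, ?_, ?_, ?_⟩ <;>
  · intro h
    rw [Prod.ext_iff] at h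
    simp [add_assoc] at h
    simp_all

theorem gaugeHopping_horizontal (σ : Edge (4 * (ℓ + 1)) → ℤˣ) (x : Site (4 * (ℓ + 1))) :
    gaugeHopping σ x (x + (1, 0)) = ((σ (x, 0) : ℤˣ) : ℤ) := by
  obtain ⟨h1, h2, h3, -, -⟩ := step_ne (x := x)
  simp only [gaugeHopping, Matrix.of_apply, Fin.sum_univ_two, unitStep, if_true, one_ne_zero,
    if_false, h1, h2, h3, add_zero]

theorem gaugeHopping_vertical (σ : Edge (4 * (ℓ + 1)) → ℤˣ) (x : Site (4 * (ℓ + 1))) :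
    gaugeHopping σ x (x + (0, 1)) = ((σ (x, 1) : ℤˣ) : ℤ) := by
  obtain ⟨-, -, h3, h4, h5⟩ := step_ne (x := x)
  simp only [gaugeHopping, Matrix.of_apply, Fin.sum_univ_two, unitStep, if_true, one_ne_zero,
    if_false, h3.symm, h4, h5, add_zero, zero_add]

theorem gaugeHopping_eq_zero {L : ℕ} [NeZero L] (σ : Edge L → ℤˣ) {x y : Site L}
    (h1 : y ≠ x + (1, 0)) (h2 : y ≠ x + (0, 1)) (h3 : x ≠ y + (1, 0)) (h4 : x ≠ y + (0, 1)) :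
    gaugeHopping σ x y = 0 := by
  simp [gaugeHopping, Fin.sum_univ_two, unitStep, h1, h2, h3, h4]

theorem cast_units_sq (u : ℤˣ) : (((u : ℤˣ) : ℤ) : ℝ) * ((u : ℤˣ) : ℤ) = 1 := by
  rcases Int.units_eq_one_or u with rfl | rfl <;> norm_num

theorem isHopping_gaugeHopping (σ : Edge (4 * (ℓ + 1)) → ℤˣ) : IsHopping (gaugeHopping σ) where
  symm := gaugeHopping_symm σ
  horizontal x := by rw [gaugeHopping_horizontal, cast_units_sq]
  vertical x := by rw [gaugeHopping_vertical, cast_units_sq]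
  eq_zero _ _ := gaugeHopping_eq_zero σ

theorem flux_gaugeHopping (σ : Edge (4 * (ℓ + 1)) → ℤˣ) (x : Site (4 * (ℓ + 1))) :
    flux (gaugeHopping σ) x = ((σ (x, 0) * σ (x + unitStep _ 0, 1) * σ (x + unitStep _ 1, 0) *
      σ (x, 1) : ℤˣ) : ℤ) := by
  have e1 : x + (1, 1) = x + (1, 0) + (0, 1) := by rw [add_assoc]; simp
  have e2 : x + (1, 1) = x + (0, 1) + (1, 0) := by rw [add_assoc]; simp
  rw [flux, gaugeHopping_symm σ (x + (1, 1)), gaugeHopping_symm σ (x + (0, 1)) x,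
    gaugeHopping_horizontal, gaugeHopping_vertical]
  nth_rw 1 [e1]
  rw [e2, gaugeHopping_vertical, gaugeHopping_horizontal]
  simp [unitStep]

theorem plaquetteSum_eq (σ : Edge (4 * (ℓ + 1)) → ℤˣ) :
    (plaquetteSum σ : ℝ) = ∑ x, flux (gaugeHopping σ) x := by
  simp only [flux_gaugeHopping, plaquetteSum, Int.cast_sum]

theorem IsHopping.exists_gaugeHopping
    {K : Matrix (Site (4 * (ℓ + 1))) (Site (4 * (ℓ + 1))) ℝ} (hK : IsHopping K) :
    ∃ σ : Edge (4 * (ℓ + 1)) → ℤˣ, gaugeHopping σ = K := by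
  have key : ∀ r : ℝ, r * r = 1 → (((if r = 1 then 1 else -1 : ℤˣ) : ℤ) : ℝ) = r := by
    intro r hr
    rcases mul_self_eq_one_iff.1 hr with rfl | rfl <;> norm_num
  set σ : Edge (4 * (ℓ + 1)) → ℤˣ := fun e =>
    if K e.1 (e.1 + unitStep _ e.2) = 1 then 1 else -1
  have hx : ∀ x, gaugeHopping σ x (x + (1, 0)) = K x (x + (1, 0)) := fun x => by
    rw [gaugeHopping_horizontal]
    exact key _ (hK.horizontal x)
  have hy : ∀ x, gaugeHopping σ x (x + (0, 1)) = K x (x + (0, 1)) := fun x => by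
    rw [gaugeHopping_vertical]
    exact key _ (hK.vertical x)
  refine ⟨σ, ?_⟩
  ext x y
  by_cases h1 : y = x + (1, 0)
  · rw [h1, hx]
  by_cases h2 : y = x + (0, 1)
  · rw [h2, hy]
  by_cases h3 : x = y + (1, 0)
  · rw [gaugeHopping_symm, hK.symm, h3, hx]
  by_cases h4 : x = y + (0, 1)
  · rw [gaugeHopping_symm, hK.symm, h4, hy]
  rw [gaugeHopping_eq_zero σ h1 h2 h3 h4, hK.eq_zero x y h1 h2 h3 h4]

open Classical in
theorem sum_flux_eq {K : Matrix (Site (4 * (ℓ + 1))) (Site (4 * (ℓ + 1))) ℝ} (hK : IsHopping K) :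
    ∑ x, flux K x = 2 * (∑ x, if flux K x = 1 then (1 : ℝ) else 0) -
      Fintype.card (Site (4 * (ℓ + 1))) := by
  rw [Finset.mul_sum, ← Finset.card_univ, ← nsmul_one (A := ℝ), ← Finset.sum_const,
    ← Finset.sum_sub_distrib]
  refine Finset.sum_congr rfl fun x _ => ?_
  rcases hK.flux_eq x with h | h <;> rw [h] <;> norm_num

/-- For a large hopping parameter the energy is minimized in gauge fields of flux `-1` through all
plaquettes only. -/
theorem exists_max_sector (hℓ : 1 ≤ ℓ) {t : ℝ} (ht : 800 < t) :
    ∃ M : ℝ, (∀ σ : Edge (4 * (ℓ + 1)) → ℤˣ,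
        plaquetteSum σ + t / 2 * traceNorm (gaugeHopping σ) ≤ M) ∧
      (∃ σ : Edge (4 * (ℓ + 1)) → ℤˣ, plaquetteSum σ + t / 2 * traceNorm (gaugeHopping σ) = M) ∧
      ∀ σ : Edge (4 * (ℓ + 1)) → ℤˣ, plaquetteSum σ + t / 2 * traceNorm (gaugeHopping σ) = M →
        ∀ x, flux (gaugeHopping σ) x = -1 := by
  classical
  obtain ⟨K₀, h1, h2, h3⟩ := exists_traceNorm_gap hℓ
  obtain ⟨σ₀, rfl⟩ := h1.exists_gaugeHopping
  have hn : ∀ σ : Edge (4 * (ℓ + 1)) → ℤˣ,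
      0 ≤ ∑ x, if flux (gaugeHopping σ) x = 1 then (1 : ℝ) else 0 := fun σ =>
    Finset.sum_nonneg fun x _ => by split_ifs <;> norm_num
  have h0 : ∑ x, (if flux (gaugeHopping σ₀) x = 1 then (1 : ℝ) else 0) = 0 :=
    Finset.sum_eq_zero fun x _ => by rw [h2]; norm_num
  -- A plaquette of flux 1 instead of -1 gains 2 in the plaquette sum and costs at least 0.005 t/2
  -- in the fermionic term; the cost is larger for t > 800.
  refine ⟨plaquetteSum σ₀ + t / 2 * traceNorm (gaugeHopping σ₀), fun σ => ?_, ⟨σ₀, rfl⟩,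
    fun σ hσ x => ?_⟩
  · have := h3 _ (isHopping_gaugeHopping σ)
    rw [plaquetteSum_eq, plaquetteSum_eq, sum_flux_eq (isHopping_gaugeHopping σ), sum_flux_eq h1, h0]
    nlinarith [hn σ]
  · have := h3 _ (isHopping_gaugeHopping σ)
    rw [plaquetteSum_eq, plaquetteSum_eq, sum_flux_eq (isHopping_gaugeHopping σ), sum_flux_eq h1,
      h0] at hσ
    have hz : ∑ x, (if flux (gaugeHopping σ) x = 1 then (1 : ℝ) else 0) = 0 := by
      nlinarith [hn σ]
    rw [Finset.sum_eq_zero_iff_of_nonneg fun x _ => by split_ifs <;> norm_num] at hz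
    have hx := hz x (Finset.mem_univ x)
    rcases (isHopping_gaugeHopping σ).flux_eq x with h | h
    · rw [if_pos h] at hx
      norm_num at hx
    · exact h

end GaugeHopping

/-! ### One particle matrices of the current and diamagnetic operators -/

section CurrentMatrices

variable {ℓ : ℕ}

/-- The plane wave that depends on the vertical coordinate. -/
def waveMatrix (L : ℕ) [NeZero L] (p : ℝ) : Matrix (Site L) (Site L) ℂ :=
  Matrix.diagonal fun x => Complex.exp (-(Complex.I * p * (x.2.val : ℝ)))

/-- The translations of the lattice in a gauge field. -/
def gaugeTranslation {L : ℕ} [NeZero L] (v : Site L) (σ : Edge L → ℤˣ) :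
    Matrix (Site L) (Site L) ℂ :=
  (translation v (gaugeHopping σ)).map Complex.ofReal

theorem gaugeTranslation_horizontal (σ : Edge (4 * (ℓ + 1)) → ℤˣ) (x y : Site (4 * (ℓ + 1))) :
    gaugeTranslation (1, 0) σ x y = if x = y + (1, 0) then (((σ (y, 0) : ℤˣ) : ℤ) : ℂ) else 0 := by
  rw [gaugeTranslation, Matrix.map_apply, translation, Matrix.of_apply]
  split_ifs with h
  · rw [h, gaugeHopping_symm, gaugeHopping_horizontal]
    simp
  · simp

/-- A horizontal hop does not change the vertical coordinate, so the phase can be placed to the left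
for both directions of hopping. The sign s is -1 for the current and 1 for the diamagnetic operator.
-/
theorem edgeMatrix_horizontal (u : Edge (4 * (ℓ + 1)) → ℂ) (s : ℂ) (p : ℝ)
    (hu0 : ∀ x, u (x, 0) = Complex.exp (-(Complex.I * p * (x.2.val : ℝ)))) (hu1 : ∀ x, u (x, 1) = 0)
    (r : ℂ) (σ : Edge (4 * (ℓ + 1)) → ℤˣ) :
    edgeMatrix (fun e => r * u e * ((σ e : ℤˣ) : ℤ)) (fun e => s * r * u e * ((σ e : ℤˣ) : ℤ)) =
      r • (waveMatrix _ p * (gaugeTranslation (1, 0) σ + s • (gaugeTranslation (1, 0) σ)ᵀ)) := by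
  ext x y
  rw [Matrix.smul_apply, waveMatrix, Matrix.diagonal_mul, Matrix.add_apply, Matrix.smul_apply,
    Matrix.transpose_apply, gaugeTranslation_horizontal, gaugeTranslation_horizontal, edgeMatrix,
    Matrix.of_apply, Fin.sum_univ_two]
  simp only [hu0, hu1, unitStep, if_true, one_ne_zero, if_false, mul_zero, zero_mul, ite_self,
    add_zero, smul_eq_mul]
  by_cases h1 : y = x + (1, 0) <;> by_cases h2 : x = y + (1, 0)
  · rw [h1] at h2
    exact absurd h2 step_ne.1
  · rw [if_pos h1, if_neg h2, if_neg h2, if_pos h1]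
    ring
  · have : x.2 = y.2 := by rw [h2]; simp
    rw [if_neg h1, if_pos h2, if_pos h2, if_neg h1, this]
    ring
  · rw [if_neg h1, if_neg h2, if_neg h2, if_neg h1]
    ring

theorem currentMatrix_eq (t q p : ℝ) (σ : Edge (4 * (ℓ + 1)) → ℤˣ) :
    currentMatrix t q p σ = (Complex.I * q * t) • (waveMatrix _ p *
      (gaugeTranslation (1, 0) σ - (gaugeTranslation (1, 0) σ)ᵀ)) := by
  have := edgeMatrix_horizontal (bondPhase p) (-1) p (fun x => by simp [bondPhase])
    (fun x => by simp [bondPhase]) (Complex.I * q * t) σ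
  rw [neg_one_smul, ← sub_eq_add_neg] at this
  rw [← this, currentMatrix]
  simp only [neg_mul, one_mul]

theorem diamagneticMatrix_eq (t q p : ℝ) (σ : Edge (4 * (ℓ + 1)) → ℤˣ) :
    diamagneticMatrix t q p (-p) σ = (-(q ^ 2 * t) : ℂ) •
      (gaugeTranslation (1, 0) σ + (gaugeTranslation (1, 0) σ)ᵀ) := by
  have := edgeMatrix_horizontal (fun e => bondPhase p e * bondPhase (-p) e) 1 0
    (fun x => by rw [bondPhase, bondPhase, if_pos rfl, if_pos rfl, ← Complex.exp_add]; simp)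
    (fun x => by simp [bondPhase]) (-(q ^ 2 * t)) σ
  have hw : waveMatrix (4 * (ℓ + 1)) 0 = 1 := by simp [waveMatrix]
  rw [hw, one_smul, Matrix.one_mul] at this
  rw [← this, diamagneticMatrix]
  simp only [one_mul]
  congr 1 <;> funext e <;> ring

end CurrentMatrices
end
end Z2Gauge

namespace Z2Gauge
noncomputable section
open scoped Matrix

/-! ### Spectral sums by means of projections -/

section SpectralSums

variable {ι κ : Type*} [Fintype ι] [DecidableEq ι] [Fintype κ] {V : Matrix ι ι ℝ}

theorem map_orthogonal (hV : V * Vᵀ = 1) :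
    V.map Complex.ofReal * (V.map Complex.ofReal)ᵀ = 1 := by
  rw [← Matrix.transpose_map]
  have := congrArg (fun M : Matrix ι ι ℝ => M.map Complex.ofReal) hV
  simp only [Matrix.map_one Complex.ofReal Complex.ofReal_zero Complex.ofReal_one] at this
  rw [← this]
  exact (Matrix.map_mul (f := Complex.ofRealHom)).symm

theorem inBasis_mul (hV : V * Vᵀ = 1) (A B : Matrix ι ι ℂ) :
    inBasis V (A * B) = inBasis V A * inBasis V B := by
  have h := map_orthogonal hV
  simp only [inBasis]
  calc _ = (V.map Complex.ofReal)ᵀ * A * 1 * B * V.map Complex.ofReal := by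
        simp only [Matrix.mul_assoc, Matrix.one_mul]
    _ = _ := by rw [← h]; simp only [Matrix.mul_assoc]

theorem inBasis_sum (V : Matrix ι ι ℝ) (f : κ → Matrix ι ι ℂ) :
    inBasis V (∑ k, f k) = ∑ k, inBasis V (f k) := by
  simp only [inBasis, Finset.mul_sum, Finset.sum_mul]

theorem inBasis_smul (V : Matrix ι ι ℝ) (r : ℂ) (A : Matrix ι ι ℂ) :
    inBasis V (r • A) = r • inBasis V A := by
  simp [inBasis]

theorem trace_inBasis (hV : V * Vᵀ = 1) (A : Matrix ι ι ℂ) : (inBasis V A).trace = A.trace := by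
  rw [inBasis, Matrix.mul_assoc, Matrix.trace_mul_comm, Matrix.mul_assoc, map_orthogonal hV,
    Matrix.mul_one]

variable {lam : ι → ℝ} {K : Matrix ι ι ℂ}

/-- The range of X lies in the eigenspace of K² for e². No explicit eigenvectors of K are used: only
the moduli of the eigenvalues are seen through K², which is why the sums below have weights that
depend on moduli alone. -/
theorem inBasis_apply_eq_zero_left (hV : V * Vᵀ = 1)
    (hK : inBasis V K = Matrix.diagonal fun a => (lam a : ℂ)) {X : Matrix ι ι ℂ} {e : ℝ}
    (he : 0 ≤ e) (hX : K * K * X = ((e ^ 2 : ℝ) : ℂ) • X) {a b : ι} (ha : |lam a| ≠ e) :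
    inBasis V X a b = 0 := by
  have h := congrArg (inBasis V) hX
  rw [inBasis_mul hV, inBasis_mul hV, hK, inBasis_smul, Matrix.diagonal_mul_diagonal] at h
  have h2 := congrFun (congrFun h a) b
  rw [Matrix.diagonal_mul, Matrix.smul_apply, smul_eq_mul] at h2
  have h3 : ((lam a : ℂ) * lam a - ((e ^ 2 : ℝ) : ℂ)) * inBasis V X a b = 0 := by
    linear_combination h2
  refine (mul_eq_zero.1 h3).resolve_left fun h4 => ha ?_
  have h5 : lam a * lam a = e ^ 2 := by
    have : ((lam a * lam a - e ^ 2 : ℝ) : ℂ) = 0 := by push_cast; push_cast at h4; exact h4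
    linarith [Complex.ofReal_eq_zero.1 this]
  rw [← abs_of_nonneg he]
  exact (sq_eq_sq_iff_abs_eq_abs _ _).1 (by rw [pow_two, h5])

theorem inBasis_apply_eq_zero_right (hV : V * Vᵀ = 1)
    (hK : inBasis V K = Matrix.diagonal fun a => (lam a : ℂ)) {X : Matrix ι ι ℂ} {e : ℝ}
    (he : 0 ≤ e) (hX : X * (K * K) = ((e ^ 2 : ℝ) : ℂ) • X) {a b : ι} (hb : |lam b| ≠ e) :
    inBasis V X a b = 0 := by
  have h := congrArg (inBasis V) hX
  rw [inBasis_mul hV, inBasis_mul hV, hK, inBasis_smul, Matrix.diagonal_mul_diagonal] at h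
  have h2 := congrFun (congrFun h a) b
  rw [Matrix.mul_diagonal, Matrix.smul_apply, smul_eq_mul] at h2
  have h3 : ((lam b : ℂ) * lam b - ((e ^ 2 : ℝ) : ℂ)) * inBasis V X a b = 0 := by
    linear_combination h2
  refine (mul_eq_zero.1 h3).resolve_left fun h4 => hb ?_
  have h5 : lam b * lam b = e ^ 2 := by
    have : ((lam b * lam b - e ^ 2 : ℝ) : ℂ) = 0 := by push_cast; push_cast at h4; exact h4
    linarith [Complex.ofReal_eq_zero.1 this]
  rw [← abs_of_nonneg he]
  exact (sq_eq_sq_iff_abs_eq_abs _ _).1 (by rw [pow_two, h5])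

variable {E : κ → Matrix ι ι ℂ} {e e' : κ → ℝ}

/-- Sums over pairs of eigenvectors of a function of the moduli of the eigenvalues. -/
theorem sum_pairs_eq (hV : V * Vᵀ = 1)
    (hK : inBasis V K = Matrix.diagonal fun a => (lam a : ℂ)) (hE : ∑ k, E k = 1)
    (he : ∀ k, 0 ≤ e k) (he' : ∀ k, 0 ≤ e' k)
    (hKE : ∀ k, K * K * E k = ((e k ^ 2 : ℝ) : ℂ) • E k) {m m' : Matrix ι ι ℂ}
    (hm : ∀ k, K * K * (m * E k) = ((e' k ^ 2 : ℝ) : ℂ) • (m * E k)) (G : ℝ → ℝ → ℂ) :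
    ∑ a, ∑ b, inBasis V m a b * inBasis V m' b a * G |lam a| |lam b| =
      ∑ k, G (e' k) (e k) * (m * E k * m').trace := by
  -- Inserting the resolution of the identity in front of m' confines the eigenvalue of b to modulus
  -- e k.
  have h1 : ∀ a b, inBasis V m' b a * G |lam a| |lam b| =
      ∑ k, inBasis V (E k * m') b a * G |lam a| (e k) := by
    intro a b
    have : inBasis V m' = ∑ k, inBasis V (E k * m') := by
      rw [← inBasis_sum, ← Finset.sum_mul, hE, Matrix.one_mul]
    nth_rw 1 [this]
    rw [Matrix.sum_apply, Finset.sum_mul]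
    refine Finset.sum_congr rfl fun k _ => ?_
    by_cases hb : |lam b| = e k
    · rw [hb]
    · have hX : K * K * (E k * m') = ((e k ^ 2 : ℝ) : ℂ) • (E k * m') := by
        rw [← Matrix.mul_assoc, hKE, Matrix.smul_mul]
      rw [inBasis_apply_eq_zero_left hV hK (he k) hX hb, zero_mul, zero_mul]
  have h2 : ∀ k a, inBasis V (m * E k * m') a a * G |lam a| (e k) =
      inBasis V (m * E k * m') a a * G (e' k) (e k) := by
    intro k a
    by_cases ha : |lam a| = e' k
    · rw [ha]
    · have hX : K * K * (m * E k * m') = ((e' k ^ 2 : ℝ) : ℂ) • (m * E k * m') := by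
        rw [← Matrix.mul_assoc, hm, Matrix.smul_mul]
      rw [inBasis_apply_eq_zero_left hV hK (he' k) hX ha, zero_mul, zero_mul]
  calc _ = ∑ a, ∑ b, ∑ k, inBasis V m a b * inBasis V (E k * m') b a * G |lam a| (e k) := by
        refine Finset.sum_congr rfl fun a _ => Finset.sum_congr rfl fun b _ => ?_
        rw [mul_assoc, h1, Finset.mul_sum]
        exact Finset.sum_congr rfl fun k _ => (mul_assoc _ _ _).symm
    _ = ∑ k, ∑ a, (∑ b, inBasis V m a b * inBasis V (E k * m') b a) * G |lam a| (e k) := by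
        rw [Finset.sum_comm]
        simp only [Finset.sum_mul]
        rw [Finset.sum_comm]
        rw [show ∑ y, ∑ x, ∑ k, inBasis V m y x * inBasis V (E k * m') x y * G |lam y| (e k) =
          ∑ y, ∑ k, ∑ x, inBasis V m y x * inBasis V (E k * m') x y * G |lam y| (e k) from
          Finset.sum_congr rfl fun y _ => Finset.sum_comm]
        rw [Finset.sum_comm]
    _ = ∑ k, ∑ a, inBasis V (m * E k * m') a a * G (e' k) (e k) := by
        refine Finset.sum_congr rfl fun k _ => Finset.sum_congr rfl fun a _ => ?_
        rw [← Matrix.mul_apply, ← inBasis_mul hV, ← Matrix.mul_assoc, h2]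
    _ = _ := by
        refine Finset.sum_congr rfl fun k _ => ?_
        rw [← Finset.sum_mul, mul_comm, ← trace_inBasis hV]
        rfl

theorem sum_single_eq (hV : V * Vᵀ = 1)
    (hK : inBasis V K = Matrix.diagonal fun a => (lam a : ℂ)) (hE : ∑ k, E k = 1)
    (he : ∀ k, 0 ≤ e k) (hKE : ∀ k, K * K * E k = ((e k ^ 2 : ℝ) : ℂ) • E k) (m : Matrix ι ι ℂ)
    (G : ℝ → ℂ) :
    ∑ a, inBasis V m a a * G |lam a| = ∑ k, G (e k) * (E k * m).trace := by
  have h1 : ∀ a, inBasis V m a a * G |lam a| = ∑ k, inBasis V (E k * m) a a * G (e k) := by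
    intro a
    have : inBasis V m = ∑ k, inBasis V (E k * m) := by
      rw [← inBasis_sum, ← Finset.sum_mul, hE, Matrix.one_mul]
    nth_rw 1 [this]
    rw [Matrix.sum_apply, Finset.sum_mul]
    refine Finset.sum_congr rfl fun k _ => ?_
    by_cases hb : |lam a| = e k
    · rw [hb]
    · have hX : K * K * (E k * m) = ((e k ^ 2 : ℝ) : ℂ) • (E k * m) := by
        rw [← Matrix.mul_assoc, hKE, Matrix.smul_mul]
      rw [inBasis_apply_eq_zero_left hV hK (he k) hX hb, zero_mul, zero_mul]
  simp only [h1]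
  rw [Finset.sum_comm]
  refine Finset.sum_congr rfl fun k _ => ?_
  rw [← Finset.sum_mul, mul_comm, ← trace_inBasis hV]
  rfl

/-- Each projection either does not meet the kernel of K, or is mapped by m into an eigenspace of K²
with nonzero eigenvalue. -/
theorem inBasis_eq_zero_of_kernel (hV : V * Vᵀ = 1)
    (hK : inBasis V K = Matrix.diagonal fun a => (lam a : ℂ)) (hE : ∑ k, E k = 1)
    (he : ∀ k, 0 ≤ e k) (he' : ∀ k, 0 ≤ e' k)
    (hEK : ∀ k, E k * (K * K) = ((e k ^ 2 : ℝ) : ℂ) • E k) {m : Matrix ι ι ℂ}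
    (hm : ∀ k, K * K * (m * E k) = ((e' k ^ 2 : ℝ) : ℂ) • (m * E k))
    (hne : ∀ k, e k = 0 → e' k ≠ 0) {a b : ι} (ha : lam a = 0) (hb : lam b = 0) :
    inBasis V m a b = 0 := by
  have : inBasis V m = ∑ k, inBasis V (m * E k) := by
    rw [← inBasis_sum, ← Finset.mul_sum, hE, Matrix.mul_one]
  rw [this, Matrix.sum_apply]
  refine Finset.sum_eq_zero fun k _ => ?_
  by_cases hk : e k = 0
  · refine inBasis_apply_eq_zero_left hV hK (he' k) (hm k) ?_
    rw [ha, abs_zero]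
    exact (hne k hk).symm
  · refine inBasis_apply_eq_zero_right hV hK (he k) ?_ ?_ (e := e k)
    · rw [Matrix.mul_assoc, hEK, Matrix.mul_smul]
    · rw [hb, abs_zero]
      exact Ne.symm hk

end SpectralSums

/-! ### Algebra of anticommuting translations -/

section MagneticTranslations

variable {ι : Type*} [Fintype ι] [DecidableEq ι]

/-- Anticommuting unitary translations `a`, `b` with inverses `a'`, `b'`. -/
structure IsMagnetic (a a' b b' : Matrix ι ι ℂ) : Prop where
  mul_a : a * a' = 1
  mul_b : b * b' = 1
  anti : a * b = -(b * a)

variable {a a' b b' E D D' : Matrix ι ι ℂ}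

theorem IsMagnetic.mul_a' (h : IsMagnetic a a' b b') : a' * a = 1 := mul_eq_one_comm.1 h.mul_a

theorem IsMagnetic.mul_b' (h : IsMagnetic a a' b b') : b' * b = 1 := mul_eq_one_comm.1 h.mul_b

theorem IsMagnetic.swap (h : IsMagnetic a a' b b') : IsMagnetic b b' a a' :=
  ⟨h.mul_b, h.mul_a, by rw [h.anti, neg_neg]⟩

theorem IsMagnetic.invLeft (h : IsMagnetic a a' b b') : IsMagnetic a' a b b' := by
  refine ⟨h.mul_a', h.mul_b, ?_⟩
  calc a' * b = a' * b * (a * a') := by rw [h.mul_a, Matrix.mul_one]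
    _ = a' * (b * a) * a' := by simp only [Matrix.mul_assoc]
    _ = -(a' * (a * b) * a') := by rw [h.anti]; simp
    _ = -((a' * a) * (b * a')) := by simp only [Matrix.mul_assoc]
    _ = -(b * a') := by rw [h.mul_a', Matrix.one_mul]

theorem IsMagnetic.invRight (h : IsMagnetic a a' b b') : IsMagnetic a a' b' b :=
  h.swap.invLeft.swap

/-- Anticommutation removes all mixed products; what is left are the squares, which commute with
both translations. -/
theorem IsMagnetic.sq (h : IsMagnetic a a' b b') : (a + a' + b + b') * (a + a' + b + b') =
    a * a + a' * a' + b * b + b' * b' + (4 : ℂ) • 1 := by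
  have e : (a + a' + b + b') * (a + a' + b + b') = a * a + a' * a' + b * b + b' * b' +
      (a * a' + a' * a + b * b' + b' * b) + (a * b + b * a) + (a * b' + b' * a) +
      (a' * b + b * a') + (a' * b' + b' * a') := by noncomm_ring
  rw [e, h.anti, h.invRight.anti, h.invLeft.anti, h.invLeft.invRight.anti, h.mul_a, h.mul_a',
    h.mul_b, h.mul_b']
  simp only [neg_add_cancel, add_zero]
  congr 1
  rw [show (4 : ℂ) = 1 + 1 + 1 + 1 by norm_num]
  simp only [add_smul, one_smul]

theorem IsMagnetic.commute_sq (h : IsMagnetic a a' b b') : a * (b * b) = b * b * a := by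
  rw [← Matrix.mul_assoc, h.anti, Matrix.neg_mul, Matrix.mul_assoc, h.anti, Matrix.mul_neg,
    neg_neg, Matrix.mul_assoc]

/-- Conjugation by b preserves E and reverses the sign of a. -/
theorem IsMagnetic.trace_mul (h : IsMagnetic a a' b b') (hb : b * E = E * b) :
    (E * a).trace = 0 := by
  have : (E * a).trace = -(E * a).trace := by
    calc (E * a).trace = (E * a * (b * b')).trace := by rw [h.mul_b, Matrix.mul_one]
      _ = (E * (a * b) * b').trace := by simp only [Matrix.mul_assoc]
      _ = -(E * b * a * b').trace := by
          rw [h.anti, Matrix.mul_neg, Matrix.neg_mul, Matrix.trace_neg]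
          simp only [Matrix.mul_assoc]
      _ = -(b' * (b * E * a)).trace := by rw [← hb, Matrix.trace_mul_comm]
      _ = -(b' * b * (E * a)).trace := by simp only [Matrix.mul_assoc]
      _ = _ := by rw [h.mul_b', Matrix.one_mul]
  exact self_eq_neg.1 this

theorem IsMagnetic.trace_mul_mul (h : IsMagnetic a a' b b') (hb : b * E = E * b) :
    (E * (a * b)).trace = 0 := by
  have : (E * (a * b)).trace = -(E * (a * b)).trace := by
    calc (E * (a * b)).trace = (b * (E * a)).trace := by
          rw [← Matrix.mul_assoc, Matrix.trace_mul_comm]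
      _ = (E * (b * a)).trace := by rw [← Matrix.mul_assoc, hb, Matrix.mul_assoc]
      _ = _ := by rw [h.swap.anti, Matrix.mul_neg, Matrix.trace_neg]
  exact self_eq_neg.1 this

theorem inv_sq_mul {z z' : ℂ} (ha : a' * a = 1) (hz : z * z' = 1) (h : a * a * E = z • E) :
    a' * a' * E = z' • E := by
  have h1 : a' * a' * (a * a * E) = E := by
    calc _ = a' * (a' * a) * a * E := by simp only [Matrix.mul_assoc]
      _ = E := by rw [ha, Matrix.mul_one, ha, Matrix.one_mul]
  rw [h, Matrix.mul_smul] at h1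
  calc a' * a' * E = (z' * z) • (a' * a' * E) := by rw [mul_comm, hz, one_smul]
    _ = _ := by rw [mul_smul, h1]

/-- A joint spectral projection of the squares of magnetic translations. -/
structure IsBand (a a' b b' E : Matrix ι ι ℂ) (z z' w w' : ℂ) : Prop extends
    IsMagnetic a a' b b' where
  comm_a : a * E = E * a
  comm_b : b * E = E * b
  sq_a : a * a * E = z • E
  sq_b : b * b * E = w • E
  inv_z : z * z' = 1
  inv_w : w * w' = 1

variable {z z' w w' : ℂ}

theorem comm_inv (h1 : a * a' = 1) (h2 : a' * a = 1) (h : a * E = E * a) : a' * E = E * a' := by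
  calc a' * E = a' * E * (a * a') := by rw [h1, Matrix.mul_one]
    _ = a' * (a * E) * a' := by rw [h]; simp only [Matrix.mul_assoc]
    _ = (a' * a) * (E * a') := by simp only [Matrix.mul_assoc]
    _ = _ := by rw [h2, Matrix.one_mul]

theorem IsBand.comm_a' (h : IsBand a a' b b' E z z' w w') : a' * E = E * a' :=
  comm_inv h.mul_a h.mul_a' h.comm_a

theorem IsBand.comm_b' (h : IsBand a a' b b' E z z' w w') : b' * E = E * b' :=
  comm_inv h.mul_b h.mul_b' h.comm_b

theorem IsBand.sq_a' (h : IsBand a a' b b' E z z' w w') : a' * a' * E = z' • E :=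
  inv_sq_mul h.mul_a' h.inv_z h.sq_a

theorem IsBand.sq_b' (h : IsBand a a' b b' E z z' w w') : b' * b' * E = w' • E :=
  inv_sq_mul h.mul_b' h.inv_w h.sq_b

theorem IsBand.sq_mul (h : IsBand a a' b b' E z z' w w') :
    (a + a' + b + b') * (a + a' + b + b') * E = (z + z' + w + w' + 4) • E := by
  rw [h.sq]
  simp only [Matrix.add_mul, h.sq_a, h.sq_a', h.sq_b, h.sq_b', Matrix.smul_mul, Matrix.one_mul,
    add_smul]

theorem IsBand.mul_sq (h : IsBand a a' b b' E z z' w w') :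
    E * ((a + a' + b + b') * (a + a' + b + b')) = (z + z' + w + w' + 4) • E := by
  rw [← h.sq_mul]
  have : (a + a' + b + b') * E = E * (a + a' + b + b') := by
    simp only [Matrix.add_mul, Matrix.mul_add, h.comm_a, h.comm_a', h.comm_b, h.comm_b']
  rw [← Matrix.mul_assoc, ← this, Matrix.mul_assoc, ← this, ← Matrix.mul_assoc]

/-- `D'` shifts the quasimomentum of the translation `b` by the phase `u`. -/
structure IsBoost (a b D D' : Matrix ι ι ℂ) (u u' : ℂ) : Prop where
  mul_D : D * D' = 1
  comm : a * D' = D' * a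
  shift : b * D' = u • (D' * b)
  inv_u : u * u' = 1

variable {u u' : ℂ}

theorem IsBoost.shift' (h : IsBoost a b D D' u u') (h1 : b * b' = 1) (h2 : b' * b = 1) :
    b' * D' = u' • (D' * b') := by
  have e : b' * (b * D') * b' = D' * b' := by
    rw [← Matrix.mul_assoc, h2, Matrix.one_mul]
  rw [h.shift, Matrix.mul_smul, Matrix.smul_mul] at e
  rw [← e, smul_smul, mul_comm, h.inv_u, one_smul]
  simp only [Matrix.mul_assoc, h1, Matrix.mul_one]

/-- The factor a - a' commutes with all the squares and stays in the band; D' then multiplies the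
eigenvalue of the square of b by u². -/
theorem IsBand.sq_mul_boost (h : IsBand a a' b b' E z z' w w') (hD : IsBoost a b D D' u u') :
    (a + a' + b + b') * (a + a' + b + b') * (D' * (a - a') * E) =
      (z + z' + u ^ 2 * w + u' ^ 2 * w' + 4) • (D' * (a - a') * E) := by
  have ca := hD.comm
  have ca' := comm_inv h.mul_a h.mul_a' ca
  have hb := hD.shift
  have hb' := hD.shift' h.mul_b h.mul_b'
  have sa : a * a * D' = D' * (a * a) := by
    rw [Matrix.mul_assoc, ca, ← Matrix.mul_assoc, ca, Matrix.mul_assoc]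
  have sa' : a' * a' * D' = D' * (a' * a') := by
    rw [Matrix.mul_assoc, ca', ← Matrix.mul_assoc, ca', Matrix.mul_assoc]
  have sb : b * b * D' = u ^ 2 • (D' * (b * b)) := by
    rw [Matrix.mul_assoc, hb, Matrix.mul_smul, ← Matrix.mul_assoc, hb, Matrix.smul_mul, smul_smul,
      Matrix.mul_assoc, pow_two]
  have sb' : b' * b' * D' = u' ^ 2 • (D' * (b' * b')) := by
    rw [Matrix.mul_assoc, hb', Matrix.mul_smul, ← Matrix.mul_assoc, hb', Matrix.smul_mul,
      smul_smul, Matrix.mul_assoc, pow_two]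
  have ta : a * a * (a - a') * E = z • ((a - a') * E) := by
    have : a * a * (a - a') = (a - a') * (a * a) := by
      rw [Matrix.mul_sub, Matrix.sub_mul, Matrix.mul_assoc a a a', h.mul_a, Matrix.mul_one,
        ← Matrix.mul_assoc a' a a, h.mul_a', Matrix.one_mul, Matrix.mul_assoc]
    rw [this, Matrix.mul_assoc, h.sq_a, Matrix.mul_smul]
  have ta' : a' * a' * (a - a') * E = z' • ((a - a') * E) := by
    have : a' * a' * (a - a') = (a - a') * (a' * a') := by
      rw [Matrix.mul_sub, Matrix.sub_mul, Matrix.mul_assoc a' a' a, h.mul_a', Matrix.mul_one,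
        ← Matrix.mul_assoc a a' a', h.mul_a, Matrix.one_mul, Matrix.mul_assoc]
    rw [this, Matrix.mul_assoc, h.sq_a', Matrix.mul_smul]
  have tb : b * b * (a - a') * E = w • ((a - a') * E) := by
    rw [Matrix.mul_sub, ← h.commute_sq, ← h.invLeft.commute_sq, ← Matrix.sub_mul, Matrix.mul_assoc,
      h.sq_b, Matrix.mul_smul]
  have tb' : b' * b' * (a - a') * E = w' • ((a - a') * E) := by
    rw [Matrix.mul_sub, ← h.invRight.commute_sq, ← h.invRight.invLeft.commute_sq, ← Matrix.sub_mul,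
      Matrix.mul_assoc, h.sq_b', Matrix.mul_smul]
  have key : ∀ (M : Matrix ι ι ℂ) (r s : ℂ), M * D' = r • (D' * M) →
      M * (a - a') * E = s • ((a - a') * E) →
      M * (D' * (a - a') * E) = (r * s) • (D' * (a - a') * E) := by
    intro M r s h1 h2
    calc M * (D' * (a - a') * E) = M * D' * (a - a') * E := by simp only [Matrix.mul_assoc]
      _ = r • (D' * (M * (a - a') * E)) := by
          rw [h1, Matrix.smul_mul, Matrix.smul_mul]
          simp only [Matrix.mul_assoc]
      _ = _ := by rw [h2, Matrix.mul_smul, smul_smul, Matrix.mul_assoc]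
  rw [h.sq, Matrix.add_mul, Matrix.add_mul, Matrix.add_mul, Matrix.add_mul,
    key _ 1 z (by rw [sa, one_smul]) ta, key _ 1 z' (by rw [sa', one_smul]) ta',
    key _ _ w sb tb, key _ _ w' sb' tb', Matrix.smul_mul, Matrix.one_mul, one_mul, one_mul]
  simp only [add_smul]

theorem IsBand.trace_current (h : IsBand a a' b b' E z z' w w') (hD : IsBoost a b D D' u u') :
    (D' * (a - a') * E * (D * (a - a'))).trace = (z + z' - 2) * E.trace := by
  have hD' : D' * D = 1 := mul_eq_one_comm.1 hD.mul_D
  have ca : a * D = D * a := comm_inv hD' hD.mul_D hD.comm.symm |>.symm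
  have ca' : a' * D = D * a' := comm_inv h.mul_a h.mul_a' ca
  have e1 : D * (a - a') = (a - a') * D := by rw [Matrix.mul_sub, Matrix.sub_mul, ca, ca']
  have e2 : (a - a') * (a - a') * E = (z + z' - 2) • E := by
    have : (a - a') * (a - a') = a * a + a' * a' - (2 : ℂ) • 1 := by
      rw [Matrix.mul_sub, Matrix.sub_mul, Matrix.sub_mul, h.mul_a, h.mul_a', two_smul]
      abel
    rw [this, Matrix.sub_mul, Matrix.add_mul, h.sq_a, h.sq_a', Matrix.smul_mul, Matrix.one_mul,
      sub_smul, add_smul]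
  rw [e1, ← Matrix.mul_assoc, Matrix.trace_mul_comm]
  have : D * (D' * (a - a') * E * (a - a')) = (a - a') * E * (a - a') := by
    calc _ = (D * D') * ((a - a') * E * (a - a')) := by simp only [Matrix.mul_assoc]
      _ = _ := by rw [hD.mul_D, Matrix.one_mul]
  rw [this, Matrix.trace_mul_comm, ← Matrix.mul_assoc, e2, Matrix.trace_smul, smul_eq_mul]

/-- Moving D' to the left of the hopping matrix multiplies b and b' by phases, and moving a - a'
through the result changes their sign again. After D and D' have cancelled, the square of a - a' is
a number on E, and of the remaining quadratic words only those in a single translation have a trace.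
-/
theorem IsBand.trace_hopping_current (h : IsBand a a' b b' E z z' w w')
    (hD : IsBoost a b D D' u u') :
    ((a + a' + b + b') * (D' * (a - a')) * E * ((a + a' + b + b') * (D * (a - a')))).trace =
      (z + z' - 2) * (z + z' + 2 - (u * w + u' * w' + u + u')) * E.trace := by
  have hD' : D' * D = 1 := mul_eq_one_comm.1 hD.mul_D
  have ca : a * D = D * a := comm_inv hD' hD.mul_D hD.comm.symm |>.symm
  have ca' : a' * D = D * a' := comm_inv h.mul_a h.mul_a' ca
  have dS : D * (a - a') = (a - a') * D := by rw [Matrix.mul_sub, Matrix.sub_mul, ca, ca']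
  have cD' := comm_inv h.mul_a h.mul_a' hD.comm
  have hb := hD.shift
  have hb' := hD.shift' h.mul_b h.mul_b'
  set K := a + a' + b + b' with hKdef
  set S := a - a' with hS
  have kD : K * D' = D' * (a + a' + u • b + u' • b') := by
    rw [hKdef]
    simp only [Matrix.add_mul, Matrix.mul_add, Matrix.mul_smul, hD.comm, cD', hb, hb']
  have sB : S * (a + a' + u • b + u' • b') = (a + a' - u • b - u' • b') * S := by
    rw [hS]
    simp only [Matrix.sub_mul, Matrix.mul_sub, Matrix.add_mul, Matrix.mul_add, Matrix.mul_smul,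
      Matrix.smul_mul, h.anti, h.invLeft.anti, h.invRight.anti, h.invRight.invLeft.anti,
      h.mul_a, h.mul_a']
    module
  have e2 : S * S * E = (z + z' - 2) • E := by
    have : S * S = a * a + a' * a' - (2 : ℂ) • 1 := by
      rw [hS, Matrix.mul_sub, Matrix.sub_mul, Matrix.sub_mul, h.mul_a, h.mul_a', two_smul]
      abel
    rw [this, Matrix.sub_mul, Matrix.add_mul, h.sq_a, h.sq_a', Matrix.smul_mul, Matrix.one_mul,
      sub_smul, add_smul]
  have t1 : (K * (D' * S) * E * (K * (D * S))).trace =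
      (S * S * E * (K * (a + a' - u • b - u' • b'))).trace := by
    calc _ = (E * (K * (D * S)) * (K * D' * S)).trace := by
          rw [Matrix.mul_assoc, Matrix.trace_mul_comm]
          simp only [Matrix.mul_assoc]
      _ = (E * K * (S * (D * D') * (a + a' + u • b + u' • b') * S)).trace := by
          rw [kD, dS]
          simp only [Matrix.mul_assoc]
      _ = (E * K * (a + a' - u • b - u' • b') * (S * S)).trace := by
          rw [hD.mul_D, Matrix.mul_one, sB]
          simp only [Matrix.mul_assoc]
      _ = _ := by
          rw [Matrix.trace_mul_comm]
          simp only [Matrix.mul_assoc]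
  have n1 := h.trace_mul_mul (E := E) h.comm_b
  have n2 := h.invLeft.trace_mul_mul (E := E) h.comm_b
  have n3 := h.invRight.trace_mul_mul (E := E) h.comm_b'
  have n4 := h.invLeft.invRight.trace_mul_mul (E := E) h.comm_b'
  have p1 := h.swap.trace_mul_mul (E := E) h.comm_a
  have p2 := h.invLeft.swap.trace_mul_mul (E := E) h.comm_a'
  have p3 := h.invRight.swap.trace_mul_mul (E := E) h.comm_a
  have p4 := h.invLeft.invRight.swap.trace_mul_mul (E := E) h.comm_a'
  have q1 : (E * (a * a)).trace = z * E.trace := by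
    rw [Matrix.trace_mul_comm, h.sq_a, Matrix.trace_smul, smul_eq_mul]
  have q2 : (E * (a' * a')).trace = z' * E.trace := by
    rw [Matrix.trace_mul_comm, h.sq_a', Matrix.trace_smul, smul_eq_mul]
  have q3 : (E * (b * b)).trace = w * E.trace := by
    rw [Matrix.trace_mul_comm, h.sq_b, Matrix.trace_smul, smul_eq_mul]
  have q4 : (E * (b' * b')).trace = w' * E.trace := by
    rw [Matrix.trace_mul_comm, h.sq_b', Matrix.trace_smul, smul_eq_mul]
  rw [t1, e2, Matrix.smul_mul, Matrix.trace_smul, smul_eq_mul, mul_assoc]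
  congr 1
  rw [hKdef]
  simp only [Matrix.mul_sub, Matrix.add_mul, Matrix.mul_add, Matrix.mul_smul, Matrix.trace_add,
    Matrix.trace_sub, Matrix.trace_smul, smul_eq_mul, n1, n2, n3, n4, p1, p2, p3, p4, q1, q2, q3,
    q4, h.mul_a, h.mul_a', h.mul_b, h.mul_b', Matrix.mul_one]
  ring

theorem IsBand.trace_diamagnetic (h : IsBand a a' b b' E z z' w w') :
    (E * ((a + a') * (a + a' + b + b'))).trace = (z + z' + 2) * E.trace := by
  have n1 := h.trace_mul_mul (E := E) h.comm_b
  have n2 := h.invLeft.trace_mul_mul (E := E) h.comm_b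
  have n3 := h.invRight.trace_mul_mul (E := E) h.comm_b'
  have n4 := h.invLeft.invRight.trace_mul_mul (E := E) h.comm_b'
  have q1 : (E * (a * a)).trace = z * E.trace := by
    rw [Matrix.trace_mul_comm, h.sq_a, Matrix.trace_smul, smul_eq_mul]
  have q2 : (E * (a' * a')).trace = z' * E.trace := by
    rw [Matrix.trace_mul_comm, h.sq_a', Matrix.trace_smul, smul_eq_mul]
  simp only [Matrix.add_mul, Matrix.mul_add, Matrix.trace_add, n1, n2, n3, n4, q1, q2, h.mul_a,
    h.mul_a', Matrix.mul_one]
  ring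

theorem IsBand.trace_hopping (h : IsBand a a' b b' E z z' w w') :
    (E * (a + a' + b + b')).trace = 0 := by
  simp only [Matrix.mul_add, Matrix.trace_add, h.trace_mul h.comm_b, h.invLeft.trace_mul h.comm_b,
    h.swap.trace_mul h.comm_a, h.swap.invLeft.trace_mul h.comm_a, add_zero]

end MagneticTranslations
end
end Z2Gauge

namespace Z2Gauge
noncomputable section
open scoped Matrix

/-! ### Spectral projections of the squared translations -/

section BandProjection

variable {ι : Type*} [Fintype ι] [DecidableEq ι] {m : ℕ} {U : Matrix ι ι ℂ} {φ : ℝ}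

/-- The quasimomenta of a system of circumference `2 m` with twisted boundary conditions. -/
def bandMomentum (m : ℕ) (φ : ℝ) (n : ℕ) : ℝ := (2 * Real.pi * n + φ) / (2 * m)

/-- The spectral projection of `U ^ 2` on the eigenvalue `exp (2 i k)`, where `k` is the `n`th
quasimomentum. -/
def bandProjection (m : ℕ) (φ : ℝ) (U : Matrix ι ι ℂ) (n : ℕ) : Matrix ι ι ℂ :=
  (1 / m : ℂ) • ∑ j ∈ Finset.range m,
    (Complex.exp (-(2 * Complex.I * bandMomentum m φ n)) • (U * U)) ^ j

theorem exp_bandMomentum (hm : m ≠ 0) (n : ℕ) :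
    Complex.exp (-(2 * Complex.I * bandMomentum m φ n)) ^ m = Complex.exp (-(Complex.I * φ)) := by
  have hm' : (m : ℂ) ≠ 0 := Nat.cast_ne_zero.2 hm
  rw [← Complex.exp_nat_mul]
  have : (m : ℂ) * -(2 * Complex.I * bandMomentum m φ n) =
      -(Complex.I * φ) - n * (2 * Real.pi * Complex.I) := by
    rw [bandMomentum]
    push_cast
    field_simp
    ring
  rw [this, Complex.exp_sub, Complex.exp_nat_mul_two_pi_mul_I, div_one]

theorem sq_mul_bandProjection (hm : m ≠ 0) (hU : (U * U) ^ m = Complex.exp (Complex.I * φ) • 1)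
    (n : ℕ) : U * U * bandProjection m φ U n =
      Complex.exp (2 * Complex.I * bandMomentum m φ n) • bandProjection m φ U n := by
  set c := Complex.exp (-(2 * Complex.I * bandMomentum m φ n)) with hc
  have hR : (c • (U * U)) ^ m = 1 := by
    rw [smul_pow, hU, hc, exp_bandMomentum hm, smul_smul, ← Complex.exp_add]
    simp
  have key : (c • (U * U)) * bandProjection m φ U n = bandProjection m φ U n := by
    rw [bandProjection, Matrix.mul_smul, Finset.mul_sum]
    congr 1
    rw [Finset.sum_congr rfl fun j _ => (pow_succ' (c • (U * U)) j).symm]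
    have e1 := Finset.sum_range_succ (fun j => (c • (U * U)) ^ j) m
    have e2 := Finset.sum_range_succ' (fun j => (c • (U * U)) ^ j) m
    rw [hR] at e1
    rw [pow_zero] at e2
    exact add_right_cancel (e2.symm.trans e1)
  have hcc : Complex.exp (2 * Complex.I * bandMomentum m φ n) * c = 1 := by
    rw [hc, ← Complex.exp_add]
    simp
  calc _ = (Complex.exp (2 * Complex.I * bandMomentum m φ n) * c) •
        (U * U * bandProjection m φ U n) := by rw [hcc, one_smul]
    _ = _ := by rw [mul_smul, ← Matrix.smul_mul, key]

/-- Summing over the quasimomenta first, orthogonality of the roots of unity leaves only the power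
zero. -/
theorem sum_bandProjection (hm : m ≠ 0) (φ : ℝ) (U : Matrix ι ι ℂ) :
    ∑ n : Fin m, bandProjection m φ U n = 1 := by
  have hm' : (m : ℂ) ≠ 0 := Nat.cast_ne_zero.2 hm
  have e : ∀ n : ℕ, Complex.exp (-(2 * Complex.I * bandMomentum m φ n)) =
      Complex.exp (-(Complex.I * φ / m)) * (Complex.exp (2 * Real.pi * Complex.I / m))⁻¹ ^ n := by
    intro n
    rw [← Complex.exp_neg, ← Complex.exp_nat_mul, ← Complex.exp_add, bandMomentum]
    congr 1
    push_cast
    field_simp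
    ring
  have hr := (Complex.isPrimitiveRoot_exp m hm).inv
  set r := (Complex.exp (2 * Real.pi * Complex.I / m))⁻¹
  have hz : ∀ j ∈ Finset.range m, j ≠ 0 → ∑ n ∈ Finset.range m, (r ^ n) ^ j = 0 := by
    intro j hj hj0
    have h1 : r ^ j - 1 ≠ 0 := sub_ne_zero.2 (hr.pow_ne_one_of_pos_of_lt hj0 (Finset.mem_range.1 hj))
    have h2 := mul_geom_sum (r ^ j) m
    rw [← pow_mul, mul_comm j m, pow_mul, hr.pow_eq_one, one_pow, sub_self] at h2
    simp only [← pow_mul, mul_comm j] at h2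
    simp only [← pow_mul]
    exact (mul_eq_zero.1 h2).resolve_left h1
  rw [Fin.sum_univ_eq_sum_range (fun n => bandProjection m φ U n) m]
  simp only [bandProjection]
  rw [← Finset.smul_sum, Finset.sum_comm, Finset.sum_eq_single 0]
  · simp only [pow_zero, Finset.sum_const, Finset.card_range]
    rw [← Nat.cast_smul_eq_nsmul ℂ, smul_smul, one_div, inv_mul_cancel₀ hm', one_smul]
  · intro j hj hj0
    simp only [e, smul_pow, ← smul_smul]
    rw [← Finset.smul_sum, ← Finset.sum_smul, hz j hj hj0, zero_smul, smul_zero]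
  · intro h
    simp [hm] at h

theorem commute_bandProjection {W : Matrix ι ι ℂ} (h : Commute W (U * U)) (φ : ℝ) (n : ℕ) :
    Commute W (bandProjection m φ U n) :=
  (Commute.sum_right _ _ _ fun _ _ => (h.smul_right _).pow_right _).smul_right _

end BandProjection

/-! ### Translations and holonomies in a gauge field of flux -1 -/

section Concrete

variable {ℓ : ℕ}

theorem IsShift.pow {L : ℕ} [NeZero L] {v : Site L} {M : Matrix (Site L) (Site L) ℂ}
    (h : IsShift v M) (n : ℕ) : IsShift (n • v) (M ^ n) := by
  induction n with
  | zero =>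
    intro x y hxy
    rw [pow_zero, Matrix.one_apply] at hxy
    simp only [ne_eq, ite_eq_right_iff, one_ne_zero, imp_false, not_not] at hxy
    simp [hxy]
  | succ n ih =>
    rw [pow_succ, succ_nsmul]
    exact ih.mul h

theorem isShift_gaugeTranslation {L : ℕ} [NeZero L] (v : Site L) (σ : Edge L → ℤˣ) :
    IsShift v (gaugeTranslation v σ) := by
  intro x y h
  refine isShift_translation v (gaugeHopping σ) x y fun h0 => h ?_
  rw [gaugeTranslation, Matrix.map_apply, h0, Complex.ofReal_zero]

theorem map_mul_ofReal {ι : Type*} [Fintype ι] (A B : Matrix ι ι ℝ) :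
    A.map Complex.ofReal * B.map Complex.ofReal = (A * B).map Complex.ofReal :=
  (Matrix.map_mul (f := Complex.ofRealHom)).symm

theorem map_one_ofReal {ι : Type*} [DecidableEq ι] :
    (1 : Matrix ι ι ℝ).map Complex.ofReal = 1 :=
  Matrix.map_one Complex.ofReal Complex.ofReal_zero Complex.ofReal_one

theorem isMagnetic_gaugeTranslation {σ : Edge (4 * (ℓ + 1)) → ℤˣ}
    (hσ : ∀ x, flux (gaugeHopping σ) x = -1) :
    IsMagnetic (gaugeTranslation (1, 0) σ) (gaugeTranslation (1, 0) σ)ᵀ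
      (gaugeTranslation (0, 1) σ) (gaugeTranslation (0, 1) σ)ᵀ := by
  have hK := isHopping_gaugeHopping σ
  refine ⟨?_, ?_, ?_⟩
  · rw [gaugeTranslation, ← Matrix.transpose_map, map_mul_ofReal,
      translation_mul_transpose hK.symm hK.horizontal, map_one_ofReal]
  · rw [gaugeTranslation, ← Matrix.transpose_map, map_mul_ofReal,
      translation_mul_transpose hK.symm hK.vertical, map_one_ofReal]
  · have h := hK.anticommute hσ
    rw [diagonalStep] at h
    rw [gaugeTranslation, gaugeTranslation, map_mul_ofReal, map_mul_ofReal,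
      eq_neg_of_add_eq_zero_left h]
    ext x y
    simp

theorem gaugeHopping_map (σ : Edge (4 * (ℓ + 1)) → ℤˣ) :
    (gaugeHopping σ).map Complex.ofReal = gaugeTranslation (1, 0) σ + (gaugeTranslation (1, 0) σ)ᵀ +
      gaugeTranslation (0, 1) σ + (gaugeTranslation (0, 1) σ)ᵀ := by
  have h := (isHopping_gaugeHopping σ).eq_sum_translation
  ext x y
  have h2 := congrArg Complex.ofReal (congrFun (congrFun h x) y)
  simpa [gaugeTranslation] using h2

theorem gaugeTranslation_ne_zero (σ : Edge (4 * (ℓ + 1)) → ℤˣ) (x : Site (4 * (ℓ + 1))) :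
    gaugeTranslation (1, 0) σ (x + (1, 0)) x ≠ 0 ∧
      gaugeTranslation (0, 1) σ (x + (0, 1)) x ≠ 0 := by
  constructor
  · simp [gaugeTranslation, translation, gaugeHopping_symm σ (x + (1, 0)),
      gaugeHopping_horizontal]
  · simp [gaugeTranslation, translation, gaugeHopping_symm σ (x + (0, 1)),
      gaugeHopping_vertical]

/-- Operators that commute with the translations and do not displace are scalars. -/
theorem eq_smul_one_of_commute (σ : Edge (4 * (ℓ + 1)) → ℤˣ)
    {M : Matrix (Site (4 * (ℓ + 1))) (Site (4 * (ℓ + 1))) ℂ} (h0 : IsShift 0 M)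
    (h1 : M * gaugeTranslation (1, 0) σ = gaugeTranslation (1, 0) σ * M)
    (h2 : M * gaugeTranslation (0, 1) σ = gaugeTranslation (0, 1) σ * M) : M = M 0 0 • 1 := by
  have hd : M = Matrix.diagonal fun x => M x x := by
    ext x y
    rw [Matrix.diagonal_apply]
    split_ifs with h
    · rw [h]
    · exact h0.apply_add (by simpa using h)
  have step : ∀ (v : Site (4 * (ℓ + 1))), gaugeTranslation v σ * M = M * gaugeTranslation v σ →
      (∀ x, gaugeTranslation v σ (x + v) x ≠ 0) → ∀ x, M (x + v) (x + v) = M x x := by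
    intro v h hv x
    rw [hd] at h
    have := congrFun (congrFun h (x + v)) x
    rw [Matrix.mul_diagonal, Matrix.diagonal_mul, mul_comm] at this
    exact (mul_right_cancel₀ (hv x) this).symm
  have s1 := step _ h1.symm fun x => (gaugeTranslation_ne_zero σ x).1
  have s2 := step _ h2.symm fun x => (gaugeTranslation_ne_zero σ x).2
  have t1 : ∀ (n : ℕ) x, M (x + n • (1, 0)) (x + n • (1, 0)) = M x x := by
    intro n
    induction n with
    | zero => simp
    | succ n ih => intro x; rw [succ_nsmul, ← add_assoc, s1, ih]
  have t2 : ∀ (n : ℕ) x, M (x + n • (0, 1)) (x + n • (0, 1)) = M x x := by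
    intro n
    induction n with
    | zero => simp
    | succ n ih => intro x; rw [succ_nsmul, ← add_assoc, s2, ih]
  have hall : ∀ x, M x x = M 0 0 := by
    intro x
    rw [← t1 x.1.val 0, ← t2 x.2.val (0 + _)]
    have : x = 0 + x.1.val • ((1, 0) : Site (4 * (ℓ + 1))) + x.2.val • ((0, 1) : Site _) := by
      ext <;> simp
    rw [← this]
  rw [hd]
  ext x y
  rw [Matrix.diagonal_apply, hall, Matrix.smul_apply, Matrix.one_apply]
  simp

/-- A full turn around the torus does not displace and commutes with both translations, so it is a
scalar; being real and orthogonal, it is ±1. The phase φ is 0 or π accordingly. -/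
theorem exists_holonomy {σ : Edge (4 * (ℓ + 1)) → ℤˣ} {v : Site (4 * (ℓ + 1))}
    {W W' : Matrix (Site (4 * (ℓ + 1))) (Site (4 * (ℓ + 1))) ℂ}
    (h : IsMagnetic (gaugeTranslation v σ) (gaugeTranslation v σ)ᵀ W W')
    (hc : ∀ M, M * gaugeTranslation v σ = gaugeTranslation v σ * M → M * W = W * M →
      IsShift 0 M → M = M 0 0 • 1) :
    ∃ φ : ℝ, 0 ≤ φ ∧ φ ≤ Real.pi ∧
      (gaugeTranslation v σ * gaugeTranslation v σ) ^ (2 * (ℓ + 1)) =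
        Complex.exp (Complex.I * φ) • 1 := by
  set U := gaugeTranslation v σ
  set M := (U * U) ^ (2 * (ℓ + 1)) with hM
  have hU : Commute M U := ((Commute.refl U).mul_left (Commute.refl U)).pow_left _
  have hW : Commute M W := by
    have : Commute (U * U) W := h.swap.commute_sq.symm
    exact this.pow_left _
  have hs : IsShift 0 M := by
    have := ((isShift_gaugeTranslation v σ).mul (isShift_gaugeTranslation v σ)).pow (2 * (ℓ + 1))
    have h0 : (2 * (ℓ + 1)) • (v + v) = 0 := by
      rw [← two_nsmul, ← mul_nsmul, show 2 * (2 * (ℓ + 1)) = 4 * (ℓ + 1) by ring]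
      rw [← Nat.cast_smul_eq_nsmul (ZMod (4 * (ℓ + 1))), ZMod.natCast_self, zero_smul]
    rwa [h0] at this
  have hM1 := hc M hU.eq hW.eq hs
  have hMM : M * Mᵀ = 1 := by
    rw [hM, Matrix.transpose_pow, Matrix.transpose_mul, ← Commute.mul_pow]
    · rw [Matrix.mul_assoc, ← Matrix.mul_assoc U Uᵀ, h.mul_a, Matrix.one_mul, h.mul_a, one_pow]
    · rw [Commute, SemiconjBy]
      rw [Matrix.mul_assoc, ← Matrix.mul_assoc U Uᵀ, h.mul_a, Matrix.one_mul, h.mul_a,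
        Matrix.mul_assoc, ← Matrix.mul_assoc Uᵀ U, h.mul_a', Matrix.one_mul, h.mul_a']
  rw [hM1] at hMM
  have h1 : M 0 0 * M 0 0 = 1 := by
    have := congrFun (congrFun hMM 0) 0
    simpa using this
  rcases mul_self_eq_one_iff.1 h1 with h | h
  · exact ⟨0, le_rfl, Real.pi_pos.le, by rw [hM1, h]; simp⟩
  · refine ⟨Real.pi, Real.pi_pos.le, le_rfl, ?_⟩
    rw [hM1, h, mul_comm Complex.I, Complex.exp_pi_mul_I]

/-- The coordinate is a representative in [0, L), so the phase is additive across the boundary only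
for momenta in (2π/L)ℤ. -/
theorem exp_val_add_one {p : ℝ} {n : ℤ} (hp : p = 2 * Real.pi * n / (4 * (ℓ + 1) : ℕ))
    (a : ZMod (4 * (ℓ + 1))) : Complex.exp (-(Complex.I * p * ((a + 1).val : ℝ))) =
      Complex.exp (-(Complex.I * p)) * Complex.exp (-(Complex.I * p * (a.val : ℝ))) := by
  have hL : ((4 * (ℓ + 1) : ℕ) : ℂ) ≠ 0 := Nat.cast_ne_zero.2 (by omega)
  obtain ⟨k, hk⟩ : ∃ k : ℕ, a.val + 1 = (a + 1).val + 4 * (ℓ + 1) * k := by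
    refine ⟨(a.val + 1) / (4 * (ℓ + 1)), ?_⟩
    have h1 : (a + 1).val = (a.val + 1) % (4 * (ℓ + 1)) := by
      rw [ZMod.val_add]
      have : Fact (1 < 4 * (ℓ + 1)) := ⟨by omega⟩
      rw [ZMod.val_one]
    rw [h1, Nat.mod_add_div]
  have hk' : ((a + 1).val : ℂ) = a.val + 1 - (4 * (ℓ + 1) : ℕ) * k := by
    have := congrArg (fun n : ℕ => (n : ℂ)) hk
    push_cast at this ⊢
    linear_combination -this
  rw [← Complex.exp_add, Complex.exp_eq_exp_iff_exists_int]
  refine ⟨n * k, ?_⟩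
  rw [Complex.ofReal_natCast, hk', Complex.ofReal_natCast]
  have hp' : (p : ℂ) * (4 * (ℓ + 1) : ℕ) = 2 * Real.pi * n := by
    rw [hp]
    push_cast
    push_cast at hL
    field_simp
  push_cast at hp' ⊢
  linear_combination Complex.I * k * hp'

theorem isBoost_waveMatrix {p : ℝ} {n : ℤ} (hp : p = 2 * Real.pi * n / (4 * (ℓ + 1) : ℕ))
    (σ : Edge (4 * (ℓ + 1)) → ℤˣ) :
    IsBoost (gaugeTranslation (1, 0) σ) (gaugeTranslation (0, 1) σ) (waveMatrix _ p)
      (waveMatrix _ (-p)) (Complex.exp (-(Complex.I * p))) (Complex.exp (Complex.I * p)) where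
  mul_D := by
    rw [waveMatrix, waveMatrix, Matrix.diagonal_mul_diagonal, ← Matrix.diagonal_one]
    congr 1
    funext x
    rw [← Complex.exp_add]
    simp
  comm := by
    ext x y
    rw [waveMatrix, Matrix.mul_diagonal, Matrix.diagonal_mul]
    by_cases h : x = y + (1, 0)
    · have : x.2 = y.2 := by rw [h]; simp
      rw [this, mul_comm]
    · rw [(isShift_gaugeTranslation (1, 0) σ).apply_add h]
      simp
  shift := by
    ext x y
    rw [waveMatrix, Matrix.mul_diagonal, Matrix.smul_apply, Matrix.diagonal_mul]
    by_cases h : x = y + (0, 1)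
    · have : x.2 = y.2 + 1 := by rw [h]; simp
      have e := exp_val_add_one (ℓ := ℓ) (p := -p) (n := -n) (by rw [hp]; push_cast; ring) y.2
      rw [this, e, smul_eq_mul, mul_comm, ← mul_assoc, ← mul_assoc, ← Complex.exp_add]
      simp
    · rw [(isShift_gaugeTranslation (0, 1) σ).apply_add h]
      simp
  inv_u := by
    rw [← Complex.exp_add]
    simp

end Concrete
end
end Z2Gauge

namespace Z2Gauge
noncomputable section
open scoped Matrix

/-- The dispersion relation of the two-dimensional lattice Dirac fermion. -/
def bandEnergy (x y : ℝ) : ℝ := Real.sqrt (Real.cos x ^ 2 + Real.cos y ^ 2)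

/-- The contribution of the quasimomentum `(x, y)` to the ground state response at momentum
`(0, p)`, in units of `q² t`. -/
def responseDensity (p x y : ℝ) : ℝ :=
  Real.sin x ^ 2 * (1 - (Real.cos x ^ 2 - Real.cos y * Real.cos (y - p)) /
      (bandEnergy x y * bandEnergy x (y - p))) / (bandEnergy x y + bandEnergy x (y - p)) -
    Real.cos x ^ 2 / bandEnergy x y

theorem bandEnergy_nonneg (x y : ℝ) : 0 ≤ bandEnergy x y := Real.sqrt_nonneg _

theorem bandEnergy_sq (x y : ℝ) : bandEnergy x y ^ 2 = Real.cos x ^ 2 + Real.cos y ^ 2 :=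
  Real.sq_sqrt (by positivity)

theorem exp_add_exp_neg (x : ℝ) : Complex.exp (2 * Complex.I * x) +
    Complex.exp (-(2 * Complex.I * x)) = ((4 * Real.cos x ^ 2 - 2 : ℝ) : ℂ) := by
  have h := Complex.two_cos (2 * x : ℂ)
  have h2 := Complex.cos_two_mul (x : ℂ)
  push_cast
  rw [show (2 * Complex.I * x : ℂ) = 2 * x * Complex.I by ring,
    show (-(2 * x * Complex.I) : ℂ) = -(2 * x) * Complex.I by ring, ← h, h2]
  ring

/-! ### Ground state response of a band system -/

section BandSystem

variable {ι κ : Type*} [Fintype ι] [DecidableEq ι] [Fintype κ] {V : Matrix ι ι ℝ}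
  {lam : ι → ℝ} {a a' b b' D D' : Matrix ι ι ℂ} {E : κ → Matrix ι ι ℂ} {x y : κ → ℝ} {p : ℝ}

/-- The joint spectral projections of the squares of two anticommuting translations, indexed by
the quasimomenta `(x k, y k)`, all of rank four. -/
structure IsBandSystem (a a' b b' : Matrix ι ι ℂ) (E : κ → Matrix ι ι ℂ) (x y : κ → ℝ) : Prop where
  band : ∀ k, IsBand a a' b b' (E k) (Complex.exp (2 * Complex.I * x k))
    (Complex.exp (-(2 * Complex.I * x k))) (Complex.exp (2 * Complex.I * y k))
    (Complex.exp (-(2 * Complex.I * y k)))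
  sum_eq : ∑ k, E k = 1
  trace_eq : ∀ k, (E k).trace = 4

theorem IsBandSystem.energy_add (x y : ℝ) :
    Complex.exp (2 * Complex.I * x) + Complex.exp (-(2 * Complex.I * x)) +
      Complex.exp (2 * Complex.I * y) + Complex.exp (-(2 * Complex.I * y)) + 4 =
        (((2 * bandEnergy x y) ^ 2 : ℝ) : ℂ) := by
  rw [mul_pow, bandEnergy_sq, add_assoc (Complex.exp _ + Complex.exp _), exp_add_exp_neg,
    exp_add_exp_neg]
  push_cast
  ring

theorem IsBandSystem.sq_mul (h : IsBandSystem a a' b b' E x y) (k : κ) :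
    (a + a' + b + b') * (a + a' + b + b') * E k =
      (((2 * bandEnergy (x k) (y k)) ^ 2 : ℝ) : ℂ) • E k := by
  rw [(h.band k).sq_mul, energy_add]

theorem IsBandSystem.mul_sq (h : IsBandSystem a a' b b' E x y) (k : κ) :
    E k * ((a + a' + b + b') * (a + a' + b + b')) =
      (((2 * bandEnergy (x k) (y k)) ^ 2 : ℝ) : ℂ) • E k := by
  rw [(h.band k).mul_sq, energy_add]

theorem IsBandSystem.sq_mul_boost (h : IsBandSystem a a' b b' E x y)
    (hD : IsBoost a b D D' (Complex.exp (-(Complex.I * p))) (Complex.exp (Complex.I * p))) (k : κ) :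
    (a + a' + b + b') * (a + a' + b + b') * (D' * (a - a') * E k) =
      (((2 * bandEnergy (x k) (y k - p)) ^ 2 : ℝ) : ℂ) • (D' * (a - a') * E k) := by
  rw [(h.band k).sq_mul_boost hD, ← energy_add, ← Complex.exp_nat_mul, ← Complex.exp_nat_mul,
    ← Complex.exp_add, ← Complex.exp_add]
  congr 4
  · congr 2
    push_cast
    ring
  · push_cast
    ring

theorem inBasis_hopping_mul (hV : V * Vᵀ = 1) {K : Matrix ι ι ℂ}
    (hK : inBasis V K = Matrix.diagonal fun i => (lam i : ℂ)) (m : Matrix ι ι ℂ) (i j : ι) :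
    inBasis V (K * m) i j = lam i * inBasis V m i j := by
  rw [inBasis_mul hV, hK, Matrix.diagonal_mul]

theorem inBasis_mul_hopping (hV : V * Vᵀ = 1) {K : Matrix ι ι ℂ}
    (hK : inBasis V K = Matrix.diagonal fun i => (lam i : ℂ)) (m : Matrix ι ι ℂ) (i j : ι) :
    inBasis V (m * K) i j = inBasis V m i j * lam j := by
  rw [inBasis_mul hV, hK, Matrix.mul_diagonal]

/-- The sum of the signs is the sum over the bands of tr(E K) divided by the energy, and each trace
vanishes by anticommutation. A zero eigenvalue counts 0 on both sides. -/
theorem IsBandSystem.sum_eigenvalues (h : IsBandSystem a a' b b' E x y) (hV : V * Vᵀ = 1)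
    (hK : inBasis V (a + a' + b + b') = Matrix.diagonal fun i => (lam i : ℂ)) :
    ∑ i, lam i / |lam i| = 0 := by
  have := sum_single_eq hV hK h.sum_eq (fun k => by have := bandEnergy_nonneg (x k) (y k); positivity)
    h.sq_mul (a + a' + b + b') (fun r => ((r⁻¹ : ℝ) : ℂ))
  simp only [(h.band _).trace_hopping, mul_zero, Finset.sum_const_zero, hK,
    Matrix.diagonal_apply_eq] at this
  rw [← Complex.ofReal_inj, Complex.ofReal_zero, ← this, Complex.ofReal_sum]
  exact Finset.sum_congr rfl fun i _ => by push_cast; rw [div_eq_mul_inv]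

/-- Zero modes have cos x = cos y = 0; a shift of y by p leads away from such points if sin p ≠ 0.
So the current does not connect zero modes. -/
theorem IsBandSystem.inBasis_eq_zero (h : IsBandSystem a a' b b' E x y) (hV : V * Vᵀ = 1)
    (hK : inBasis V (a + a' + b + b') = Matrix.diagonal fun i => (lam i : ℂ))
    (hD : IsBoost a b D D' (Complex.exp (-(Complex.I * p))) (Complex.exp (Complex.I * p)))
    (hp : Real.sin p ≠ 0) {i j : ι} (hi : lam i = 0) (hj : lam j = 0) :
    inBasis V (D' * (a - a')) i j = 0 := by
  refine inBasis_eq_zero_of_kernel hV hK h.sum_eq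
    (fun k => by have := bandEnergy_nonneg (x k) (y k); positivity)
    (fun k => by have := bandEnergy_nonneg (x k) (y k - p); positivity)
    h.mul_sq (h.sq_mul_boost hD) (fun k h1 h2 => hp ?_) hi hj
  have h1' := bandEnergy_sq (x k) (y k)
  have h2' := bandEnergy_sq (x k) (y k - p)
  rw [show bandEnergy (x k) (y k) = 0 by linarith] at h1'
  rw [show bandEnergy (x k) (y k - p) = 0 by linarith] at h2'
  have c1 : Real.cos (y k) = 0 := by nlinarith [sq_nonneg (Real.cos (x k)), sq_nonneg (Real.cos (y k))]
  have c2 : Real.cos (y k - p) = 0 := by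
    nlinarith [sq_nonneg (Real.cos (x k)), sq_nonneg (Real.cos (y k - p))]
  have s1 := Real.sin_sq_add_cos_sq (y k)
  rw [Real.cos_sub, c1, zero_mul, zero_add] at c2
  rw [c1] at s1
  rcases mul_eq_zero.1 c2 with h | h
  · rw [h] at s1
    norm_num at s1
  · exact h

/-- The response of a pair of modes is a function of the moduli of the eigenvalues plus their
product times another such function. The explicit eigenvalues are absorbed into factors K next to
the current matrices, which leaves sums over bands of computable traces; the diamagnetic term is
treated in the same way. -/
theorem IsBandSystem.groundResponse_eq (h : IsBandSystem a a' b b' E x y) (hV : V * Vᵀ = 1)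
    (hK : inBasis V (a + a' + b + b') = Matrix.diagonal fun i => (lam i : ℂ))
    (hD : IsBoost a b D D' (Complex.exp (-(Complex.I * p))) (Complex.exp (Complex.I * p)))
    {t : ℝ} (ht : 0 < t) (q : ℝ) :
    groundResponse (fun i => -(t * lam i))
      (fun i j => inBasis V ((Complex.I * q * t) • (D' * (a - a'))) i j *
        inBasis V ((Complex.I * q * t) • (D * (a - a'))) j i)
      (fun i => inBasis V ((-(q ^ 2 * t) : ℂ) • (a + a')) i i) =
    ((4 * (q ^ 2 * t) * ∑ k, responseDensity p (x k) (y k) : ℝ) : ℂ) := by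
  set K := a + a' + b + b' with hKdef
  have he : ∀ k, 0 ≤ 2 * bandEnergy (x k) (y k) := fun k => by
    have := bandEnergy_nonneg (x k) (y k); positivity
  have he' : ∀ k, 0 ≤ 2 * bandEnergy (x k) (y k - p) := fun k => by
    have := bandEnergy_nonneg (x k) (y k - p); positivity
  have hm := h.sq_mul_boost hD
  have hm2 : ∀ k, K * K * (K * (D' * (a - a')) * E k) =
      (((2 * bandEnergy (x k) (y k - p)) ^ 2 : ℝ) : ℂ) • (K * (D' * (a - a')) * E k) := by
    intro k
    calc _ = K * (K * K * (D' * (a - a') * E k)) := by simp only [Matrix.mul_assoc]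
      _ = _ := by rw [hm k, Matrix.mul_smul, Matrix.mul_assoc K]
  have S1 := sum_pairs_eq hV hK h.sum_eq he he' h.sq_mul hm (m' := D * (a - a'))
    (fun r s => ((1 / 2 / (r + s) : ℝ) : ℂ))
  have S2 := sum_pairs_eq hV hK h.sum_eq he he' h.sq_mul hm2 (m' := K * (D * (a - a')))
    (fun r s => ((1 / 2 / (r * s) / (r + s) : ℝ) : ℂ))
  have S3 := sum_single_eq hV hK h.sum_eq he h.sq_mul ((a + a') * K)
    (fun r => ((1 / 2 / r : ℝ) : ℂ))
  have S4 : ∑ i, inBasis V (a + a') i i = 0 := by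
    have : ∑ i, inBasis V (a + a') i i = (inBasis V (a + a')).trace := rfl
    rw [this, trace_inBasis hV, ← Matrix.one_mul (a + a'), ← h.sum_eq, Finset.sum_mul,
      Matrix.trace_sum]
    refine Finset.sum_eq_zero fun k _ => ?_
    rw [Matrix.mul_add, Matrix.trace_add, (h.band k).trace_mul (h.band k).comm_b,
      (h.band k).invLeft.trace_mul (h.band k).comm_b, add_zero]
  have R2 := fun k => (h.band k).trace_hopping_current hD
  have R3 := fun k => (h.band k).trace_diamagnetic
  rw [← hKdef] at R2 R3
  simp only [(h.band _).trace_current hD, R2, R3, h.trace_eq, inBasis_hopping_mul hV hK,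
    inBasis_mul_hopping hV hK] at S1 S2 S3
  -- Separates the dependence on the signs of the eigenvalues, carried by r * s, from that on their
  -- moduli.
  have hpr : ∀ r s : ℝ, pairResponse (-(t * r)) (-(t * s)) =
      1 / t * (1 / 2 / (|r| + |s|) - r * s * (1 / 2 / (|r| * |s|) / (|r| + |s|))) := by
    intro r s
    rw [pairResponse, abs_neg, abs_neg, abs_mul, abs_mul, abs_of_pos ht, neg_mul_neg]
    rw [show t * r * (t * s) / (t * |r| * (t * |s|)) = r * s / (|r| * |s|) by
      rw [show t * r * (t * s) = t ^ 2 * (r * s) by ring,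
        show t * |r| * (t * |s|) = t ^ 2 * (|r| * |s|) by ring, mul_div_mul_left _ _ (by positivity)]]
    rw [← mul_add]
    simp only [div_eq_mul_inv, mul_inv]
    ring
  have hoc : ∀ r : ℝ, occupation (-(t * r)) = 1 / 2 + r * (1 / 2 / |r|) := by
    intro r
    rw [occupation, abs_neg, abs_mul, abs_of_pos ht, neg_div, mul_div_mul_left _ _ ht.ne']
    ring
  have ht' : (t : ℂ) ≠ 0 := Complex.ofReal_ne_zero.2 ht.ne'
  have T1 : ∑ i, ∑ j, (inBasis V ((Complex.I * q * t) • (D' * (a - a'))) i j *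
        inBasis V ((Complex.I * q * t) • (D * (a - a'))) j i) *
          (pairResponse (-(t * lam i)) (-(t * lam j)) : ℝ) =
      -(q ^ 2 * t) * (∑ i, ∑ j, inBasis V (D' * (a - a')) i j * inBasis V (D * (a - a')) j i *
          ((1 / 2 / (|lam i| + |lam j|) : ℝ) : ℂ) -
        ∑ i, ∑ j, lam i * inBasis V (D' * (a - a')) i j * (lam j * inBasis V (D * (a - a')) j i) *
          ((1 / 2 / (|lam i| * |lam j|) / (|lam i| + |lam j|) : ℝ) : ℂ)) := by
    rw [← Finset.sum_sub_distrib, Finset.mul_sum]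
    refine Finset.sum_congr rfl fun i _ => ?_
    rw [← Finset.sum_sub_distrib, Finset.mul_sum]
    refine Finset.sum_congr rfl fun j _ => ?_
    rw [hpr, inBasis_smul, inBasis_smul, Matrix.smul_apply, Matrix.smul_apply]
    push_cast
    simp only [smul_eq_mul]
    generalize inBasis V (D' * (a - a')) i j = A1
    generalize inBasis V (D * (a - a')) j i = A2
    have hI : Complex.I * Complex.I = -1 := Complex.I_mul_I
    field_simp
    rw [Complex.I_sq]
    ring
  have T2 : ∑ i, inBasis V ((-(q ^ 2 * t) : ℂ) • (a + a')) i i *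
        (occupation (-(t * lam i)) : ℝ) =
      -(q ^ 2 * t) * (1 / 2 * ∑ i, inBasis V (a + a') i i +
        ∑ i, inBasis V (a + a') i i * lam i * ((1 / 2 / |lam i| : ℝ) : ℂ)) := by
    rw [Finset.mul_sum, ← Finset.sum_add_distrib, Finset.mul_sum]
    refine Finset.sum_congr rfl fun i _ => ?_
    rw [hoc, inBasis_smul, Matrix.smul_apply]
    push_cast
    rw [smul_eq_mul]
    ring
  rw [groundResponse, T1, T2, S1, S2, S3, S4, mul_zero, zero_add, ← mul_add,
    ← Finset.sum_sub_distrib, ← Finset.sum_add_distrib, Complex.ofReal_mul, Complex.ofReal_sum,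
    Finset.mul_sum, Finset.mul_sum]
  refine Finset.sum_congr rfl fun k _ => ?_
  have c0 : Complex.exp (2 * Complex.I * x k) + Complex.exp (-(2 * Complex.I * x k)) - 2 =
      ((-(4 * Real.sin (x k) ^ 2) : ℝ) : ℂ) := by
    rw [exp_add_exp_neg]
    have := Real.sin_sq_add_cos_sq (x k)
    rw [show Real.sin (x k) ^ 2 = 1 - Real.cos (x k) ^ 2 by linarith]
    push_cast
    ring
  have c1 : Complex.exp (2 * Complex.I * x k) + Complex.exp (-(2 * Complex.I * x k)) + 2 =
      ((4 * Real.cos (x k) ^ 2 : ℝ) : ℂ) := by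
    rw [exp_add_exp_neg]
    push_cast
    ring
  -- The four phases are the product of exp(iy) + exp(-iy) and exp(i(y-p)) + exp(-i(y-p)),
  -- multiplied out.
  have c2 : Complex.exp (-(Complex.I * p)) * Complex.exp (2 * Complex.I * y k) +
      Complex.exp (Complex.I * p) * Complex.exp (-(2 * Complex.I * y k)) +
      Complex.exp (-(Complex.I * p)) + Complex.exp (Complex.I * p) =
      ((4 * (Real.cos (y k) * Real.cos (y k - p)) : ℝ) : ℂ) := by
    have e1 : Complex.exp (-(Complex.I * p)) * Complex.exp (2 * Complex.I * y k) =
        Complex.exp (Complex.I * y k) * Complex.exp (Complex.I * (y k - p)) := by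
      rw [← Complex.exp_add, ← Complex.exp_add]
      congr 1
      ring
    have e2 : Complex.exp (Complex.I * p) * Complex.exp (-(2 * Complex.I * y k)) =
        Complex.exp (-(Complex.I * y k)) * Complex.exp (-(Complex.I * (y k - p))) := by
      rw [← Complex.exp_add, ← Complex.exp_add]
      congr 1
      ring
    have e3 : Complex.exp (-(Complex.I * p)) =
        Complex.exp (-(Complex.I * y k)) * Complex.exp (Complex.I * (y k - p)) := by
      rw [← Complex.exp_add]
      congr 1
      ring
    have e4 : Complex.exp (Complex.I * p) =
        Complex.exp (Complex.I * y k) * Complex.exp (-(Complex.I * (y k - p))) := by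
      rw [← Complex.exp_add]
      congr 1
      ring
    rw [e1, e2, e3, e4]
    push_cast
    rw [Complex.cos, Complex.cos, mul_comm Complex.I, mul_comm Complex.I, neg_mul, neg_mul]
    ring
  rw [c0, c1, c2, responseDensity, show 2 * bandEnergy (x k) (y k - p) + 2 * bandEnergy (x k) (y k) =
    2 * (bandEnergy (x k) (y k) + bandEnergy (x k) (y k - p)) by ring]
  push_cast
  simp only [div_eq_mul_inv, mul_inv]
  ring

end BandSystem

/-! ### The band system of a gauge field of flux -1 -/

section Concrete

variable {ℓ : ℕ} {σ : Edge (4 * (ℓ + 1)) → ℤˣ} {φ ψ : ℝ}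

/-- All powers except the zeroth displace and have no trace; the rank is L²/m² = 4 with L = 2m. -/
theorem trace_bandProjection_mul (σ : Edge (4 * (ℓ + 1)) → ℤˣ) (φ ψ : ℝ) (n k : ℕ) :
    (bandProjection (2 * (ℓ + 1)) φ (gaugeTranslation (1, 0) σ) n *
      bandProjection (2 * (ℓ + 1)) ψ (gaugeTranslation (0, 1) σ) k).trace = 4 := by
  simp only [bandProjection, Matrix.smul_mul, Matrix.mul_smul, Matrix.trace_smul, Finset.sum_mul,
    Finset.mul_sum, Matrix.trace_sum, smul_pow]
  rw [Finset.sum_eq_single 0, Finset.sum_eq_single 0]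
  · simp only [pow_zero, Matrix.mul_one, Matrix.trace_one, smul_eq_mul,
      Fintype.card_prod, ZMod.card]
    have h : (ℓ + 1 : ℂ) ≠ 0 := by exact_mod_cast (Nat.succ_ne_zero ℓ)
    push_cast
    field_simp
    norm_num
  · intro i hi hi0
    rw [Finset.mem_range] at hi
    have hs := ((isShift_gaugeTranslation (1, 0) σ).mul (isShift_gaugeTranslation (1, 0) σ)).pow i
      |>.mul (((isShift_gaugeTranslation (0, 1) σ).mul (isShift_gaugeTranslation (0, 1) σ)).pow 0)
    rw [hs.trace_eq_zero, smul_zero]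
    have := pair_ne_zero (ℓ := ℓ) (m := 2 * i) (n := 0) (Or.inl ⟨by omega, by omega⟩)
    convert this using 1
    ext <;> simp
    ring
  · intro h
    simp at h
  · intro j hj hj0
    rw [Finset.mem_range] at hj
    rw [Finset.sum_eq_zero, smul_zero, smul_zero]
    intro i hi
    rw [Finset.mem_range] at hi
    have hs := ((isShift_gaugeTranslation (1, 0) σ).mul (isShift_gaugeTranslation (1, 0) σ)).pow i
      |>.mul (((isShift_gaugeTranslation (0, 1) σ).mul (isShift_gaugeTranslation (0, 1) σ)).pow j)
    rw [hs.trace_eq_zero, smul_zero]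
    have := pair_ne_zero (ℓ := ℓ) (m := 2 * i) (n := 2 * j) (Or.inr ⟨by omega, by omega⟩)
    convert this using 1
    ext <;> simp <;> ring
  · intro h
    simp at h

theorem isBandSystem_gaugeTranslation (hσ : ∀ x, flux (gaugeHopping σ) x = -1)
    (hφ : (gaugeTranslation (1, 0) σ * gaugeTranslation (1, 0) σ) ^ (2 * (ℓ + 1)) =
      Complex.exp (Complex.I * φ) • 1)
    (hψ : (gaugeTranslation (0, 1) σ * gaugeTranslation (0, 1) σ) ^ (2 * (ℓ + 1)) =
      Complex.exp (Complex.I * ψ) • 1) :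
    IsBandSystem (gaugeTranslation (1, 0) σ) (gaugeTranslation (1, 0) σ)ᵀ
      (gaugeTranslation (0, 1) σ) (gaugeTranslation (0, 1) σ)ᵀ
      (fun k : Fin (2 * (ℓ + 1)) × Fin (2 * (ℓ + 1)) =>
        bandProjection (2 * (ℓ + 1)) φ (gaugeTranslation (1, 0) σ) k.1 *
          bandProjection (2 * (ℓ + 1)) ψ (gaugeTranslation (0, 1) σ) k.2)
      (fun k => bandMomentum (2 * (ℓ + 1)) φ k.1) (fun k => bandMomentum (2 * (ℓ + 1)) ψ k.2) := by
  have hM := isMagnetic_gaugeTranslation hσ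
  have hm : 2 * (ℓ + 1) ≠ 0 := by omega
  set a := gaugeTranslation (1, 0) σ
  set b := gaugeTranslation (0, 1) σ
  have caa : Commute a (a * a) := (Commute.refl a).mul_right (Commute.refl a)
  have cbb : Commute b (b * b) := (Commute.refl b).mul_right (Commute.refl b)
  have cab : Commute a (b * b) := hM.commute_sq
  have cba : Commute b (a * a) := hM.swap.commute_sq
  refine ⟨fun k => ⟨hM, ?_, ?_, ?_, ?_, ?_, ?_⟩, ?_, fun k => trace_bandProjection_mul σ φ ψ _ _⟩
  · exact ((commute_bandProjection caa φ k.1).mul_right (commute_bandProjection cab ψ k.2)).eq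
  · exact ((commute_bandProjection cba φ k.1).mul_right (commute_bandProjection cbb ψ k.2)).eq
  · rw [← Matrix.mul_assoc, sq_mul_bandProjection hm hφ, Matrix.smul_mul]
  · have : Commute (b * b) (bandProjection (2 * (ℓ + 1)) φ a k.1) :=
      commute_bandProjection (cba.mul_left cba) φ k.1
    rw [← Matrix.mul_assoc, this.eq, Matrix.mul_assoc, sq_mul_bandProjection hm hψ, Matrix.mul_smul]
  · rw [← Complex.exp_add]
    simp
  · rw [← Complex.exp_add]
    simp
  · rw [Fintype.sum_prod_type]
    simp only [← Finset.mul_sum, sum_bandProjection hm, Matrix.mul_one]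

theorem exists_isBandSystem (hσ : ∀ x, flux (gaugeHopping σ) x = -1) :
    ∃ φ ψ : ℝ, (0 ≤ φ ∧ φ ≤ Real.pi) ∧ (0 ≤ ψ ∧ ψ ≤ Real.pi) ∧
    IsBandSystem (gaugeTranslation (1, 0) σ) (gaugeTranslation (1, 0) σ)ᵀ
      (gaugeTranslation (0, 1) σ) (gaugeTranslation (0, 1) σ)ᵀ
      (fun k : Fin (2 * (ℓ + 1)) × Fin (2 * (ℓ + 1)) =>
        bandProjection (2 * (ℓ + 1)) φ (gaugeTranslation (1, 0) σ) k.1 *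
          bandProjection (2 * (ℓ + 1)) ψ (gaugeTranslation (0, 1) σ) k.2)
      (fun k => bandMomentum (2 * (ℓ + 1)) φ k.1) (fun k => bandMomentum (2 * (ℓ + 1)) ψ k.2) := by
  have hM := isMagnetic_gaugeTranslation hσ
  obtain ⟨φ, h1, h2, hφ⟩ := exists_holonomy hM fun M c1 c2 h0 => eq_smul_one_of_commute σ h0 c1 c2
  obtain ⟨ψ, h3, h4, hψ⟩ := exists_holonomy hM.swap
    fun M c1 c2 h0 => eq_smul_one_of_commute σ h0 c2 c1
  exact ⟨φ, ψ, ⟨h1, h2⟩, ⟨h3, h4⟩, isBandSystem_gaugeTranslation hσ hφ hψ⟩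

end Concrete
end
end Z2Gauge

/-! ### The zero temperature response in finite volume -/

namespace Z2Gauge
noncomputable section
open scoped Matrix
open Filter Topology

/-- The average of the response density over the quasimomenta of the torus of circumference `2 m`,
with twists `φ` and `ψ`. -/
def bandAverage (m : ℕ) (p φ ψ : ℝ) : ℝ :=
  1 / (m : ℝ) ^ 2 * ∑ k : Fin m × Fin m,
    responseDensity p (bandMomentum m φ k.1) (bandMomentum m ψ k.2)

/-- A weighted mean is at most as far from c as its farthest term. The weights, which count
degenerate ground states, thus need not be known. -/
theorem norm_weighted_sub_le {τ : Type*} {s : Finset τ} (hs : s.Nonempty) {w : τ → ℝ}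
    (hw : ∀ i ∈ s, 0 < w i) (f : τ → ℝ) (c : ℝ) :
    ∃ i ∈ s, ‖(∑ i ∈ s, (w i : ℂ) * (f i : ℂ)) / ((∑ i ∈ s, w i : ℝ) : ℂ) - (c : ℂ)‖ ≤
      |f i - c| := by
  obtain ⟨i, hi, hmax⟩ := s.exists_max_image (fun i => |f i - c|) hs
  refine ⟨i, hi, ?_⟩
  have hW : 0 < ∑ i ∈ s, w i := Finset.sum_pos hw hs
  have e : (∑ i ∈ s, (w i : ℂ) * (f i : ℂ)) / ((∑ i ∈ s, w i : ℝ) : ℂ) - (c : ℂ) =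
      (((∑ i ∈ s, w i * (f i - c)) / ∑ i ∈ s, w i : ℝ) : ℂ) := by
    have hW' : ((∑ i ∈ s, w i : ℝ) : ℂ) ≠ 0 := Complex.ofReal_ne_zero.2 hW.ne'
    simp only [mul_sub, Finset.sum_sub_distrib, ← Finset.sum_mul, sub_div]
    rw [mul_div_cancel_left₀ _ hW.ne']
    push_cast
    rfl
  rw [e, Complex.norm_real, Real.norm_eq_abs, abs_div, abs_of_pos hW, div_le_iff₀ hW,
    mul_comm, Finset.sum_mul]
  refine (Finset.abs_sum_le_sum_abs _ _).trans (Finset.sum_le_sum fun j hj => ?_)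
  rw [abs_mul, abs_of_pos (hw j hj)]
  exact mul_le_mul_of_nonneg_left (hmax j hj) (hw j hj).le

variable {ℓ : ℕ}

/-- The limit G is a weighted mean of band averages over the optimal gauge fields, with twists that
depend on the gauge field. The bound by one unspecified pair of twists is all that is needed, since
the twists disappear in infinite volume. -/
theorem exists_response_limit (hℓ : 1 ≤ ℓ) {t : ℝ} (ht : 800 < t) (q : ℝ) {p : ℝ} {n : ℤ}
    (hp : p = 2 * Real.pi * n / (4 * (ℓ + 1) : ℕ)) (hsin : Real.sin p ≠ 0) :
    ∃ G : ℂ, Tendsto (fun β : ℝ => response (4 * (ℓ + 1)) t q β p) atTop (𝓝 G) ∧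
      ∀ c : ℝ, ∃ φ ψ : ℝ, (0 ≤ φ ∧ φ ≤ Real.pi) ∧ (0 ≤ ψ ∧ ψ ≤ Real.pi) ∧
        ‖G - (c : ℂ)‖ ≤ |q ^ 2 * t * bandAverage (2 * (ℓ + 1)) p φ ψ - c| := by
  classical
  have h10 : ((1, 0) : Site (4 * (ℓ + 1))) ≠ 0 := by
    simpa using pair_ne_zero (ℓ := ℓ) (m := 1) (n := 0) (Or.inl ⟨by omega, by omega⟩)
  have h01 : ((0, 1) : Site (4 * (ℓ + 1))) ≠ 0 := by
    simpa using pair_ne_zero (ℓ := ℓ) (m := 0) (n := 1) (Or.inr ⟨by omega, by omega⟩)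
  have self_ne_add : ∀ {v : Site (4 * (ℓ + 1))}, v ≠ 0 → ∀ x, x ≠ x + v := fun h x hx =>
    h (left_eq_add.1 hx)
  have ht0 : 0 < t := by linarith
  have hh := fun σ : Edge (4 * (ℓ + 1)) → ℤˣ =>
    exists_orthogonal_diagonalization (isHopping_gaugeHopping σ).isHermitian
  choose V hV hV' hK using hh
  set lam := fun σ : Edge (4 * (ℓ + 1)) → ℤˣ => (isHopping_gaugeHopping σ).isHermitian.eigenvalues
    with hlam
  obtain ⟨M, hM, hne, hflux⟩ := exists_max_sector (ℓ := ℓ) hℓ ht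
  have hE : ∀ σ, (plaquetteSum σ : ℝ) + 1 / 2 * ∑ a, |-(t * lam σ a)| =
      plaquetteSum σ + t / 2 * traceNorm (gaugeHopping σ) := by
    intro σ
    have h1 : traceNorm (gaugeHopping σ) = ∑ a, |lam σ a| := by
      rw [hK σ]
      exact traceNorm_eq_sum (hV σ) (hV' σ) _
    simp only [h1, abs_neg, abs_mul, abs_of_pos ht0, ← Finset.mul_sum]
    ring
  have hin : ∀ σ, inBasis (V σ) (gaugeTranslation (1, 0) σ + (gaugeTranslation (1, 0) σ)ᵀ +
      gaugeTranslation (0, 1) σ + (gaugeTranslation (0, 1) σ)ᵀ) =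
      Matrix.diagonal fun a => (lam σ a : ℂ) := by
    intro σ
    rw [← gaugeHopping_map, hK σ]
    exact inBasis_diagonalized (hV' σ) _
  have h4 : 4 ∣ Fintype.card (Site (4 * (ℓ + 1))) := by
    rw [Fintype.card_prod, ZMod.card]
    exact Dvd.intro _ (by ring : 4 * ((ℓ + 1) * (4 * (ℓ + 1))) = _)
  have hL : ((4 * (ℓ + 1) : ℕ) : ℂ) ≠ 0 := Nat.cast_ne_zero.2 (by omega)
  have hboost := fun σ => isBoost_waveMatrix hp σ
  have hsgn : ∀ σ, (plaquetteSum σ : ℝ) + 1 / 2 * ∑ a, |-(t * lam σ a)| = M →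
      ∑ a, -(t * lam σ a) / |-(t * lam σ a)| = 0 := by
    intro σ hσ
    rw [hE] at hσ
    obtain ⟨φ, ψ, -, -, hB⟩ := exists_isBandSystem (hflux σ hσ)
    have h1 := hB.sum_eigenvalues (hV σ) (hin σ)
    rw [← neg_zero, ← h1, ← Finset.sum_neg_distrib]
    refine Finset.sum_congr rfl fun a _ => ?_
    rw [abs_neg, abs_mul, abs_of_pos ht0, neg_div, mul_div_mul_left _ _ ht0.ne']
  have key := tendsto_mixture (ε := fun σ a => -(t * lam σ a)) (P := fun σ => (plaquetteSum σ : ℝ))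
    (M := M)
    (κ := fun σ a b => inBasis (V σ) (currentMatrix t q (-p) σ) a b *
            inBasis (V σ) (currentMatrix t q p σ) b a)
    (k := fun σ a => inBasis (V σ) (diamagneticMatrix t q p (-p) σ) a a) h4
    (by
      intro σ
      have h1 := (isHopping_gaugeHopping σ).isHermitian.trace_eq_sum_eigenvalues
      have h2 : (gaugeHopping σ).trace = 0 :=
        Finset.sum_eq_zero fun x _ => gaugeHopping_eq_zero σ (self_ne_add h10 x) (self_ne_add h01 x)
          (self_ne_add h10 x) (self_ne_add h01 x)
      rw [h2] at h1
      have h3 : ∑ a, lam σ a = 0 := by simpa using h1.symm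
      rw [Finset.sum_neg_distrib, ← Finset.mul_sum, h3, mul_zero, neg_zero])
    (fun σ => by rw [hE]; exact hM σ)
    (fun σ a => by simp only [inBasis_currentMatrix_diag, mul_zero])
    (by obtain ⟨σ, hσ⟩ := hne; exact ⟨σ, by rw [hE]; exact hσ⟩)
    hsgn
    (by
      intro σ hσ a b ha hb
      rw [hE] at hσ
      obtain ⟨φ, ψ, -, -, hB⟩ := exists_isBandSystem (hflux σ hσ)
      have ha' : lam σ a = 0 := by simpa [ht0.ne'] using ha
      have hb' : lam σ b = 0 := by simpa [ht0.ne'] using hb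
      rw [currentMatrix_eq, inBasis_smul, Matrix.smul_apply,
        hB.inBasis_eq_zero (hV σ) (hin σ) (hboost σ) hsin ha' hb', smul_zero, zero_mul])
  refine ⟨_, (key.const_mul (1 / (((4 * (ℓ + 1) : ℕ) : ℂ)) ^ 2)).congr fun β =>
    (response_eq hV hK t q β p).symm, ?_⟩
  intro c
  have hex : ∀ σ, ∃ φ ψ : ℝ, (plaquetteSum σ : ℝ) + 1 / 2 * ∑ a, |-(t * lam σ a)| = M →
      (0 ≤ φ ∧ φ ≤ Real.pi) ∧ (0 ≤ ψ ∧ ψ ≤ Real.pi) ∧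
      groundResponse (fun a => -(t * lam σ a)) (fun a b => inBasis (V σ) (currentMatrix t q (-p) σ) a b *
            inBasis (V σ) (currentMatrix t q p σ) b a)
        (fun a => inBasis (V σ) (diamagneticMatrix t q p (-p) σ) a a) =
      (((4 * (ℓ + 1) : ℕ) : ℝ) ^ 2 * (q ^ 2 * t * bandAverage (2 * (ℓ + 1)) p φ ψ) : ℝ) := by
    intro σ
    by_cases hσ : (plaquetteSum σ : ℝ) + 1 / 2 * ∑ a, |-(t * lam σ a)| = M
    · rw [hE] at hσ
      obtain ⟨φ, ψ, hφ, hψ, hB⟩ := exists_isBandSystem (hflux σ hσ)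
      refine ⟨φ, ψ, fun _ => ⟨hφ, hψ, ?_⟩⟩
      rw [currentMatrix_eq, currentMatrix_eq, diamagneticMatrix_eq,
        hB.groundResponse_eq (hV σ) (hin σ) (hboost σ) ht0 q, bandAverage]
      congr 1
      push_cast
      have : (ℓ : ℝ) + 1 ≠ 0 := by positivity
      field_simp
      ring
    · exact ⟨0, 0, fun h => absurd h hσ⟩
  choose φ ψ hφψ using hex
  have hnes : (Finset.univ.filter fun σ : Edge (4 * (ℓ + 1)) → ℤˣ =>
      (plaquetteSum σ : ℝ) + 1 / 2 * ∑ a, |-(t * lam σ a)| = M).Nonempty := by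
    obtain ⟨σ, hσ⟩ := hne
    exact ⟨σ, Finset.mem_filter.2 ⟨Finset.mem_univ _, by rw [hE]; exact hσ⟩⟩
  obtain ⟨σ, hσ, hle⟩ := norm_weighted_sub_le hnes
    (w := fun σ => groundWeight fun a => -(t * lam σ a))
    (fun σ hσ => groundWeight_pos (hsgn σ (Finset.mem_filter.1 hσ).2) h4)
    (fun σ => q ^ 2 * t * bandAverage (2 * (ℓ + 1)) p (φ σ) (ψ σ)) c
  obtain ⟨h1, h2, -⟩ := hφψ σ (Finset.mem_filter.1 hσ).2
  refine ⟨φ σ, ψ σ, h1, h2, le_trans (le_of_eq ?_) hle⟩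
  congr 2
  rw [← mul_div_assoc, Finset.mul_sum]
  congr 1
  refine Finset.sum_congr rfl fun σ hσ => ?_
  rw [(hφψ σ (Finset.mem_filter.1 hσ).2).2.2, mul_left_comm, Complex.ofReal_mul, ← mul_assoc (1 / _)]
  congr 1
  rw [Complex.ofReal_pow, Complex.ofReal_natCast, one_div_mul_cancel (pow_ne_zero 2 hL), one_mul]

end
end Z2Gauge

namespace Z2Gauge
noncomputable section
open Filter Topology MeasureTheory

/-! ### Riemann sums as integrals of step functions -/

section RiemannSums

theorem floor_eq_of_mem {m k : ℕ} (hm : m ≠ 0) {x : ℝ} (h1 : (k : ℝ) / m ≤ x)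
    (h2 : x < ((k + 1 : ℕ) : ℝ) / m) : ⌊m * x⌋₊ = k := by
  have hm' : (0 : ℝ) < m := Nat.cast_pos.2 (Nat.pos_of_ne_zero hm)
  rw [Nat.floor_eq_iff (mul_nonneg hm'.le ((by positivity : (0 : ℝ) ≤ k / m).trans h1))]
  rw [div_le_iff₀ hm'] at h1
  rw [lt_div_iff₀ hm'] at h2
  push_cast at h2
  constructor <;> linarith

theorem ae_floor_eq {m k : ℕ} (hm : m ≠ 0) (g : ℕ → ℝ) :
    ∀ᵐ x : ℝ, x ∈ Set.uIoc ((k : ℝ) / m) (((k + 1 : ℕ) : ℝ) / m) → g k = g ⌊m * x⌋₊ := by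
  have hm' : (0 : ℝ) < m := Nat.cast_pos.2 (Nat.pos_of_ne_zero hm)
  have hle : (k : ℝ) / m ≤ ((k + 1 : ℕ) : ℝ) / m :=
    div_le_div_of_nonneg_right (by push_cast; linarith) hm'.le
  filter_upwards [Measure.ae_ne volume (((k + 1 : ℕ) : ℝ) / m)] with x hx h
  rw [Set.uIoc_of_le hle] at h
  rw [floor_eq_of_mem hm h.1.le (lt_of_le_of_ne h.2 hx)]

/-- An average is the integral of a step function. -/
theorem average_eq_integral {m : ℕ} (hm : m ≠ 0) (g : ℕ → ℝ) :
    1 / (m : ℝ) * ∑ i ∈ Finset.range m, g i = ∫ x in (0 : ℝ)..1, g ⌊m * x⌋₊ := by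
  have hm' : (m : ℝ) ≠ 0 := Nat.cast_ne_zero.2 hm
  have h := intervalIntegral.sum_integral_adjacent_intervals (μ := volume)
    (f := fun x : ℝ => g ⌊m * x⌋₊) (a := fun k : ℕ => (k : ℝ) / m) (n := m) fun k _ => by
      refine (intervalIntegrable_const (c := g k)).congr_ae ?_
      exact (ae_restrict_iff' measurableSet_uIoc).2 (ae_floor_eq hm g)
  rw [Nat.cast_zero, zero_div, div_self hm'] at h
  rw [← h, Finset.mul_sum]
  refine Finset.sum_congr rfl fun k _ => ?_
  rw [← intervalIntegral.integral_congr_ae (ae_floor_eq hm g), intervalIntegral.integral_const,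
    smul_eq_mul]
  congr 1
  push_cast
  ring

/-- Riemann sums of a sequence of functions that converges on the sampling points. -/
theorem tendsto_average {m : ℕ → ℕ} (hm : ∀ n, m n ≠ 0) {g : ℕ → ℕ → ℕ → ℝ} {f : ℝ → ℝ → ℝ}
    {C : ℝ} (hC : ∀ᶠ n in atTop, ∀ i j, |g n i j| ≤ C)
    (hg : ∀ x y : ℝ, 0 < x → x ≤ 1 → 0 < y → y ≤ 1 → y ≠ 1 / 2 →
      Tendsto (fun n => g n ⌊m n * x⌋₊ ⌊m n * y⌋₊) atTop (𝓝 (f x y))) :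
    Tendsto (fun n => 1 / (m n : ℝ) ^ 2 * ∑ k : Fin (m n) × Fin (m n), g n k.1 k.2) atTop
      (𝓝 (∫ x in (0 : ℝ)..1, ∫ y in (0 : ℝ)..1, f x y)) := by
  have e : ∀ n, 1 / (m n : ℝ) ^ 2 * ∑ k : Fin (m n) × Fin (m n), g n k.1 k.2 =
      ∫ x in (0 : ℝ)..1, ∫ y in (0 : ℝ)..1, g n ⌊m n * x⌋₊ ⌊m n * y⌋₊ := by
    intro n
    simp only [← average_eq_integral (hm n)]
    rw [← average_eq_integral (hm n) fun i => 1 / (m n : ℝ) * ∑ j ∈ Finset.range (m n), g n i j,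
      ← Finset.mul_sum, Fintype.sum_prod_type, ← mul_assoc,
      ← Fin.sum_univ_eq_sum_range (fun i => ∑ j ∈ Finset.range (m n), g n i j)]
    simp only [← Fin.sum_univ_eq_sum_range (fun j => g n _ j)]
    congr 1
    ring
  simp only [e]
  have hmeas : ∀ (n : ℕ) (h : ℕ → ℝ), AEStronglyMeasurable (fun x : ℝ => h ⌊m n * x⌋₊)
      (volume.restrict (Set.uIoc 0 1)) := fun n h =>
    ((measurable_from_nat (f := h)).comp
      (Nat.measurable_floor.comp (measurable_const_mul _))).aestronglyMeasurable
  refine intervalIntegral.tendsto_integral_filter_of_dominated_convergence (fun _ => C)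
    (Eventually.of_forall fun n => hmeas n fun i => ∫ y in (0 : ℝ)..1, g n i ⌊m n * y⌋₊) ?_
    intervalIntegrable_const ?_
  · filter_upwards [hC] with n hn
    refine Eventually.of_forall fun x _ => ?_
    have := intervalIntegral.norm_integral_le_of_norm_le_const (a := 0) (b := 1) (C := C)
      (f := fun y : ℝ => g n ⌊m n * x⌋₊ ⌊m n * y⌋₊) fun y _ => hn _ _
    simpa using this
  · refine Eventually.of_forall fun x h => ?_
    rw [Set.uIoc_of_le zero_le_one] at h
    refine intervalIntegral.tendsto_integral_filter_of_dominated_convergence (fun _ => C)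
      (Eventually.of_forall fun n => hmeas n fun j => g n ⌊m n * x⌋₊ j) ?_
      intervalIntegrable_const ?_
    · filter_upwards [hC] with n hn
      exact Eventually.of_forall fun y _ => hn _ _
    -- The point 1/2, where a discontinuity is allowed, is a null set for the inner variable.
    · filter_upwards [Measure.ae_ne volume (1 / 2 : ℝ)] with y hy0 hy
      rw [Set.uIoc_of_le zero_le_one] at hy
      exact hg x y h.1 h.2 hy.1 hy.2 hy0

end RiemannSums

/-! ### Thermodynamic limit of the response -/

section ThermodynamicLimit

/-- The ground state response at momentum `(0, p)` in infinite volume, in units of `q² t`. -/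
def bulkResponse (p : ℝ) : ℝ :=
  ∫ y in (0 : ℝ)..1, ∫ x in (0 : ℝ)..1, responseDensity p (Real.pi * x) (Real.pi * y)

theorem abs_cos_le_bandEnergy (x y : ℝ) :
    |Real.cos x| ≤ bandEnergy x y ∧ |Real.cos y| ≤ bandEnergy x y := by
  constructor
  · exact Real.abs_le_sqrt (by nlinarith [sq_nonneg (Real.cos y)])
  · exact Real.abs_le_sqrt (by nlinarith [sq_nonneg (Real.cos x)])

/-- The energies at y and y - p cannot be small at the same time. This keeps the response density
bounded although each energy vanishes at the Dirac points. -/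
theorem abs_sin_le_add_bandEnergy (p x y : ℝ) :
    |Real.sin p| ≤ bandEnergy x y + bandEnergy x (y - p) := by
  have h : Real.sin p = Real.sin y * Real.cos (y - p) - Real.cos y * Real.sin (y - p) := by
    rw [← Real.sin_sub]
    congr 1
    ring
  calc |Real.sin p| ≤ |Real.sin y * Real.cos (y - p)| + |Real.cos y * Real.sin (y - p)| := by
        rw [h]; exact abs_sub _ _
    _ ≤ 1 * |Real.cos (y - p)| + |Real.cos y| * 1 := by
        rw [abs_mul, abs_mul]
        exact add_le_add (mul_le_mul_of_nonneg_right (Real.abs_sin_le_one _) (abs_nonneg _))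
          (mul_le_mul_of_nonneg_left (Real.abs_sin_le_one _) (abs_nonneg _))
    _ ≤ _ := by
        have h1 := (abs_cos_le_bandEnergy x y).2
        have h2 := (abs_cos_le_bandEnergy x (y - p)).2
        linarith

theorem abs_coherence_le (x y z : ℝ) :
    |(Real.cos x ^ 2 - Real.cos y * Real.cos z) / (bandEnergy x y * bandEnergy x z)| ≤ 1 := by
  have h0 : 0 ≤ bandEnergy x y * bandEnergy x z :=
    mul_nonneg (bandEnergy_nonneg _ _) (bandEnergy_nonneg _ _)
  rw [abs_div, abs_of_nonneg h0]
  refine div_le_one_of_le₀ (abs_le_of_sq_le_sq ?_ h0) h0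
  rw [mul_pow, bandEnergy_sq, bandEnergy_sq]
  nlinarith [sq_nonneg (Real.cos x * (Real.cos y + Real.cos z))]

theorem abs_responseDensity_le {p : ℝ} (hp : Real.sin p ≠ 0) (x y : ℝ) :
    |responseDensity p x y| ≤ 2 / |Real.sin p| + 1 := by
  have hE := abs_sin_le_add_bandEnergy p x y
  have hs := abs_pos.2 hp
  rw [responseDensity]
  refine (abs_sub _ _).trans (add_le_add ?_ ?_)
  · rw [abs_div, abs_mul, abs_of_pos (hs.trans_le hE)]
    have h1 := abs_le.1 (abs_coherence_le x y (y - p))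
    refine div_le_div₀ (by norm_num) ?_ hs hE
    have h2 : |Real.sin x ^ 2| ≤ 1 := by
      rw [abs_of_nonneg (sq_nonneg _)]
      exact Real.sin_sq_le_one x
    have h3 : |1 - (Real.cos x ^ 2 - Real.cos y * Real.cos (y - p)) /
        (bandEnergy x y * bandEnergy x (y - p))| ≤ 2 := by
      rw [abs_le]
      constructor <;> linarith
    calc _ ≤ (1 : ℝ) * 2 := mul_le_mul h2 h3 (abs_nonneg _) zero_le_one
      _ = 2 := one_mul _
  · rw [abs_div, abs_of_nonneg (bandEnergy_nonneg x y), abs_of_nonneg (sq_nonneg _)]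
    refine div_le_one_of_le₀ ?_ (bandEnergy_nonneg x y)
    have h1 := (abs_cos_le_bandEnergy x y).1
    have h2 := Real.abs_cos_le_one x
    rw [← sq_abs]
    nlinarith [abs_nonneg (Real.cos x)]

theorem continuous_bandEnergy : Continuous fun v : ℝ × ℝ => bandEnergy v.1 v.2 := by
  unfold bandEnergy
  exact Real.continuous_sqrt.comp (by fun_prop)

theorem bandEnergy_pos {x : ℝ} (hx : Real.cos x ≠ 0) (y : ℝ) : 0 < bandEnergy x y :=
  (abs_pos.2 hx).trans_le (abs_cos_le_bandEnergy x y).1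

theorem continuousAt_responseDensity {p x y : ℝ} (hx : Real.cos x ≠ 0) :
    ContinuousAt (fun v : ℝ × ℝ × ℝ => responseDensity v.1 v.2.1 v.2.2) (p, x, y) := by
  have c1 : ContinuousAt (fun v : ℝ × ℝ × ℝ => bandEnergy v.2.1 v.2.2) (p, x, y) :=
    (continuous_bandEnergy.comp
      (by fun_prop : Continuous fun v : ℝ × ℝ × ℝ => (v.2.1, v.2.2))).continuousAt
  have c2 : ContinuousAt (fun v : ℝ × ℝ × ℝ => bandEnergy v.2.1 (v.2.2 - v.1)) (p, x, y) :=
    (continuous_bandEnergy.comp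
      (by fun_prop : Continuous fun v : ℝ × ℝ × ℝ => (v.2.1, v.2.2 - v.1))).continuousAt
  have c3 : ContinuousAt (fun v : ℝ × ℝ × ℝ => Real.sin v.2.1 ^ 2) (p, x, y) := by fun_prop
  have c4 : ContinuousAt (fun v : ℝ × ℝ × ℝ => Real.cos v.2.1 ^ 2) (p, x, y) := by fun_prop
  have c5 : ContinuousAt (fun v : ℝ × ℝ × ℝ =>
    Real.cos v.2.1 ^ 2 - Real.cos v.2.2 * Real.cos (v.2.2 - v.1)) (p, x, y) := by fun_prop
  have h1 := (bandEnergy_pos hx y).ne'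
  have h2 := (bandEnergy_pos hx (y - p)).ne'
  have h3 := (add_pos (bandEnergy_pos hx y) (bandEnergy_pos hx (y - p))).ne'
  simp only [responseDensity]
  generalize hA : (fun v : ℝ × ℝ × ℝ => bandEnergy v.2.1 v.2.2) = A at c1
  generalize hB : (fun v : ℝ × ℝ × ℝ => bandEnergy v.2.1 (v.2.2 - v.1)) = B at c2
  have hA' : ∀ v : ℝ × ℝ × ℝ, bandEnergy v.2.1 v.2.2 = A v := fun v => congrFun hA v
  have hB' : ∀ v : ℝ × ℝ × ℝ, bandEnergy v.2.1 (v.2.2 - v.1) = B v := fun v => congrFun hB v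
  rw [hA' (p, x, y)] at h1 h3
  rw [hB' (p, x, y)] at h2 h3
  simp only [hA', hB']
  exact (((c3.mul (continuousAt_const.sub (c5.div (c1.mul c2) (mul_ne_zero h1 h2)))).div
    (c1.add c2) h3).sub (c4.div c1 h1))

theorem cos_pi_mul_ne_zero {x : ℝ} (hx : 0 < x) (hx1 : x ≤ 1) (hx2 : x ≠ 1 / 2) :
    Real.cos (Real.pi * x) ≠ 0 := by
  intro h
  rw [Real.cos_eq_zero_iff] at h
  obtain ⟨k, hk⟩ := h
  have : x = (2 * k + 1) / 2 := by
    have := Real.pi_pos.ne'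
    field_simp at hk ⊢
    linarith
  have h1 : (0 : ℝ) < 2 * k + 1 := by linarith
  have h2 : (2 * k + 1 : ℝ) ≤ 2 := by linarith
  have h3 : 0 < 2 * k + 1 := by exact_mod_cast h1
  have h4 : 2 * k + 1 ≤ 2 := by exact_mod_cast h2
  have : k = 0 := by omega
  subst this
  simp_all

/-- A twist in [0, π] shifts the quasimomenta by at most π/(2m), which tends to zero. -/
theorem tendsto_bandMomentum {m : ℕ → ℕ} (hm : Tendsto m atTop atTop) {φ : ℕ → ℝ}
    (hφ : ∀ n, 0 ≤ φ n ∧ φ n ≤ Real.pi) {x : ℝ} (hx : 0 ≤ x) :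
    Tendsto (fun n => bandMomentum (m n) (φ n) ⌊m n * x⌋₊) atTop (𝓝 (Real.pi * x)) := by
  have hm' : Tendsto (fun n => (m n : ℝ)) atTop atTop := tendsto_natCast_atTop_atTop.comp hm
  have h1 : Tendsto (fun n => (⌊m n * x⌋₊ : ℝ) / m n) atTop (𝓝 x) := by
    have := (tendsto_nat_floor_mul_div_atTop hx).comp hm'
    refine this.congr fun n => ?_
    simp [mul_comm]
  have h2 : Tendsto (fun n => φ n / (2 * m n)) atTop (𝓝 0) := by
    have : Tendsto (fun n => Real.pi / 2 / (m n : ℝ)) atTop (𝓝 0) := hm'.const_div_atTop _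
    refine squeeze_zero (fun n => div_nonneg (hφ n).1 (by positivity)) (fun n => ?_) this
    rw [div_div]
    exact div_le_div_of_nonneg_right (hφ n).2 (by positivity)
  have := (h1.const_mul Real.pi).add h2
  rw [add_zero] at this
  refine this.congr' ?_
  filter_upwards [hm.eventually_gt_atTop 0] with n hn
  have : (m n : ℝ) ≠ 0 := Nat.cast_ne_zero.2 hn.ne'
  rw [bandMomentum]
  field_simp

theorem tendsto_bandAverage {m : ℕ → ℕ} (hm0 : ∀ n, m n ≠ 0) (hm : Tendsto m atTop atTop)
    {φ ψ p : ℕ → ℝ} (hφ : ∀ n, 0 ≤ φ n ∧ φ n ≤ Real.pi) (hψ : ∀ n, 0 ≤ ψ n ∧ ψ n ≤ Real.pi)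
    {p₀ : ℝ} (hp : Tendsto p atTop (𝓝 p₀)) (hp₀ : Real.sin p₀ ≠ 0) :
    Tendsto (fun n => bandAverage (m n) (p n) (φ n) (ψ n)) atTop (𝓝 (bulkResponse p₀)) := by
  -- The coordinates are exchanged so that the inner variable is the horizontal quasimomentum, whose
  -- cosine vanishes at the excluded point 1/2; elsewhere the density is continuous.
  have hswap : ∀ n, bandAverage (m n) (p n) (φ n) (ψ n) = 1 / (m n : ℝ) ^ 2 *
      ∑ k : Fin (m n) × Fin (m n), responseDensity (p n) (bandMomentum (m n) (φ n) k.2)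
        (bandMomentum (m n) (ψ n) k.1) := fun n => by
    rw [bandAverage, ← (Equiv.prodComm _ _).sum_comp]
    rfl
  simp only [hswap]
  refine tendsto_average hm0 (g := fun n i j => responseDensity (p n) (bandMomentum (m n) (φ n) j)
    (bandMomentum (m n) (ψ n) i)) (C := 2 / (|Real.sin p₀| / 2) + 1) ?_ ?_
  · have hs : Tendsto (fun n => |Real.sin (p n)|) atTop (𝓝 |Real.sin p₀|) :=
      ((Real.continuous_sin.tendsto p₀).comp hp).abs
    have h0 := abs_pos.2 hp₀
    filter_upwards [hs.eventually_const_lt (half_lt_self h0)] with n hn i j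
    refine (abs_responseDensity_le (abs_pos.1 ((half_pos h0).trans hn)) _ _).trans (add_le_add_left ?_ _)
    exact div_le_div_of_nonneg_left (by norm_num) (by positivity) hn.le
  · intro y x hy hy1 hx hx1 hx2
    have hc := cos_pi_mul_ne_zero hx hx1 hx2
    have := (continuousAt_responseDensity (p := p₀) (y := Real.pi * y) hc).tendsto.comp
      (hp.prodMk_nhds ((tendsto_bandMomentum hm hφ hx.le).prodMk_nhds
        (tendsto_bandMomentum hm hψ hy.le)))
    exact this

theorem isSusceptibility_bulkResponse {t : ℝ} (ht : 800 < t) (q : ℝ) {p : ℝ} (hp : 0 < |p|)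
    (hp' : |p| < Real.pi) : IsSusceptibility t q p (q ^ 2 * t * bulkResponse p / p ^ 2) := by
  intro n hn
  have hp0 : p ≠ 0 := abs_pos.1 hp
  have hsin : Real.sin p ≠ 0 := fun h =>
    hp0 ((Real.sin_eq_zero_iff_of_lt_of_lt (by linarith [neg_abs_le p]) (by linarith [le_abs_self p])).1 h)
  have hev : ∀ᶠ ℓ : ℕ in atTop, 1 ≤ ℓ ∧ Real.sin (2 * Real.pi * n ℓ / (4 * (ℓ + 1) : ℕ)) ≠ 0 :=
    (eventually_ge_atTop 1).and (((Real.continuous_sin.tendsto p).comp hn).eventually_ne hsin)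
  have hex : ∀ ℓ : ℕ, ∃ (G : ℂ) (φ ψ : ℝ), (0 ≤ φ ∧ φ ≤ Real.pi) ∧ (0 ≤ ψ ∧ ψ ≤ Real.pi) ∧
      (1 ≤ ℓ ∧ Real.sin (2 * Real.pi * n ℓ / (4 * (ℓ + 1) : ℕ)) ≠ 0 →
        Tendsto (fun β : ℝ => response (4 * (ℓ + 1)) t q β (2 * Real.pi * n ℓ / (4 * (ℓ + 1) : ℕ)))
          atTop (𝓝 G) ∧
        ‖G - ((q ^ 2 * t * bulkResponse p : ℝ) : ℂ)‖ ≤ |q ^ 2 * t * bandAverage (2 * (ℓ + 1))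
          (2 * Real.pi * n ℓ / (4 * (ℓ + 1) : ℕ)) φ ψ - q ^ 2 * t * bulkResponse p|) := by
    intro ℓ
    by_cases h : 1 ≤ ℓ ∧ Real.sin (2 * Real.pi * n ℓ / (4 * (ℓ + 1) : ℕ)) ≠ 0
    · obtain ⟨G, hG, hc⟩ := exists_response_limit h.1 ht q rfl h.2
      obtain ⟨φ, ψ, hφ, hψ, hle⟩ := hc (q ^ 2 * t * bulkResponse p)
      exact ⟨G, φ, ψ, hφ, hψ, fun _ => ⟨hG, hle⟩⟩
    · exact ⟨0, 0, 0, ⟨le_rfl, Real.pi_pos.le⟩, ⟨le_rfl, Real.pi_pos.le⟩, fun h' => absurd h' h⟩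
  choose G φ ψ hφ hψ hG using hex
  refine ⟨G, hev.mono fun ℓ h => (hG ℓ h).1, ?_⟩
  have hlim := tendsto_bandAverage (m := fun ℓ => 2 * (ℓ + 1)) (fun ℓ => by omega)
    (tendsto_atTop_mono (fun ℓ => (by omega : ℓ ≤ 2 * (ℓ + 1))) tendsto_id) hφ hψ hn hsin
  have h0 := ((hlim.const_mul (q ^ 2 * t)).sub_const (q ^ 2 * t * bulkResponse p)).abs
  rw [sub_self, abs_zero] at h0
  rw [mul_div_cancel₀ _ (pow_ne_zero 2 hp0), tendsto_iff_norm_sub_tendsto_zero]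
  exact squeeze_zero' (Eventually.of_forall fun _ => norm_nonneg _) (hev.mono fun ℓ h => (hG ℓ h).2) h0

end ThermodynamicLimit
end
end Z2Gauge

namespace Z2Gauge
noncomputable section
open Filter Topology MeasureTheory

/-! ### The response of a Dirac cone, integrated over one momentum -/

section DiracIntegral

variable {a b u : ℝ}

/-- The dispersion relation of a Dirac fermion. -/
def diracEnergy (a u : ℝ) : ℝ := Real.sqrt (u ^ 2 + a ^ 2)

/-- The response of Dirac modes of momenta `(u, a)` and `(u, b)`. -/
def diracResponse (a b u : ℝ) : ℝ :=
  (1 - (u ^ 2 - a * b) / (diracEnergy a u * diracEnergy b u)) / (diracEnergy a u + diracEnergy b u)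

/-- The response of a pair of Dirac modes, with the diamagnetic contribution subtracted. -/
def diracExcess (a b u : ℝ) : ℝ :=
  diracResponse a b u - 1 / 2 * (a ^ 2 / diracEnergy a u ^ 3) - 1 / 2 * (b ^ 2 / diracEnergy b u ^ 3)

theorem diracEnergy_sq (a u : ℝ) : diracEnergy a u ^ 2 = u ^ 2 + a ^ 2 :=
  Real.sq_sqrt (by positivity)

theorem diracEnergy_nonneg (a u : ℝ) : 0 ≤ diracEnergy a u := Real.sqrt_nonneg _

theorem diracEnergy_pos (ha : a ≠ 0) (u : ℝ) : 0 < diracEnergy a u := Real.sqrt_pos.2 (by positivity)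

theorem abs_le_diracEnergy (a u : ℝ) : |u| ≤ diracEnergy a u ∧ |a| ≤ diracEnergy a u :=
  ⟨Real.abs_le_sqrt (by nlinarith [sq_nonneg a]), Real.abs_le_sqrt (by nlinarith [sq_nonneg u])⟩

theorem diracEnergy_pos' (hu : u ≠ 0) (a : ℝ) : 0 < diracEnergy a u :=
  (abs_pos.2 hu).trans_le (abs_le_diracEnergy a u).1

theorem diracResponse_bounds {c : ℝ} (hc : 0 < c) (h1 : c ≤ diracEnergy a u)
    (h2 : c ≤ diracEnergy b u) : 0 ≤ diracResponse a b u ∧ diracResponse a b u ≤ 1 / c := by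
  have hE := hc.trans_le h1
  have hE' := hc.trans_le h2
  have h : |(u ^ 2 - a * b) / (diracEnergy a u * diracEnergy b u)| ≤ 1 := by
    rw [abs_div, abs_of_pos (mul_pos hE hE')]
    refine div_le_one_of_le₀ (abs_le_of_sq_le_sq ?_ (mul_pos hE hE').le) (mul_pos hE hE').le
    rw [mul_pow, diracEnergy_sq, diracEnergy_sq]
    nlinarith [sq_nonneg (u * (a + b))]
  rw [abs_le] at h
  refine ⟨div_nonneg (by linarith) (by linarith), ?_⟩
  rw [diracResponse, div_le_div_iff₀ (by linarith) hc]
  nlinarith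

theorem diamagnetic_bounds {c : ℝ} (hc : 0 < c) (h1 : c ≤ diracEnergy a u) :
    0 ≤ a ^ 2 / diracEnergy a u ^ 3 ∧ a ^ 2 / diracEnergy a u ^ 3 ≤ 1 / c := by
  have hE := hc.trans_le h1
  refine ⟨by positivity, ?_⟩
  rw [div_le_div_iff₀ (by positivity) hc, one_mul, pow_succ (diracEnergy a u), diracEnergy_sq]
  exact mul_le_mul (by nlinarith [sq_nonneg u]) h1 hc.le (by positivity)

theorem abs_diracExcess_le {c : ℝ} (hc : 0 < c) (h1 : c ≤ diracEnergy a u)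
    (h2 : c ≤ diracEnergy b u) : |diracExcess a b u| ≤ 1 / c := by
  have e1 := diracResponse_bounds hc h1 h2
  have e2 := diamagnetic_bounds hc h1
  have e3 := diamagnetic_bounds hc h2
  rw [diracExcess, abs_le]
  constructor <;> linarith

/-- Eliminating a², b² and ab in favour of the energies and (a - b)² exhibits both terms as
quadratically small in a - b, since the energies differ by at most |a - b|. This cancellation gives
the decay in u. -/
theorem diracExcess_eq (hE : 0 < diracEnergy a u) (hE' : 0 < diracEnergy b u) :
    diracExcess a b u = u ^ 2 * ((diracEnergy a u - diracEnergy b u) ^ 2 *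
      ((diracEnergy a u + diracEnergy b u) ^ 2 + diracEnergy a u * diracEnergy b u)) /
        (2 * (diracEnergy a u * diracEnergy b u) ^ 3 * (diracEnergy a u + diracEnergy b u)) -
      (a - b) ^ 2 / (2 * (diracEnergy a u * diracEnergy b u) *
        (diracEnergy a u + diracEnergy b u)) := by
  have h1 := diracEnergy_sq a u
  have h2 := diracEnergy_sq b u
  rw [diracExcess, diracResponse]
  have ha : a ^ 2 = diracEnergy a u ^ 2 - u ^ 2 := by linarith
  have hb : b ^ 2 = diracEnergy b u ^ 2 - u ^ 2 := by linarith
  have hab : a * b = (diracEnergy a u ^ 2 + diracEnergy b u ^ 2 - 2 * u ^ 2 - (a - b) ^ 2) / 2 := by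
    rw [h1, h2]; ring
  rw [ha, hb, hab]
  generalize diracEnergy a u = E at *
  generalize diracEnergy b u = E' at *
  generalize (a - b) ^ 2 = D
  field_simp
  ring

theorem abs_diracEnergy_sub_le (a b u : ℝ) : (diracEnergy a u - diracEnergy b u) ^ 2 ≤ (a - b) ^ 2 := by
  have h1 := diracEnergy_sq a u
  have h2 := diracEnergy_sq b u
  have h : u ^ 2 + a * b ≤ diracEnergy a u * diracEnergy b u := by
    refine le_of_sq_le_sq ?_ (mul_nonneg (diracEnergy_nonneg a u) (diracEnergy_nonneg b u))
    rw [mul_pow, h1, h2]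
    nlinarith [sq_nonneg (u * (a - b))]
  nlinarith

theorem abs_diracExcess_mul_le (hu : u ≠ 0) : |diracExcess a b u| * |u| ^ 3 ≤ 3 / 2 * (a - b) ^ 2 := by
  have hE := diracEnergy_pos' hu a
  have hE' := diracEnergy_pos' hu b
  have h1 := (abs_le_diracEnergy a u).1
  have h2 := (abs_le_diracEnergy b u).1
  have h3 := abs_diracEnergy_sub_le a b u
  have hu' := abs_pos.2 hu
  rw [diracExcess_eq hE hE', ← sq_abs u]
  generalize diracEnergy a u = E at *
  generalize diracEnergy b u = E' at *
  generalize (a - b) ^ 2 = D at *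
  generalize |u| = v at *
  have hD : 0 ≤ D := (sq_nonneg _).trans h3
  have hv2 : v * v ≤ E * E' := mul_le_mul h1 h2 hu'.le hE.le
  have t1 : v ^ 2 * ((E - E') ^ 2 * ((E + E') ^ 2 + E * E')) / (2 * (E * E') ^ 3 * (E + E')) * v ^ 3 ≤
      5 / 4 * D := by
    have s1 : (E + E') ^ 2 + E * E' ≤ 5 / 4 * (E + E') ^ 2 := by nlinarith [sq_nonneg (E - E')]
    have s2 : v * (E + E') ≤ 2 * (E * E') := by nlinarith
    rw [div_mul_eq_mul_div, div_le_iff₀ (by positivity)]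
    calc v ^ 2 * ((E - E') ^ 2 * ((E + E') ^ 2 + E * E')) * v ^ 3
        ≤ v ^ 2 * (D * (5 / 4 * (E + E') ^ 2)) * v ^ 3 := by gcongr
      _ = 5 / 4 * D * (v * v) ^ 2 * (v * (E + E')) * (E + E') := by ring
      _ ≤ 5 / 4 * D * (E * E') ^ 2 * (2 * (E * E')) * (E + E') := by gcongr
      _ = 5 / 4 * D * (2 * (E * E') ^ 3 * (E + E')) := by ring
  have t2 : D / (2 * (E * E') * (E + E')) * v ^ 3 ≤ 1 / 4 * D := by
    rw [div_mul_eq_mul_div, div_le_iff₀ (by positivity)]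
    calc D * v ^ 3 = 1 / 4 * D * (2 * (v * v) * (v + v)) := by ring
      _ ≤ 1 / 4 * D * (2 * (E * E') * (E + E')) := by gcongr
  have t3 : 0 ≤ v ^ 2 * ((E - E') ^ 2 * ((E + E') ^ 2 + E * E')) / (2 * (E * E') ^ 3 * (E + E')) := by
    positivity
  have t4 : 0 ≤ D / (2 * (E * E') * (E + E')) := by positivity
  refine (mul_le_mul_of_nonneg_right (abs_sub _ _) (by positivity)).trans ?_
  rw [abs_of_nonneg t3, abs_of_nonneg t4, add_mul]
  linarith

/-- Adds the bounds by 1/|u|, multiplied by P², and by (3/2)P²/|u|³, multiplied by u²: the first is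
good near the cone, the second far away. -/
theorem abs_diracExcess_le_kernel (hu : u ≠ 0) {P : ℝ} (hP : (a - b) ^ 2 ≤ P ^ 2) :
    |diracExcess a b u| ≤ 5 / 2 * (P ^ 2 / (|u| * (u ^ 2 + P ^ 2))) := by
  have hu' := abs_pos.2 hu
  have h1 := abs_diracExcess_mul_le (a := a) (b := b) hu
  have h2 := abs_diracExcess_le hu' (abs_le_diracEnergy a u).1 (abs_le_diracEnergy b u).1
  rw [le_div_iff₀ hu'] at h2
  rw [← mul_div_assoc, le_div_iff₀ (by positivity), ← sq_abs u]
  have h3 := mul_le_mul_of_nonneg_right h2 (sq_nonneg P)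
  nlinarith

theorem continuous_diracExcess (ha : a ≠ 0) (hb : b ≠ 0) : Continuous (diracExcess a b) := by
  have c : ∀ a : ℝ, Continuous (diracEnergy a) := fun a => by
    unfold diracEnergy
    exact Real.continuous_sqrt.comp (by fun_prop)
  have c1 := c a
  have c2 := c b
  have p1 := fun u => (diracEnergy_pos ha u).ne'
  have p2 := fun u => (diracEnergy_pos hb u).ne'
  have hR : Continuous (diracResponse a b) :=
    (continuous_const.sub (((continuous_id.pow 2).sub continuous_const).div (c1.mul c2)
      fun u => mul_ne_zero (p1 u) (p2 u))).div (c1.add c2)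
      fun u => (add_pos (diracEnergy_pos ha u) (diracEnergy_pos hb u)).ne'
  exact (hR.sub (continuous_const.mul (continuous_const.div (c1.pow 3) fun u => pow_ne_zero 3 (p1 u)))).sub
    (continuous_const.mul (continuous_const.div (c2.pow 3) fun u => pow_ne_zero 3 (p2 u)))

theorem integrable_diracExcess (ha : a ≠ 0) (hb : b ≠ 0) : Integrable (diracExcess a b) := by
  obtain ⟨c, hc, hca, hcb⟩ : ∃ c : ℝ, 0 < c ∧ c ≤ |a| ∧ c ≤ |b| :=
    ⟨min |a| |b|, lt_min (abs_pos.2 ha) (abs_pos.2 hb), min_le_left _ _, min_le_right _ _⟩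
  refine (integrable_inv_one_add_sq.const_mul (2 / c + 3 / 2 * (a - b) ^ 2)).mono'
    (continuous_diracExcess ha hb).aestronglyMeasurable (Eventually.of_forall fun u => ?_)
  rw [Real.norm_eq_abs, ← div_eq_mul_inv, le_div_iff₀ (by positivity)]
  have h1 : |diracExcess a b u| ≤ 1 / c := abs_diracExcess_le hc
    (hca.trans (abs_le_diracEnergy a u).2) (hcb.trans (abs_le_diracEnergy b u).2)
  have h2 : |diracExcess a b u| * |u| ^ 3 ≤ 3 / 2 * (a - b) ^ 2 := by
    by_cases hu : u = 0
    · rw [hu]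
      simp
      positivity
    · exact abs_diracExcess_mul_le hu
  have h3 : u ^ 2 ≤ 1 + |u| ^ 3 := by
    rw [← sq_abs]
    rcases le_total |u| 1 with h | h
    · nlinarith [abs_nonneg u, pow_nonneg (abs_nonneg u) 3]
    · nlinarith [abs_nonneg u, sq_nonneg |u|]
  have h4 := mul_le_mul_of_nonneg_left h3 (abs_nonneg (diracExcess a b u))
  rw [show 2 / c = 2 * (1 / c) by ring]
  nlinarith

/-- An antiderivative of `diracExcess`. -/
def diracPrimitive (a b u : ℝ) : ℝ :=
  (u * (diracEnergy b u - diracEnergy a u) - a * b * (Real.log (u + diracEnergy b u) -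
    Real.log (u + diracEnergy a u))) / (b ^ 2 - a ^ 2) - 1 / 2 * (u / diracEnergy a u) -
      1 / 2 * (u / diracEnergy b u)

theorem hasDerivAt_diracEnergy (ha : a ≠ 0) (u : ℝ) :
    HasDerivAt (diracEnergy a) (u / diracEnergy a u) u := by
  have h : HasDerivAt (fun u : ℝ => u ^ 2 + a ^ 2) (2 * u) u := by
    simpa using (hasDerivAt_pow 2 u).add_const (a ^ 2)
  have := h.sqrt (by positivity)
  rw [mul_div_mul_left _ _ two_ne_zero] at this
  exact this

theorem add_diracEnergy_pos (ha : a ≠ 0) (u : ℝ) : 0 < u + diracEnergy a u := by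
  have h1 := diracEnergy_sq a u
  have h2 := diracEnergy_pos ha u
  by_contra h
  have : 0 < a ^ 2 := by positivity
  nlinarith

theorem hasDerivAt_diracPrimitive (ha : a ≠ 0) (hb : b ≠ 0) (hab : b ^ 2 - a ^ 2 ≠ 0) (u : ℝ) :
    HasDerivAt (diracPrimitive a b) (diracExcess a b u) u := by
  have d1 := hasDerivAt_diracEnergy ha u
  have d2 := hasDerivAt_diracEnergy hb u
  have l1 := ((hasDerivAt_id u).add d1).log (add_diracEnergy_pos ha u).ne'
  have l2 := ((hasDerivAt_id u).add d2).log (add_diracEnergy_pos hb u).ne'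
  have q1 := (hasDerivAt_id u).div d1 (diracEnergy_pos ha u).ne'
  have q2 := (hasDerivAt_id u).div d2 (diracEnergy_pos hb u).ne'
  have key : HasDerivAt (diracPrimitive a b) _ u := (((((hasDerivAt_id u).mul (d2.sub d1)).sub ((l2.sub l1).const_mul (a * b))).div_const
    (b ^ 2 - a ^ 2)).sub (q1.const_mul (1 / 2))).sub (q2.const_mul (1 / 2))
  refine key.congr_deriv ?_
  have h1 := diracEnergy_sq a u
  have h2 := diracEnergy_sq b u
  have p1 := diracEnergy_pos ha u
  have p2 := diracEnergy_pos hb u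
  have p3 := add_diracEnergy_pos ha u
  have p4 := add_diracEnergy_pos hb u
  have e1 : (1 + u / diracEnergy a u) / (u + diracEnergy a u) = 1 / diracEnergy a u := by
    field_simp
    ring
  have e2 : (1 + u / diracEnergy b u) / (u + diracEnergy b u) = 1 / diracEnergy b u := by
    field_simp
    ring
  simp only [id, Pi.sub_apply, Pi.add_apply, e1, e2, one_mul]
  have hab' : diracEnergy b u - diracEnergy a u ≠ 0 := fun h => hab (by
    have : b ^ 2 - a ^ 2 = (diracEnergy b u - diracEnergy a u) *
      (diracEnergy b u + diracEnergy a u) := by linear_combination h1 - h2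
    rw [this, h, zero_mul])
  rw [show b ^ 2 - a ^ 2 = (diracEnergy b u - diracEnergy a u) *
      (diracEnergy a u + diracEnergy b u) by linear_combination h1 - h2]
  rw [diracExcess, diracResponse]
  have ha2 : a ^ 2 = diracEnergy a u ^ 2 - u ^ 2 := by linarith
  have hb2 : b ^ 2 = diracEnergy b u ^ 2 - u ^ 2 := by linarith
  rw [ha2, hb2]
  generalize diracEnergy a u = E at *
  generalize diracEnergy b u = E' at *
  generalize a * b = c
  field_simp
  ring

theorem tendsto_div_diracEnergy (a : ℝ) :
    Tendsto (fun u => diracEnergy a u / u) atTop (𝓝 1) := by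
  have h : Tendsto (fun u : ℝ => Real.sqrt (1 + a ^ 2 * (u⁻¹) ^ 2)) atTop (𝓝 1) := by
    have := ((tendsto_inv_atTop_zero (𝕜 := ℝ)).pow 2).const_mul (a ^ 2)
    have := (Real.continuous_sqrt.tendsto _).comp (this.const_add 1)
    simpa [Function.comp_def] using this
  refine h.congr' ?_
  filter_upwards [eventually_gt_atTop 0] with u hu
  rw [diracEnergy, eq_div_iff hu.ne']
  nth_rw 2 [← Real.sqrt_sq hu.le]
  rw [← Real.sqrt_mul (by positivity)]
  congr 1
  field_simp

theorem tendsto_diracPrimitive (hab : b ^ 2 - a ^ 2 ≠ 0) :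
    Tendsto (diracPrimitive a b) atTop (𝓝 (-(1 / 2))) := by
  have h1 := tendsto_div_diracEnergy a
  have h2 := tendsto_div_diracEnergy b
  have h3 : Tendsto (fun u => Real.log ((1 + diracEnergy b u / u) / (1 + diracEnergy a u / u)))
      atTop (𝓝 0) := by
    have := ((h2.const_add 1).div (h1.const_add 1) (by norm_num)).log (by norm_num)
    simpa using this
  have h4 : Tendsto (fun u => (((b ^ 2 - a ^ 2) * (diracEnergy a u / u + diracEnergy b u / u)⁻¹ -
      a * b * Real.log ((1 + diracEnergy b u / u) / (1 + diracEnergy a u / u))) / (b ^ 2 - a ^ 2) -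
        1 / 2 * (diracEnergy a u / u)⁻¹) - 1 / 2 * (diracEnergy b u / u)⁻¹) atTop
      (𝓝 (-(1 / 2))) := by
    have := ((((((h1.add h2).inv₀ (by norm_num)).const_mul (b ^ 2 - a ^ 2)).sub
      (h3.const_mul (a * b))).div_const (b ^ 2 - a ^ 2)).sub ((h1.inv₀ one_ne_zero).const_mul (1 / 2))).sub
        ((h2.inv₀ one_ne_zero).const_mul (1 / 2))
    convert this using 2
    field_simp
    ring
  refine h4.congr' ?_
  filter_upwards [eventually_gt_atTop 0] with u hu
  have e1 := diracEnergy_sq a u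
  have e2 := diracEnergy_sq b u
  have p1 := diracEnergy_pos' hu.ne' a
  have p2 := diracEnergy_pos' hu.ne' b
  rw [diracPrimitive, ← Real.log_div (by positivity) (by positivity), inv_div, inv_div]
  congr 4
  · rw [← add_div, inv_div]
    field_simp
    linear_combination e1 - e2
  · congr 2
    field_simp

/-- The integral of `diracExcess` over the momentum along the vector potential. -/
theorem integral_diracExcess (ha : a ≠ 0) (hb : b ≠ 0) (hab : b ^ 2 - a ^ 2 ≠ 0) :
    ∫ u, diracExcess a b u = 2 * (a * b) * (Real.log b - Real.log a) / (b ^ 2 - a ^ 2) - 1 := by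
  -- By symmetry the integral is twice that over the half line, where the antiderivative has the
  -- limit -1/2.
  have heven : ∀ u, diracExcess a b |u| = diracExcess a b u := fun u => by
    simp only [diracExcess, diracResponse, diracEnergy, sq_abs]
  have h := integral_comp_abs (f := diracExcess a b)
  simp only [heven] at h
  rw [h, integral_Ioi_of_hasDerivAt_of_tendsto'
    (fun u _ => hasDerivAt_diracPrimitive ha hb hab u) (integrable_diracExcess ha hb).integrableOn
    (tendsto_diracPrimitive hab)]
  -- The real logarithm depends on the modulus only, so no sign of a or b is assumed; opposite signs
  -- do occur.
  have h0 : ∀ a : ℝ, Real.log (diracEnergy a 0) = Real.log a := fun a => by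
    rw [diracEnergy, zero_pow two_ne_zero, zero_add, Real.sqrt_sq_eq_abs, Real.log_abs]
  simp only [diracPrimitive, zero_add, zero_mul, h0, zero_div, mul_zero]
  ring

end DiracIntegral
end
end Z2Gauge

/-! ### Reduction of the bulk response to the Dirac cone -/

namespace Z2Gauge
noncomputable section
open Filter Topology MeasureTheory

/-- The response of the modes of quasimomentum `k` along the direction of the external momentum. -/
def bandResponse (p k : ℝ) : ℝ := ∫ x in (0 : ℝ)..1, responseDensity p (Real.pi * x) k

theorem responseDensity_eq (p x y : ℝ) : responseDensity p x y =
    Real.sin x ^ 2 * diracResponse (Real.cos y) (Real.cos (y - p)) (Real.cos x) -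
      Real.cos x ^ 2 / diracEnergy (Real.cos y) (Real.cos x) := by
  rw [responseDensity, diracResponse, mul_div_assoc]
  rfl

theorem responseDensity_add_pi (p x y : ℝ) :
    responseDensity p x (y + Real.pi) = responseDensity p x y := by
  rw [responseDensity_eq, responseDensity_eq, show y + Real.pi - p = y - p + Real.pi by ring,
    Real.cos_add_pi, Real.cos_add_pi]
  simp only [diracResponse, diracEnergy, neg_mul_neg, neg_sq]

theorem periodic_bandResponse (p : ℝ) : Function.Periodic (bandResponse p) Real.pi := fun k => by
  simp only [bandResponse, responseDensity_add_pi]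

theorem continuous_bandResponse {p : ℝ} (hp : Real.sin p ≠ 0) : Continuous (bandResponse p) := by
  rw [continuous_iff_continuousAt]
  intro k
  have hmeas : ∀ k, Measurable fun x : ℝ => responseDensity p (Real.pi * x) k := by
    intro k
    unfold responseDensity bandEnergy
    fun_prop
  refine intervalIntegral.continuousAt_of_dominated_interval
    (bound := fun _ => 2 / |Real.sin p| + 1)
    (Eventually.of_forall fun k => (hmeas k).aestronglyMeasurable)
    (Eventually.of_forall fun k => Eventually.of_forall fun x _ => abs_responseDensity_le hp _ _)
    intervalIntegrable_const ?_
  filter_upwards [Measure.ae_ne volume (1 / 2 : ℝ)] with x hx h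
  rw [Set.uIoc_of_le zero_le_one] at h
  have := continuousAt_responseDensity (p := p) (y := k) (cos_pi_mul_ne_zero h.1 h.2 hx)
  exact ContinuousAt.comp (f := fun k : ℝ => ((p, Real.pi * x, k) : ℝ × ℝ × ℝ)) this
    (by fun_prop)

/-- By periodicity the momentum can be centred so that the two states have momenta k ± p/2, and then
symmetrized in k, which makes the diamagnetic terms of both states appear. -/
theorem bulkResponse_eq {p : ℝ} (hp : Real.sin p ≠ 0) : bulkResponse p =
    1 / Real.pi * ∫ k in (-(Real.pi / 2))..(Real.pi / 2),
      1 / 2 * (bandResponse p (p / 2 + k) + bandResponse p (p / 2 - k)) := by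
  have hc := continuous_bandResponse hp
  have hper := periodic_bandResponse p
  have h0 : bulkResponse p = 1 / Real.pi * ∫ k in (0 : ℝ)..Real.pi, bandResponse p k := by
    have := intervalIntegral.integral_comp_mul_left (bandResponse p) (a := 0) (b := 1)
      Real.pi_pos.ne'
    rw [mul_zero, mul_one, smul_eq_mul] at this
    rw [one_div, ← this]
    rfl
  have hI : ∀ s : ℝ, ∫ k in s..(s + Real.pi), bandResponse p k =
      ∫ k in (0 : ℝ)..Real.pi, bandResponse p k := fun s => by
    rw [hper.intervalIntegral_add_eq s 0, zero_add]
  have c1 : Continuous fun k => bandResponse p (p / 2 + k) := hc.comp (by fun_prop)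
  have c2 : Continuous fun k => bandResponse p (p / 2 - k) := hc.comp (by fun_prop)
  rw [h0, intervalIntegral.integral_const_mul,
    intervalIntegral.integral_add (c1.intervalIntegrable _ _) (c2.intervalIntegrable _ _),
    intervalIntegral.integral_comp_add_left, intervalIntegral.integral_comp_sub_left,
    show p / 2 + Real.pi / 2 = p / 2 + -(Real.pi / 2) + Real.pi by ring,
    show p / 2 - -(Real.pi / 2) = p / 2 - Real.pi / 2 + Real.pi by ring, hI, hI]
  ring

/-- The integrand is the derivative of sin x cos x / E, which vanishes at 0 and π. This trades the
diamagnetic term for one with the weight sin² x of the current. -/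
theorem integral_diamagnetic {a : ℝ} (ha : a ≠ 0) :
    ∫ x in (0 : ℝ)..Real.pi, (Real.cos x ^ 2 / diracEnergy a (Real.cos x) -
      Real.sin x ^ 2 * (a ^ 2 / diracEnergy a (Real.cos x) ^ 3)) = 0 := by
  have hE : Continuous (diracEnergy a) := by
    unfold diracEnergy
    exact Real.continuous_sqrt.comp (by fun_prop)
  have hE' : Continuous fun x => diracEnergy a (Real.cos x) := hE.comp Real.continuous_cos
  have hpos := fun x => (diracEnergy_pos ha (Real.cos x)).ne'
  rw [intervalIntegral.integral_eq_sub_of_hasDerivAt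
    (f := fun x => Real.sin x * Real.cos x / diracEnergy a (Real.cos x))]
  · simp
  · intro x _
    have h1 := (hasDerivAt_diracEnergy ha (Real.cos x)).comp x (Real.hasDerivAt_cos x)
    have := ((Real.hasDerivAt_sin x).mul (Real.hasDerivAt_cos x)).div h1 (hpos x)
    refine this.congr_deriv ?_
    have h2 := diracEnergy_sq a (Real.cos x)
    have ha2 : a ^ 2 = diracEnergy a (Real.cos x) ^ 2 - Real.cos x ^ 2 := by linarith
    have := hpos x
    simp only [Function.comp_apply, Pi.mul_apply]
    rw [ha2]
    generalize diracEnergy a (Real.cos x) = E at *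
    field_simp
    ring
  · refine Continuous.intervalIntegrable ?_ _ _
    exact ((Real.continuous_cos.pow 2).div hE' hpos).sub ((Real.continuous_sin.pow 2).mul
      (continuous_const.div (hE'.pow 3) fun x => pow_ne_zero 3 (hpos x)))

/-- Substitution u = cos x. The square root of a negative number is 0, so the integral over [-1, 1]
extends to the line. -/
theorem integral_sin_sq_mul {φ : ℝ → ℝ} (hφ : Continuous φ) :
    ∫ x in (0 : ℝ)..Real.pi, Real.sin x ^ 2 * φ (Real.cos x) =
      ∫ u, Real.sqrt (1 - u ^ 2) * φ u := by
  have h1 := intervalIntegral.integral_comp_mul_deriv (a := 0) (b := Real.pi)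
    (f := Real.cos) (f' := fun x => -Real.sin x) (g := fun u => Real.sqrt (1 - u ^ 2) * φ u)
    (fun x _ => Real.hasDerivAt_cos x) (by fun_prop) (by fun_prop)
  rw [Real.cos_zero, Real.cos_pi, intervalIntegral.integral_symm (-1) 1] at h1
  have h2 : ∫ x in (0 : ℝ)..Real.pi, Real.sin x ^ 2 * φ (Real.cos x) =
      ∫ u in (-1 : ℝ)..1, Real.sqrt (1 - u ^ 2) * φ u := by
    rw [← neg_inj, ← h1, ← intervalIntegral.integral_neg]
    refine intervalIntegral.integral_congr fun x hx => ?_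
    rw [Set.uIcc_of_le Real.pi_pos.le] at hx
    have hs := Real.sin_nonneg_of_mem_Icc hx
    have : Real.sqrt (1 - Real.cos x ^ 2) = Real.sin x := by
      rw [show 1 - Real.cos x ^ 2 = Real.sin x ^ 2 by linarith [Real.sin_sq_add_cos_sq x],
        Real.sqrt_sq hs]
    simp only [Function.comp_apply, this]
    ring
  rw [h2, intervalIntegral.integral_of_le (by norm_num)]
  refine setIntegral_eq_integral_of_forall_compl_eq_zero fun u hu => ?_
  rw [Real.sqrt_eq_zero_of_nonpos, zero_mul]
  by_contra h
  push Not at h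
  have := abs_lt.1 ((sq_lt_one_iff_abs_lt_one u).1 (by linarith))
  exact hu ⟨this.1, this.2.le⟩

/-- The two responses share the paramagnetic part, symmetric in its momenta, and carry one
diamagnetic term each; `integral_diamagnetic` turns these into the subtractions of `diracExcess`. -/
theorem symmetrized_bandResponse (p k : ℝ) (ha : Real.cos (k - p / 2) ≠ 0)
    (hb : Real.cos (k + p / 2) ≠ 0) :
    Real.pi * (1 / 2 * (bandResponse p (p / 2 + k) + bandResponse p (p / 2 - k))) =
      ∫ u, Real.sqrt (1 - u ^ 2) *
        diracExcess (Real.cos (k - p / 2)) (Real.cos (k + p / 2)) u := by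
  have e1 : Real.cos (p / 2 + k) = Real.cos (k + p / 2) := by rw [add_comm]
  have e2 : Real.cos (p / 2 + k - p) = Real.cos (k - p / 2) := by congr 1; ring
  have e3 : Real.cos (p / 2 - k) = Real.cos (k - p / 2) := by rw [← Real.cos_neg]; congr 1; ring
  have e4 : Real.cos (p / 2 - k - p) = Real.cos (k + p / 2) := by
    rw [← Real.cos_neg]; congr 1; ring
  set a := Real.cos (k - p / 2)
  set b := Real.cos (k + p / 2)
  have hcE : ∀ a, Continuous (diracEnergy a) := fun a => by
    unfold diracEnergy
    exact Real.continuous_sqrt.comp (by fun_prop)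
  have cE : ∀ a, Continuous fun x => diracEnergy a (Real.cos x) :=
    fun a => (hcE a).comp Real.continuous_cos
  have pa := fun x => (diracEnergy_pos ha x).ne'
  have pb := fun x => (diracEnergy_pos hb x).ne'
  have hsymm : ∀ u, diracResponse b a u = diracResponse a b u := fun u => by
    simp only [diracResponse, mul_comm b, mul_comm (diracEnergy b u), add_comm (diracEnergy b u)]
  have hR : Continuous fun x => diracResponse a b (Real.cos x) := by
    have : Continuous (diracResponse a b) :=
      (continuous_const.sub (((continuous_id.pow 2).sub continuous_const).div ((hcE a).mul (hcE b))
        fun u => mul_ne_zero (pa u) (pb u))).div ((hcE a).add (hcE b))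
        fun u => (add_pos (diracEnergy_pos ha u) (diracEnergy_pos hb u)).ne'
    exact this.comp Real.continuous_cos
  have hscale : ∀ f : ℝ → ℝ, Real.pi * ∫ x in (0 : ℝ)..1, f (Real.pi * x) =
      ∫ x in (0 : ℝ)..Real.pi, f x := fun f => by
    rw [intervalIntegral.mul_integral_comp_mul_left, mul_zero, mul_one]
  have cS : Continuous fun x => Real.sin x ^ 2 := by fun_prop
  have cD : ∀ {a : ℝ}, a ≠ 0 → Continuous fun x => Real.cos x ^ 2 / diracEnergy a (Real.cos x) :=
    fun ha => (Real.continuous_cos.pow 2).div (cE _) fun x => (diracEnergy_pos ha _).ne'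
  have cD3 : ∀ {a : ℝ}, a ≠ 0 →
      Continuous fun x => Real.sin x ^ 2 * (a ^ 2 / diracEnergy a (Real.cos x) ^ 3) :=
    fun ha => cS.mul (continuous_const.div ((cE _).pow 3)
      fun x => pow_ne_zero 3 (diracEnergy_pos ha _).ne')
  have r1 : Real.pi * bandResponse p (p / 2 + k) = ∫ x in (0 : ℝ)..Real.pi,
      (Real.sin x ^ 2 * diracResponse a b (Real.cos x) - Real.cos x ^ 2 / diracEnergy b (Real.cos x)) := by
    rw [bandResponse, hscale fun x => responseDensity p x (p / 2 + k)]
    simp only [responseDensity_eq, e1, e2, hsymm]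
  have r2 : Real.pi * bandResponse p (p / 2 - k) = ∫ x in (0 : ℝ)..Real.pi,
      (Real.sin x ^ 2 * diracResponse a b (Real.cos x) - Real.cos x ^ 2 / diracEnergy a (Real.cos x)) := by
    rw [bandResponse, hscale fun x => responseDensity p x (p / 2 - k)]
    simp only [responseDensity_eq, e3, e4]
  have d1 := integral_diamagnetic ha
  have d2 := integral_diamagnetic hb
  rw [← integral_sin_sq_mul (continuous_diracExcess ha hb)]
  have lin : ∀ {f g h k : ℝ → ℝ}, Continuous f → Continuous g → Continuous h → Continuous k →
      ∫ x in (0 : ℝ)..Real.pi, (1 / 2 * f x + 1 / 2 * g x + 1 / 2 * h x + 1 / 2 * k x) =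
        1 / 2 * (∫ x in (0 : ℝ)..Real.pi, f x) + 1 / 2 * (∫ x in (0 : ℝ)..Real.pi, g x) +
          1 / 2 * (∫ x in (0 : ℝ)..Real.pi, h x) + 1 / 2 * (∫ x in (0 : ℝ)..Real.pi, k x) := by
    intro f g h k hf hg hh hk
    have ii : ∀ {f : ℝ → ℝ}, Continuous f → IntervalIntegrable f volume 0 Real.pi :=
      fun h => h.intervalIntegrable _ _
    rw [intervalIntegral.integral_add (ii (by fun_prop)) (ii (by fun_prop)),
      intervalIntegral.integral_add (ii (by fun_prop)) (ii (by fun_prop)),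
      intervalIntegral.integral_add (ii (by fun_prop)) (ii (by fun_prop))]
    simp only [intervalIntegral.integral_const_mul]
  have split : ∀ x, Real.sin x ^ 2 * diracExcess a b (Real.cos x) =
      1 / 2 * (Real.sin x ^ 2 * diracResponse a b (Real.cos x) -
        Real.cos x ^ 2 / diracEnergy b (Real.cos x)) +
      1 / 2 * (Real.sin x ^ 2 * diracResponse a b (Real.cos x) -
        Real.cos x ^ 2 / diracEnergy a (Real.cos x)) +
      1 / 2 * (Real.cos x ^ 2 / diracEnergy a (Real.cos x) -
        Real.sin x ^ 2 * (a ^ 2 / diracEnergy a (Real.cos x) ^ 3)) +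
      1 / 2 * (Real.cos x ^ 2 / diracEnergy b (Real.cos x) -
        Real.sin x ^ 2 * (b ^ 2 / diracEnergy b (Real.cos x) ^ 3)) := fun x => by
    rw [diracExcess]; ring
  have key := lin ((cS.mul hR).sub (cD hb)) ((cS.mul hR).sub (cD ha)) ((cD ha).sub (cD3 ha))
    ((cD hb).sub (cD3 hb))
  simp only [Pi.sub_apply, Pi.mul_apply] at key
  simp only [split]
  rw [key, d1, d2, ← r1, ← r2]
  ring

/-- The error made by extending the Dirac cone to infinity. -/
def coneError (P : ℝ) : ℝ := ∫ u : ℝ, |u| * P / ((1 + u ^ 2) * (u ^ 2 + P ^ 2))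

theorem coneError_integrand_le {P : ℝ} (hP : 0 < P) (u : ℝ) :
    ‖|u| * P / ((1 + u ^ 2) * (u ^ 2 + P ^ 2))‖ ≤ (1 + u ^ 2)⁻¹ := by
  rw [Real.norm_eq_abs, abs_of_nonneg (by positivity), inv_eq_one_div,
    div_le_div_iff₀ (by positivity) (by positivity)]
  have : |u| * P ≤ u ^ 2 + P ^ 2 := by
    rw [← sq_abs u]
    nlinarith [sq_nonneg (|u| - P), abs_nonneg u]
  have h1 : 0 < 1 + u ^ 2 := by positivity
  nlinarith

theorem measurable_coneError_integrand (P : ℝ) :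
    Measurable fun u : ℝ => |u| * P / ((1 + u ^ 2) * (u ^ 2 + P ^ 2)) := by
  fun_prop

theorem integrable_coneError {P : ℝ} (hP : 0 < P) :
    Integrable fun u : ℝ => |u| * P / ((1 + u ^ 2) * (u ^ 2 + P ^ 2)) :=
  integrable_inv_one_add_sq.mono' (measurable_coneError_integrand P).aestronglyMeasurable
    (Eventually.of_forall fun u => coneError_integrand_le hP u)

theorem tendsto_coneError : Tendsto coneError (𝓝[>] 0) (𝓝 0) := by
  have : Tendsto coneError (𝓝[>] 0) (𝓝 (∫ _ : ℝ, (0 : ℝ))) := by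
    refine tendsto_integral_filter_of_dominated_convergence (fun u => (1 + u ^ 2)⁻¹)
      (Eventually.of_forall fun P => (measurable_coneError_integrand P).aestronglyMeasurable) ?_
      integrable_inv_one_add_sq ?_
    · filter_upwards [self_mem_nhdsWithin] with P hP
      exact Eventually.of_forall fun u => coneError_integrand_le hP u
    · filter_upwards [Measure.ae_ne volume (0 : ℝ)] with u hu
      have hc : ContinuousAt (fun P : ℝ => |u| * P / ((1 + u ^ 2) * (u ^ 2 + P ^ 2))) 0 :=
        ContinuousAt.div (by fun_prop) (by fun_prop) (by positivity)
      have := hc.tendsto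
      rw [mul_zero, zero_div] at this
      exact this.mono_left nhdsWithin_le_nhds
  simpa using this

theorem one_sub_sqrt_le (u : ℝ) : |1 - Real.sqrt (1 - u ^ 2)| ≤ 2 * u ^ 2 / (1 + u ^ 2) := by
  have h1 : Real.sqrt (1 - u ^ 2) ≤ 1 := Real.sqrt_le_one.2 (by nlinarith [sq_nonneg u])
  rw [abs_of_nonneg (by linarith), le_div_iff₀ (by positivity)]
  rcases le_total (u ^ 2) 1 with h | h
  · have h2 : 1 - u ^ 2 ≤ Real.sqrt (1 - u ^ 2) := by
      refine Real.le_sqrt_of_sq_le ?_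
      nlinarith [sq_nonneg u]
    nlinarith [sq_nonneg u]
  · rw [Real.sqrt_eq_zero_of_nonpos (by linarith)]
    linarith

/-- The factor 1 - √(1 - u²) is quadratically small near the cone, where the excess is of order
1/|u|. The product of the two bounds is 5P times the integrand of `coneError`, so the change is
o(P). -/
theorem abs_integral_sub_le {a b : ℝ} (ha : a ≠ 0) (hb : b ≠ 0) {P : ℝ} (hP0 : 0 < P)
    (hP : (a - b) ^ 2 ≤ P ^ 2) :
    |(∫ u, Real.sqrt (1 - u ^ 2) * diracExcess a b u) - ∫ u, diracExcess a b u| ≤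
      5 * P * coneError P := by
  have hI := integrable_diracExcess ha hb
  have hsq : Measurable fun u : ℝ => Real.sqrt (1 - u ^ 2) := by fun_prop
  have hI' : Integrable fun u => Real.sqrt (1 - u ^ 2) * diracExcess a b u := by
    refine hI.bdd_mul (c := 1) hsq.aestronglyMeasurable (Eventually.of_forall fun u => ?_)
    rw [Real.norm_eq_abs, abs_of_nonneg (Real.sqrt_nonneg _)]
    exact Real.sqrt_le_one.2 (by nlinarith [sq_nonneg u])
  rw [← integral_sub hI' hI, coneError, ← integral_const_mul, ← Real.norm_eq_abs]
  refine norm_integral_le_of_norm_le ((integrable_coneError hP0).const_mul _) ?_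
  filter_upwards [Measure.ae_ne volume (0 : ℝ)] with u hu
  rw [Real.norm_eq_abs, ← abs_neg, show -(Real.sqrt (1 - u ^ 2) * diracExcess a b u -
    diracExcess a b u) = (1 - Real.sqrt (1 - u ^ 2)) * diracExcess a b u by ring, abs_mul]
  refine (mul_le_mul (one_sub_sqrt_le u) (abs_diracExcess_le_kernel hu hP) (abs_nonneg _)
    (by positivity)).trans (le_of_eq ?_)
  have hu' := abs_pos.2 hu
  rw [← sq_abs u]
  field_simp

end
end Z2Gauge

/-! ### The universal integral over the Dirac cone -/

namespace Z2Gauge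
noncomputable section
open Filter Topology MeasureTheory

/-- The integral of the response of a Dirac cone, as a function of the ratio of the momenta. -/
def coneKernel (w : ℝ) : ℝ := (1 - w ^ 2) / (2 * w) * (Real.log (1 + w) - Real.log (1 - w))

/-- The density, in the ratio of the momenta, of the total response of a Dirac cone. -/
def coneDensity (w : ℝ) : ℝ := (1 - coneKernel w) / w ^ 2

theorem hasSum_of_eq {f g : ℕ → ℝ} {a b : ℝ} (h : HasSum f a) (hf : ∀ n, g n = f n) (ha : b = a) :
    HasSum g b := by
  rw [ha, funext hf]
  exact h

/-- The difference of the reciprocals of consecutive odd numbers. -/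
def oddGap (n : ℕ) : ℝ := 1 / (2 * n + 1) - 1 / (2 * n + 3)

theorem oddGap_pos (n : ℕ) : 0 < oddGap n := by
  rw [oddGap, sub_pos]
  exact one_div_lt_one_div_of_lt (by positivity) (by linarith)

theorem hasSum_oddGap : HasSum oddGap 1 := by
  rw [hasSum_iff_tendsto_nat_of_nonneg fun n => (oddGap_pos n).le]
  have h : ∀ n : ℕ, ∑ i ∈ Finset.range n, oddGap i = 1 - 1 / (2 * n + 1) := by
    intro n
    induction n with
    | zero => simp
    | succ n ih =>
      rw [Finset.sum_range_succ, ih, oddGap]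
      push_cast
      ring
  simp only [h]
  have : Tendsto (fun n : ℕ => (2 * n + 1 : ℝ)) atTop atTop :=
    tendsto_atTop_add_const_right _ _ ((tendsto_natCast_atTop_atTop).const_mul_atTop two_pos)
  simpa using (this.const_div_atTop 1).const_sub 1

theorem hasSum_odd_sq : HasSum (fun n : ℕ => 1 / (2 * n + 1 : ℝ) ^ 2) (Real.pi ^ 2 / 8) := by
  have h := hasSum_zeta_two
  have he : HasSum (fun n : ℕ => 1 / ((2 * n : ℕ) : ℝ) ^ 2) (1 / 4 * (Real.pi ^ 2 / 6)) :=
    hasSum_of_eq (h.mul_left (1 / 4)) (fun n => by push_cast; rw [mul_pow]; ring) rfl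
  have ho : Summable fun n : ℕ => 1 / ((2 * n + 1 : ℕ) : ℝ) ^ 2 :=
    h.summable.comp_injective (i := fun n : ℕ => 2 * n + 1) fun a b (h : 2 * a + 1 = 2 * b + 1) => by
      omega
  have := (HasSum.even_add_odd (f := fun n : ℕ => 1 / (n : ℝ) ^ 2) he ho.hasSum).unique h
  exact hasSum_of_eq ho.hasSum (fun n => by push_cast; rfl) (by linarith)

/-- The square of a difference of consecutive odd reciprocals is the sum of their squares minus the
difference itself, because their product is half of it. -/
theorem hasSum_oddGap_sq : HasSum (fun n => oddGap n ^ 2) (Real.pi ^ 2 / 4 - 2) := by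
  have h1 := hasSum_odd_sq
  have h2 : HasSum (fun n : ℕ => 1 / (2 * n + 3 : ℝ) ^ 2) (Real.pi ^ 2 / 8 - 1) := by
    have := (hasSum_nat_add_iff' 1).2 h1
    simp only [Finset.sum_range_one] at this
    refine hasSum_of_eq this (fun n => ?_) (by norm_num)
    push_cast
    congr 2
    ring
  refine hasSum_of_eq ((h1.add h2).sub hasSum_oddGap) (fun n => ?_) (by ring)
  rw [oddGap]
  field_simp
  ring

theorem hasSum_coneDensity {w : ℝ} (h0 : 0 < w) (h1 : w < 1) :
    HasSum (fun n => oddGap n * w ^ (2 * n)) (coneDensity w) := by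
  have hs := Real.hasSum_log_sub_log_of_abs_lt_one (x := w) (by rw [abs_of_pos h0]; exact h1)
  have s1 : HasSum (fun n : ℕ => 1 / (2 * n + 1 : ℝ) * w ^ (2 * n))
      ((Real.log (1 + w) - Real.log (1 - w)) / (2 * w)) := by
    refine hasSum_of_eq (hs.div_const (2 * w)) (fun n => ?_) rfl
    rw [pow_succ]
    field_simp
  have s2 : HasSum (fun n : ℕ => 1 / (2 * n + 3 : ℝ) * w ^ (2 * n))
      (((Real.log (1 + w) - Real.log (1 - w)) / (2 * w) - 1) / w ^ 2) := by
    have := ((hasSum_nat_add_iff' 1).2 s1).div_const (w ^ 2)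
    simp only [Finset.sum_range_one] at this
    refine hasSum_of_eq this (fun n => ?_) (by simp)
    rw [mul_add, mul_one, pow_add, ← mul_assoc, mul_div_cancel_right₀ _ (pow_ne_zero 2 h0.ne')]
    push_cast
    congr 2
    ring
  refine hasSum_of_eq (s1.sub s2) (fun n => ?_) ?_
  · rw [oddGap]
    ring
  · rw [coneDensity, coneKernel]
    field_simp
    ring

theorem coneDensity_bounds {w : ℝ} (h0 : 0 < w) (h1 : w < 1) :
    0 ≤ coneDensity w ∧ coneDensity w ≤ 1 := by
  have h := hasSum_coneDensity h0 h1
  refine ⟨h.nonneg fun n => mul_nonneg (oddGap_pos n).le (by positivity), ?_⟩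
  refine hasSum_le (fun n => ?_) h hasSum_oddGap
  exact mul_le_of_le_one_right (oddGap_pos n).le (pow_le_one₀ h0.le h1.le)

/-- The logarithm of |w| cancels between the two terms, as log depends on the modulus only, while
the prefactor changes sign. -/
theorem coneKernel_inv {w : ℝ} (h0 : 0 < w) : coneKernel w⁻¹ = -coneKernel w := by
  by_cases h1 : w = 1
  · simp [h1, coneKernel]
  have hw1 : w - 1 ≠ 0 := sub_ne_zero.2 h1
  have e1 : Real.log (1 + w⁻¹) = Real.log (1 + w) - Real.log w := by
    rw [← Real.log_div (by positivity) h0.ne']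
    congr 1
    field_simp
    ring
  have e2 : Real.log (1 - w⁻¹) = Real.log (1 - w) - Real.log w := by
    rw [← Real.log_neg_eq_log (1 - w), neg_sub, ← Real.log_div hw1 h0.ne']
    congr 1
    field_simp
  rw [coneKernel, coneKernel, e1, e2]
  field_simp
  ring

theorem coneDensity_inv {w : ℝ} (h0 : 0 < w) :
    coneDensity w⁻¹ = w ^ 2 * (2 - w ^ 2 * coneDensity w) := by
  rw [coneDensity, coneKernel_inv h0, coneDensity]
  field_simp
  ring

theorem coneDensity_neg (w : ℝ) : coneDensity (-w) = coneDensity w := by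
  rw [coneDensity, coneDensity, coneKernel, coneKernel, neg_sq, sub_neg_eq_add, ← sub_eq_add_neg,
    mul_neg, div_neg]
  ring

/-- On (0, 1) the power series has positive terms of sum at most 1; the inversion gives decay like
1/w² beyond 1. The poles 0 and ±1 of the formula are excluded. -/
theorem abs_coneDensity_le {w : ℝ} (h0 : w ≠ 0) (h1 : |w| ≠ 1) :
    |coneDensity w| ≤ 4 * (1 + w ^ 2)⁻¹ := by
  have key : ∀ w : ℝ, 0 < w → w ≠ 1 → |coneDensity w| ≤ 4 * (1 + w ^ 2)⁻¹ := by
    intro w hw hw1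
    rw [← div_eq_mul_inv, le_div_iff₀ (by positivity)]
    rcases lt_or_gt_of_ne hw1 with h | h
    · have := coneDensity_bounds hw h
      rw [abs_of_nonneg this.1]
      nlinarith
    · have hb := coneDensity_bounds (inv_pos.2 hw) (inv_lt_one_of_one_lt₀ h)
      have hi := coneDensity_inv (inv_pos.2 hw)
      rw [inv_inv] at hi
      have e : w⁻¹ ^ 2 ≤ 1 := pow_le_one₀ (inv_pos.2 hw).le (inv_lt_one_of_one_lt₀ h).le
      have e0 : 0 < w⁻¹ ^ 2 := by have := inv_pos.2 hw; positivity
      have b1 : w⁻¹ ^ 2 * coneDensity w⁻¹ ≤ 1 := mul_le_one₀ e hb.1 hb.2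
      have b2 : 0 ≤ w⁻¹ ^ 2 * coneDensity w⁻¹ := mul_nonneg e0.le hb.1
      have b3 : w⁻¹ ^ 2 * w ^ 2 = 1 := by field_simp
      rw [hi, abs_of_nonneg (mul_nonneg e0.le (by linarith))]
      nlinarith
  rcases lt_or_gt_of_ne h0 with h | h
  · have := key (-w) (by linarith) (by rwa [abs_of_neg h] at h1)
    rwa [coneDensity_neg, neg_sq] at this
  · exact key w h (by rwa [abs_of_pos h] at h1)

theorem measurable_coneDensity : Measurable coneDensity := by
  unfold coneDensity coneKernel
  fun_prop

theorem ae_ne_pole : ∀ᵐ w : ℝ, w ≠ 0 ∧ |w| ≠ 1 := by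
  filter_upwards [Measure.ae_ne volume (0 : ℝ), Measure.ae_ne volume (1 : ℝ),
    Measure.ae_ne volume (-1 : ℝ)] with w h0 h1 h2
  refine ⟨h0, fun h => ?_⟩
  rcases eq_or_eq_neg_of_abs_eq h with h | h
  exacts [h1 h, h2 h]

theorem integrable_coneDensity : Integrable coneDensity :=
  (integrable_inv_one_add_sq.const_mul 4).mono' measurable_coneDensity.aestronglyMeasurable
    (ae_ne_pole.mono fun _ h => abs_coneDensity_le h.1 h.2)

/-- With the weight 1 - w² the n-th term of the series integrates to the square of `oddGap n`, and
the sum is reduced to that of the inverse odd squares. -/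
theorem integral_coneDensity_Ioo : ∫ w in Set.Ioo (0 : ℝ) 1, (1 - w ^ 2) * coneDensity w =
    Real.pi ^ 2 / 4 - 2 := by
  rw [← integral_Ioc_eq_integral_Ioo, ← intervalIntegral.integral_of_le zero_le_one]
  have hsum := intervalIntegral.hasSum_intervalIntegral_of_summable_norm (a := 0) (b := 1)
    (f := fun n : ℕ => (⟨fun w : ℝ => (1 - w ^ 2) * (oddGap n * w ^ (2 * n)), by fun_prop⟩ : C(ℝ, ℝ)))
    (hasSum_oddGap.summable.of_nonneg_of_le (fun _ => norm_nonneg _) fun n => by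
      rw [ContinuousMap.norm_le _ (oddGap_pos n).le]
      rintro ⟨w, hw'⟩
      have hw : w ∈ Set.Icc (0 : ℝ) 1 := by rwa [← Set.uIcc_of_le (zero_le_one' ℝ)]
      have h1 : 0 ≤ 1 - w ^ 2 := by nlinarith [hw.1, hw.2]
      have h2 : w ^ (2 * n) ≤ 1 := pow_le_one₀ hw.1 hw.2
      have h3 : 0 ≤ w ^ (2 * n) := pow_nonneg hw.1 _
      have h4 := oddGap_pos n
      simp only [ContinuousMap.restrict_apply, ContinuousMap.coe_mk, Real.norm_eq_abs]
      rw [abs_of_nonneg (by positivity)]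
      calc (1 - w ^ 2) * (oddGap n * w ^ (2 * n)) ≤ 1 * (oddGap n * 1) := by
            gcongr
            nlinarith
        _ = _ := by ring)
  have hterm : ∀ n : ℕ, ∫ w in (0 : ℝ)..1, (1 - w ^ 2) * (oddGap n * w ^ (2 * n)) = oddGap n ^ 2 := by
    intro n
    have e : ∀ w : ℝ, (1 - w ^ 2) * (oddGap n * w ^ (2 * n)) =
        oddGap n * w ^ (2 * n) - oddGap n * w ^ (2 * n + 2) := fun w => by ring
    simp only [e]
    rw [intervalIntegral.integral_sub (Continuous.intervalIntegrable (by fun_prop) _ _)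
      (Continuous.intervalIntegrable (by fun_prop) _ _), intervalIntegral.integral_const_mul,
      intervalIntegral.integral_const_mul, integral_pow, integral_pow, oddGap]
    simp only [one_pow, zero_pow (Nat.succ_ne_zero _), sub_zero]
    push_cast
    ring
  simp only [ContinuousMap.coe_mk, hterm] at hsum
  rw [hasSum_oddGap_sq.unique hsum]
  refine intervalIntegral.integral_congr_ae ?_
  filter_upwards [Measure.ae_ne volume (1 : ℝ)] with w hw h
  rw [Set.uIoc_of_le zero_le_one] at h
  rw [tsum_mul_left, (hasSum_coneDensity h.1 (lt_of_le_of_ne h.2 hw)).tsum_eq]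

theorem integral_coneDensity_Ioi_one :
    ∫ w in Set.Ioi (1 : ℝ), coneDensity w =
      ∫ w in Set.Ioo (0 : ℝ) 1, (2 - w ^ 2 * coneDensity w) := by
  have himg : (fun w : ℝ => w⁻¹) '' Set.Ioo 0 1 = Set.Ioi 1 := by
    ext x
    constructor
    · rintro ⟨w, hw, rfl⟩
      exact (one_lt_inv₀ hw.1).2 hw.2
    · intro hx
      have hx0 : (0 : ℝ) < x := zero_lt_one.trans hx
      exact ⟨x⁻¹, ⟨inv_pos.2 hx0, inv_lt_one_of_one_lt₀ hx⟩, inv_inv x⟩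
  rw [← himg, integral_image_eq_integral_abs_deriv_smul measurableSet_Ioo
    (fun w hw => (hasDerivAt_inv hw.1.ne').hasDerivWithinAt) inv_injective.injOn]
  refine setIntegral_congr_fun measurableSet_Ioo fun w hw => ?_
  have hw0 := hw.1.ne'
  simp only [smul_eq_mul]
  rw [coneDensity_inv hw.1, abs_neg, abs_of_nonneg (by positivity), ← mul_assoc,
    inv_mul_cancel₀ (pow_ne_zero 2 hw0), one_mul]

/-- The part beyond 1, pulled back by w ↦ 1/w, adds 2 - w² f(w) to f(w) on (0, 1), where f is the
density. So the half line carries 2 plus the integral of (1 - w²) f(w), that is π²/4. -/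
theorem integral_coneDensity : ∫ w, coneDensity w = Real.pi ^ 2 / 2 := by
  have hI := integrable_coneDensity
  have heven : ∀ w, coneDensity |w| = coneDensity w := fun w => by
    rcases abs_choice w with h | h <;> rw [h]
    exact coneDensity_neg w
  have h := integral_comp_abs (f := coneDensity)
  simp only [heven] at h
  have h2 : Set.Ioi (0 : ℝ) = Set.Ioc 0 1 ∪ Set.Ioi 1 := (Set.Ioc_union_Ioi_eq_Ioi zero_le_one).symm
  have hb : IntegrableOn (fun w => w ^ 2 * coneDensity w) (Set.Ioo 0 1) := by
    refine hI.integrableOn.bdd_mul (c := 1) (by fun_prop) ?_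
    refine (ae_restrict_iff' measurableSet_Ioo).2 (Eventually.of_forall fun w hw => ?_)
    rw [Real.norm_eq_abs, abs_of_nonneg (sq_nonneg _)]
    exact pow_le_one₀ hw.1.le hw.2.le
  have hc : IntegrableOn (fun _ : ℝ => (2 : ℝ)) (Set.Ioo 0 1) := by simp
  have e1 := integral_coneDensity_Ioo
  have e : ∀ w, (1 - w ^ 2) * coneDensity w = coneDensity w - w ^ 2 * coneDensity w := fun w => by
    ring
  simp only [e] at e1
  rw [integral_sub hI.integrableOn hb] at e1
  rw [h, h2, setIntegral_union (Set.Ioc_disjoint_Ioi le_rfl) measurableSet_Ioi hI.integrableOn hI.integrableOn, integral_coneDensity_Ioi_one,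
    integral_Ioc_eq_integral_Ioo, integral_sub hc hb]
  have e2 : ∫ _ in Set.Ioo (0 : ℝ) 1, (2 : ℝ) = 2 := by simp
  rw [e2]
  linarith

end
end Z2Gauge

namespace Z2Gauge
noncomputable section
open Filter Topology MeasureTheory

/-! ### The substitution k = arctan(w/κ) -/

section ChangeOfVariables

variable {κ : ℝ}

theorem hasDerivAt_arctan_div (hκ : κ ≠ 0) (w : ℝ) :
    HasDerivAt (fun w => Real.arctan (w / κ)) (κ / (κ ^ 2 + w ^ 2)) w := by
  have := ((hasDerivAt_id w).div_const κ).arctan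
  refine this.congr_deriv ?_
  have : 0 < κ ^ 2 := by positivity
  have h2 : κ ^ 2 + w ^ 2 ≠ 0 := by positivity
  simp only [id]
  field_simp

theorem image_arctan_div (hκ : κ ≠ 0) :
    (fun w => Real.arctan (w / κ)) '' Set.univ = Set.Ioo (-(Real.pi / 2)) (Real.pi / 2) := by
  rw [Set.image_univ, ← Real.range_arctan]
  exact (Equiv.mulRight₀ κ⁻¹ (inv_ne_zero hκ)).surjective.range_comp Real.arctan

theorem arctan_div_injective (hκ : κ ≠ 0) :
    Function.Injective fun w => Real.arctan (w / κ) := fun a b h => by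
  have := Real.arctan_injective h
  field_simp at this
  exact this

theorem integral_arctan_div (hκ : κ ≠ 0) (f : ℝ → ℝ) :
    ∫ k in (-(Real.pi / 2))..(Real.pi / 2), f k =
      ∫ w, |κ| / (κ ^ 2 + w ^ 2) * f (Real.arctan (w / κ)) := by
  rw [intervalIntegral.integral_of_le (by linarith [Real.pi_pos]), integral_Ioc_eq_integral_Ioo,
    ← image_arctan_div hκ, integral_image_eq_integral_abs_deriv_smul MeasurableSet.univ
      (fun w _ => (hasDerivAt_arctan_div hκ w).hasDerivWithinAt) (arctan_div_injective hκ).injOn,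
    setIntegral_univ]
  refine integral_congr_ae (Eventually.of_forall fun w => ?_)
  simp only [smul_eq_mul]
  rw [abs_div, abs_of_nonneg (by positivity : 0 ≤ κ ^ 2 + w ^ 2)]

theorem integrable_arctan_div (hκ : κ ≠ 0) {f : ℝ → ℝ} (hf : Continuous f) :
    Integrable fun w => |κ| / (κ ^ 2 + w ^ 2) * f (Real.arctan (w / κ)) := by
  have h : IntegrableOn f (Set.Ioo (-(Real.pi / 2)) (Real.pi / 2)) :=
    (hf.integrableOn_Icc).mono_set Set.Ioo_subset_Icc_self
  rw [← image_arctan_div hκ, integrableOn_image_iff_integrableOn_abs_deriv_smul MeasurableSet.univ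
      (fun w _ => (hasDerivAt_arctan_div hκ w).hasDerivWithinAt) (arctan_div_injective hκ).injOn,
    integrableOn_univ] at h
  refine h.congr (Eventually.of_forall fun w => ?_)
  simp only [smul_eq_mul]
  rw [abs_div, abs_of_nonneg (by positivity : 0 ≤ κ ^ 2 + w ^ 2)]

end ChangeOfVariables

/-! ### Asymptotics of the bulk response and of the susceptibility -/

theorem integral_diracExcess_cone {p k w : ℝ} (hp : Real.cos (p / 2) ≠ 0) (hk : Real.cos k ≠ 0)
    (hw : Real.tan k * Real.tan (p / 2) = w) (h0 : w ≠ 0) (h1 : |w| ≠ 1) :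
    Real.cos (k - p / 2) ≠ 0 ∧ Real.cos (k + p / 2) ≠ 0 ∧
      ∫ u, diracExcess (Real.cos (k - p / 2)) (Real.cos (k + p / 2)) u = coneKernel w - 1 := by
  have hs : Real.sin k * Real.sin (p / 2) = Real.cos k * Real.cos (p / 2) * w := by
    rw [← hw, Real.tan_eq_sin_div_cos, Real.tan_eq_sin_div_cos]
    field_simp
  have ea : Real.cos (k - p / 2) = Real.cos k * Real.cos (p / 2) * (1 + w) := by
    rw [Real.cos_sub, hs]; ring
  have eb : Real.cos (k + p / 2) = Real.cos k * Real.cos (p / 2) * (1 - w) := by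
    rw [Real.cos_add, hs]; ring
  have w1 : 1 + w ≠ 0 := fun h => h1 (by rw [show w = -1 by linarith]; simp)
  have w2 : 1 - w ≠ 0 := fun h => h1 (by rw [show w = 1 by linarith]; simp)
  have hc : Real.cos k * Real.cos (p / 2) ≠ 0 := mul_ne_zero hk hp
  rw [ea, eb]
  generalize Real.cos k * Real.cos (p / 2) = c at *
  refine ⟨mul_ne_zero hc w1, mul_ne_zero hc w2, ?_⟩
  have hd : (c * (1 - w)) ^ 2 - (c * (1 + w)) ^ 2 = -(4 * c ^ 2 * w) := by ring
  rw [integral_diracExcess (mul_ne_zero hc w1) (mul_ne_zero hc w2) (by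
    rw [hd]; exact neg_ne_zero.2 (by positivity)), hd, Real.log_mul hc w1, Real.log_mul hc w2,
    coneKernel]
  field_simp
  ring

/-- The integral over the cone, with the weight that comes from the change of variables. -/
def coneIntegral (κ : ℝ) : ℝ := ∫ w, w ^ 2 / (κ ^ 2 + w ^ 2) * coneDensity w

theorem abs_coneWeight_le (κ w : ℝ) : ‖w ^ 2 / (κ ^ 2 + w ^ 2)‖ ≤ 1 := by
  rw [Real.norm_eq_abs, abs_of_nonneg (by positivity)]
  exact div_le_one_of_le₀ (by nlinarith [sq_nonneg κ]) (by positivity)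

theorem integrable_coneIntegral (κ : ℝ) :
    Integrable fun w => w ^ 2 / (κ ^ 2 + w ^ 2) * coneDensity w :=
  integrable_coneDensity.bdd_mul (c := 1)
    (by fun_prop : Measurable fun w : ℝ => w ^ 2 / (κ ^ 2 + w ^ 2)).aestronglyMeasurable
    (Eventually.of_forall fun w => abs_coneWeight_le κ w)

theorem tendsto_coneIntegral : Tendsto coneIntegral (𝓝 0) (𝓝 (Real.pi ^ 2 / 2)) := by
  rw [← integral_coneDensity]
  refine tendsto_integral_filter_of_dominated_convergence (fun w => ‖coneDensity w‖)
    (Eventually.of_forall fun κ => (integrable_coneIntegral κ).aestronglyMeasurable)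
    (Eventually.of_forall fun κ => Eventually.of_forall fun w => ?_)
    integrable_coneDensity.norm ?_
  · rw [norm_mul]
    exact mul_le_of_le_one_left (norm_nonneg _) (abs_coneWeight_le κ w)
  · filter_upwards [Measure.ae_ne volume (0 : ℝ)] with w hw
    have hc : ContinuousAt (fun κ : ℝ => w ^ 2 / (κ ^ 2 + w ^ 2) * coneDensity w) 0 :=
      (ContinuousAt.div (by fun_prop) (by fun_prop) (by positivity)).mul continuousAt_const
    have := hc.tendsto
    rwa [zero_pow two_ne_zero, zero_add, div_self (by positivity), one_mul] at this

/-- With κ = tan(p/2) and w = κ tan k, the measure dk becomes |κ|/(κ² + w²) dw, and the integral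
over u becomes `coneKernel w - 1`, a function of w alone because cos(k ∓ p/2) = cos k cos(p/2)(1 ±
w). The only error is the replacement of √(1 - u²) by 1, with P = |p|; the measure has total mass π.
-/
theorem abs_bulkResponse_add_le {p : ℝ} (h0 : p ≠ 0) (h1 : |p| < Real.pi) :
    |Real.pi ^ 2 * bulkResponse p + |Real.tan (p / 2)| * coneIntegral (Real.tan (p / 2))| ≤
      Real.pi * (5 * |p| * coneError |p|) := by
  have hp := abs_lt.1 h1
  have hsin : Real.sin p ≠ 0 := fun h => h0 ((Real.sin_eq_zero_iff_of_lt_of_lt hp.1 hp.2).1 h)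
  have hcos : Real.cos (p / 2) ≠ 0 :=
    (Real.cos_pos_of_mem_Ioo ⟨by linarith, by linarith⟩).ne'
  set κ := Real.tan (p / 2) with hκdef
  have hκ : κ ≠ 0 := by
    rw [hκdef, Real.tan_eq_sin_div_cos]
    refine div_ne_zero (fun h => h0 ?_) hcos
    have := (Real.sin_eq_zero_iff_of_lt_of_lt (by linarith) (by linarith)).1 h
    linarith
  have hP : 0 < |p| := abs_pos.2 h0
  set H : ℝ → ℝ := fun k => Real.pi * (1 / 2 * (bandResponse p (p / 2 + k) + bandResponse p (p / 2 - k)))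
    with hH
  have hcont : Continuous H := by
    have := continuous_bandResponse hsin
    fun_prop
  have e1 : Real.pi ^ 2 * bulkResponse p =
      ∫ w, |κ| / (κ ^ 2 + w ^ 2) * H (Real.arctan (w / κ)) := by
    rw [← integral_arctan_div hκ, hH, intervalIntegral.integral_const_mul, bulkResponse_eq hsin]
    have := Real.pi_pos.ne'
    field_simp
  have e2 : |κ| * coneIntegral κ = -∫ w, |κ| / (κ ^ 2 + w ^ 2) * (coneKernel w - 1) := by
    rw [coneIntegral, ← integral_const_mul, ← integral_neg]
    refine integral_congr_ae (ae_ne_pole.mono fun w hw => ?_)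
    have hw0 := hw.1
    have : κ ^ 2 + w ^ 2 ≠ 0 := by positivity
    simp only [coneDensity]
    field_simp
    ring
  have i1 := integrable_arctan_div hκ hcont
  have i2 : Integrable fun w => |κ| / (κ ^ 2 + w ^ 2) * (coneKernel w - 1) := by
    refine ((integrable_coneIntegral κ).const_mul (-|κ|)).congr (ae_ne_pole.mono fun w hw => ?_)
    have hw0 := hw.1
    have : κ ^ 2 + w ^ 2 ≠ 0 := by positivity
    simp only [coneDensity]
    field_simp
    ring
  have i3 := integrable_arctan_div hκ (continuous_const (y := 5 * |p| * coneError |p|))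
  have e3 : Real.pi * (5 * |p| * coneError |p|) =
      ∫ w, |κ| / (κ ^ 2 + w ^ 2) * (5 * |p| * coneError |p|) := by
    rw [← integral_arctan_div hκ fun _ => 5 * |p| * coneError |p|, intervalIntegral.integral_const,
      smul_eq_mul]
    ring
  rw [e1, e2, e3, ← sub_eq_add_neg, ← integral_sub i1 i2, ← Real.norm_eq_abs]
  refine norm_integral_le_of_norm_le i3 (ae_ne_pole.mono fun w hw => ?_)
  rw [← mul_sub, norm_mul, Real.norm_eq_abs, Real.norm_eq_abs, abs_of_nonneg (by positivity)]
  refine mul_le_mul_of_nonneg_left ?_ (by positivity)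
  have hk := (Real.cos_arctan_pos (w / κ)).ne'
  obtain ⟨ha, hb, hint⟩ := integral_diracExcess_cone hcos hk
    (by rw [Real.tan_arctan, ← hκdef, div_mul_cancel₀ _ hκ]) hw.1 hw.2
  rw [hH, ← hint]
  simp only []
  rw [symmetrized_bandResponse p _ ha hb]
  refine abs_integral_sub_le ha hb hP ?_
  rw [Real.cos_sub, Real.cos_add, sq_abs, show ∀ x y : ℝ, (x + y - (x - y)) ^ 2 = (2 * y) ^ 2 by
    intro x y; ring]
  have s1 : Real.sin (Real.arctan (w / κ)) ^ 2 ≤ 1 := Real.sin_sq_le_one _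
  have s2 : Real.sin (p / 2) ^ 2 ≤ (p / 2) ^ 2 := sq_le_sq.2 Real.abs_sin_le_abs
  nlinarith [mul_le_mul s1 s2 (sq_nonneg _) zero_le_one]

-- As |tan(p/2)| is asymptotic to |p|/2 and the cone integral tends to π²/2, the leading term of π²
-- times the response is -π²|p|/4.
open Asymptotics in
theorem bulkResponse_isLittleO :
    (fun p => bulkResponse p + |p| / 4) =o[𝓝[≠] 0] fun p => |p| := by
  have hκ : Tendsto (fun p : ℝ => |Real.tan (p / 2)| / |p|) (𝓝[≠] 0) (𝓝 (1 / 2)) := by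
    have hd : HasDerivAt (fun p : ℝ => Real.tan (p / 2)) (1 / 2) 0 := by
      have h1 : HasDerivAt Real.tan (1 / Real.cos ((0 : ℝ) / 2) ^ 2) ((0 : ℝ) / 2) :=
        Real.hasDerivAt_tan (by simp)
      have := h1.comp (0 : ℝ) ((hasDerivAt_id (0 : ℝ)).div_const 2)
      simpa [Function.comp_def] using this
    have := (hasDerivAt_iff_tendsto_slope.1 hd).abs
    rw [abs_of_pos (by norm_num : (0 : ℝ) < 1 / 2)] at this
    refine this.congr fun p => ?_
    simp [slope_def_field, abs_div]
  have hcone : Tendsto (fun p : ℝ => coneIntegral (Real.tan (p / 2))) (𝓝[≠] 0)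
      (𝓝 (Real.pi ^ 2 / 2)) := by
    have hc : ContinuousAt (fun p : ℝ => Real.tan (p / 2)) 0 :=
      ContinuousAt.comp (f := fun p : ℝ => p / 2) (g := Real.tan)
        (Real.continuousAt_tan.2 (by simp)) (by fun_prop)
    have h2 : Tendsto (fun p : ℝ => Real.tan (p / 2)) (𝓝 0) (𝓝 0) := by
      simpa using hc.tendsto
    exact tendsto_coneIntegral.comp (h2.mono_left nhdsWithin_le_nhds)
  have herr : Tendsto (fun p : ℝ => coneError |p|) (𝓝[≠] 0) (𝓝 0) :=
    tendsto_coneError.comp tendsto_abs_nhdsNE_zero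
  have hlim : Tendsto (fun p => (Real.pi ^ 2 * bulkResponse p +
      |Real.tan (p / 2)| * coneIntegral (Real.tan (p / 2))) / |p|) (𝓝[≠] 0) (𝓝 0) := by
    have h5 := herr.const_mul (Real.pi * 5)
    rw [mul_zero] at h5
    refine squeeze_zero_norm' ?_ h5
    have hs : ∀ᶠ p : ℝ in 𝓝[≠] 0, |p| < Real.pi :=
      nhdsWithin_le_nhds ((continuous_abs.tendsto (0 : ℝ)).eventually_lt_const
        (by rw [abs_zero]; exact Real.pi_pos))
    filter_upwards [hs, self_mem_nhdsWithin] with p hp1 hp0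
    have hP : 0 < |p| := abs_pos.2 hp0
    rw [norm_div, Real.norm_eq_abs, Real.norm_eq_abs, abs_abs, div_le_iff₀ hP]
    refine (abs_bulkResponse_add_le hp0 hp1).trans (le_of_eq ?_)
    ring
  rw [isLittleO_iff_tendsto' (by
    filter_upwards [self_mem_nhdsWithin] with p hp0 h
    exact absurd (abs_eq_zero.1 h) hp0)]
  have := (hlim.sub (hκ.mul hcone)).div_const (Real.pi ^ 2)
  have h6 := this.add_const (1 / 4)
  have hpi := Real.pi_pos.ne'
  rw [show (0 - 1 / 2 * (Real.pi ^ 2 / 2)) / Real.pi ^ 2 + 1 / 4 = 0 by field_simp; ring] at h6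
  refine h6.congr' ?_
  filter_upwards [self_mem_nhdsWithin] with p hp0
  have hP : |p| ≠ 0 := abs_ne_zero.2 hp0
  field_simp
  ring

open Asymptotics in
theorem susceptibility_isLittleO (t q : ℝ) :
    (fun p : ℝ => q ^ 2 * t * bulkResponse p / p ^ 2 - -(q ^ 2 * (2 * t) / (8 * |p|)))
      =o[𝓝[≠] 0] fun p : ℝ => 1 / |p| := by
  have h := (bulkResponse_isLittleO.mul_isBigO (isBigO_refl (fun p : ℝ => 1 / p ^ 2) _)).const_mul_left
    (q ^ 2 * t)
  refine h.congr' ?_ ?_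
  · filter_upwards [self_mem_nhdsWithin] with p hp0
    have hP : |p| ≠ 0 := abs_ne_zero.2 hp0
    rw [← sq_abs p]
    field_simp
    ring
  · filter_upwards [self_mem_nhdsWithin] with p hp0
    have hP : |p| ≠ 0 := abs_ne_zero.2 hp0
    rw [← sq_abs p]
    field_simp

end
end Z2Gauge

theorem proposition2p2 :
    ∃ t₀ : ℝ, 0 < t₀ ∧ ∀ t : ℝ, t₀ < t → ∀ q : ℝ,
      ∃ χ : ℝ → ℝ,
        (∀ p₂ : ℝ, 0 < |p₂| → |p₂| < Real.pi → Z2Gauge.IsSusceptibility t q p₂ (χ p₂)) ∧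
        (fun p₂ : ℝ => χ p₂ - -(q ^ 2 * (2 * t) / (8 * |p₂|)))
          =o[nhdsWithin 0 {0}ᶜ] (fun p₂ : ℝ => 1 / |p₂|) := by
  refine ⟨800, by norm_num, fun t ht q => ⟨fun p => q ^ 2 * t * Z2Gauge.bulkResponse p / p ^ 2,
    fun p hp hp' => Z2Gauge.isSusceptibility_bulkResponse ht q hp hp',
    Z2Gauge.susceptibility_isLittleO t q⟩⟩
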